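/- Let $\mathbb{F}_q$ be a finite field of characteristic $p$ and let $K$ be a global function field over $\mathbb{F}_q$ (a finite extension of some $\mathbb{F}_q(t)$ in which $\mathbb{F}_q$ is algebraically closed). A place $\omega$ of $K$ is a discrete valuation $v_\omega$ of $K$, trivial on $\mathbb{F}_q^\times$, with value group exactly $\mathbb{Z}$; let $K_\omega$ be the completion, $O_\omega$ its local ring, and let $R_\omega$ be the ring of the elements $x\in K$ with $v_{\omega'}(x)\ge 0$ for every place $\omega'\neq\omega$. Fix two distinct places $\infty$ and $\nu$, and $\pi_\nu\in R_\infty$ with $v_\nu(\pi_\nu)=1$ and $R_\infty[\pi_\nu^{-1}]\cap O_\nu=R_\infty$ (that is, $\pi_\nu$ generates the prime ideal $\nu$ of $R_\infty$). For a subring $R$ of a field $F$, $\mathrm{PGL}_2(R)$ denotes the image of $\mathrm{GL}_2(R)$ in $\mathrm{PGL}_2(F)$. Put $G_\omega=\mathrm{PGL}_2(K_\omega)$ with its quotient topology from $\mathrm{GL}_2(K_\omega)$, $\Gamma_\infty=\mathrm{PGL}_2(R_\infty)$, $\Gamma_S=\mathrm{PGL}_2(R_\infty[\pi_\nu^{-1}])$,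 $X_\infty=\Gamma_\infty\backslash G_\infty$, let $A_\infty$ be the diagonal subgroup of $G_\infty$ acting on $X_\infty$ on the right, and, for $t\in K_\infty^\times$, let $\alpha(t)\in A_\infty$ be the class of the diagonal matrix with entries $1,t$. The point $\Gamma_\infty g$ of $X_\infty$ is identified with the homothety class of the $R_\infty$-lattice $g^{-1}(R_\infty\times R_\infty)$ in $K_\infty\times K_\infty$. A point $x\in X_\infty$ is $A_\infty$-periodic if there is a unique $A_\infty$-invariant probability measure $\mu_x$ on $xA_\infty$. Let $\mathbb{T}_\omega$ be the Bruhat–Tits tree, with vertices the homothety classes of $O_\omega$-lattices, that is, $G_\omega/\mathrm{PGL}_2(O_\omega)$, and base vertex $*_\omega=[O_\omega\times O_\omega]$; the point at infinity of the ray $n\mapsto [O_\omega\times\pi_\omega^nO_\omega]$, where $\pi_\omega$ is a uniformizer, is $\infty=[1:0]\in\mathbb{P}_1(K)\subset\partial_\infty\mathbb{T}_\omega=\mathbb{P}_1(K_\omega)$. The set of cusps $\mathcal{E}_\infty=\Gamma_\infty\backslash\mathbb{P}_1(K)$ is identified with the set of ends of the graph $\Gamma_\infty\backslash\mathbb{T}_\infty$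 (the cusp $\Gamma_\infty\widetilde z$ being the end of the image of any geodesic ray of $\mathbb{T}_\infty$ with point at infinity $\widetilde z$), and $\widehat{X_\infty}=X_\infty\sqcup\mathcal{E}_\infty$ has the topology generated by the open subsets of $X_\infty$ and the inverse images of the open neighbourhoods of the ends in Freudenthal's compactification of $\Gamma_\infty\backslash\mathbb{T}_\infty$. The $\nu$-Hecke tree of $x_0\in X_\infty$ is the component of $x_0$ in the graph on $X_\infty$ whose edges are the pairs of classes having representatives $\Lambda\subset\Lambda'$ with $\Lambda'/\Lambda\simeq R_\infty/\pi_\nu R_\infty$. For $x_0=\Gamma_\infty g_0$, the map $s\,*_\nu\mapsto\Gamma_\infty s^{-1}g_0$ ($s\in\Gamma_S$) is an isomorphism $\mathrm{hec}_{g_0}$ from $\mathbb{T}_\nu$ onto the Hecke tree of $x_0$. An end $\xi$ of the Hecke tree is rational if $\xi\in\mathrm{hec}_{g_0}(\mathbb{P}_1(K))$, and $S$-rational if $\xi\in\mathrm{hec}_{g_0}(\Gamma_S\infty)$; the cusp associated with a rational end $\xi=\mathrm{hec}_{g_0}(\gamma\infty)$, $\gamma\in\mathrm{PGL}_2(K)$,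 is $z_\xi=\Gamma_\infty\gamma\infty$. These notions do not depend on the choice of $g_0$. Let $(x_n^\xi)_{n\ge 0}$ be the geodesic ray from $x_0$ to $\xi$ in the Hecke tree. For $c>0$, $\xi$ has uniform $c$-escape of mass (respectively, towards the cusp $z$) if every weak-star accumulation point $\theta$ of $(\mu_{x_n^\xi})_{n}$ in the space of probability measures on $\widehat{X_\infty}$ satisfies $\theta(\mathcal{E}_\infty)\ge c$ (respectively $\theta(\{z\})\ge c$). Theorem. Let $x_0\in X_\infty$ be $A_\infty$-periodic. Then all vertices of the $\nu$-Hecke tree of $x_0$ are $A_\infty$-periodic, and there is a constant $c=c(x_0)>0$ such that every rational end $\xi$ of the $\nu$-Hecke tree of $x_0$ has uniform $c$-escape of mass, and if moreover $\xi$ is $S$-rational, then $\xi$ has uniform $c$-escape of mass towards its associated cusp $z_\xi$. The constant is explicit. Write $x_0=\Gamma_\infty g_0$. There are $\widetilde\gamma_0\in\mathrm{GL}_2(R_\infty)$, with image $\gamma_0$ in $\Gamma_\infty$, and $t_0\in K_\infty^\times$ such that $\gamma_0g_0=g_0\,\alpha(t_0)$ with $v_\infty(t_0)$ positive and minimal.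 For every such choice of $g_0,\widetilde\gamma_0,t_0$, one may take $$c=\frac{\mathrm{LOM}(\gamma_0)}{p},\qquad \mathrm{LOM}(\gamma_0)=\frac{r_\nu\,|v_\infty(\pi_\nu)|}{|v_\infty(\operatorname{tr}\widetilde\gamma_0)|\;e_\nu\,d_\nu}>0 .$$ Here $\lambda_\pm$ are the eigenvalues of $\widetilde\gamma_0$ in its splitting field $\widetilde K_\nu$ over $K_\nu$, $e_\nu$ is the ramification index of $\widetilde K_\nu/K_\nu$, $d_\nu$ is the smallest integer $d>0$ such that $(\lambda_+/\lambda_-)^d$ is $1$ in the residue field of $\widetilde K_\nu$, and $r_\nu$ is the normalized valuation of $(\lambda_+/\lambda_-)^{d_\nu}-1$ in $\widetilde K_\nu$. -/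

import Mathlib

open Filter Topology MeasureTheory
open scoped WithZero BoundedContinuousFunction

noncomputable section

namespace HeckeEscape

/-! ### Global function fields, places, completions -/

/-- `K` is a global function field with (full) field of constants the finite field `Fq`:
a finite extension of a rational function field `Fq(t)` in which `Fq` is algebraically closed. -/
structure IsGlobalFunctionField (Fq K : Type*) [Field Fq] [Field K] [Algebra Fq K] : Prop where
  finite_const : Finite Fq
  finite_over_ratFunc : ∃ t : K, Transcendental Fq t ∧
    FiniteDimensional (IntermediateField.adjoin Fq ({t} : Set K)) K
  algClosed_const : ∀ x : K, IsAlgebraic Fq x → x ∈ (algebraMap Fq K).range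

/-- The primes (places) of `K`: the discrete valuations of `K`, trivial on `Fqˣ`, with value group
exactly `ℤ`. Valuations are written multiplicatively, so the additive valuation of `x ≠ 0` is
`-(val x).log`. -/
@[ext]
structure Place (Fq K : Type*) [Field Fq] [Field K] [Algebra Fq K] where
  val : Valuation K ℤᵐ⁰
  surj : Function.Surjective val
  trivial_on_const : ∀ c : Fq, c ≠ 0 → val (algebraMap Fq K c) = 1

section

variable {Fq K : Type*} [Field Fq] [Field K] [Algebra Fq K]

/-- The completion `K_ω`. -/
def Place.Compl (ω : Place Fq K) : Type _ := ω.val.Completion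

instance (ω : Place Fq K) : Field ω.Compl := inferInstanceAs (Field ω.val.Completion)

/-- The extension of the valuation of `ω` to `K_ω`, with the topology that it defines. -/
instance (ω : Place Fq K) : Valued ω.Compl ℤᵐ⁰ := inferInstanceAs (Valued ω.val.Completion ℤᵐ⁰)

/-- The embedding of `K` in `K_ω`. -/
def Place.emb (ω : Place Fq K) : K →+* ω.Compl :=
  ((UniformSpace.Completion.coeRingHom (α := WithVal ω.val)).comp
    (WithVal.equiv ω.val).symm.toRingHom : K →+* ω.val.Completion)

/-- The local ring `O_ω` of `K_ω`. -/
abbrev Place.integers (ω : Place Fq K) : Subring ω.Compl := Valued.integer ω.Compl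

/-- The ring `R_ω` of functions with no pole away from `ω`. -/
def Place.affineRing (ω : Place Fq K) : Subring K :=
  ⨅ (ω' : Place Fq K) (_ : ω' ≠ ω), ω'.val.integer

/-- The ring `R_∞[π⁻¹]`. -/
def Place.sRing (ω : Place Fq K) (π : K) : Subring K :=
  Subring.closure ((ω.affineRing : Set K) ∪ {π⁻¹})

/-- The (additive) valuation `v_ω(x) ∈ ℤ` of an element `x ≠ 0` of `K`. -/
def Place.ord (ω : Place Fq K) (x : K) : ℤ := -(ω.val x).log

/-- A uniformizer at `ω`, chosen in `K`. -/
def Place.unif (ω : Place Fq K) : K := (ω.surj (WithZero.exp (-1))).choose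

end

/-! ### `PGL₂`, lattices -/

/-- The group `PGL₂(F)`. -/
abbrev PGL2 (F : Type*) [CommRing F] : Type _ := Matrix.ProjGenLinGroup (Fin 2) F

/-- `PGL₂(F)` carries the quotient topology of `GL₂(F)`. -/
instance pglTopology (F : Type*) [CommRing F] [TopologicalSpace F] :
    TopologicalSpace (PGL2 F) :=
  TopologicalSpace.coinduced
    (Matrix.ProjGenLinGroup.mk : Matrix.GeneralLinearGroup (Fin 2) F →* PGL2 F) inferInstance

/-- For a subring `R` of `F`, the image of `GL₂(R)` in `PGL₂(F)`; it is the stabilizer of the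
homothety class of the lattice `R × R`. -/
def pglOf {F : Type*} [CommRing F] (R : Subring F) : Subgroup (PGL2 F) :=
  (Matrix.ProjGenLinGroup.map (n := Fin 2) R.subtype).range

/-- The element `α(t)` of `PGL₂(F)` represented by the diagonal matrix `(1, t)`. All elements of the
diagonal group of `PGL₂(F)` are of this form. -/
def alpha {F : Type*} [Field F] (t : Fˣ) : PGL2 F :=
  Matrix.ProjGenLinGroup.mk
    (Matrix.GeneralLinearGroup.mkOfDetNeZero !![(1 : F), 0; 0, (t : F)] (by simp))

/-- The `R`-lattice `M (R × R)` in `F × F`, spanned by the columns of `M ∈ GL₂(F)`. -/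
def lattice {F : Type*} [Field F] (R : Subring F) (M : Matrix.GeneralLinearGroup (Fin 2) F) :
    Submodule R (Fin 2 → F) :=
  Submodule.span R (Set.range fun j : Fin 2 => fun i : Fin 2 => (M : Matrix (Fin 2) (Fin 2) F) i j)

/-- `L ⊆ L'` and `L' / L` is isomorphic to `R / π R` as an `R`-module. -/
def IsElementarySublattice {F : Type*} [Field F] (R : Subring F) (π : R)
    (L L' : Submodule R (Fin 2 → F)) : Prop :=
  L ≤ L' ∧ Nonempty ((L' ⧸ L.submoduleOf L') ≃ₗ[R] (R ⧸ Ideal.span ({π} : Set R)))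

section

variable {Fq K : Type*} [Field Fq] [Field K] [Algebra Fq K]

/-- The map `PGL₂(K) → PGL₂(K_ω)`. -/
def Place.toG (ω : Place Fq K) : PGL2 K →* PGL2 ω.Compl :=
  Matrix.ProjGenLinGroup.map ω.emb

/-- `Γ_∞ = PGL₂(R_∞)`, as a subgroup of `PGL₂(K)`. -/
def Gam (inf : Place Fq K) : Subgroup (PGL2 K) := pglOf inf.affineRing

/-- `Γ_S = PGL₂(R_∞[π⁻¹])`, as a subgroup of `PGL₂(K)`. -/
def GamS (inf : Place Fq K) (π : K) : Subgroup (PGL2 K) := pglOf (inf.sRing π)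

/-- `Γ_∞` as a subgroup of `G_∞ = PGL₂(K_∞)`. -/
def GamInf (inf : Place Fq K) : Subgroup (PGL2 inf.Compl) := (Gam inf).map inf.toG

/-! ### The space `X_∞ = Γ_∞ \ G_∞` and its `A_∞`-periodic points -/

/-- The space `X_∞ = Γ_∞ \ G_∞` of right cosets `Γ_∞ g`, with its quotient topology. The coset
`Γ_∞ g` corresponds to the homothety class of the `R_∞`-lattice `g⁻¹ (R_∞ × R_∞)`. -/
def XInf (inf : Place Fq K) : Type _ := Quotient (QuotientGroup.rightRel (GamInf inf))

instance (inf : Place Fq K) : TopologicalSpace (XInf inf) :=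
  inferInstanceAs (TopologicalSpace (Quotient (QuotientGroup.rightRel (GamInf inf))))

instance (inf : Place Fq K) : MeasurableSpace (XInf inf) := borel _

instance (inf : Place Fq K) : BorelSpace (XInf inf) := ⟨rfl⟩

/-- The projection `G_∞ → X_∞`, `g ↦ Γ_∞ g`. -/
def XInf.mk (inf : Place Fq K) (g : PGL2 inf.Compl) : XInf inf :=
  Quotient.mk (QuotientGroup.rightRel (GamInf inf)) g

/-- The right action `Γ_∞ g ↦ Γ_∞ g a` of `G_∞` on `X_∞`. -/
def XInf.act {inf : Place Fq K} (a : PGL2 inf.Compl) : XInf inf → XInf inf :=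
  Quotient.map (fun g => g * a) (by
    intro g h hgh
    have hgh' : h * g⁻¹ ∈ GamInf inf := QuotientGroup.rightRel_apply.mp hgh
    exact QuotientGroup.rightRel_apply.mpr (by simpa [mul_assoc] using hgh'))

/-- `μ` is an `A_∞`-invariant probability measure on the orbit `x A_∞`. -/
structure IsOrbitMeasure {inf : Place Fq K} (x : XInf inf) (μ : Measure (XInf inf)) : Prop where
  prob : IsProbabilityMeasure μ
  invariant : ∀ t : inf.Complˣ, μ.map (XInf.act (alpha t)) = μ
  on_orbit : μ (Set.range fun t : inf.Complˣ => XInf.act (alpha t) x)ᶜ = 0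

/-- `x` is `A_∞`-periodic: there is a unique `A_∞`-invariant probability measure on `x A_∞`. -/
def IsPeriodic {inf : Place Fq K} (x : XInf inf) : Prop :=
  ∃! μ : Measure (XInf inf), IsOrbitMeasure x μ

open Classical in
/-- The measure `μ_x` of an `A_∞`-periodic point `x` (and `0` if `x` is not `A_∞`-periodic). -/
def periodicMeasure {inf : Place Fq K} (x : XInf inf) : Measure (XInf inf) :=
  if h : IsPeriodic x then h.choose else 0

/-- The image in `PGL₂(K)` of a matrix in `GL₂(R_∞)`. -/
def ofGL (inf : Place Fq K) (γ : Matrix.GeneralLinearGroup (Fin 2) inf.affineRing) : PGL2 K :=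
  Matrix.ProjGenLinGroup.map inf.affineRing.subtype (Matrix.ProjGenLinGroup.mk γ)

/-- The class `γ₀ ∈ Γ_∞` of the matrix `γ` and `t₀ ∈ K_∞ˣ` are associated with `g₀ ∈ G_∞`:
`γ₀ g₀ = g₀ α(t₀)`, with `v_∞(t₀)` positive and minimal. -/
structure IsAssociated {inf : Place Fq K} (g₀ : PGL2 inf.Compl)
    (γ : Matrix.GeneralLinearGroup (Fin 2) inf.affineRing) (t₀ : inf.Complˣ) : Prop where
  pos : Valued.v (t₀ : inf.Compl) < 1
  comm : inf.toG (ofGL inf γ) * g₀ = g₀ * alpha t₀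
  minimal : ∀ γ' ∈ Gam inf, ∀ t : inf.Complˣ, Valued.v (t : inf.Compl) < 1 →
    inf.toG γ' * g₀ = g₀ * alpha t → Valued.v (t : inf.Compl) ≤ Valued.v (t₀ : inf.Compl)

/-! ### Bruhat–Tits trees and the modular graph at infinity -/

/-- The vertices `G_ω / PGL₂(O_ω)` of the Bruhat–Tits tree: `g PGL₂(O_ω)` is the homothety class of
the `O_ω`-lattice `g (O_ω × O_ω)`. -/
abbrev BTVertex (ω : Place Fq K) : Type _ := PGL2 ω.Compl ⧸ pglOf ω.integers

/-- The vertex `g *_ω`. -/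
abbrev btv (ω : Place Fq K) (g : PGL2 ω.Compl) : BTVertex ω := QuotientGroup.mk g

/-- The Bruhat–Tits tree of `PGL₂` over `K_ω`. -/
def btTree (ω : Place Fq K) : SimpleGraph (BTVertex ω) :=
  SimpleGraph.fromRel fun x x' => ∃ M M' : Matrix.GeneralLinearGroup (Fin 2) ω.Compl,
    btv ω (.mk M) = x ∧ btv ω (.mk M') = x' ∧
    ∃ ϖ : ω.integers, Valued.v (ϖ : ω.Compl) = WithZero.exp (-1) ∧
      IsElementarySublattice ω.integers ϖ (lattice ω.integers M) (lattice ω.integers M')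

/-- The vertices of the modular graph `Γ_∞ \ T_∞`. -/
def ModVertex (inf : Place Fq K) : Type _ :=
  MulAction.orbitRel.Quotient (GamInf inf) (BTVertex inf)

/-- The projection from the vertices of the tree to those of the modular graph. -/
def modProj (inf : Place Fq K) (v : BTVertex inf) : ModVertex inf :=
  Quotient.mk (MulAction.orbitRel (GamInf inf) (BTVertex inf)) v

/-- The modular graph `Γ_∞ \ T_∞`. -/
def modGraph (inf : Place Fq K) : SimpleGraph (ModVertex inf) :=
  SimpleGraph.fromRel fun y y' => ∃ v v' : BTVertex inf,
    modProj inf v = y ∧ modProj inf v' = y' ∧ (btTree inf).Adj v v'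

/-- The projection `p_∞ : X_∞ = Γ_∞ \ G_∞ → Γ_∞ \ G_∞ / PGL₂(O_∞)`. -/
def pInf {inf : Place Fq K} : XInf inf → ModVertex inf :=
  Quotient.lift (fun g => modProj inf (btv inf g)) (by
    intro g h hgh
    have hgh' : h * g⁻¹ ∈ GamInf inf := QuotientGroup.rightRel_apply.mp hgh
    refine Quotient.sound (s := MulAction.orbitRel (GamInf inf) (BTVertex inf)) ?_
    refine (MulAction.orbitRel (GamInf inf) (BTVertex inf)).symm ?_
    refine ⟨⟨h * g⁻¹, hgh'⟩, ?_⟩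
    change ((h * g⁻¹ * g : PGL2 inf.Compl) : BTVertex inf) = (h : BTVertex inf)
    rw [inv_mul_cancel_right])

/-! ### Cusps and the compactification of `X_∞` -/

/-- The point `∞ = [1 : 0]` of the projective line over `K`. -/
def ptInf (K : Type*) [Field K] : Projectivization K (Fin 2 → K) :=
  Projectivization.mk K ![1, 0] (fun h => one_ne_zero (congrFun h 0))

/-- The set of cusps `Γ_∞ \ P₁(K)`. -/
def Cusp (inf : Place Fq K) : Type _ :=
  MulAction.orbitRel.Quotient (Gam inf) (Projectivization K (Fin 2 → K))

/-- The cusp `Γ_∞ γ ∞` for `γ ∈ PGL₂(K)`. Every cusp is of this form. -/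
def cuspOf (inf : Place Fq K) (γ : PGL2 K) : Cusp inf :=
  Quotient.mk (MulAction.orbitRel (Gam inf) (Projectivization K (Fin 2 → K))) (γ • ptInf K)

theorem unif_ne_zero (ω : Place Fq K) : ω.unif ≠ 0 := by
  intro h
  have h1 : ω.val ω.unif = WithZero.exp (-1) := (ω.surj (WithZero.exp (-1))).choose_spec
  rw [h, map_zero] at h1
  exact WithZero.exp_ne_zero h1.symm

/-- The element `a_ω` of `PGL₂(K)`, the diagonal matrix with entries `1` and a uniformizer. -/
def aElt (ω : Place Fq K) : PGL2 K := alpha (Units.mk0 ω.unif (unif_ne_zero ω))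

/-- The image in the modular graph of the geodesic ray `n ↦ γ a_∞ⁿ *_∞` of the Bruhat–Tits tree,
whose point at infinity is `γ ∞`. -/
def cuspRay (inf : Place Fq K) (γ : PGL2 K) (n : ℕ) : ModVertex inf :=
  modProj inf (btv inf (inf.toG (γ * aElt inf ^ n)))

/-- `y` and `y'` lie in the same connected component of the modular graph minus `F`. -/
def SameComponent (inf : Place Fq K) (F : Set (ModVertex inf)) (y y' : ModVertex inf) : Prop :=
  ∃ (hy : y ∈ Fᶜ) (hy' : y' ∈ Fᶜ), ((modGraph inf).induce Fᶜ).Reachable ⟨y, hy⟩ ⟨y', hy'⟩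

/-- The vertices of the component of the modular graph minus `F` which contains a
subray of the rays that converge to the cusp `z`. -/
def endNhd (inf : Place Fq K) (F : Set (ModVertex inf)) (z : Cusp inf) : Set (ModVertex inf) :=
  {y | ∃ γ : PGL2 K, cuspOf inf γ = z ∧ ∀ᶠ n in atTop, SameComponent inf F y (cuspRay inf γ n)}

/-- The set underlying the compactification of `X_∞` by its cusps. -/
inductive XHat (inf : Place Fq K) : Type _
  | pt (x : XInf inf) : XHat inf
  | cusp (z : Cusp inf) : XHat inf

/-- The basic neighbourhood, defined by a finite set `F` of vertices of the modular graph, of the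
cusp `z`: the inverse image of the component of `z` in the complement of `F` in Freudenthal's
compactification of the modular graph. -/
def cuspNhd (inf : Place Fq K) (F : Set (ModVertex inf)) (z : Cusp inf) : Set (XHat inf) :=
  {w | (∃ x, w = .pt x ∧ pInf x ∈ endNhd inf F z) ∨
    ∃ γ : PGL2 K, w = .cusp (cuspOf inf γ) ∧ ∀ᶠ n in atTop, cuspRay inf γ n ∈ endNhd inf F z}

/-- The topology generated by the open subsets of `X_∞` and the basic neighbourhoods of the cusps. -/
instance (inf : Place Fq K) : TopologicalSpace (XHat inf) :=
  TopologicalSpace.generateFrom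
    ({s | ∃ U : Set (XInf inf), IsOpen U ∧ s = XHat.pt '' U} ∪
      {s | ∃ (F : Set (ModVertex inf)) (z : Cusp inf), F.Finite ∧ s = cuspNhd inf F z})

instance (inf : Place Fq K) : MeasurableSpace (XHat inf) := borel _

instance (inf : Place Fq K) : BorelSpace (XHat inf) := ⟨rfl⟩

/-! ### Hecke trees and rational Hecke rays -/

/-- The graph on `X_∞` whose components are the Hecke trees; `Γ_∞ g` is seen as the homothety class
of the lattice `g⁻¹ (R_∞ × R_∞)`. Here `π` is an element of `R_∞`. -/
def heckeGraph (inf : Place Fq K) (π : K) : SimpleGraph (XInf inf) :=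
  SimpleGraph.fromRel fun x x' => ∃ M M' : Matrix.GeneralLinearGroup (Fin 2) inf.Compl,
    XInf.mk inf (.mk M⁻¹) = x ∧ XInf.mk inf (.mk M'⁻¹) = x' ∧
    ∃ ϖ : inf.affineRing.map inf.emb, (ϖ : inf.Compl) = inf.emb π ∧
      IsElementarySublattice (inf.affineRing.map inf.emb) ϖ
        (lattice (inf.affineRing.map inf.emb) M) (lattice (inf.affineRing.map inf.emb) M')

/-- `x` is a Hecke ray from `x₀`: a geodesic ray, starting from `x₀`, of the Hecke tree of `x₀`. -/
structure IsHeckeRay (inf : Place Fq K) (π : K) (x₀ : XInf inf) (x : ℕ → XInf inf) : Prop where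
  start : x 0 = x₀
  reachable : ∀ m k, (heckeGraph inf π).Reachable (x m) (x (m + k))
  isometric : ∀ m k, (heckeGraph inf π).dist (x m) (x (m + k)) = k

/-- The graph of the map `hec_g` from the vertices of the Bruhat–Tits tree at `ν` to those of the
Hecke tree of `Γ_∞ g`. Writing a vertex as `s *_ν` with `s ∈ Γ_S`, its image is
`π_∞(Γ_S (g, s)) = Γ_∞ s⁻¹ g`. -/
def IsHec (inf ν : Place Fq K) (π : K) (g : PGL2 inf.Compl) (y : BTVertex ν) (x : XInf inf) : Prop :=
  ∃ s ∈ GamS inf π, y = btv ν (ν.toG s) ∧ x = XInf.mk inf ((inf.toG s)⁻¹ * g)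

/-- The ray `x` converges to the end `hec_g(γ ∞)` of the Hecke tree: up to a shift it eventually
coincides with the image by `hec_g` of the ray `n ↦ γ a_νⁿ *_ν`, whose point at infinity
is `γ ∞`. -/
def ConvergesTo (inf ν : Place Fq K) (π : K) (g : PGL2 inf.Compl) (γ : PGL2 K)
    (x : ℕ → XInf inf) : Prop :=
  ∃ a b : ℕ, ∀ n : ℕ, IsHec inf ν π g (btv ν (ν.toG (γ * aElt ν ^ (n + a)))) (x (n + b))

/-- The Hecke ray `x` from `x₀` is rational: its point at infinity is in `hec_{g₀}(P₁(K))`. -/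
def IsRational (inf ν : Place Fq K) (π : K) (x₀ : XInf inf) (x : ℕ → XInf inf) : Prop :=
  ∃ g₀, XInf.mk inf g₀ = x₀ ∧ ∃ γ, ConvergesTo inf ν π g₀ γ x

/-- The Hecke ray `x` from `x₀` is `S`-rational: its point at infinity is in `hec_{g₀}(Γ_S ∞)`. -/
def IsSRational (inf ν : Place Fq K) (π : K) (x₀ : XInf inf) (x : ℕ → XInf inf) : Prop :=
  ∃ g₀, XInf.mk inf g₀ = x₀ ∧ ∃ γ ∈ GamS inf π, ConvergesTo inf ν π g₀ γ x

/-- `z` is the cusp `Γ_∞ γ ∞` associated with the rational Hecke ray `x` from `x₀`, where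
`hec_{g₀}(γ ∞)` is the point at infinity of `x`. -/
def IsCuspOf (inf ν : Place Fq K) (π : K) (x₀ : XInf inf) (x : ℕ → XInf inf)
    (z : Cusp inf) : Prop :=
  ∃ g₀, XInf.mk inf g₀ = x₀ ∧ ∃ γ, ConvergesTo inf ν π g₀ γ x ∧ z = cuspOf inf γ

/-! ### Escape of mass -/

/-- `θ` is a weak-star accumulation point, among the probability measures on the compact metrizable
space `XHat`, of the sequence of the periodic measures `μ_{x n}`. -/
def IsAccumulation {inf : Place Fq K} (x : ℕ → XInf inf) (θ : Measure (XHat inf)) : Prop :=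
  IsProbabilityMeasure θ ∧ ∃ φ : ℕ → ℕ, StrictMono φ ∧ ∀ f : XHat inf →ᵇ ℝ,
    Tendsto (fun n => ∫ w, f (XHat.pt w) ∂(periodicMeasure (x (φ n)))) atTop (𝓝 (∫ w, f w ∂θ))

/-- Uniform `c`-escape of mass towards a subset `Z` of the set of cusps. -/
def UniformEscape {inf : Place Fq K} (x : ℕ → XInf inf) (Z : Set (Cusp inf)) (c : ℝ) : Prop :=
  ∀ θ : Measure (XHat inf), IsAccumulation x θ → ENNReal.ofReal c ≤ θ (XHat.cusp '' Z)

/-! ### The explicit constant -/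

/-- The characteristic polynomial over `K_ν` of a matrix in `GL₂(R_∞)`. -/
def charpolyAt (inf ν : Place Fq K) (γ : Matrix.GeneralLinearGroup (Fin 2) inf.affineRing) :
    Polynomial ν.Compl :=
  (γ : Matrix (Fin 2) (Fin 2) inf.affineRing).charpoly.map (ν.emb.comp inf.affineRing.subtype)

/-- The splitting field `K̃_ν` of `γ` over `K_ν`. -/
abbrev SplitField (inf ν : Place Fq K) (γ : Matrix.GeneralLinearGroup (Fin 2) inf.affineRing) :
    Type _ := (charpolyAt inf ν γ).SplittingField

/-- The local ring `Õ_ν` of `K̃_ν`: the integral closure of `O_ν`. -/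
abbrev SplitIntegers (inf ν : Place Fq K) (γ : Matrix.GeneralLinearGroup (Fin 2) inf.affineRing) :
    Subalgebra ν.integers (SplitField inf ν γ) :=
  integralClosure ν.integers (SplitField inf ν γ)

/-- The element `u` of `K̃_ν` has normalized valuation at least `k`: it is in the `k`-th power
of the maximal ideal (that is, of the Jacobson radical) of the local ring `Õ_ν`. -/
def OrdAtLeast (inf ν : Place Fq K) (γ : Matrix.GeneralLinearGroup (Fin 2) inf.affineRing)
    (k : ℕ) (u : SplitField inf ν γ) : Prop :=
  ∃ y : SplitIntegers inf ν γ,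
    y ∈ (Ideal.jacobson (⊥ : Ideal (SplitIntegers inf ν γ))) ^ k ∧ (y : SplitField inf ν γ) = u

/-- `lam` and `lam'` are the two eigenvalues of `γ` in `K̃_ν`, in some order. -/
def IsEigenpair (inf ν : Place Fq K) (γ : Matrix.GeneralLinearGroup (Fin 2) inf.affineRing)
    (lam lam' : SplitField inf ν γ) : Prop :=
  (charpolyAt inf ν γ).map (algebraMap ν.Compl (SplitField inf ν γ)) =
    (Polynomial.X - Polynomial.C lam) * (Polynomial.X - Polynomial.C lam')

/-- The ramification index `e_ν` of `K̃_ν` over `K_ν`. -/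
def eIndex (inf ν : Place Fq K) (γ : Matrix.GeneralLinearGroup (Fin 2) inf.affineRing) : ℕ :=
  sSup {k | OrdAtLeast inf ν γ k (algebraMap ν.Compl _ (ν.emb ν.unif))}

/-- The smallest `d > 0` such that `(λ₊/λ₋)^d` is `1` in the residue field of `K̃_ν`. -/
def dIndex (inf ν : Place Fq K) (γ : Matrix.GeneralLinearGroup (Fin 2) inf.affineRing) : ℕ :=
  sInf {d | 0 < d ∧ ∃ lam lam', IsEigenpair inf ν γ lam lam' ∧
    OrdAtLeast inf ν γ 1 ((lam / lam') ^ d - 1)}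

/-- The normalized valuation `r_ν` in `K̃_ν` of `(λ₊/λ₋)^d - 1`, where `d = d_ν`. -/
def rIndex (inf ν : Place Fq K) (γ : Matrix.GeneralLinearGroup (Fin 2) inf.affineRing) : ℕ :=
  sSup {k | ∃ lam lam', IsEigenpair inf ν γ lam lam' ∧
    OrdAtLeast inf ν γ k ((lam / lam') ^ dIndex inf ν γ - 1)}

/-- `LOM(γ) = r_ν |v_∞(π)| / (|v_∞(tr γ)| e_ν d_ν)`. -/
def LOM (inf ν : Place Fq K) (π : K) (γ : Matrix.GeneralLinearGroup (Fin 2) inf.affineRing) : ℝ :=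
  ((rIndex inf ν γ : ℝ) * |(inf.ord π : ℝ)|) /
    (|(inf.ord ((γ : Matrix (Fin 2) (Fin 2) inf.affineRing).trace : K) : ℝ)| *
      (eIndex inf ν γ : ℝ) * (dIndex inf ν γ : ℝ))

end

end HeckeEscape

end

open HeckeEscape

open HeckeEscape

noncomputable section

namespace HeckeEscape

/-! ### Valuations whose restriction to a subfield of finite index is discrete -/

/-! Write x₀ = Γ_∞ g₀ with γ₀ g₀ = g₀ α(t₀), let γ be the given lift of γ₀ to GL₂(R_∞), G₀ a matrix
representing g₀, and ϖ a uniformizer at ν. Up to a shift of indices, the N-th point of the Hecke ray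
towards C∞ is Γ_∞ S⁻¹g₀, where S is invertible over R_∞[π⁻¹] and S⁻¹ C diag(1, ϖ^N) lies in GL₂(O_ν)
(`IsRayMatrix`). The proof compares the period of this point under A_∞ with the time that its orbit
spends near the cusps.

The period is bounded above. By Cayley–Hamilton γ^k = a_k γ + b_k with a_k, b_k in R_∞. The matrix
S⁻¹γS has denominators of order at most N + O(1) at ν, so S⁻¹γ^kS is in GL₂(R_∞) as soon as v_ν(a_k)
≥ N + O(1) (`IsRayMatrix.exists_conj_pow`), and then α(t₀^k) fixes the point. If λ, λ' are the
eigenvalues and Δ the discriminant, a_k² Δ = λ'^(2k) ((λ/λ')^k − 1)² (`IsEigenpair.sq_mul_discr`).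
For k = d_ν p^m, the Frobenius map turns (λ/λ')^k − 1 into the p^m-th power of (λ/λ')^(d_ν) − 1, so
v_ν(a_k) ≥ r_ν p^m / e_ν − O(1). The least suitable m gives k ≤ (p d_ν e_ν / r_ν)(N + O(1)); the
factor p is lost because m is an integer (`exists_small_glCoeffs`). Moreover v_∞(t₀) = 2 |v_∞(tr γ)|
(`HasPeriod.v_trace`).

The time near the cusps is bounded below. Some z in K², on the line of C∞, is such that u = S⁻¹z is
in R_∞² for every point of the ray. In the lattice of the point translated by α(t), the vector of u
is diag(1, t)⁻¹ G₀⁻¹ z, which does not depend on S, while the covolume has been multiplied by |det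
S|_∞ = |π|_∞^(N + O(1)), because det S is a unit of R_∞[π⁻¹]. So this vector is short whenever
|v_∞(t)| ≤ N |v_∞(π)| − O(1) (`exists_isShort_mul_glDiag`). Distinct values of v_∞(t) in this window
give distinct points: a coincidence would make u an eigenvector, defined over K, of a matrix of
GL₂(R_∞) whose eigenvalues have distinct absolute values (`v_eq_of_ofMat_eq`). Hence the points with
a short vector have mass at least about 2N |v_∞(π)| / (2 |v_∞(tr γ)| k), whose lower limit is at
least LOM(γ₀)/p (`exists_mass_bound`, `eventually_le_measureReal_cuspSet`).

In the limit, having a short vector is a condition on the vertex of Γ_∞\𝕋_∞ below the point. No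
vertex has nonzero vectors of arbitrarily large height, so a finite set of vertices keeps mass at
most 1 − c (`uniformEscape_univ`). For an S-rational end, u can be taken in the GL₂(R_∞)-orbit of
the first basis vector; the corresponding horoballs, with the cusp Γ_∞∞ added, are clopen and shrink
to that cusp (`uniformEscape_cusp`).

The arithmetic input is that nonzero elements of R_∞ have absolute value at least 1 at ∞, that R_∞
is cocompact in K_∞ and that residue fields are finite. -/

open MonoidWithZeroHom in
open Classical in
-- In a linear dependence between 1, x, …, x^n, with n = [L : F], two terms have the same value. So
-- v(x)^j is a power of v(ϖ) for some 0 < j ≤ n, and so is v(x)^(n!). Raising to the power n! then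
-- embeds the value group, which is torsion-free, in a cyclic group.
theorem isCyclic_valueGroup_of_finiteDimensional {F L Γ₀ : Type*} [Field F] [Field L] [Algebra F L]
    [FiniteDimensional F L] [LinearOrderedCommGroupWithZero Γ₀] (v : Valuation L Γ₀) (ϖ : F)
    (hϖ : v (algebraMap F L ϖ) < 1) (hϖ0 : ϖ ≠ 0)
    (h : ∀ y : F, y ≠ 0 → ∃ n : ℤ, v (algebraMap F L y) = v (algebraMap F L ϖ) ^ n) :
    IsCyclic (valueGroup (.ofClass v)) ∧ Nontrivial (valueGroup (.ofClass v)) := by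
  have hϖv : v (algebraMap F L ϖ) ≠ 0 := by simpa using hϖ0
  set n := Module.finrank F L with hn
  have key : ∀ x : L, x ≠ 0 → ∃ k : ℤ, v x ^ (n.factorial) = v (algebraMap F L ϖ) ^ k := by
    intro x hx
    have hvx : v x ≠ 0 := by simpa using hx
    have hdep : ¬ LinearIndependent F (fun i : Fin (n + 1) => x ^ (i : ℕ)) := by
      intro hli
      have := hli.fintype_card_le_finrank
      simp [← hn] at this
    rw [Fintype.not_linearIndependent_iff] at hdep
    obtain ⟨g, hg, i₀, hi₀⟩ := hdep
    -- If the nonzero terms had distinct values, their sum would have the value of the largest one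
    -- and could not vanish.
    obtain ⟨i, j, hij, hi, hj, hval⟩ : ∃ i j : Fin (n + 1), i < j ∧ g i ≠ 0 ∧ g j ≠ 0 ∧
        v (g i • x ^ (i : ℕ)) = v (g j • x ^ (j : ℕ)) := by
      by_contra! hcon
      have hne : ∀ i j : Fin (n + 1), i ≠ j → g i ≠ 0 → g j ≠ 0 →
          v (g i • x ^ (i : ℕ)) ≠ v (g j • x ^ (j : ℕ)) := by
        intro i j hij hi hj
        rcases lt_or_gt_of_ne hij with h | h
        · exact hcon i j h hi hj
        · exact (hcon j i h hj hi).symm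
      obtain ⟨m, hm, hmax⟩ := Finset.exists_max_image (Finset.univ.filter fun i => g i ≠ 0)
        (fun i => v (g i • x ^ (i : ℕ))) ⟨i₀, by simpa using hi₀⟩
      simp only [Finset.mem_filter, Finset.mem_univ, true_and] at hm hmax
      have h1 : v (∑ i ∈ Finset.univ.erase m, g i • x ^ (i : ℕ)) < v (g m • x ^ (m : ℕ)) := by
        have hpos : v (g m • x ^ (m : ℕ)) ≠ 0 := by
          rw [Algebra.smul_def, map_mul, map_pow]
          exact mul_ne_zero (by simpa using hm) (pow_ne_zero _ hvx)
        refine v.map_sum_lt hpos fun i hi => ?_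
        by_cases hgi : g i = 0
        · simpa [hgi] using zero_lt_iff.mpr hpos
        · exact lt_of_le_of_ne (hmax i hgi) (hne i m (Finset.ne_of_mem_erase hi) hgi hm)
      rw [← Finset.add_sum_erase _ _ (Finset.mem_univ m)] at hg
      have := v.map_add_eq_of_lt_left h1
      rw [hg, map_zero] at this
      rw [← this] at h1
      exact not_lt_zero h1
    obtain ⟨a, ha⟩ := h _ hi
    obtain ⟨b, hb⟩ := h _ hj
    rw [Algebra.smul_def, Algebra.smul_def, map_mul, map_mul, map_pow, map_pow, ha, hb] at hval
    obtain ⟨d, hd⟩ := Nat.exists_eq_add_of_lt (Fin.lt_def.mp hij)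
    have hdn : (d + 1) ∣ n.factorial := Nat.dvd_factorial (by omega) (by omega)
    have h2 : v x ^ (d + 1) = v (algebraMap F L ϖ) ^ (a - b) := by
      rw [zpow_sub₀ hϖv, eq_div_iff (zpow_ne_zero _ hϖv)]
      apply mul_right_cancel₀ (pow_ne_zero (i : ℕ) hvx)
      rw [hval, hd, mul_assoc, mul_left_comm, ← pow_add, add_comm (d + 1), add_assoc]
    obtain ⟨c, hc⟩ := hdn
    exact ⟨(a - b) * c, by rw [hc, pow_mul, h2, zpow_mul, zpow_natCast]⟩
  set u : Γ₀ˣ := Units.mk0 _ hϖv with hu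
  have hpow : ∀ g : valueGroup (.ofClass v), (g : Γ₀ˣ) ^ (n.factorial) ∈ Subgroup.zpowers u := by
    rintro ⟨g, hg⟩
    have : (g : Γ₀) ∈ Units.val '' (valueGroup (.ofClass v) : Set Γ₀ˣ) := ⟨g, hg, rfl⟩
    rw [valueGroup_eq_range] at this
    obtain ⟨⟨x, hx⟩, -⟩ := this
    have hx' : v x = g := hx
    have hx0 : x ≠ 0 := by rintro rfl; simp at hx'; exact g.ne_zero hx'.symm
    obtain ⟨k, hk⟩ := key x hx0
    refine ⟨k, ?_⟩
    ext
    simp [hu, ← hk, hx']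
  constructor
  · let f : valueGroup (.ofClass v) →* Subgroup.zpowers u :=
      { toFun := fun g => ⟨(g : Γ₀ˣ) ^ (n.factorial), hpow g⟩
        map_one' := by ext; simp
        map_mul' := fun a b => by ext; simp [mul_pow] }
    have hf : Function.Injective f := by
      intro a b hab
      have : (a : Γ₀ˣ) ^ n.factorial = (b : Γ₀ˣ) ^ n.factorial := congrArg Subtype.val hab
      exact Subtype.ext (pow_left_injective (Nat.factorial_ne_zero n) this)
    exact isCyclic_of_injective f hf
  · refine ⟨⟨⟨u, mem_valueGroup _ ⟨algebraMap F L ϖ, rfl⟩⟩, 1, fun h => ?_⟩⟩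
    have : u = 1 := congrArg Subtype.val h
    have : v (algebraMap F L ϖ) = 1 := congrArg Units.val this
    exact hϖ.ne this

theorem isDiscreteValuationRing_of_finiteDimensional {F L : Type*} [Field F] [Field L]
    [Algebra F L] [FiniteDimensional F L] (V : ValuationSubring L) (ϖ : F)
    (hϖ : V.valuation (algebraMap F L ϖ) < 1) (hϖ0 : ϖ ≠ 0)
    (h : ∀ y : F, y ≠ 0 → ∃ n : ℤ, V.valuation (algebraMap F L y) =
      V.valuation (algebraMap F L ϖ) ^ n) :
    IsDiscreteValuationRing V := by
  obtain ⟨h1, h2⟩ := isCyclic_valueGroup_of_finiteDimensional V.valuation ϖ hϖ hϖ0 h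
  have := Valuation.valuationSubring_isDiscreteValuationRing V.valuation
  rwa [ValuationSubring.valuationSubring_valuation] at this

/-! ### Places of a global function field and arithmetic of R_∞ -/

section

variable {Fq K : Type*} [Field Fq] [Field K] [Algebra Fq K]

open IntermediateField in
-- Exchange: y is algebraic over Fq(x), so x is algebraic over Fq(y), and K is finite over Fq(x, y).
-- This frees the choice of the transcendental element, which can then be taken with a pole at a
-- given place or in R_∞.
theorem IsGlobalFunctionField.finiteDimensional_adjoin (hK : IsGlobalFunctionField Fq K) {y : K}
    (hy : Transcendental Fq y) : FiniteDimensional (adjoin Fq ({y} : Set K)) K := by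
  obtain ⟨x, hx, hfin⟩ := hK.finite_over_ratFunc
  have halg : IsAlgebraic Fq⟮y⟯ x := isAlgebraic_adjoin_iff.mpr (IsAlgebraic.adjoin_singleton hx hy
    (isAlgebraic_adjoin_iff.mp (Algebra.IsAlgebraic.isAlgebraic (R := Fq⟮x⟯) y)))
  let Fyx := restrictScalars Fq Fq⟮y⟯⟮x⟯
  let Fxy := restrictScalars Fq Fq⟮x⟯⟮y⟯
  let : Algebra Fq⟮y⟯ Fyx := Fq⟮y⟯⟮x⟯.algebra
  let : Module Fq⟮y⟯ Fyx := Algebra.toModule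
  let : SMul Fq⟮y⟯ Fyx := Algebra.toSMul
  let : Algebra Fq⟮x⟯ Fxy := Fq⟮x⟯⟮y⟯.algebra
  let : Module Fq⟮x⟯ Fxy := Algebra.toModule
  let : SMul Fq⟮x⟯ Fxy := Algebra.toSMul
  have : FiniteDimensional Fq⟮y⟯ Fyx := adjoin.finiteDimensional
    (isAlgebraic_iff_isIntegral.mp halg)
  have : FiniteDimensional Fyx K := by
    unfold Fyx
    rw [adjoin_simple_comm]
    have : IsScalarTower Fq⟮x⟯ Fxy K := isScalarTower_mid' Fq⟮x⟯⟮y⟯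
    exact .right Fq⟮x⟯ Fxy K
  have : IsScalarTower Fq⟮y⟯ Fyx K := isScalarTower_mid' Fq⟮y⟯⟮x⟯
  exact .trans Fq⟮y⟯ Fyx K


instance Place.isTrivialOn (ω : Place Fq K) : ω.val.IsTrivialOn Fq := ⟨ω.trivial_on_const⟩

theorem Place.transcendental (ω : Place Fq K) {x : K} (h0 : x ≠ 0) (h1 : ω.val x ≠ 1) :
    Transcendental Fq x :=
  Valuation.transcendental_of_ne_one Fq x h0 h1

/-- The elements of `F(x)` are quotients of polynomials in `x`. -/
theorem exists_eq_aeval_div_aeval {x z : K}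
    (hz : z ∈ IntermediateField.adjoin Fq ({x} : Set K)) (hz0 : z ≠ 0) :
    ∃ f g : Polynomial Fq, f ≠ 0 ∧ g ≠ 0 ∧ z = Polynomial.aeval x f / Polynomial.aeval x g := by
  obtain ⟨f, g, rfl⟩ := (IntermediateField.mem_adjoin_simple_iff Fq z).mp hz
  refine ⟨f, g, ?_, ?_, rfl⟩ <;> rintro rfl <;> simp at hz0

/-- As x⁻¹ is not invertible in Fq[x⁻¹], some valuation ring of K contains Fq[x⁻¹] and has x⁻¹ as a
nonunit. It is discrete because K is finite over Fq(x), and its normalized valuation is the required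
place. -/
theorem exists_place_one_lt (hK : IsGlobalFunctionField Fq K) {x : K} (hx : Transcendental Fq x) :
    ∃ ω : Place Fq K, 1 < ω.val x := by
  have hx0 : x ≠ 0 := fun h => hx (h ▸ isAlgebraic_zero)
  have := hK.finiteDimensional_adjoin hx
  set A : Subring K := (Algebra.adjoin Fq ({x⁻¹} : Set K)).toSubring with hA
  have hxA : x⁻¹ ∈ A := Algebra.self_mem_adjoin_singleton Fq x⁻¹
  have hxt : Transcendental Fq x⁻¹ := fun h => hx ((IsAlgebraic.inv_iff).mp h)
  have hI : Ideal.span {(⟨x⁻¹, hxA⟩ : A)} ≠ ⊤ := by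
    intro h
    rw [Ideal.span_singleton_eq_top] at h
    obtain ⟨⟨b, hb⟩, hb1⟩ := h.exists_right_inv
    have hb1' : x⁻¹ * b = 1 := congrArg Subtype.val hb1
    obtain ⟨f, rfl⟩ := Algebra.adjoin_eq_exists_aeval Fq x⁻¹ ⟨b, hb⟩
    have h2 : Polynomial.aeval x⁻¹ (Polynomial.X * f - 1) = 0 := by
      simpa [sub_eq_zero] using hb1'
    have h3 := (transcendental_iff.mp hxt) _ h2
    simpa using congrArg (Polynomial.eval 0) h3
  obtain ⟨V, hAV, hV⟩ := Ideal.image_subset_nonunits_valuationSubring _ hI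
  have hVx : V.valuation x⁻¹ < 1 :=
    V.mem_nonunits_iff.mp (hV ⟨_, Ideal.subset_span rfl, rfl⟩)
  have hconst : ∀ c : Fq, c ≠ 0 → V.valuation (algebraMap Fq K c) = 1 := by
    have h1 : ∀ c : Fq, V.valuation (algebraMap Fq K c) ≤ 1 := fun c =>
      (V.valuation_le_one_iff _).mpr (hAV (Subalgebra.algebraMap_mem _ c))
    intro c hc
    refine le_antisymm (h1 c) ?_
    have := h1 c⁻¹
    rw [map_inv₀, map_inv₀] at this
    exact (inv_le_one₀ (zero_lt_iff.mpr (by simpa using hc))).mp this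
  have htriv : V.valuation.IsTrivialOn Fq := ⟨hconst⟩
  have hVx1 : 1 < V.valuation x := by
    rw [map_inv₀] at hVx
    exact (inv_lt_one₀ (zero_lt_iff.mpr (by simpa using hx0))).mp hVx
  have hdvr : IsDiscreteValuationRing V := by
    refine isDiscreteValuationRing_of_finiteDimensional
      (F := IntermediateField.adjoin Fq ({x} : Set K)) V
      (IntermediateField.AdjoinSimple.gen Fq x)⁻¹ (by simpa using hVx) ?_ ?_
    · intro h
      exact hx0 (congrArg Subtype.val (inv_eq_zero.mp h))
    · rintro ⟨z, hz⟩ hz0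
      obtain ⟨f, g, hf, hg, hfg⟩ := exists_eq_aeval_div_aeval hz (fun h => hz0 (Subtype.ext h))
      refine ⟨(g.natDegree : ℤ) - f.natDegree, ?_⟩
      change V.valuation z = V.valuation x⁻¹ ^ _
      rw [hfg, map_div₀,
        Polynomial.valuation_aeval_eq_valuation_X_pow_natDegree_of_one_lt_valuation_X x hVx1 hf,
        Polynomial.valuation_aeval_eq_valuation_X_pow_natDegree_of_one_lt_valuation_X x hVx1 hg,
        map_inv₀, inv_zpow', neg_sub, zpow_sub₀ (by simpa using hx0), zpow_natCast, zpow_natCast]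
  let w := (IsDiscreteValuationRing.maximalIdeal V).valuation K
  have hw : ∀ z : K, w z ≤ 1 ↔ z ∈ V := by
    intro z
    constructor
    · intro h
      obtain ⟨a, rfl⟩ := IsDiscreteValuationRing.exists_lift_of_le_one h
      exact a.2
    · intro h
      exact (IsDiscreteValuationRing.maximalIdeal V).valuation_le_one (K := K) ⟨z, h⟩
  refine ⟨⟨w, IsDedekindDomain.HeightOneSpectrum.valuation_surjective K _, ?_⟩, ?_⟩
  · intro c hc
    refine le_antisymm ((hw _).mpr (hAV (Subalgebra.algebraMap_mem _ c))) ?_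
    have : w (algebraMap Fq K c⁻¹) ≤ 1 := (hw _).mpr (hAV (Subalgebra.algebraMap_mem _ c⁻¹))
    rw [map_inv₀, map_inv₀] at this
    exact (inv_le_one₀ (zero_lt_iff.mpr (by simpa using hc))).mp this
  · change 1 < w x
    by_contra! h
    have := (V.valuation_le_one_iff _).mpr ((hw x).mp h)
    exact absurd this (not_le.mpr hVx1)

theorem Place.mem_affineRing_iff (inf : Place Fq K) (x : K) :
    x ∈ inf.affineRing ↔ ∀ ω : Place Fq K, ω ≠ inf → ω.val x ≤ 1 := by
  simp [Place.affineRing, Subring.mem_iInf, Valuation.mem_integer_iff]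

theorem Place.one_lt_val_of_transcendental (hK : IsGlobalFunctionField Fq K) (inf : Place Fq K)
    {x : K} (hx : x ∈ inf.affineRing) (ht : Transcendental Fq x) : 1 < inf.val x := by
  obtain ⟨ω, hω⟩ := exists_place_one_lt hK ht
  by_cases h : ω = inf
  · rwa [← h]
  · exact absurd ((inf.mem_affineRing_iff x).mp hx ω h) (not_le.mpr hω)

/-- A nonconstant function has a pole, which for an element of R_∞ can only be at ∞; constants have
absolute value 1. This plays the role of the product formula: it yields the discreteness of Γ_∞ and
the lower bounds for vectors of R_∞². -/
theorem Place.one_le_val (hK : IsGlobalFunctionField Fq K) (inf : Place Fq K) {x : K}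
    (hx : x ∈ inf.affineRing) (hx0 : x ≠ 0) : 1 ≤ inf.val x := by
  by_cases ht : Transcendental Fq x
  · exact (inf.one_lt_val_of_transcendental hK hx ht).le
  · obtain ⟨c, rfl⟩ := hK.algClosed_const x (not_not.mp ht)
    exact (inf.trivial_on_const c (by rintro rfl; simp at hx0)).ge

theorem Place.algebraMap_mem_affineRing (inf : Place Fq K) (c : Fq) :
    algebraMap Fq K c ∈ inf.affineRing := by
  rw [inf.mem_affineRing_iff]
  intro ω _
  by_cases hc : c = 0
  · simp [hc]
  · exact (ω.trivial_on_const c hc).le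

theorem mem_integer_of_isIntegralElem {A : Type*} [CommRing A] {L Γ₀ : Type*} [Field L]
    [LinearOrderedCommGroupWithZero Γ₀] (v : Valuation L Γ₀) (f : A →+* L)
    (hf : ∀ a, v (f a) ≤ 1) {x : L} (hx : f.IsIntegralElem x) : v x ≤ 1 := by
  obtain ⟨p, hp, hpx⟩ := hx
  let g : A →+* v.integer := f.codRestrict _ hf
  have : IsIntegral v.integer x := ⟨p.map g, hp.map _, by
    rw [Polynomial.eval₂_map]; exact hpx⟩
  exact (Valuation.integer.integers v).mem_of_integral this

/-- R_∞ is an intersection of valuation rings, hence integrally closed. -/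
theorem Place.mem_affineRing_of_isIntegralElem (inf : Place Fq K) {A : Type*} [CommRing A]
    (f : A →+* K) (hf : ∀ a, f a ∈ inf.affineRing) {x : K} (hx : f.IsIntegralElem x) :
    x ∈ inf.affineRing := by
  rw [inf.mem_affineRing_iff]
  exact fun ω hω => mem_integer_of_isIntegralElem ω.val f
    (fun a => (inf.mem_affineRing_iff _).mp (hf a) ω hω) hx

theorem Place.aeval_mem_affineRing (inf : Place Fq K) {y : K} (hy : y ∈ inf.affineRing)
    (f : Polynomial Fq) : Polynomial.aeval y f ∈ inf.affineRing := by
  induction f using Polynomial.induction_on' with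
  | add p q hp hq => rw [map_add]; exact add_mem hp hq
  | monomial n a =>
    rw [Polynomial.aeval_monomial]
    exact mul_mem (inf.algebraMap_mem_affineRing a) (pow_mem hy n)

/-- K is algebraic over Fq[y], so b has a nonzero multiple which is integral over Fq[y] ⊆ R_∞. -/
theorem Place.exists_aeval_mul_mem (hK : IsGlobalFunctionField Fq K) (inf : Place Fq K) {y : K}
    (hy : y ∈ inf.affineRing) (ht : Transcendental Fq y) (b : K) :
    ∃ f : Polynomial Fq, f ≠ 0 ∧ Polynomial.aeval y f * b ∈ inf.affineRing := by
  have := hK.finiteDimensional_adjoin ht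
  have hb : IsAlgebraic (Algebra.adjoin Fq ({y} : Set K)) b :=
    IntermediateField.isAlgebraic_adjoin_iff.mp (Algebra.IsAlgebraic.isAlgebraic b)
  obtain ⟨⟨a, ha⟩, ha0, hint⟩ := hb.exists_integral_multiple
  obtain ⟨f, hf⟩ := Algebra.adjoin_eq_exists_aeval Fq y ⟨a, ha⟩
  refine ⟨f, ?_, ?_⟩
  · rintro rfl
    exact ha0 (Subtype.ext (by simpa using hf.symm))
  · have hf' : Polynomial.aeval y f = a := by simpa using hf
    rw [hf']
    refine inf.mem_affineRing_of_isIntegralElem _ ?_ hint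
    intro a
    obtain ⟨g, hg⟩ := Algebra.adjoin_eq_exists_aeval Fq y a
    have : algebraMap (Algebra.adjoin Fq ({y} : Set K)) K a = Polynomial.aeval y g := by
      simpa using hg.symm
    rw [this]
    exact inf.aeval_mem_affineRing hy g

/-- `K` is the fraction field of `R_∞`. -/
theorem Place.exists_mul_mem_affineRing (hK : IsGlobalFunctionField Fq K) (inf : Place Fq K) {y : K}
    (hy : y ∈ inf.affineRing) (ht : Transcendental Fq y) (b : K) :
    ∃ f ∈ inf.affineRing, f ≠ 0 ∧ f * b ∈ inf.affineRing := by
  obtain ⟨f, hf0, hf⟩ := inf.exists_aeval_mul_mem hK hy ht b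
  exact ⟨_, inf.aeval_mem_affineRing hy f, fun h => hf0 ((transcendental_iff.mp ht) f h), hf⟩

end

section

variable {Fq K : Type*} [Field Fq] [Field K] [Algebra Fq K]

/-! ### Completions -/

@[simp]
theorem Place.v_emb (ω : Place Fq K) (x : K) : Valued.v (ω.emb x) = ω.val x :=
  Valued.valuedCompletion_apply (K := WithVal ω.val) ((WithVal.equiv ω.val).symm x)

instance (ω : Place Fq K) : CompleteSpace ω.Compl :=
  inferInstanceAs (CompleteSpace ω.val.Completion)

instance (ω : Place Fq K) : T2Space ω.Compl :=
  inferInstanceAs (T2Space ω.val.Completion)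

theorem Place.denseRange_emb (ω : Place Fq K) : DenseRange ω.emb := by
  have : DenseRange ((↑) : WithVal ω.val → ω.val.Completion) :=
    UniformSpace.Completion.denseRange_coe
  intro x
  have h := this x
  rwa [show Set.range ((↑) : WithVal ω.val → ω.val.Completion) = Set.range ω.emb from
    ((WithVal.equiv ω.val).symm.surjective.range_comp _).symm] at h

theorem Place.v_surjective (ω : Place Fq K) :
    Function.Surjective (Valued.v : Valuation ω.Compl ℤᵐ⁰) := by
  intro γ
  obtain ⟨x, hx⟩ := ω.surj γ
  exact ⟨ω.emb x, by rw [ω.v_emb, hx]⟩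

theorem Place.mem_nhds (ω : Place Fq K) {s : Set ω.Compl} {x : ω.Compl} :
    s ∈ 𝓝 x ↔ ∃ γ : ℤᵐ⁰, γ ≠ 0 ∧ {y | Valued.v (y - x) < γ} ⊆ s := by
  rw [Valued.mem_nhds]
  constructor
  · rintro ⟨γ, hγ⟩
    refine ⟨MonoidWithZeroHom.ValueGroup₀.embedding γ.1, by simp, ?_⟩
    simpa only [Valuation.restrict_lt_iff_lt_embedding] using hγ
  · rintro ⟨γ, hγ0, hγ⟩
    obtain ⟨z, rfl⟩ := ω.v_surjective γ
    refine ⟨Units.mk0 (Valued.v.restrict z) (by simpa using hγ0), ?_⟩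
    simpa only [Units.val_mk0, Valuation.restrict_lt_iff] using hγ

theorem Place.exists_approx (ω : Place Fq K) (x : ω.Compl) {γ : ℤᵐ⁰} (hγ : γ ≠ 0) :
    ∃ y : K, Valued.v (ω.emb y - x) < γ := by
  obtain ⟨_, h, y, rfl⟩ := mem_closure_iff_nhds.mp (ω.denseRange_emb x) _
    (ω.mem_nhds.mpr ⟨γ, hγ, subset_rfl⟩)
  exact ⟨y, h⟩


theorem Place.isOpen_setOf_v_sub_lt (ω : Place Fq K) (x : ω.Compl) {γ : ℤᵐ⁰} (hγ : γ ≠ 0) :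
    IsOpen {y : ω.Compl | Valued.v (y - x) < γ} := by
  rw [isOpen_iff_mem_nhds]
  intro y hy
  refine ω.mem_nhds.mpr ⟨γ, hγ, fun z hz => ?_⟩
  have := Valued.v.map_add_lt (x := z - y) (y := y - x) hz hy
  simpa using this

/-! ### Finiteness of residue fields -/

/-- As x has a pole at ω, the size of a polynomial in x is given by its degree. A regular quotient
f(x)/g(x) is therefore congruent to 0, or to the quotient of the leading coefficients when the
degrees agree. -/
theorem Place.exists_const_sub_lt (ω : Place Fq K) {x z : K} (hx : 1 < ω.val x)
    (hz : z ∈ IntermediateField.adjoin Fq ({x} : Set K)) (hz1 : ω.val z ≤ 1) :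
    ∃ c : Fq, ω.val (z - algebraMap Fq K c) < 1 := by
  by_cases hz0 : z = 0
  · exact ⟨0, by simp [hz0]⟩
  obtain ⟨f, g, hf, hg, rfl⟩ := exists_eq_aeval_div_aeval hz hz0
  have hval : ∀ f : Polynomial Fq, f ≠ 0 →
      ω.val (Polynomial.aeval x f) = ω.val x ^ f.natDegree := fun f hf =>
    Polynomial.valuation_aeval_eq_valuation_X_pow_natDegree_of_one_lt_valuation_X x hx hf
  have hx0 : 0 < ω.val x := zero_lt_one.trans hx
  have hg0 : Polynomial.aeval x g ≠ 0 := by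
    rw [← ω.val.ne_zero_iff, hval g hg]
    exact (pow_pos hx0 _).ne'
  have hgpos : 0 < ω.val (Polynomial.aeval x g) := by rw [hval g hg]; exact pow_pos hx0 _
  have hdeg : f.natDegree ≤ g.natDegree := by
    rw [map_div₀, div_le_one₀ hgpos, hval f hf, hval g hg] at hz1
    exact (pow_le_pow_iff_right₀ hx).mp hz1
  rcases hdeg.lt_or_eq with hlt | heq
  · refine ⟨0, ?_⟩
    rw [map_zero, sub_zero, map_div₀, div_lt_one₀ hgpos, hval f hf, hval g hg]
    exact pow_lt_pow_right₀ hx hlt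
  · set c := f.leadingCoeff / g.leadingCoeff with hc
    have hc0 : c ≠ 0 := div_ne_zero (by simpa using hf) (by simpa using hg)
    refine ⟨c, ?_⟩
    have h1 : Polynomial.aeval x f / Polynomial.aeval x g - algebraMap Fq K c =
        Polynomial.aeval x (f - Polynomial.C c * g) / Polynomial.aeval x g := by
      field_simp
      simp
      ring
    rw [h1, map_div₀, div_lt_one₀ hgpos]
    by_cases h0 : f - Polynomial.C c * g = 0
    · simpa [h0] using hgpos
    rw [hval _ h0, hval g hg]
    refine pow_lt_pow_right₀ hx ?_
    have hdeg' : (Polynomial.C c * g).degree = f.degree := by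
      rw [Polynomial.degree_C_mul hc0, Polynomial.degree_eq_natDegree hf,
        Polynomial.degree_eq_natDegree hg, heq]
    have hlead : f.leadingCoeff = (Polynomial.C c * g).leadingCoeff := by
      rw [Polynomial.leadingCoeff_mul, Polynomial.leadingCoeff_C, hc,
        div_mul_cancel₀ _ (by simpa using hg)]
    have := Polynomial.degree_sub_lt_left hdeg'.symm hf hlead
    rw [← heq]
    exact Polynomial.natDegree_lt_natDegree h0 this

/-- If y has a pole at ω, residues that are independent over Fq lift to elements that are
independent over Fq(y), so the residue field has dimension at most [K : Fq(y)] over Fq. -/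
theorem Place.exists_finite_residues (hK : IsGlobalFunctionField Fq K) (ω : Place Fq K) :
    ∃ T : Set K, T.Finite ∧ ∀ x : K, ω.val x ≤ 1 → ∃ t ∈ T, ω.val t ≤ 1 ∧ ω.val (x - t) < 1 := by
  classical
  have := hK.finite_const
  obtain ⟨y, hy⟩ := ω.surj (WithZero.exp 1)
  have hy1 : 1 < ω.val y := by rw [hy, ← WithZero.exp_zero, WithZero.exp_lt_exp]; exact one_pos
  have hyt : Transcendental Fq y := ω.transcendental (by rintro rfl; simp at hy1) hy1.ne'
  have := hK.finiteDimensional_adjoin hyt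
  set F := IntermediateField.adjoin Fq ({y} : Set K)
  let O : Submodule Fq K :=
    { carrier := {x | ω.val x ≤ 1}
      add_mem' := fun ha hb => ω.val.map_add_le ha hb
      zero_mem' := by simp
      smul_mem' := by
        intro c x hx
        by_cases hc : c = 0
        · simp [hc]
        · simpa [Algebra.smul_def, ω.trivial_on_const c hc] using hx }
  let m : Submodule Fq O :=
    { carrier := {x | ω.val (x : K) < 1}
      add_mem' := fun ha hb => ω.val.map_add_lt ha hb
      zero_mem' := by simp
      smul_mem' := by
        intro c x hx
        by_cases hc : c = 0
        · simp [hc]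
        · simpa [Algebra.smul_def, ω.trivial_on_const c hc] using hx }
  have key : ∀ n (z : Fin n → O), LinearIndependent Fq (fun i => m.mkQ (z i)) →
      LinearIndependent F (fun i => (z i : K)) := by
    intro n z hz
    rw [Fintype.linearIndependent_iff]
    by_contra! hcon
    obtain ⟨g, hg, i₀, hi₀⟩ := hcon
    -- Dividing a relation over Fq(y) by its largest coefficient makes all coefficients regular at
    -- ω; replacing them by the constants congruent to them gives a relation between the residues,
    -- with coefficient 1 at j.
    obtain ⟨j, -, hj⟩ := Finset.exists_max_image Finset.univ (fun i => ω.val (g i : K))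
      ⟨i₀, Finset.mem_univ _⟩
    have hgj : g j ≠ 0 := by
      intro h0
      have := hj i₀ (Finset.mem_univ _)
      rw [h0] at this
      simp only [ZeroMemClass.coe_zero, map_zero, le_zero_iff, map_eq_zero,
        ZeroMemClass.coe_eq_zero] at this
      exact hi₀ this
    have hgj' : (g j : K) ≠ 0 := fun h => hgj (Subtype.ext h)
    have hh : ∀ i, ∃ c : Fq, ω.val ((g i / g j : F) - algebraMap Fq K c) < 1 := by
      intro i
      refine ω.exists_const_sub_lt hy1 (g i / g j : F).2 ?_
      push_cast
      rw [map_div₀, div_le_one₀ (zero_lt_iff.mpr (by simpa using hgj))]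
      exact hj i (Finset.mem_univ _)
    choose c hc using hh
    have hsum : ∑ i, (g i / g j : F) • (z i : K) = 0 := by
      have : ∑ i, (g i / g j : F) • (z i : K) = (g j : F)⁻¹ • ∑ i, g i • (z i : K) := by
        rw [Finset.smul_sum]
        refine Finset.sum_congr rfl fun i _ => ?_
        rw [smul_smul, div_eq_inv_mul]
      rw [this, hg, smul_zero]
    have hmem : ∑ i, c i • z i ∈ m := by
      change ω.val ((∑ i, c i • z i : O) : K) < 1
      have h2 : ((∑ i, c i • z i : O) : K) =
          - ∑ i, ((g i / g j : F) - algebraMap Fq K (c i)) * (z i : K) := by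
        simp only [sub_mul, Finset.sum_sub_distrib]
        have h3 : ∑ i, ((g i / g j : F) : K) * (z i : K) = 0 := hsum
        rw [h3]
        simp [Algebra.smul_def]
      rw [h2, Valuation.map_neg]
      refine ω.val.map_sum_lt one_ne_zero fun i _ => ?_
      rw [map_mul]
      exact mul_lt_one_of_lt_of_le (hc i) (z i).2
    have hzero : ∑ i, c i • m.mkQ (z i) = 0 := by
      have : m.mkQ (∑ i, c i • z i) = 0 := (Submodule.Quotient.mk_eq_zero m).mpr hmem
      simpa only [map_sum, map_smul] using this
    have hcj := Fintype.linearIndependent_iff.mp hz c hzero j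
    have := hc j
    rw [hcj, div_self hgj] at this
    simp at this
  have hrank : Module.rank Fq (O ⧸ m) ≤ Module.finrank F K := by
    refine rank_le fun s hs => ?_
    have hs' : LinearIndependent Fq (fun i : Fin s.card => ((s.equivFin.symm i : s) : O ⧸ m)) :=
      hs.comp _ s.equivFin.symm.injective
    have hz : ∀ i : Fin s.card, ∃ z : O, m.mkQ z = ((s.equivFin.symm i : s) : O ⧸ m) :=
      fun i => m.mkQ_surjective _
    choose z hz using hz
    have := (key s.card z (by simpa only [hz] using hs')).fintype_card_le_finrank
    simpa using this
  have hfin : FiniteDimensional Fq (O ⧸ m) :=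
    Module.rank_lt_aleph0_iff.mp (hrank.trans_lt (Cardinal.natCast_lt_aleph0))
  have : Finite (O ⧸ m) := Module.finite_of_finite Fq
  refine ⟨Set.range fun w : O ⧸ m => ((Quotient.out w : O) : K), Set.finite_range _, ?_⟩
  intro x hx
  refine ⟨_, ⟨m.mkQ ⟨x, hx⟩, rfl⟩, (Quotient.out (m.mkQ ⟨x, hx⟩) : O).2, ?_⟩
  have h1 : m.mkQ (Quotient.out (m.mkQ ⟨x, hx⟩)) = m.mkQ ⟨x, hx⟩ := Quotient.out_eq _
  have h2 := (Submodule.Quotient.eq m).mp h1.symm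
  exact h2

end

section

variable {Fq K : Type*} [Field Fq] [Field K] [Algebra Fq K]

/-! ### Compactness of the local ring and cocompactness of `R_∞` -/

open Valuation in
instance Place.isRankOneDiscrete (ω : Place Fq K) :
    IsRankOneDiscrete (Valued.v : Valuation ω.Compl ℤᵐ⁰) := by
  obtain ⟨x, hx⟩ := ω.v_surjective (WithZero.exp (-1))
  have : Nontrivial (MonoidWithZeroHom.valueGroup (.ofClass (Valued.v : Valuation ω.Compl ℤᵐ⁰))) := by
    rw [Subgroup.nontrivial_iff_exists_ne_one]
    refine ⟨Units.mk0 (Valued.v x) (by rw [hx]; exact WithZero.exp_ne_zero), MonoidWithZeroHom.mem_valueGroup _ ⟨x, rfl⟩, ?_⟩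
    intro h
    have : Valued.v x = 1 := congrArg Units.val h
    rw [hx, WithZero.exp_eq_one] at this
    omega
  infer_instance

instance (ω : Place Fq K) : IsDiscreteValuationRing ω.integers :=
  inferInstanceAs (IsDiscreteValuationRing (Valued.v : Valuation ω.Compl ℤᵐ⁰).valuationSubring)

theorem Place.compactSpace_integers (hK : IsGlobalFunctionField Fq K) (ω : Place Fq K) :
    CompactSpace ω.integers := by
  let : (Valued.v : Valuation ω.Compl ℤᵐ⁰).RankOne :=
    Valuation.IsRankOneDiscrete.rankOne _ (one_lt_two : (1 : NNReal) < 2)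
  rw [Valued.integer.compactSpace_iff_completeSpace_and_isDiscreteValuationRing_and_finite_residueField]
  refine ⟨(Valued.isClosed_integer ω.Compl).completeSpace_coe, inferInstance, ?_⟩
  obtain ⟨T, hT, hres⟩ := ω.exists_finite_residues hK
  have : Finite T := hT
  have h : ∀ w : Valued.ResidueField ω.Compl, ∃ t : T, ∀ a : ω.integers,
      IsLocalRing.residue _ a = w → Valued.v ((a : ω.Compl) - ω.emb t) < 1 := by
    intro w
    obtain ⟨a, rfl⟩ := IsLocalRing.residue_surjective w
    obtain ⟨x, hx⟩ := ω.exists_approx (a : ω.Compl) one_ne_zero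
    have hx1 : ω.val x ≤ 1 := by
      rw [← ω.v_emb]
      simpa using Valued.v.map_add_le (x := ω.emb x - a) (y := a) hx.le a.2
    obtain ⟨t, htT, -, ht⟩ := hres x hx1
    refine ⟨⟨t, htT⟩, fun b hb => ?_⟩
    have h1 : Valued.v ((b : ω.Compl) - a) < 1 := by
      have := (IsLocalRing.residue_eq_zero_iff (b - a)).mp (by rw [map_sub, hb, sub_self])
      exact (Valuation.Integer.not_isUnit_iff_valuation_lt_one).mp this
    have h2 : Valued.v ((b : ω.Compl) - ω.emb x) < 1 := by
      have := Valued.v.map_add_lt h1 (y := a - ω.emb x) (by rwa [Valuation.map_sub_swap])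
      simpa using this
    have := Valued.v.map_add_lt h2 (y := ω.emb x - ω.emb t) (by rwa [← map_sub, ω.v_emb])
    simpa using this
  choose f hf using h
  refine Finite.of_injective f fun w w' hww => ?_
  obtain ⟨a, rfl⟩ := IsLocalRing.residue_surjective w
  obtain ⟨b, rfl⟩ := IsLocalRing.residue_surjective w'
  have h1 := hf _ a rfl
  have h2 := hf _ b rfl
  rw [hww] at h1
  rw [← sub_eq_zero, ← map_sub, IsLocalRing.residue_eq_zero_iff]
  refine (Valuation.Integer.not_isUnit_iff_valuation_lt_one).mpr ?_
  have := Valued.v.map_sub_lt h1 h2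
  simpa using this

theorem Place.isCompact_setOf_v_le (hK : IsGlobalFunctionField Fq K) (ω : Place Fq K) (γ : ℤᵐ⁰) :
    IsCompact {x : ω.Compl | Valued.v x ≤ γ} := by
  obtain ⟨c, rfl⟩ := ω.v_surjective γ
  have := ω.compactSpace_integers hK
  have h1 : IsCompact (ω.integers : Set ω.Compl) := isCompact_iff_compactSpace.mpr this
  by_cases hc : c = 0
  · simp [hc]
  convert h1.image (continuous_const_mul c) using 1
  ext x
  have hc' : 0 < Valued.v c := zero_lt_iff.mpr (by simpa using hc)
  constructor
  · intro hx
    refine ⟨c⁻¹ * x, ?_, mul_inv_cancel_left₀ hc x⟩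
    change Valued.v (c⁻¹ * x) ≤ 1
    rw [map_mul, map_inv₀]
    exact (inv_mul_le_one₀ hc').mpr hx
  · rintro ⟨z, hz, rfl⟩
    change Valued.v (c * z) ≤ _
    rw [map_mul]
    exact mul_le_of_le_one_right' hz

/-- `K_∞ = R_∞ + {|x| ≤ γ}` for some `γ`. -/
theorem Place.exists_affineRing_sub_le (hK : IsGlobalFunctionField Fq K) (inf : Place Fq K) {y : K}
    (hy : y ∈ inf.affineRing) (ht : Transcendental Fq y) :
    ∃ γ : ℤᵐ⁰, γ ≠ 0 ∧ ∀ x : inf.Compl, ∃ r ∈ inf.affineRing, Valued.v (x - inf.emb r) ≤ γ := by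
  have hy1 := inf.one_lt_val_of_transcendental hK hy ht
  have := hK.finiteDimensional_adjoin ht
  set F := IntermediateField.adjoin Fq ({y} : Set K)
  have hval : ∀ f : Polynomial Fq, f ≠ 0 →
      inf.val (Polynomial.aeval y f) = inf.val y ^ f.natDegree := fun f hf =>
    Polynomial.valuation_aeval_eq_valuation_X_pow_natDegree_of_one_lt_valuation_X y hy1 hf
  -- a basis
  let b := Module.finBasis F K
  have hb : ∀ i, ∃ f : Polynomial Fq, f ≠ 0 ∧ Polynomial.aeval y f * b i ∈ inf.affineRing :=
    fun i => inf.exists_aeval_mul_mem hK hy ht (b i)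
  choose f hf0 hfR using hb
  set e : Fin (Module.finrank F K) → K := fun i => Polynomial.aeval y (f i) * b i
  -- division with remainder
  have hdiv : ∀ z ∈ F, ∃ g : Polynomial Fq, inf.val (z - Polynomial.aeval y g) ≤ 1 := by
    intro z hz
    by_cases hz0 : z = 0
    · exact ⟨0, by simp [hz0]⟩
    obtain ⟨p, q, hp, hq, rfl⟩ := exists_eq_aeval_div_aeval hz hz0
    have hq0 : Polynomial.aeval y q ≠ 0 := fun h => hq ((transcendental_iff.mp ht) q h)
    refine ⟨p / q, ?_⟩
    have h1 : Polynomial.aeval y p / Polynomial.aeval y q - Polynomial.aeval y (p / q) =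
        Polynomial.aeval y (p % q) / Polynomial.aeval y q := by
      rw [div_sub' hq0]
      congr 1
      rw [← map_mul, ← map_sub]
      congr 1
      rw [EuclideanDomain.mod_eq_sub_mul_div]
    rw [h1, map_div₀]
    by_cases h0 : p % q = 0
    · simp [h0]
    have hqpos : 0 < inf.val (Polynomial.aeval y q) := zero_lt_iff.mpr (by simpa using hq0)
    rw [div_le_one₀ hqpos, hval _ h0, hval _ hq]
    refine pow_le_pow_right₀ hy1.le (Polynomial.natDegree_le_natDegree ?_)
    exact (Polynomial.degree_mod_lt p hq).le
  have hKx : ∃ γ : ℤᵐ⁰, γ ≠ 0 ∧ ∀ x : K, ∃ r ∈ inf.affineRing, inf.val (x - r) ≤ γ := by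
    -- The coordinates in the basis e_i of elements of R_∞ are rounded to polynomials in y; the
    -- error is a combination of the e_i with coefficients of absolute value at most 1.
    refine ⟨Finset.univ.sup (fun i => inf.val (e i)) ⊔ 1,
      (zero_lt_one.trans_le le_sup_right).ne', fun x => ?_⟩
    have hc : ∀ i, ∃ g : Polynomial Fq,
        inf.val ((b.repr x i : K) / Polynomial.aeval y (f i) - Polynomial.aeval y g) ≤ 1 :=
      fun i => hdiv _ (div_mem (b.repr x i).2
        (IntermediateField.algebra_adjoin_le_adjoin Fq _
          (Polynomial.aeval_mem_adjoin_singleton _ _)))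
    choose g hg using hc
    refine ⟨∑ i, Polynomial.aeval y (g i) * e i,
      sum_mem fun i _ => mul_mem (inf.aeval_mem_affineRing hy _) (hfR i), ?_⟩
    have hx : x = ∑ i, (b.repr x i : K) / Polynomial.aeval y (f i) * e i := by
      conv_lhs => rw [← b.sum_repr x]
      refine Finset.sum_congr rfl fun i _ => ?_
      have hfi : Polynomial.aeval y (f i) ≠ 0 := fun h => hf0 i ((transcendental_iff.mp ht) _ h)
      rw [← mul_assoc, div_mul_cancel₀ _ hfi]
      rfl
    conv_lhs => rw [hx, ← Finset.sum_sub_distrib]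
    refine inf.val.map_sum_le fun i _ => ?_
    rw [← sub_mul, map_mul]
    refine (mul_le_of_le_one_left' (hg i)).trans (le_sup_of_le_left ?_)
    exact Finset.le_sup (f := fun i => inf.val (e i)) (Finset.mem_univ i)
  obtain ⟨γ, hγ, h⟩ := hKx
  refine ⟨γ, hγ, fun x => ?_⟩
  obtain ⟨z, hz⟩ := inf.exists_approx x hγ
  obtain ⟨r, hr, hzr⟩ := h z
  refine ⟨r, hr, ?_⟩
  have := Valued.v.map_add_le (x := x - inf.emb z) (y := inf.emb z - inf.emb r) (g := γ)
    (by rw [Valuation.map_sub_swap]; exact hz.le) (by rwa [← map_sub, inf.v_emb])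
  simpa using this

end

/-! ### The topological group `PGL₂` -/

theorem pgl_mk_eq_mk_iff {F : Type*} [CommRing F] {g h : Matrix.GeneralLinearGroup (Fin 2) F} :
    (Matrix.ProjGenLinGroup.mk g : PGL2 F) = .mk h ↔
      ∃ u : Fˣ, (h : Matrix (Fin 2) (Fin 2) F) = (u : F) • (g : Matrix (Fin 2) (Fin 2) F) := by
  rw [Matrix.ProjGenLinGroup.mk_eq_mk_iff]
  refine exists_congr fun u => ?_
  have h1 : ((g * .scalar (Fin 2) u : Matrix.GeneralLinearGroup (Fin 2) F) :
      Matrix (Fin 2) (Fin 2) F) = (u : F) • (g : Matrix (Fin 2) (Fin 2) F) := by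
    rw [Units.val_mul, Matrix.GeneralLinearGroup.coe_scalar, Matrix.scalar_apply,
      ← Matrix.smul_eq_mul_diagonal]
  rw [Units.ext_iff, h1, eq_comm]

section

variable {F : Type*} [Field F] [TopologicalSpace F] [IsTopologicalRing F]

instance pgl_isTopologicalGroup : IsTopologicalGroup (PGL2 F) :=
  inferInstanceAs (IsTopologicalGroup
    (Matrix.GeneralLinearGroup (Fin 2) F ⧸ Subgroup.center (Matrix.GeneralLinearGroup (Fin 2) F)))

omit [IsTopologicalRing F] in
theorem continuous_pgl_mk : Continuous
    (Matrix.ProjGenLinGroup.mk : Matrix.GeneralLinearGroup (Fin 2) F →* PGL2 F) :=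
  continuous_coinduced_rng

theorem isOpenMap_pgl_mk : IsOpenMap
    (Matrix.ProjGenLinGroup.mk : Matrix.GeneralLinearGroup (Fin 2) F →* PGL2 F) :=
  QuotientGroup.isOpenMap_coe (N := Subgroup.center (Matrix.GeneralLinearGroup (Fin 2) F))

theorem pgl_t2Space [T2Space F] : T2Space (PGL2 F) := by
  have : IsClosed ((Subgroup.center (Matrix.GeneralLinearGroup (Fin 2) F) : Subgroup _) :
      Set (Matrix.GeneralLinearGroup (Fin 2) F)) := by
    have : ((Subgroup.center (Matrix.GeneralLinearGroup (Fin 2) F) : Subgroup _) :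
      Set (Matrix.GeneralLinearGroup (Fin 2) F)) = ⋂ g, {h | g * h = h * g} := by
      ext h; simp [Subgroup.mem_center_iff]
    rw [this]
    exact isClosed_iInter fun g => isClosed_eq (continuous_const_mul g) (continuous_mul_const g)
  exact inferInstanceAs (T2Space
    (Matrix.GeneralLinearGroup (Fin 2) F ⧸ Subgroup.center (Matrix.GeneralLinearGroup (Fin 2) F)))

omit [TopologicalSpace F] [IsTopologicalRing F] in
theorem alpha_mul (s t : Fˣ) : alpha (s * t) = alpha s * alpha t := by
  rw [alpha, alpha, alpha, ← map_mul]
  congr 1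
  ext i j
  fin_cases i <;> fin_cases j <;> simp [Matrix.mul_apply]

omit [TopologicalSpace F] [IsTopologicalRing F] in
theorem alpha_one : alpha (1 : Fˣ) = 1 := by
  rw [alpha, ← map_one Matrix.ProjGenLinGroup.mk]
  congr 1
  ext i j
  fin_cases i <;> fin_cases j <;> simp

theorem continuous_alpha : Continuous (alpha : Fˣ → PGL2 F) := by
  refine continuous_pgl_mk.comp ?_
  rw [Units.continuous_iff]
  constructor
  · refine continuous_matrix fun i j => ?_
    fin_cases i <;> fin_cases j <;>
      simp [Matrix.GeneralLinearGroup.mkOfDetNeZero, continuous_const, Units.continuous_val]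
  · have : ∀ t : Fˣ, (((Matrix.GeneralLinearGroup.mkOfDetNeZero !![(1 : F), 0; 0, (t : F)]
        (by simp) : Matrix.GeneralLinearGroup (Fin 2) F)⁻¹ :
          Matrix.GeneralLinearGroup (Fin 2) F) : Matrix (Fin 2) (Fin 2) F) =
        !![(1 : F), 0; 0, ((t⁻¹ : Fˣ) : F)] := by
      intro t
      rw [Matrix.coe_units_inv]
      refine Matrix.inv_eq_right_inv ?_
      ext i j
      fin_cases i <;> fin_cases j <;> simp [Matrix.mul_apply]
    simp only [this]
    refine continuous_matrix fun i j => ?_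
    fin_cases i <;> fin_cases j <;> simp [continuous_const]
    simp only [← Units.val_inv_eq_inv_val]
    exact Units.continuous_val.comp (continuous_inv (G := Fˣ))

/-- An open subring contains an open subgroup of invertible matrices. -/
theorem isOpen_pglOf {R : Subring F} (hR : IsOpen (R : Set F)) :
    IsOpen ((pglOf R : Subgroup (PGL2 F)) : Set (PGL2 F)) := by
  refine Subgroup.isOpen_of_mem_nhds (pglOf R) (g := 1) ?_
  let U : Set (Matrix.GeneralLinearGroup (Fin 2) F) :=
    {g | (∀ i j, (g : Matrix (Fin 2) (Fin 2) F) i j ∈ R) ∧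
      ∀ i j, ((g⁻¹ : Matrix.GeneralLinearGroup (Fin 2) F) : Matrix (Fin 2) (Fin 2) F) i j ∈ R}
  have hU : IsOpen U := by
    have h1 : ∀ i j : Fin 2, Continuous fun g : Matrix.GeneralLinearGroup (Fin 2) F =>
        (g : Matrix (Fin 2) (Fin 2) F) i j := fun i j =>
      (continuous_id.matrix_elem i j).comp Units.continuous_val
    have h2 : U = (⋂ i, ⋂ j, (fun g : Matrix.GeneralLinearGroup (Fin 2) F =>
        (g : Matrix (Fin 2) (Fin 2) F) i j) ⁻¹' (R : Set F)) ∩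
        (⋂ i, ⋂ j, (fun g : Matrix.GeneralLinearGroup (Fin 2) F =>
        ((g⁻¹ : Matrix.GeneralLinearGroup (Fin 2) F) : Matrix (Fin 2) (Fin 2) F) i j) ⁻¹'
          (R : Set F)) := by
      ext g; simp [U]
    rw [h2]
    refine IsOpen.inter ?_ ?_
    · exact isOpen_iInter_of_finite fun i => isOpen_iInter_of_finite fun j => hR.preimage (h1 i j)
    · exact isOpen_iInter_of_finite fun i => isOpen_iInter_of_finite fun j =>
        hR.preimage ((h1 i j).comp continuous_inv)
  have h1U : (1 : Matrix.GeneralLinearGroup (Fin 2) F) ∈ U := by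
    constructor <;> intro i j <;> simp only [inv_one, Units.val_one, Matrix.one_apply] <;>
      split_ifs <;> simp [one_mem, zero_mem]
  refine Filter.mem_of_superset ((isOpenMap_pgl_mk U hU).mem_nhds ⟨1, h1U, map_one _⟩) ?_
  rintro _ ⟨g, ⟨hg, hg'⟩, rfl⟩
  refine ⟨Matrix.ProjGenLinGroup.mk ⟨Matrix.of fun i j => ⟨_, hg i j⟩,
    Matrix.of fun i j => ⟨_, hg' i j⟩, ?_, ?_⟩, ?_⟩
  · ext i j
    have := congrFun (congrFun g.mul_inv i) j
    simp only [Matrix.mul_apply, Matrix.of_apply, Subring.coe_mul, AddSubmonoidClass.coe_finsetSum] at this ⊢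
    rw [this]
    simp [Matrix.one_apply, apply_ite]
  · ext i j
    have := congrFun (congrFun g.inv_mul i) j
    simp only [Matrix.mul_apply, Matrix.of_apply, Subring.coe_mul, AddSubmonoidClass.coe_finsetSum] at this ⊢
    rw [this]
    simp [Matrix.one_apply, apply_ite]
  · rw [Matrix.ProjGenLinGroup.map_mk]
    congr 1

end

/-! ### Discreteness of Γ_∞ in G_∞ -/

section

variable {Fq K : Type*} [Field Fq] [Field K] [Algebra Fq K]

theorem Place.isOpen_pglOf_integers (ω : Place Fq K) :
    IsOpen ((pglOf ω.integers : Subgroup (PGL2 ω.Compl)) : Set (PGL2 ω.Compl)) :=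
  isOpen_pglOf (Valued.isOpen_integer ω.Compl)

theorem Place.toG_mk (ω : Place Fq K) (M : Matrix.GeneralLinearGroup (Fin 2) K) :
    ω.toG (.mk M) = .mk (Matrix.GeneralLinearGroup.map ω.emb M) := rfl

theorem mem_Gam_iff (inf : Place Fq K) (g : PGL2 K) :
    g ∈ Gam inf ↔ ∃ M : Matrix.GeneralLinearGroup (Fin 2) inf.affineRing,
      g = .mk (Matrix.GeneralLinearGroup.map inf.affineRing.subtype M) := by
  constructor
  · rintro ⟨M, rfl⟩
    obtain ⟨M, rfl⟩ := Matrix.ProjGenLinGroup.mk_surjective M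
    exact ⟨M, rfl⟩
  · rintro ⟨M, rfl⟩
    exact ⟨.mk M, rfl⟩

theorem v_unit_affineRing (hK : IsGlobalFunctionField Fq K) (inf : Place Fq K)
    (u : inf.affineRingˣ) : inf.val (u : inf.affineRing) = 1 := by
  have h1 := inf.one_le_val hK (u : inf.affineRing).2 (by simp)
  have h2 := inf.one_le_val hK ((u⁻¹ : inf.affineRingˣ) : inf.affineRing).2 (by simp)
  have h3 : inf.val (u : inf.affineRing) * inf.val ((u⁻¹ : inf.affineRingˣ) : inf.affineRing) = 1 := by
    rw [← map_mul, ← Subring.coe_mul, Units.mul_inv]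
    simp
  refine le_antisymm ?_ h1
  calc _ ≤ inf.val (u : inf.affineRing) * inf.val ((u⁻¹ : inf.affineRingˣ) : inf.affineRing) :=
        le_mul_of_one_le_right' h2
    _ = 1 := h3

/-- `Γ_∞` is discrete in `G_∞`. -/
theorem isClosed_GamInf (hK : IsGlobalFunctionField Fq K) (inf : Place Fq K) :
    IsClosed ((GamInf inf : Subgroup (PGL2 inf.Compl)) : Set (PGL2 inf.Compl)) := by
  have := pgl_t2Space (F := inf.Compl)
  have : DiscreteTopology (GamInf inf) := by
    rw [discreteTopology_iff_isOpen_singleton_one, isOpen_induced_iff]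
    let U : Set (Matrix.GeneralLinearGroup (Fin 2) inf.Compl) :=
      {g | ∀ i j, Valued.v ((g : Matrix (Fin 2) (Fin 2) inf.Compl) i j -
        (1 : Matrix (Fin 2) (Fin 2) inf.Compl) i j) < 1}
    have hU : IsOpen U := by
      have h2 : U = ⋂ i, ⋂ j, (fun g : Matrix.GeneralLinearGroup (Fin 2) inf.Compl =>
        (g : Matrix (Fin 2) (Fin 2) inf.Compl) i j) ⁻¹'
          {y | Valued.v (y - (1 : Matrix (Fin 2) (Fin 2) inf.Compl) i j) < 1} := by
        ext g; simp [U]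
      rw [h2]
      exact isOpen_iInter_of_finite fun i => isOpen_iInter_of_finite fun j =>
        (inf.isOpen_setOf_v_sub_lt _ one_ne_zero).preimage
          ((continuous_id.matrix_elem i j).comp Units.continuous_val)
    refine ⟨_, isOpenMap_pgl_mk U hU, ?_⟩
    ext ⟨g, hg⟩
    simp only [Set.mem_preimage, Set.mem_singleton_iff, Subgroup.mk_eq_one]
    constructor
    · rintro ⟨h, hh, hhg⟩
      obtain ⟨_, hγ, rfl⟩ := hg
      obtain ⟨M, rfl⟩ := (mem_Gam_iff inf _).mp hγ
      rw [inf.toG_mk, pgl_mk_eq_mk_iff] at hhg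
      obtain ⟨u, hu⟩ := hhg
      set a : Fin 2 → Fin 2 → K := fun i j => ((M : Matrix (Fin 2) (Fin 2) inf.affineRing) i j : K)
        with ha
      have haR : ∀ i j, a i j ∈ inf.affineRing := fun i j => Subtype.property _
      have hent : ∀ i j, (h : Matrix (Fin 2) (Fin 2) inf.Compl) i j * (u : inf.Compl) =
          inf.emb (a i j) := by
        intro i j
        rw [mul_comm]
        exact (congrFun (congrFun hu i) j).symm
      set H : Matrix (Fin 2) (Fin 2) inf.Compl := (h : Matrix (Fin 2) (Fin 2) inf.Compl) with hH
      have h00 : Valued.v (H 0 0 - 1) < 1 := by simpa using hh 0 0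
      have h01 : Valued.v (H 0 1) < 1 := by simpa using hh 0 1
      have h10 : Valued.v (H 1 0) < 1 := by simpa using hh 1 0
      have h11 : Valued.v (H 1 1 - 1) < 1 := by simpa using hh 1 1
      have e00 : Valued.v (H 0 0) = 1 := by
        have := Valued.v.map_eq_of_sub_lt (x := 1) (y := H 0 0) (by simpa using h00)
        simpa using this
      have e11 : Valued.v (H 1 1) = 1 := by
        have := Valued.v.map_eq_of_sub_lt (x := 1) (y := H 1 1) (by simpa using h11)
        simpa using this
      have hdet : Valued.v (H 0 0 * H 1 1 - H 0 1 * H 1 0) = 1 := by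
        have h1 : Valued.v (H 0 1 * H 1 0) < 1 := by
          rw [map_mul]; exact mul_lt_one_of_lt_of_le h01 h10.le
        have h2 : Valued.v (H 0 0 * H 1 1) = 1 := by rw [map_mul, e00, e11, one_mul]
        rw [Valuation.map_sub_eq_of_lt_left _ (by rw [h2]; exact h1), h2]
      have hdetM : inf.val (a 0 0 * a 1 1 - a 0 1 * a 1 0) = 1 := by
        have := v_unit_affineRing hK inf (Matrix.GeneralLinearGroup.det M)
        rw [Matrix.GeneralLinearGroup.val_det_apply, Matrix.det_fin_two] at this
        exact this
      -- Both determinants have absolute value 1, that of M because it is a unit of R_∞, so the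
      -- scalar u neither shrinks nor enlarges the entries.
      have hu1 : Valued.v (u : inf.Compl) = 1 := by
        have h3 : inf.emb (a 0 0 * a 1 1 - a 0 1 * a 1 0) =
            (H 0 0 * H 1 1 - H 0 1 * H 1 0) * (u : inf.Compl) ^ 2 := by
          rw [map_sub, map_mul, map_mul, ← hent, ← hent, ← hent, ← hent]
          ring
        have h4 := congrArg Valued.v h3
        rw [inf.v_emb, hdetM, map_mul, hdet, one_mul, map_pow] at h4
        exact (pow_eq_one_iff_of_nonneg zero_le two_ne_zero).mp h4.symm
      -- The off-diagonal entries of M and the difference of its diagonal entries are elements of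
      -- R_∞ smaller than 1, hence zero: M is scalar.
      have hzero : ∀ b ∈ inf.affineRing, Valued.v (inf.emb b) < 1 → b = 0 := by
        intro b hb hb1
        by_contra hb0
        rw [inf.v_emb] at hb1
        exact absurd (inf.one_le_val hK hb hb0) (not_le.mpr hb1)
      have a01 : a 0 1 = 0 := hzero _ (haR _ _) (by rw [← hent, map_mul, hu1, mul_one]; exact h01)
      have a10 : a 1 0 = 0 := hzero _ (haR _ _) (by rw [← hent, map_mul, hu1, mul_one]; exact h10)
      have a0011 : a 0 0 = a 1 1 := by
        refine sub_eq_zero.mp (hzero _ (sub_mem (haR _ _) (haR _ _)) ?_)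
        rw [map_sub, ← hent, ← hent, ← sub_mul, map_mul, hu1, mul_one]
        have := Valued.v.map_sub_lt h00 h11
        simpa using this
      have a00 : a 0 0 ≠ 0 := by
        intro h0
        rw [a01, h0] at hdetM
        simp at hdetM
      rw [inf.toG_mk, Matrix.ProjGenLinGroup.mk_eq_one,
        Matrix.GeneralLinearGroup.center_eq_range_scalar]
      refine ⟨Units.mk0 (inf.emb (a 0 0)) (by simpa using a00), ?_⟩
      ext i j
      change _ = inf.emb (a i j)
      fin_cases i <;> fin_cases j <;> simp [Matrix.GeneralLinearGroup.coe_scalar, a01, a10, a0011]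
    · rintro rfl
      exact ⟨1, by simp [U], map_one _⟩
  exact Subgroup.isClosed_of_discrete

end

section

variable {Fq K : Type*} [Field Fq] [Field K] [Algebra Fq K] {inf : Place Fq K}

/-! ### Topology of `X_∞` -/

theorem XInf.mk_eq_mk {g h : PGL2 inf.Compl} :
    XInf.mk inf g = XInf.mk inf h ↔ h * g⁻¹ ∈ GamInf inf :=
  Quotient.eq.trans QuotientGroup.rightRel_apply

theorem XInf.mk_surjective : Function.Surjective (XInf.mk inf) := Quotient.mk_surjective

@[simp]
theorem XInf.act_mk (a g : PGL2 inf.Compl) : XInf.act a (XInf.mk inf g) = XInf.mk inf (g * a) := rfl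

theorem XInf.act_act (a b : PGL2 inf.Compl) (x : XInf inf) :
    XInf.act a (XInf.act b x) = XInf.act (b * a) x := by
  obtain ⟨g, rfl⟩ := XInf.mk_surjective x
  simp [mul_assoc]

@[simp]
theorem XInf.act_one (x : XInf inf) : XInf.act 1 x = x := by
  obtain ⟨g, rfl⟩ := XInf.mk_surjective x
  simp

theorem XInf.continuous_mk : Continuous (XInf.mk inf) := continuous_quot_mk

theorem XInf.isOpenMap_mk : IsOpenMap (XInf.mk inf) := by
  intro U hU
  have h : IsQuotientMap (XInf.mk inf) := isQuotientMap_quot_mk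
  rw [← h.isOpen_preimage]
  have : XInf.mk inf ⁻¹' (XInf.mk inf '' U) = ⋃ γ : GamInf inf, (fun g => (γ : PGL2 inf.Compl) * g) ⁻¹' U := by
    ext g
    simp only [Set.mem_preimage, Set.mem_image, Set.mem_iUnion]
    constructor
    · rintro ⟨u, hu, hug⟩
      refine ⟨⟨_, inv_mem (XInf.mk_eq_mk.mp hug)⟩, ?_⟩
      simpa using hu
    · rintro ⟨γ, hγ⟩
      exact ⟨_, hγ, XInf.mk_eq_mk.mpr (by simp)⟩
  rw [this]
  exact isOpen_iUnion fun γ => hU.preimage (continuous_const_mul _)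

theorem XInf.isOpenQuotientMap_mk : IsOpenQuotientMap (XInf.mk inf) :=
  ⟨XInf.mk_surjective, XInf.continuous_mk, XInf.isOpenMap_mk⟩

theorem XInf.t2Space (hK : IsGlobalFunctionField Fq K) : T2Space (XInf inf) := by
  rw [t2Space_iff_of_isOpenQuotientMap XInf.isOpenQuotientMap_mk]
  simp only [XInf.mk_eq_mk]
  exact (isClosed_GamInf hK inf).preimage (continuous_snd.mul continuous_fst.inv)

theorem XInf.continuous_act (a : PGL2 inf.Compl) : Continuous (XInf.act a : XInf inf → XInf inf) := by
  refine XInf.isOpenQuotientMap_mk.isQuotientMap.continuous_iff.mpr ?_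
  exact XInf.continuous_mk.comp (continuous_mul_const a)

theorem XInf.continuous_orbit (x : XInf inf) :
    Continuous fun t : inf.Complˣ => XInf.act (alpha t) x := by
  obtain ⟨g, rfl⟩ := XInf.mk_surjective x
  exact XInf.continuous_mk.comp ((continuous_const_mul g).comp continuous_alpha)

theorem Place.isCompact_units (hK : IsGlobalFunctionField Fq K) (a b : ℤ) :
    IsCompact {t : inf.Complˣ | WithZero.exp a ≤ Valued.v (t : inf.Compl) ∧
      Valued.v (t : inf.Compl) ≤ WithZero.exp b} := by
  rw [Units.isEmbedding_val₀.isCompact_iff]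
  have h1 : IsCompact ({x : inf.Compl | Valued.v x ≤ WithZero.exp b} ∩
      {x : inf.Compl | Valued.v x < WithZero.exp a}ᶜ) := by
    refine (inf.isCompact_setOf_v_le hK _).inter_right ?_
    rw [isClosed_compl_iff]
    simpa using inf.isOpen_setOf_v_sub_lt 0 (WithZero.exp_ne_zero (a := a))
  convert h1 using 1
  ext x
  simp only [Set.mem_image, Set.mem_ofPred_eq, Set.mem_inter_iff, Set.mem_compl_iff, not_lt]
  constructor
  · rintro ⟨t, ⟨h1, h2⟩, rfl⟩
    exact ⟨h2, h1⟩
  · rintro ⟨h2, h1⟩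
    have hx : x ≠ 0 := by
      rintro rfl
      rw [map_zero] at h1
      exact WithZero.exp_ne_zero (le_zero_iff.mp h1)
    exact ⟨Units.mk0 x hx, ⟨h1, h2⟩, rfl⟩

/-- The points `x α(t)` with `v_∞(t) = -n`. -/
def orbitPiece (x : XInf inf) (n : ℤ) : Set (XInf inf) :=
  (fun t : inf.Complˣ => XInf.act (alpha t) x) ''
    {t | Valued.v (t : inf.Compl) = WithZero.exp n}

theorem isCompact_orbitPiece (hK : IsGlobalFunctionField Fq K) (x : XInf inf) (n : ℤ) :
    IsCompact (orbitPiece x n) := by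
  refine IsCompact.image ?_ (XInf.continuous_orbit x)
  convert inf.isCompact_units hK n n using 1
  ext t
  exact ⟨fun h => ⟨h.ge, h.le⟩, fun h => le_antisymm h.2 h.1⟩

theorem measurableSet_orbitPiece (hK : IsGlobalFunctionField Fq K) (x : XInf inf) (n : ℤ) :
    MeasurableSet (orbitPiece x n) :=
  have := XInf.t2Space (inf := inf) hK
  (isCompact_orbitPiece hK x n).measurableSet

theorem iUnion_orbitPiece (x : XInf inf) :
    ⋃ n, orbitPiece x n = Set.range fun t : inf.Complˣ => XInf.act (alpha t) x := by
  ext y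
  simp only [orbitPiece, Set.mem_iUnion, Set.mem_image, Set.mem_ofPred_eq, Set.mem_range]
  constructor
  · rintro ⟨n, t, -, h⟩
    exact ⟨t, h⟩
  · rintro ⟨t, h⟩
    exact ⟨_, t, (WithZero.exp_log (by simp)).symm, h⟩

theorem act_alpha_mul (s t : inf.Complˣ) (x : XInf inf) :
    XInf.act (alpha s) (XInf.act (alpha t) x) = XInf.act (alpha (t * s)) x := by
  rw [XInf.act_act, alpha_mul]

theorem act_preimage_orbitPiece (x : XInf inf) (n k : ℤ) (s : inf.Complˣ)
    (hs : Valued.v (s : inf.Compl) = WithZero.exp k) :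
    XInf.act (alpha s) ⁻¹' orbitPiece x (n + k) = orbitPiece x n := by
  ext y
  constructor
  · rintro ⟨t, ht, hty⟩
    refine ⟨t * s⁻¹, ?_, ?_⟩
    · simp only [Set.mem_ofPred_eq] at ht ⊢
      rw [Units.val_mul, map_mul, ht, Units.val_inv_eq_inv_val, map_inv₀, hs, WithZero.exp_add,
        mul_inv_cancel_right₀ WithZero.exp_ne_zero]
    · have := congrArg (XInf.act (alpha s⁻¹)) hty
      simp only [act_alpha_mul] at this ⊢
      rw [this, mul_inv_cancel, alpha_one, XInf.act_one]
  · rintro ⟨t, ht, rfl⟩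
    refine ⟨t * s, ?_, (act_alpha_mul s t x).symm⟩
    simp only [Set.mem_ofPred_eq] at ht ⊢
    rw [Units.val_mul, map_mul, ht, hs, WithZero.exp_add]

theorem exists_unit_v_eq (inf : Place Fq K) (n : ℤ) :
    ∃ s : inf.Complˣ, Valued.v (s : inf.Compl) = WithZero.exp n := by
  obtain ⟨c, hc⟩ := inf.v_surjective (WithZero.exp n)
  exact ⟨Units.mk0 c (by rintro rfl; simp at hc; exact WithZero.exp_ne_zero hc.symm), hc⟩

/-! ### Invariant measures on A_∞-orbits and the criterion of periodicity -/

section measure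

variable {x : XInf inf} {μ : Measure (XInf inf)}

theorem IsOrbitMeasure.measure_orbitPiece (hK : IsGlobalFunctionField Fq K)
    (hμ : IsOrbitMeasure x μ) (n : ℤ) : μ (orbitPiece x n) = μ (orbitPiece x 0) := by
  obtain ⟨s, hs⟩ := exists_unit_v_eq inf n
  conv_lhs => rw [← hμ.invariant s]
  rw [Measure.map_apply (XInf.continuous_act _).measurable (measurableSet_orbitPiece hK x n)]
  have := act_preimage_orbitPiece x 0 n s hs
  rw [zero_add] at this
  rw [this]

theorem IsOrbitMeasure.measure_iUnion (hμ : IsOrbitMeasure x μ) :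
    μ (⋃ n, orbitPiece x n) = 1 := by
  have := hμ.prob
  rw [iUnion_orbitPiece]
  refine le_antisymm prob_le_one ?_
  have h := measure_univ (μ := μ)
  rw [← h, ← Set.union_compl_self (Set.range fun t : inf.Complˣ => XInf.act (alpha t) x)]
  exact (measure_union_le _ _).trans (by rw [hμ.on_orbit, add_zero])

/-- Otherwise the pieces of the orbit at different times would be infinitely many disjoint sets, of
equal mass by invariance and of total mass 1. -/
theorem IsOrbitMeasure.exists_stabilizer (hK : IsGlobalFunctionField Fq K)
    (hμ : IsOrbitMeasure x μ) :
    ∃ t : inf.Complˣ, Valued.v (t : inf.Compl) < 1 ∧ XInf.act (alpha t) x = x := by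
  by_contra! hcon
  have hstab : ∀ s t : inf.Complˣ, XInf.act (alpha s) x = XInf.act (alpha t) x →
      Valued.v (s : inf.Compl) = Valued.v (t : inf.Compl) := by
    have key : ∀ s t : inf.Complˣ, XInf.act (alpha s) x = XInf.act (alpha t) x →
      ¬ Valued.v (s : inf.Compl) < Valued.v (t : inf.Compl) := by
      intro s t hst hlt
      refine hcon (s * t⁻¹) ?_ ?_
      · rw [Units.val_mul, map_mul, Units.val_inv_eq_inv_val, map_inv₀, ← div_eq_mul_inv]
        exact (div_lt_one₀ (zero_lt_iff.mpr (by simp))).mpr hlt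
      · rw [← act_alpha_mul, hst, act_alpha_mul, mul_inv_cancel, alpha_one, XInf.act_one]
    intro s t hst
    exact le_antisymm (not_lt.mp (key t s hst.symm)) (not_lt.mp (key s t hst))
  have hdisj : Pairwise (Function.onFun Disjoint (orbitPiece x)) := by
    intro m n hmn
    refine Set.disjoint_left.mpr ?_
    rintro _ ⟨s, hs, rfl⟩ ⟨t, ht, hst⟩
    have := hstab _ _ hst
    rw [show Valued.v (s : inf.Compl) = _ from hs, show Valued.v (t : inf.Compl) = _ from ht,
      WithZero.exp_inj] at this
    exact hmn this.symm
  have h1 := hμ.measure_iUnion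
  rw [MeasureTheory.measure_iUnion hdisj (measurableSet_orbitPiece hK x)] at h1
  simp only [hμ.measure_orbitPiece hK] at h1
  by_cases h0 : μ (orbitPiece x 0) = 0
  · simp [h0] at h1
  · rw [ENNReal.tsum_const_eq_top_of_ne_zero h0] at h1
    simp at h1

/-- The mass of a window of length `L` in a periodic orbit whose period divides `l`. -/
theorem IsOrbitMeasure.mass_window (hK : IsGlobalFunctionField Fq K)
    (hμ : IsOrbitMeasure x μ) (B : Set (XInf inf)) (a : ℤ) (L l : ℕ) (hl : 0 < l) (t₁ : inf.Complˣ)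
    (ht₁ : Valued.v (t₁ : inf.Compl) = WithZero.exp (-(l : ℤ)))
    (hx : XInf.act (alpha t₁) x = x)
    (hB : ∀ t : inf.Complˣ, ∀ n : ℤ, a ≤ n → n < a + L →
      Valued.v (t : inf.Compl) = WithZero.exp n → XInf.act (alpha t) x ∈ B)
    (hinj : ∀ s t : inf.Complˣ, ∀ m n : ℤ, a ≤ m → m < a + L → a ≤ n → n < a + L →
      Valued.v (s : inf.Compl) = WithZero.exp m → Valued.v (t : inf.Compl) = WithZero.exp n →
      XInf.act (alpha s) x = XInf.act (alpha t) x → m = n) :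
    (L : ENNReal) ≤ l * μ B := by
  have hper : ∀ n : ℤ, orbitPiece x (n - l) = orbitPiece x n := by
    have h1 : ∀ (n k : ℤ) (s : inf.Complˣ), Valued.v (s : inf.Compl) = WithZero.exp k →
        XInf.act (alpha s) x = x → orbitPiece x n ⊆ orbitPiece x (n + k) := by
      rintro n k s hs hsx _ ⟨t, ht, rfl⟩
      refine ⟨s * t, ?_, ?_⟩
      · simp only [Set.mem_ofPred_eq] at ht ⊢
        rw [Units.val_mul, map_mul, ht, hs, WithZero.exp_add, mul_comm]
      · simp only [← act_alpha_mul, hsx]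
    intro n
    refine subset_antisymm ?_ ?_
    · have := h1 (n - l) l t₁⁻¹ (by
        rw [Units.val_inv_eq_inv_val, map_inv₀, ht₁, ← WithZero.exp_neg, neg_neg]) (by
        conv_lhs => rw [← hx]
        rw [act_alpha_mul, mul_inv_cancel, alpha_one, XInf.act_one])
      simpa using this
    · simpa [sub_eq_add_neg] using h1 n (-l) t₁ ht₁ hx
  have hmod : ∀ n : ℤ, orbitPiece x n = orbitPiece x (n % l) := by
    have h2 : ∀ (k : ℤ) (n : ℤ), orbitPiece x (n + k * l) = orbitPiece x n := by
      intro k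
      induction k using Int.induction_on with
      | zero => simp
      | succ k ih =>
        intro n
        rw [← ih n, ← hper (n + (k + 1) * l)]
        congr 1; ring
      | pred k ih =>
        intro n
        rw [← ih n, ← hper (n + -k * l)]
        congr 1; ring
    intro n
    conv_lhs => rw [← Int.emod_add_mul_ediv n l, mul_comm]
    exact h2 _ _
  -- The l pieces of indices 0, …, l − 1 cover the orbit and have equal mass. Only a multiple l of
  -- the period is needed.
  have h1 : (1 : ENNReal) ≤ l * μ (orbitPiece x 0) := by
    rw [← hμ.measure_iUnion]
    have hsub : (⋃ n, orbitPiece x n) ⊆ ⋃ k ∈ Finset.range l, orbitPiece x (k : ℤ) := by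
      refine Set.iUnion_subset fun n => ?_
      rw [hmod n]
      have hl' : (0 : ℤ) < l := by exact_mod_cast hl
      obtain ⟨k, hk⟩ := Int.eq_ofNat_of_zero_le (Int.emod_nonneg n hl'.ne')
      have hk2 := Int.emod_lt_of_pos n hl'
      rw [hk] at hk2 ⊢
      exact Set.subset_biUnion_of_mem (u := fun k : ℕ => orbitPiece x (k : ℤ))
        (Finset.mem_coe.mpr (Finset.mem_range.mpr (by exact_mod_cast hk2)))
    refine (measure_mono hsub).trans ((measure_biUnion_finset_le _ _).trans ?_)
    simp [hμ.measure_orbitPiece hK]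
  -- By `hinj` the L pieces of the window are disjoint, that is, the window does not wrap around the
  -- period.
  have h2 : (L : ENNReal) * μ (orbitPiece x 0) ≤ μ B := by
    have hsub : (⋃ n ∈ Finset.Ico a (a + L), orbitPiece x n) ⊆ B := by
      refine Set.iUnion₂_subset fun n hn => ?_
      rintro _ ⟨t, ht, rfl⟩
      rw [Finset.mem_Ico] at hn
      exact hB t n hn.1 hn.2 ht
    refine le_trans ?_ (measure_mono hsub)
    rw [measure_biUnion_finset]
    · simp [hμ.measure_orbitPiece hK]
    · intro m hm n hn hmn
      refine Set.disjoint_left.mpr ?_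
      rintro _ ⟨s, hs, rfl⟩ ⟨t, ht, hst⟩
      rw [Finset.mem_coe, Finset.mem_Ico] at hm hn
      exact hmn (hinj s t m n hm.1 hm.2 hn.1 hn.2 hs ht hst.symm)
    · exact fun n _ => measurableSet_orbitPiece hK x n
  calc (L : ENNReal) ≤ L * (l * μ (orbitPiece x 0)) := le_mul_of_one_le_right' h1
    _ = l * (L * μ (orbitPiece x 0)) := by ring
    _ ≤ l * μ B := by gcongr

/-- The stabilizer in `K_∞ˣ ≃ A_∞` of a point of `X_∞`. -/
def stab (x : XInf inf) : Subgroup inf.Complˣ where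
  carrier := {t | XInf.act (alpha t) x = x}
  one_mem' := by simp [alpha_one]
  mul_mem' := by
    intro s t hs ht
    have hs' : XInf.act (alpha s) x = x := hs
    have ht' : XInf.act (alpha t) x = x := ht
    change XInf.act (alpha (s * t)) x = x
    rw [← act_alpha_mul, hs', ht']
  inv_mem' := by
    intro t ht
    have ht' : XInf.act (alpha t) x = x := ht
    change XInf.act (alpha t⁻¹) x = x
    conv_lhs => rw [← ht']
    rw [act_alpha_mul, mul_inv_cancel, alpha_one, XInf.act_one]

theorem mem_stab (x : XInf inf) (t : inf.Complˣ) : t ∈ stab x ↔ XInf.act (alpha t) x = x := Iff.rfl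

/-- The orbit map, from the quotient of `K_∞ˣ` by the stabilizer. -/
def orbitMap (x : XInf inf) : inf.Complˣ ⧸ stab x → XInf inf :=
  Quotient.lift (fun t : inf.Complˣ => XInf.act (alpha t) x) (by
    intro s t hst
    have h := (mem_stab x _).mp (QuotientGroup.leftRel_apply.mp hst)
    calc XInf.act (alpha s) x = XInf.act (alpha s) (XInf.act (alpha (s⁻¹ * t)) x) := by rw [h]
      _ = XInf.act (alpha t) x := by
        rw [act_alpha_mul]
        congr 2
        rw [mul_comm, mul_inv_cancel_left])

theorem orbitMap_mk (x : XInf inf) (t : inf.Complˣ) :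
    orbitMap x (QuotientGroup.mk t) = XInf.act (alpha t) x := rfl

theorem orbitMap_mk_mul (x : XInf inf) (t : inf.Complˣ) (c : inf.Complˣ ⧸ stab x) :
    orbitMap x (QuotientGroup.mk t * c) = XInf.act (alpha t) (orbitMap x c) := by
  obtain ⟨s, rfl⟩ := QuotientGroup.mk_surjective c
  rw [← QuotientGroup.mk_mul, orbitMap_mk, orbitMap_mk, act_alpha_mul, mul_comm]

theorem range_orbitMap (x : XInf inf) :
    Set.range (orbitMap x) = Set.range fun t : inf.Complˣ => XInf.act (alpha t) x :=
  (QuotientGroup.mk_surjective.range_comp (orbitMap x)).symm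

theorem orbitMap_injective (x : XInf inf) : Function.Injective (orbitMap x) := by
  intro a b hab
  obtain ⟨s, rfl⟩ := QuotientGroup.mk_surjective a
  obtain ⟨t, rfl⟩ := QuotientGroup.mk_surjective b
  rw [orbitMap_mk, orbitMap_mk] at hab
  refine QuotientGroup.eq.mpr ((mem_stab x _).mpr ?_)
  rw [mul_comm, ← act_alpha_mul, ← hab, act_alpha_mul, mul_inv_cancel, alpha_one, XInf.act_one]

theorem continuous_orbitMap (x : XInf inf) : Continuous (orbitMap x) :=
  Continuous.quotient_lift (XInf.continuous_orbit x) _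

/-- Powers of t₁ bring every element of K_∞ˣ into the compact annulus 1 ≤ |t| ≤ |t₁|⁻¹. -/
theorem compactSpace_quotient_stab (hK : IsGlobalFunctionField Fq K) {t₁ : inf.Complˣ}
    (ht₁ : Valued.v (t₁ : inf.Compl) < 1) (hx : XInf.act (alpha t₁) x = x) :
    CompactSpace (inf.Complˣ ⧸ stab x) := by
  set l : ℤ := -(Valued.v (t₁ : inf.Compl)).log with hl
  have hv : Valued.v (t₁ : inf.Compl) = WithZero.exp (-l) := by
    rw [hl, neg_neg, WithZero.exp_log (by simp)]
  have hlpos : 0 < l := by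
    rw [hv, ← WithZero.exp_zero, WithZero.exp_lt_exp] at ht₁
    omega
  refine ⟨?_⟩
  have h1 := (inf.isCompact_units hK 0 l).image
    (QuotientGroup.continuous_mk (N := stab x))
  convert h1
  refine (Set.eq_univ_of_forall fun c => ?_).symm
  obtain ⟨s, rfl⟩ := QuotientGroup.mk_surjective c
  set n := (Valued.v (s : inf.Compl)).log with hn
  have hs : Valued.v (s : inf.Compl) = WithZero.exp n := by rw [hn, WithZero.exp_log (by simp)]
  refine ⟨s * t₁ ^ (n / l), ?_, ?_⟩
  · have : Valued.v ((s * t₁ ^ (n / l) : inf.Complˣ) : inf.Compl) = WithZero.exp (n % l) := by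
      rw [Units.val_mul, map_mul, hs, Units.val_zpow_eq_zpow_val, map_zpow₀, hv,
        ← WithZero.exp_zsmul, ← WithZero.exp_add, smul_eq_mul]
      congr 1
      have := Int.emod_add_mul_ediv n l
      linarith [mul_comm l (n / l)]
    rw [Set.mem_ofPred_eq, this, WithZero.exp_le_exp, WithZero.exp_le_exp]
    exact ⟨Int.emod_nonneg n hlpos.ne', (Int.emod_lt_of_pos n hlpos).le⟩
  · refine (QuotientGroup.eq.mpr ?_).symm
    rw [inv_mul_cancel_left]
    exact zpow_mem ((mem_stab x _).mpr hx) _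

/-- The orbit map is a closed embedding of the compact group K_∞ˣ/stab. It matches the invariant
probability measures on the orbit with the normalized Haar measure of that group, which is unique.
-/
theorem isPeriodic_of_stabilizer (hK : IsGlobalFunctionField Fq K) {t₁ : inf.Complˣ}
    (ht₁ : Valued.v (t₁ : inf.Compl) < 1) (hx : XInf.act (alpha t₁) x = x) : IsPeriodic x := by
  have := XInf.t2Space (inf := inf) hK
  have := compactSpace_quotient_stab hK ht₁ hx
  let : MeasurableSpace (inf.Complˣ ⧸ stab x) := borel _
  have : BorelSpace (inf.Complˣ ⧸ stab x) := ⟨rfl⟩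
  have hemb : MeasurableEmbedding (orbitMap x) :=
    ((continuous_orbitMap x).isClosedEmbedding (orbitMap_injective x)).measurableEmbedding
  have hcomp : ∀ t : inf.Complˣ, XInf.act (alpha t) ∘ orbitMap x =
      orbitMap x ∘ (fun c => (QuotientGroup.mk t : inf.Complˣ ⧸ stab x) * c) := by
    intro t
    funext c
    exact (orbitMap_mk_mul x t c).symm
  let m : Measure (inf.Complˣ ⧸ stab x) := Measure.haarMeasure ⊤
  have hm : IsProbabilityMeasure m := ⟨by
    have := Measure.haarMeasure_self (K₀ := (⊤ : TopologicalSpace.PositiveCompacts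
      (inf.Complˣ ⧸ stab x)))
    simpa using this⟩
  refine ⟨m.map (orbitMap x), ⟨?_, ?_, ?_⟩, ?_⟩
  · exact Measure.isProbabilityMeasure_map hemb.measurable.aemeasurable
  · intro t
    rw [Measure.map_map (XInf.continuous_act _).measurable hemb.measurable, hcomp,
      ← Measure.map_map hemb.measurable (measurable_const_mul _), map_mul_left_eq_self]
  · rw [← range_orbitMap, hemb.map_apply]
    simp
  · intro μ' hμ'
    have hprob := hμ'.prob
    have hμr : μ'.restrict (Set.range (orbitMap x)) = μ' := by
      rw [Measure.restrict_eq_self_of_ae_mem]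
      rw [ae_iff]
      have := hμ'.on_orbit
      rw [← range_orbitMap] at this
      exact this
    set n : Measure (inf.Complˣ ⧸ stab x) := μ'.comap (orbitMap x) with hn
    have hmap : n.map (orbitMap x) = μ' := by rw [hn, hemb.map_comap, hμr]
    have hnprob : IsProbabilityMeasure n := ⟨by
      have : μ' Set.univ = 1 := measure_univ
      rw [← hmap, hemb.map_apply] at this
      simpa using this⟩
    have hinv : n.IsMulLeftInvariant := by
      refine ⟨fun c => ?_⟩
      obtain ⟨t, rfl⟩ := QuotientGroup.mk_surjective c
      rw [← hemb.comap_map (Measure.map _ n), Measure.map_map hemb.measurable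
        (measurable_const_mul _), ← hcomp, ← Measure.map_map (XInf.continuous_act _).measurable
        hemb.measurable, hmap, hμ'.invariant t]
    have hopen : n.IsOpenPosMeasure :=
      isOpenPosMeasure_of_mulLeftInvariant_of_compact Set.univ isCompact_univ (by simp)
    have : n.IsHaarMeasure := {}
    have : n = m := Measure.isHaarMeasure_eq_of_isProbabilityMeasure _ _
    rw [← hmap, this]

theorem isPeriodic_iff (hK : IsGlobalFunctionField Fq K) :
    IsPeriodic x ↔ ∃ t : inf.Complˣ, Valued.v (t : inf.Compl) < 1 ∧ XInf.act (alpha t) x = x :=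
  ⟨fun ⟨_, hμ, _⟩ => hμ.exists_stabilizer hK, fun ⟨_, h1, h2⟩ => isPeriodic_of_stabilizer hK h1 h2⟩

theorem isOrbitMeasure_periodicMeasure (hx : IsPeriodic x) :
    IsOrbitMeasure x (periodicMeasure x) := by
  rw [periodicMeasure, dif_pos hx]
  exact hx.choose_spec.1

end measure

end

/-! ### The local ring of a finite extension of a completion -/

/-- The spectral norm is multiplicative because F is complete, so x or x⁻¹ has spectral norm at most
1. -/
theorem norm_coeff_minpoly_le_one_or {F L : Type*} [NontriviallyNormedField F] [IsUltrametricDist F]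
    [CompleteSpace F] [Field L] [Algebra F L] [Algebra.IsAlgebraic F L] (x : L) :
    (∀ n, ‖(minpoly F x).coeff n‖ ≤ 1) ∨ ∀ n, ‖(minpoly F x⁻¹).coeff n‖ ≤ 1 := by
  have key : ∀ y : L, spectralNorm F L y ≤ 1 → ∀ n, ‖(minpoly F y).coeff n‖ ≤ 1 := fun y hy =>
    (spectralValue_le_one_iff (minpoly.monic (Algebra.IsAlgebraic.isAlgebraic y).isIntegral)).mp hy
  rcases le_or_gt (spectralNorm F L x) 1 with h | h
  · exact Or.inl (key x h)
  · refine Or.inr (key _ ?_)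
    have hx : x ≠ 0 := by
      rintro rfl
      rw [spectralNorm_zero] at h
      linarith
    have h1 : spectralNorm F L x * spectralNorm F L x⁻¹ = 1 := by
      have := spectralAlgNorm_mul (K := F) x x⁻¹
      rw [mul_inv_cancel₀ hx] at this
      exact this.symm.trans spectralNorm_one
    by_contra! h2
    nlinarith

section

variable {Fq K : Type*} [Field Fq] [Field K] [Algebra Fq K]

theorem Place.isIntegral_or_isIntegral_inv (ω : Place Fq K) {L : Type*} [Field L]
    [Algebra ω.Compl L] [Algebra ω.integers L] [IsScalarTower ω.integers ω.Compl L]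
    [Algebra.IsAlgebraic ω.Compl L] (x : L) :
    IsIntegral ω.integers x ∨ IsIntegral ω.integers x⁻¹ := by
  let _ := Valuation.IsRankOneDiscrete.rankOne (Valued.v : Valuation ω.Compl ℤᵐ⁰) one_lt_two
  let _ : NontriviallyNormedField ω.Compl := Valued.toNontriviallyNormedField _ ℤᵐ⁰
  have key : ∀ y : L, (∀ n, ‖(minpoly ω.Compl y).coeff n‖ ≤ 1) → IsIntegral ω.integers y := by
    intro y hy
    have hm : (minpoly ω.Compl y).Monic :=
      minpoly.monic (Algebra.IsAlgebraic.isAlgebraic y).isIntegral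
    have hl : minpoly ω.Compl y ∈ Polynomial.lifts (algebraMap ω.integers ω.Compl) := by
      rw [Polynomial.lifts_iff_coeff_lifts]
      intro n
      have h : Valued.v ((minpoly ω.Compl y).coeff n) ≤ 1 :=
        Valued.toNormedField.norm_le_one_iff.mp (hy n)
      exact ⟨⟨_, h⟩, rfl⟩
    obtain ⟨q, hq, -, hqm⟩ := Polynomial.lifts_and_degree_eq_and_monic hl hm
    refine ⟨q, hqm, ?_⟩
    have := minpoly.aeval ω.Compl y
    rw [← hq, Polynomial.aeval_map_algebraMap] at this
    exact this
  exact (norm_coeff_minpoly_le_one_or (F := ω.Compl) x).imp (key x) (key _)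

/-- The local ring of a finite extension of a completion, as a valuation subring. -/
def Place.extValuationSubring (ω : Place Fq K) (L : Type*) [Field L]
    [Algebra ω.Compl L] [Algebra ω.integers L] [IsScalarTower ω.integers ω.Compl L]
    [Algebra.IsAlgebraic ω.Compl L] : ValuationSubring L :=
  { (integralClosure ω.integers L).toSubring with
    mem_or_inv_mem' := ω.isIntegral_or_isIntegral_inv }

theorem Place.v_le_one_of_isIntegral (ω : Place Fq K) {L : Type*} [Field L]
    [Algebra ω.Compl L] [Algebra ω.integers L] [IsScalarTower ω.integers ω.Compl L] {y : ω.Compl}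
    (hy : IsIntegral ω.integers (algebraMap ω.Compl L y)) : Valued.v y ≤ 1 := by
  have h1 : IsIntegral ω.integers y :=
    (isIntegral_algebraMap_iff (algebraMap ω.Compl L).injective).mp hy
  obtain ⟨f, hf, hx⟩ := h1
  exact mem_integer_of_isIntegralElem Valued.v (algebraMap ω.integers ω.Compl)
    (fun a => a.2) ⟨f, hf, hx⟩

theorem Place.isIntegral_algebraMap_of_v_le_one (ω : Place Fq K) {L : Type*} [Field L]
    [Algebra ω.Compl L] [Algebra ω.integers L] [IsScalarTower ω.integers ω.Compl L] {y : ω.Compl}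
    (hy : Valued.v y ≤ 1) : IsIntegral ω.integers (algebraMap ω.Compl L y) := by
  have := isIntegral_algebraMap (R := ω.integers) (A := L) (x := ⟨y, hy⟩)
  rwa [IsScalarTower.algebraMap_apply ω.integers ω.Compl L] at this

/-- Completeness makes the integral closure a valuation ring of L. It is discrete because L is
finite over K_ω, where every nonzero element is a power of ϖ times a unit. -/
theorem Place.isDiscreteValuationRing_integralClosure (ω : Place Fq K) (L : Type*) [Field L]
    [Algebra ω.Compl L] [Algebra ω.integers L] [IsScalarTower ω.integers ω.Compl L]
    [FiniteDimensional ω.Compl L] :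
    IsDiscreteValuationRing (integralClosure ω.integers L) := by
  obtain ⟨ϖ, hϖ⟩ := ω.v_surjective (WithZero.exp (-1))
  have hϖ0 : ϖ ≠ 0 := by
    rintro rfl
    rw [map_zero] at hϖ
    exact WithZero.exp_ne_zero hϖ.symm
  let V := ω.extValuationSubring L
  have hmem : ∀ x : L, x ∈ V ↔ IsIntegral ω.integers x := fun x => Iff.rfl
  have hle : ∀ y : ω.Compl, Valued.v y ≤ 1 → V.valuation (algebraMap ω.Compl L y) ≤ 1 :=
    fun y hy => (V.valuation_le_one_iff _).mpr
      ((hmem _).mpr (ω.isIntegral_algebraMap_of_v_le_one hy))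
  have h1 : V.valuation (algebraMap ω.Compl L ϖ) < 1 := by
    refine lt_of_le_of_ne (hle _ ?_) ?_
    · rw [hϖ, ← WithZero.exp_zero, WithZero.exp_le_exp]
      norm_num
    · intro h
      have h2 : (algebraMap ω.Compl L ϖ⁻¹) ∈ V := by
        rw [← V.valuation_le_one_iff, map_inv₀, map_inv₀, h, inv_one]
      have h3 := ω.v_le_one_of_isIntegral ((hmem _).mp h2)
      rw [map_inv₀, hϖ, ← WithZero.exp_neg, ← WithZero.exp_zero, WithZero.exp_le_exp] at h3
      norm_num at h3
  have hV : IsDiscreteValuationRing V := by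
    refine isDiscreteValuationRing_of_finiteDimensional V ϖ h1 hϖ0 ?_
    intro y hy
    have hvy : Valued.v y ≠ 0 := (Valuation.ne_zero_iff _).mpr hy
    refine ⟨-(Valued.v y).log, ?_⟩
    set n : ℤ := -(Valued.v y).log with hn
    have h2 : Valued.v (y / ϖ ^ n) = 1 := by
      rw [map_div₀, map_zpow₀, hϖ, ← WithZero.exp_zsmul, hn]
      simp [WithZero.exp_log hvy, hy]
    have h3 : V.valuation (algebraMap ω.Compl L (y / ϖ ^ n)) = 1 := by
      refine le_antisymm (hle _ h2.le) ?_
      have h4 := hle (y / ϖ ^ n)⁻¹ (by rw [map_inv₀, h2, inv_one])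
      rw [map_inv₀, map_inv₀] at h4
      refine (inv_le_one₀ ?_).mp h4
      rw [zero_lt_iff, Valuation.ne_zero_iff, map_ne_zero]
      exact div_ne_zero hy (zpow_ne_zero _ hϖ0)
    rw [map_div₀, map_div₀, map_zpow₀, map_zpow₀] at h3
    rw [div_eq_one_iff_eq] at h3
    · exact h3
    · exact zpow_ne_zero _ (by simpa using hϖ0)
  let e : V ≃+* integralClosure ω.integers L :=
    { toFun := fun x => ⟨x.1, x.2⟩
      invFun := fun x => ⟨x.1, x.2⟩
      left_inv := fun _ => rfl
      right_inv := fun _ => rfl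
      map_mul' := fun _ _ => rfl
      map_add' := fun _ _ => rfl }
  exact IsDiscreteValuationRing.RingEquivClass.isDiscreteValuationRing e

end

/-! ### Powers of a root of a quadratic polynomial -/

/-- The coefficients `(a, b)` with `x ^ k = a x + b` for the roots `x` of `X² - τ X + δ`. -/
def powCoeffs {A : Type*} [CommRing A] (τ δ : A) : ℕ → A × A
  | 0 => (0, 1)
  | k + 1 => ((powCoeffs τ δ k).1 * τ + (powCoeffs τ δ k).2, -((powCoeffs τ δ k).1 * δ))

/-- B need not be commutative: the same coefficients serve for the matrix γ, by Cayley–Hamilton, and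
for its eigenvalues. -/
theorem pow_eq_powCoeffs {A B : Type*} [CommRing A] [Ring B] [Algebra A B] {τ δ : A} {x : B}
    (hx : x * x = τ • x - δ • 1) (k : ℕ) :
    x ^ k = (powCoeffs τ δ k).1 • x + (powCoeffs τ δ k).2 • 1 := by
  induction k with
  | zero => simp [powCoeffs]
  | succ k ih =>
    rw [pow_succ, ih, powCoeffs, add_mul, smul_mul_assoc, hx]
    simp only [smul_mul_assoc, one_mul, smul_sub, smul_smul, add_smul, neg_smul]
    abel

theorem pow_eq_powCoeffs_of_ringHom {A B : Type*} [CommRing A] [CommRing B] (f : A →+* B) {τ δ : A}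
    {x : B} (hx : x * x = f τ * x - f δ) (k : ℕ) :
    x ^ k = f (powCoeffs τ δ k).1 * x + f (powCoeffs τ δ k).2 := by
  let _ := f.toAlgebra
  have h := pow_eq_powCoeffs (A := A) (B := B) (τ := τ) (δ := δ) (x := x)
    (by simpa [Algebra.smul_def, RingHom.algebraMap_toAlgebra] using hx) k
  simpa [Algebra.smul_def, RingHom.algebraMap_toAlgebra] using h

section

variable {Fq K : Type*} [Field Fq] [Field K] [Algebra Fq K]

/-! ### The normalized valuation of the splitting field -/

section

variable {inf ν : Place Fq K} {γ : Matrix.GeneralLinearGroup (Fin 2) inf.affineRing}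

instance : IsDiscreteValuationRing (SplitIntegers inf ν γ) :=
  ν.isDiscreteValuationRing_integralClosure _

theorem jacobson_splitIntegers : Ideal.jacobson (⊥ : Ideal (SplitIntegers inf ν γ)) =
    IsLocalRing.maximalIdeal (SplitIntegers inf ν γ) :=
  IsLocalRing.jacobson_eq_maximalIdeal _ bot_ne_top

theorem ordAtLeast_iff {ϖ : SplitIntegers inf ν γ} (hϖ : Irreducible ϖ) {k : ℕ}
    {u : SplitField inf ν γ} :
    OrdAtLeast inf ν γ k u ↔ ∃ y : SplitIntegers inf ν γ, (ϖ : SplitField inf ν γ) ^ k * y = u := by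
  unfold OrdAtLeast
  rw [jacobson_splitIntegers, hϖ.maximalIdeal_eq, Ideal.span_singleton_pow]
  constructor
  · rintro ⟨y, hy, rfl⟩
    obtain ⟨z, rfl⟩ := Ideal.mem_span_singleton.mp hy
    exact ⟨z, by simp⟩
  · rintro ⟨y, rfl⟩
    exact ⟨ϖ ^ k * y, Ideal.mem_span_singleton.mpr (dvd_mul_right _ _), by simp⟩

theorem OrdAtLeast.mul {k l : ℕ} {u w : SplitField inf ν γ} (hu : OrdAtLeast inf ν γ k u)
    (hw : OrdAtLeast inf ν γ l w) : OrdAtLeast inf ν γ (k + l) (u * w) := by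
  obtain ⟨y, hy, rfl⟩ := hu
  obtain ⟨z, hz, rfl⟩ := hw
  exact ⟨y * z, by rw [pow_add]; exact Ideal.mul_mem_mul hy hz, rfl⟩

theorem ordAtLeast_zero {u : SplitField inf ν γ} (hu : IsIntegral ν.integers u) :
    OrdAtLeast inf ν γ 0 u :=
  ⟨⟨u, hu⟩, by simp, rfl⟩

theorem OrdAtLeast.pow {k : ℕ} {u : SplitField inf ν γ} (hu : OrdAtLeast inf ν γ k u) (n : ℕ) :
    OrdAtLeast inf ν γ (k * n) (u ^ n) := by
  induction n with
  | zero => simpa using ordAtLeast_zero isIntegral_one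
  | succ n ih => rw [pow_succ, Nat.mul_succ]; exact ih.mul hu

theorem OrdAtLeast.mul_isIntegral {k : ℕ} {u w : SplitField inf ν γ}
    (hw : IsIntegral ν.integers w) (hu : OrdAtLeast inf ν γ k u) :
    OrdAtLeast inf ν γ k (w * u) := by
  simpa using (ordAtLeast_zero hw).mul hu

theorem exists_unif_eq : ∃ (ϖ : SplitIntegers inf ν γ) (e : ℕ) (w : (SplitIntegers inf ν γ)ˣ),
    Irreducible ϖ ∧ 0 < e ∧
    algebraMap ν.Compl (SplitField inf ν γ) (ν.emb ν.unif) = (ϖ : SplitField inf ν γ) ^ e * w := by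
  obtain ⟨ϖ, hϖ⟩ := IsDiscreteValuationRing.exists_irreducible (SplitIntegers inf ν γ)
  have hu : ν.val ν.unif = WithZero.exp (-1) := (ν.surj (WithZero.exp (-1))).choose_spec
  have h1 : Valued.v (ν.emb ν.unif) ≤ 1 := by
    rw [ν.v_emb, hu, ← WithZero.exp_zero, WithZero.exp_le_exp]; norm_num
  have hint := ν.isIntegral_algebraMap_of_v_le_one (L := SplitField inf ν γ) h1
  have h0 : (⟨_, hint⟩ : SplitIntegers inf ν γ) ≠ 0 := by
    intro h
    have := congrArg Subtype.val h
    simp [unif_ne_zero] at this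
  obtain ⟨e, w, hw⟩ := IsDiscreteValuationRing.eq_unit_mul_pow_irreducible h0 hϖ
  have hw' := congrArg Subtype.val hw
  refine ⟨ϖ, e, w, hϖ, ?_, ?_⟩
  · rcases Nat.eq_zero_or_pos e with rfl | h
    · exfalso
      have h2 : algebraMap ν.Compl (SplitField inf ν γ) (ν.emb ν.unif)⁻¹ =
          ((w⁻¹ : (SplitIntegers inf ν γ)ˣ) : SplitIntegers inf ν γ) := by
        rw [map_inv₀]
        refine inv_eq_of_mul_eq_one_right ?_
        change (algebraMap ν.Compl (SplitField inf ν γ) (ν.emb ν.unif)) = _ at hw'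
        rw [hw', ← Subalgebra.coe_mul]
        simp
      have h3 := ν.v_le_one_of_isIntegral (L := SplitField inf ν γ) (y := (ν.emb ν.unif)⁻¹)
        (by rw [h2]; exact Subtype.property _)
      rw [map_inv₀, ν.v_emb, hu, ← WithZero.exp_neg, ← WithZero.exp_zero,
        WithZero.exp_le_exp] at h3
      norm_num at h3
    · exact h
  · exact hw'.trans (by simp [mul_comm])

/-- An element of K_ν of valuation n is a unit times the (e n)-th power of a uniformizer of the
splitting field, where e is the exponent of that uniformizer in a uniformizer of K_ν. -/
theorem OrdAtLeast.le_eIndex_mul {N n : ℕ} {y : ν.Compl} (hy : Valued.v y = WithZero.exp (-(n : ℤ)))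
    (h : OrdAtLeast inf ν γ N (algebraMap ν.Compl _ y)) : N ≤ eIndex inf ν γ * n := by
  obtain ⟨ϖ, e, w, hϖ, he, hw⟩ := exists_unif_eq (inf := inf) (ν := ν) (γ := γ)
  have hϖ0 : (ϖ : SplitField inf ν γ) ≠ 0 := by
    simpa using hϖ.ne_zero
  have key : ∀ (M m : ℕ) (z : SplitIntegers inf ν γ) (s : SplitIntegers inf ν γ),
      IsUnit s → (ϖ : SplitField inf ν γ) ^ M * z = (ϖ : SplitField inf ν γ) ^ m * s → M ≤ m := by
    intro M m z s hs hz
    have h1 : ϖ ^ M * z = ϖ ^ m * s := Subtype.ext (by simpa using hz)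
    have h2 : ϖ ^ M ∣ ϖ ^ m := hs.dvd_mul_right.mp ⟨z, h1.symm⟩
    exact (pow_dvd_pow_iff hϖ.ne_zero hϖ.not_isUnit).mp h2
  -- The set in the definition of `eIndex` is the interval of integers up to e, so its supremum is
  -- attained and is not the default value of an unbounded set.
  have hE : eIndex inf ν γ = e := by
    have : {k | OrdAtLeast inf ν γ k (algebraMap ν.Compl _ (ν.emb ν.unif))} = Set.Iic e := by
      ext k
      rw [Set.mem_ofPred_eq, ordAtLeast_iff hϖ, Set.mem_Iic, hw]
      constructor
      · rintro ⟨z, hz⟩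
        exact key k e z w w.isUnit hz
      · intro hk
        refine ⟨ϖ ^ (e - k) * w, ?_⟩
        simp only [MulMemClass.coe_mul, SubmonoidClass.coe_pow]
        rw [← mul_assoc, ← pow_add, Nat.add_sub_cancel' hk]
    rw [eIndex, this]
    exact csSup_Iic
  have hu : ν.val ν.unif = WithZero.exp (-1) := (ν.surj (WithZero.exp (-1))).choose_spec
  have hu0 : ν.emb ν.unif ≠ 0 := by simpa using unif_ne_zero ν
  have h1 : Valued.v (y / ν.emb ν.unif ^ n) = 1 := by
    rw [map_div₀, map_pow, ν.v_emb, hu, hy, ← WithZero.exp_nsmul]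
    simp
  have hs : IsIntegral ν.integers (algebraMap ν.Compl (SplitField inf ν γ) (y / ν.emb ν.unif ^ n)) :=
    ν.isIntegral_algebraMap_of_v_le_one h1.le
  have hs' : IsIntegral ν.integers
      (algebraMap ν.Compl (SplitField inf ν γ) (y / ν.emb ν.unif ^ n)⁻¹) :=
    ν.isIntegral_algebraMap_of_v_le_one (by rw [map_inv₀, h1, inv_one])
  have hsu : IsUnit (⟨_, hs⟩ : SplitIntegers inf ν γ) := by
    refine IsUnit.of_mul_eq_one ⟨_, hs'⟩ (Subtype.ext ?_)
    change algebraMap ν.Compl (SplitField inf ν γ) _ * algebraMap ν.Compl _ _ = 1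
    rw [← map_mul, mul_inv_cancel₀, map_one]
    intro h
    rw [h, map_zero] at h1
    exact zero_ne_one h1
  obtain ⟨z, hz⟩ := (ordAtLeast_iff hϖ).mp h
  rw [hE]
  refine key N (e * n) z (w ^ n * ⟨_, hs⟩) ((w.isUnit.pow n).mul hsu) ?_
  rw [hz, MulMemClass.coe_mul, SubmonoidClass.coe_pow, ← mul_assoc, pow_mul, ← mul_pow, ← hw,
    ← map_pow, ← map_mul, mul_div_cancel₀]
  exact pow_ne_zero _ hu0

theorem eIndex_pos : 0 < eIndex inf ν γ := by
  obtain ⟨ϖ, e, w, hϖ, he, hw⟩ := exists_unif_eq (inf := inf) (ν := ν) (γ := γ)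
  have hu : ν.val ν.unif = WithZero.exp (-1) := (ν.surj (WithZero.exp (-1))).choose_spec
  have h : OrdAtLeast inf ν γ e (algebraMap ν.Compl _ (ν.emb ν.unif)) :=
    (ordAtLeast_iff hϖ).mpr ⟨w, hw.symm⟩
  have := OrdAtLeast.le_eIndex_mul (n := 1) (by rw [ν.v_emb, hu]; rfl) h
  omega

end

end

/-! ### Eigenvalues in the splitting field and the indices d_ν and r_ν -/

section

variable {Fq K : Type*} [Field Fq] [Field K] [Algebra Fq K]

/-- For infinitely many elements with integral coordinates there are two with congruent
coordinates. -/
theorem Place.exists_lt_val_sub_lt_one (hK : IsGlobalFunctionField Fq K) (ω : Place Fq K)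
    {ι : Type*} [Finite ι] (f : ℕ → ι → K) (hf : ∀ n i, ω.val (f n i) ≤ 1) :
    ∃ m n, m < n ∧ ∀ i, ω.val (f n i - f m i) < 1 := by
  obtain ⟨T, hT, h⟩ := ω.exists_finite_residues hK
  choose g hgT hg1 hg using fun n i => h (f n i) (hf n i)
  have : Finite T := hT
  obtain ⟨m, n, hmn, he⟩ := Finite.exists_ne_map_eq_of_infinite
    (fun n => (fun i => ⟨g n i, hgT n i⟩ : ι → T))
  have key : ∀ i, ω.val (f n i - f m i) < 1 := by
    intro i
    have h1 : g m i = g n i := congrArg Subtype.val (congrFun he i)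
    have h2 : f n i - f m i = (f n i - g n i) - (f m i - g m i) := by rw [h1]; ring
    rw [h2]
    exact (Valuation.map_sub _ _ _).trans_lt (max_lt (hg n i) (hg m i))
  rcases lt_or_gt_of_ne hmn with h1 | h1
  · exact ⟨m, n, h1, key⟩
  · exact ⟨n, m, h1, fun i => by rw [Valuation.map_sub_swap]; exact key i⟩

section

variable {inf ν : Place Fq K} {γ : Matrix.GeneralLinearGroup (Fin 2) inf.affineRing}

variable (inf ν γ) in
/-- The embedding of `R_∞` in the splitting field. -/
def splitHom : inf.affineRing →+* SplitField inf ν γ :=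
  (algebraMap ν.Compl (SplitField inf ν γ)).comp (ν.emb.comp inf.affineRing.subtype)

theorem charpolyAt_eq : charpolyAt inf ν γ = Polynomial.X ^ 2 -
    Polynomial.C (ν.emb (γ : Matrix (Fin 2) (Fin 2) inf.affineRing).trace) * Polynomial.X +
      Polynomial.C (ν.emb (γ : Matrix (Fin 2) (Fin 2) inf.affineRing).det) := by
  rw [charpolyAt, Matrix.charpoly_fin_two]
  simp

theorem charpolyAt_map_eq : (charpolyAt inf ν γ).map (algebraMap ν.Compl (SplitField inf ν γ)) =
      Polynomial.X ^ 2 - Polynomial.C (splitHom inf ν γ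
        (γ : Matrix (Fin 2) (Fin 2) inf.affineRing).trace) * Polynomial.X +
      Polynomial.C (splitHom inf ν γ (γ : Matrix (Fin 2) (Fin 2) inf.affineRing).det) := by
  refine (congrArg (Polynomial.map _) charpolyAt_eq).trans ?_
  simp [splitHom]

theorem isEigenpair_iff {lam lam' : SplitField inf ν γ} : IsEigenpair inf ν γ lam lam' ↔
    lam + lam' = splitHom inf ν γ (γ : Matrix (Fin 2) (Fin 2) inf.affineRing).trace ∧
    lam * lam' = splitHom inf ν γ (γ : Matrix (Fin 2) (Fin 2) inf.affineRing).det := by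
  have h2 : (Polynomial.X - Polynomial.C lam) * (Polynomial.X - Polynomial.C lam') =
      Polynomial.X ^ 2 - Polynomial.C (lam + lam') * Polynomial.X + Polynomial.C (lam * lam') := by
    rw [Polynomial.C_add, Polynomial.C_mul]
    ring
  rw [IsEigenpair, charpolyAt_map_eq, h2]
  constructor
  · intro h
    have e0 := congrArg (fun q => Polynomial.coeff q 0) h
    have e1 := congrArg (fun q => Polynomial.coeff q 1) h
    simp [Polynomial.coeff_X_pow, Polynomial.coeff_C, Polynomial.coeff_X] at e0 e1
    exact ⟨by linear_combination e1, e0.symm⟩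
  · rintro ⟨e0, e1⟩
    rw [e0, e1]

theorem exists_isEigenpair : ∃ lam lam', IsEigenpair inf ν γ lam lam' := by
  have hs := Polynomial.SplittingField.splits (charpolyAt inf ν γ)
  have hd : ((charpolyAt inf ν γ).map (algebraMap ν.Compl (SplitField inf ν γ))).degree ≠ 0 := by
    rw [Polynomial.degree_map]
    refine (congrArg Polynomial.degree (charpolyAt_eq (inf := inf) (ν := ν) (γ := γ))).trans_ne ?_
    generalize (ν.emb (γ : Matrix (Fin 2) (Fin 2) inf.affineRing).trace) = a
    generalize (ν.emb (γ : Matrix (Fin 2) (Fin 2) inf.affineRing).det) = b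
    have : (Polynomial.X ^ 2 - Polynomial.C a * Polynomial.X + Polynomial.C b).degree = 2 := by
      compute_degree!
    rw [this]
    decide
  obtain ⟨lam, hl⟩ := hs.exists_eval_eq_zero hd
  rw [charpolyAt_map_eq] at hl
  refine ⟨lam, splitHom inf ν γ (γ : Matrix (Fin 2) (Fin 2) inf.affineRing).trace - lam,
    isEigenpair_iff.mpr ⟨by ring, ?_⟩⟩
  simp at hl
  linear_combination -hl

theorem IsEigenpair.symm {lam lam' : SplitField inf ν γ} (h : IsEigenpair inf ν γ lam lam') :
    IsEigenpair inf ν γ lam' lam := by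
  rw [IsEigenpair, mul_comm]
  exact h

theorem IsEigenpair.mul_self {lam lam' : SplitField inf ν γ} (h : IsEigenpair inf ν γ lam lam') :
    lam * lam = splitHom inf ν γ (γ : Matrix (Fin 2) (Fin 2) inf.affineRing).trace * lam -
      splitHom inf ν γ (γ : Matrix (Fin 2) (Fin 2) inf.affineRing).det := by
  rw [isEigenpair_iff] at h
  rw [← h.1, ← h.2]
  ring

theorem val_le_one_of_mem_affineRing (hν : ν ≠ inf) (x : inf.affineRing) : ν.val (x : K) ≤ 1 :=
  (inf.mem_affineRing_iff _).mp x.2 ν hν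

theorem isIntegral_splitHom (hν : ν ≠ inf) (x : inf.affineRing) :
    IsIntegral ν.integers (splitHom inf ν γ x) :=
  ν.isIntegral_algebraMap_of_v_le_one (by
    rw [RingHom.comp_apply, ν.v_emb]; exact val_le_one_of_mem_affineRing hν x)

/-- Of λ and λ⁻¹ one is integral, and λ = tr γ − det γ · λ⁻¹ settles the second case. -/
theorem IsEigenpair.isIntegral (hν : ν ≠ inf) {lam lam' : SplitField inf ν γ}
    (h : IsEigenpair inf ν γ lam lam') : IsIntegral ν.integers lam := by
  rcases ν.isIntegral_or_isIntegral_inv lam with h1 | h1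
  · exact h1
  · by_cases h0 : lam = 0
    · rw [h0]; exact isIntegral_zero
    have h2 : lam = splitHom inf ν γ (γ : Matrix (Fin 2) (Fin 2) inf.affineRing).trace -
      splitHom inf ν γ (γ : Matrix (Fin 2) (Fin 2) inf.affineRing).det * lam⁻¹ := by
      field_simp
      linear_combination h.mul_self
    rw [h2]
    exact (isIntegral_splitHom hν _).sub ((isIntegral_splitHom hν _).mul h1)

theorem splitHom_det_mul : splitHom inf ν γ (γ : Matrix (Fin 2) (Fin 2) inf.affineRing).det *
    splitHom inf ν γ ((γ⁻¹ : Matrix.GeneralLinearGroup (Fin 2) inf.affineRing) :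
      Matrix (Fin 2) (Fin 2) inf.affineRing).det = 1 := by
  rw [← map_mul, ← Matrix.det_mul, ← Units.val_mul, mul_inv_cancel, Units.val_one, Matrix.det_one,
    map_one]

theorem IsEigenpair.ne_zero {lam lam' : SplitField inf ν γ}
    (h : IsEigenpair inf ν γ lam lam') : lam ≠ 0 := by
  intro h0
  have := splitHom_det_mul (inf := inf) (ν := ν) (γ := γ)
  rw [← (isEigenpair_iff.mp h).2, h0] at this
  simp at this

theorem IsEigenpair.isIntegral_inv (hν : ν ≠ inf) {lam lam' : SplitField inf ν γ}
    (h : IsEigenpair inf ν γ lam lam') : IsIntegral ν.integers lam⁻¹ := by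
  have h1 : lam⁻¹ = lam' * splitHom inf ν γ
      ((γ⁻¹ : Matrix.GeneralLinearGroup (Fin 2) inf.affineRing) :
        Matrix (Fin 2) (Fin 2) inf.affineRing).det := by
    refine inv_eq_of_mul_eq_one_right ?_
    rw [← mul_assoc, (isEigenpair_iff.mp h).2, splitHom_det_mul]
  rw [h1]
  exact (h.symm.isIntegral hν).mul (isIntegral_splitHom hν _)

/-- The coefficients of the powers of `γ`, with `γ ^ k = a γ + b`. -/
abbrev glCoeffs {R : Type*} [CommRing R] (γ : Matrix.GeneralLinearGroup (Fin 2) R) (k : ℕ) : R × R :=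
  powCoeffs (γ : Matrix (Fin 2) (Fin 2) R).trace (γ : Matrix (Fin 2) (Fin 2) R).det k

/-- The discriminant of the characteristic polynomial of `γ`. -/
abbrev glDiscr {R : Type*} [CommRing R] (γ : Matrix.GeneralLinearGroup (Fin 2) R) : R :=
  (γ : Matrix (Fin 2) (Fin 2) R).trace ^ 2 - 4 * (γ : Matrix (Fin 2) (Fin 2) R).det

/-- From λ^k = a_k λ + b_k follows λ^k − λ'^k = a_k (λ − λ'), and (λ − λ')² is the discriminant.
Squaring keeps the left side in R_∞, so that its valuation is computed in K_ν, in every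
characteristic. -/
theorem IsEigenpair.sq_mul_discr {lam lam' : SplitField inf ν γ}
    (h : IsEigenpair inf ν γ lam lam') (k : ℕ) :
    splitHom inf ν γ ((glCoeffs γ k).1 ^ 2 * glDiscr γ) =
      lam' ^ (2 * k) * ((lam / lam') ^ k - 1) ^ 2 := by
  have h1 := pow_eq_powCoeffs_of_ringHom (splitHom inf ν γ) h.mul_self k
  have h2 := pow_eq_powCoeffs_of_ringHom (splitHom inf ν γ) h.symm.mul_self k
  have h3 : lam' ^ (2 * k) * ((lam / lam') ^ k - 1) ^ 2 = (lam ^ k - lam' ^ k) ^ 2 := by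
    have := pow_ne_zero k h.symm.ne_zero
    rw [div_pow, two_mul, pow_add]
    field_simp
  rw [h3, h1, h2]
  have h4 := isEigenpair_iff.mp h
  simp only [map_mul, map_pow, map_sub, map_ofNat, glDiscr]
  linear_combination (splitHom inf ν γ (glCoeffs γ k).1) ^ 2 * (-(lam + lam' + splitHom inf ν γ
    (γ : Matrix (Fin 2) (Fin 2) inf.affineRing).trace) * h4.1 + 4 * h4.2)

theorem ordAtLeast_one_of_val_lt_one {y : ν.Compl} (hy : Valued.v y < 1) :
    OrdAtLeast inf ν γ 1 (algebraMap ν.Compl _ y) := by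
  have hint := ν.isIntegral_algebraMap_of_v_le_one (L := SplitField inf ν γ) hy.le
  refine ⟨⟨_, hint⟩, ?_, rfl⟩
  rw [jacobson_splitIntegers, pow_one, IsLocalRing.mem_maximalIdeal, mem_nonunits_iff]
  intro h
  obtain ⟨z, hz⟩ := h.exists_right_inv
  have hz' : algebraMap ν.Compl (SplitField inf ν γ) y * z = 1 := congrArg Subtype.val hz
  have h1 : algebraMap ν.Compl (SplitField inf ν γ) y⁻¹ = z := by
    rw [map_inv₀]
    exact inv_eq_of_mul_eq_one_right hz'
  have h2 := ν.v_le_one_of_isIntegral (L := SplitField inf ν γ) (y := y⁻¹) (by rw [h1]; exact z.2)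
  rw [map_inv₀] at h2
  have h0 : Valued.v y ≠ 0 := by
    intro h0
    rw [Valuation.zero_iff] at h0
    rw [h0, map_zero, zero_mul] at hz'
    exact zero_ne_one hz'
  exact absurd ((inv_le_one₀ (zero_lt_iff.mpr h0)).mp h2) (not_le.mpr hy)

theorem OrdAtLeast.add {k : ℕ} {u w : SplitField inf ν γ} (hu : OrdAtLeast inf ν γ k u)
    (hw : OrdAtLeast inf ν γ k w) : OrdAtLeast inf ν γ k (u + w) := by
  obtain ⟨y, hy, rfl⟩ := hu
  obtain ⟨z, hz, rfl⟩ := hw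
  exact ⟨y + z, add_mem hy hz, rfl⟩

theorem OrdAtLeast.neg {k : ℕ} {u : SplitField inf ν γ} (hu : OrdAtLeast inf ν γ k u) :
    OrdAtLeast inf ν γ k (-u) := by
  obtain ⟨y, hy, rfl⟩ := hu
  exact ⟨-y, neg_mem hy, rfl⟩

/-- The infimum is attained and is not the default value 0. The pairs (a_k, b_k) take finitely many
values modulo ν, so λ^n ≡ λ^m for some m < n, for both eigenvalues at once, and the eigenvalues are
units. -/
theorem dIndex_spec (hK : IsGlobalFunctionField Fq K) (hν : ν ≠ inf) :
    0 < dIndex inf ν γ ∧ ∃ lam lam', IsEigenpair inf ν γ lam lam' ∧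
      OrdAtLeast inf ν γ 1 ((lam / lam') ^ dIndex inf ν γ - 1) := by
  refine Nat.sInf_mem (s := {d | 0 < d ∧ ∃ lam lam', IsEigenpair inf ν γ lam lam' ∧
    OrdAtLeast inf ν γ 1 ((lam / lam') ^ d - 1)}) ?_
  obtain ⟨m, n, hmn, h⟩ := ν.exists_lt_val_sub_lt_one hK
    (fun k (i : Bool) => (((if i then (glCoeffs γ k).1 else (glCoeffs γ k).2) : inf.affineRing) : K))
    (fun k i => val_le_one_of_mem_affineRing hν _)
  obtain ⟨lam, lam', hl⟩ := exists_isEigenpair (inf := inf) (ν := ν) (γ := γ)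
  have ha : OrdAtLeast inf ν γ 1 (splitHom inf ν γ ((glCoeffs γ n).1 - (glCoeffs γ m).1)) :=
    ordAtLeast_one_of_val_lt_one (by rw [RingHom.comp_apply, ν.v_emb]; simpa using h true)
  have hb : OrdAtLeast inf ν γ 1 (splitHom inf ν γ ((glCoeffs γ n).2 - (glCoeffs γ m).2)) :=
    ordAtLeast_one_of_val_lt_one (by rw [RingHom.comp_apply, ν.v_emb]; simpa using h false)
  have key : ∀ {lam lam' : SplitField inf ν γ}, IsEigenpair inf ν γ lam lam' →
      OrdAtLeast inf ν γ 1 (lam ^ (n - m) - 1) := by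
    intro lam lam' hl
    have h1 : lam ^ (n - m) - 1 = lam⁻¹ ^ m * (lam *
        splitHom inf ν γ ((glCoeffs γ n).1 - (glCoeffs γ m).1) +
        splitHom inf ν γ ((glCoeffs γ n).2 - (glCoeffs γ m).2)) := by
      have h2 : lam * splitHom inf ν γ ((glCoeffs γ n).1 - (glCoeffs γ m).1) +
        splitHom inf ν γ ((glCoeffs γ n).2 - (glCoeffs γ m).2) = lam ^ n - lam ^ m := by
        rw [pow_eq_powCoeffs_of_ringHom (splitHom inf ν γ) hl.mul_self n,
          pow_eq_powCoeffs_of_ringHom (splitHom inf ν γ) hl.mul_self m, map_sub, map_sub]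
        ring
      have h3 : lam ^ n = lam ^ (n - m) * lam ^ m := by
        rw [← pow_add, Nat.sub_add_cancel hmn.le]
      have := pow_ne_zero m hl.ne_zero
      rw [h2, h3, inv_pow]
      field_simp
    rw [h1]
    exact ((ha.mul_isIntegral (hl.isIntegral hν)).add hb).mul_isIntegral
      ((hl.isIntegral_inv hν).pow m)
  refine ⟨n - m, Nat.sub_pos_of_lt hmn, lam, lam', hl, ?_⟩
  have h1 : (lam / lam') ^ (n - m) - 1 = lam'⁻¹ ^ (n - m) * ((lam ^ (n - m) - 1) +
      -(lam' ^ (n - m) - 1)) := by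
    have := pow_ne_zero (n - m) hl.symm.ne_zero
    rw [div_pow, inv_pow]
    field_simp
    ring
  rw [h1]
  exact ((key hl).add (key hl.symm).neg).mul_isIntegral ((hl.symm.isIntegral_inv hν).pow _)

/-- This compares valuations in `IsEigenpair.sq_mul_discr`, with λ' integral. It turns the closeness
of (λ/λ')^k to 1 into the divisibility of a_k by ν. -/
theorem IsEigenpair.two_mul_le (hν : ν ≠ inf) {lam lam' : SplitField inf ν γ}
    (hl : IsEigenpair inf ν γ lam lam') {N k : ℕ}
    (h : OrdAtLeast inf ν γ N ((lam / lam') ^ k - 1))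
    (ha : (glCoeffs γ k).1 ≠ 0) (hΔ : glDiscr γ ≠ 0) :
    2 * (N : ℤ) ≤ eIndex inf ν γ * (2 * ν.ord ((glCoeffs γ k).1 : K) + ν.ord ((glDiscr γ : inf.affineRing) : K)) := by
  have h1 : OrdAtLeast inf ν γ (N * 2) (splitHom inf ν γ ((glCoeffs γ k).1 ^ 2 * glDiscr γ)) := by
    rw [hl.sq_mul_discr k]
    exact (h.pow 2).mul_isIntegral ((hl.symm.isIntegral hν).pow _)
  have ha' : ν.val ((glCoeffs γ k).1 : K) ≠ 0 := by simpa using ha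
  have hΔ' : ν.val ((glDiscr γ : inf.affineRing) : K) ≠ 0 := by
    rw [Valuation.ne_zero_iff]; exact fun h => hΔ (Subtype.ext h)
  have ho : ∀ x : inf.affineRing, ν.val (x : K) ≠ 0 → 0 ≤ ν.ord (x : K) := by
    intro x hx
    have := val_le_one_of_mem_affineRing hν x
    rw [← WithZero.exp_log hx, ← WithZero.exp_zero, WithZero.exp_le_exp] at this
    simpa [Place.ord] using this
  have h2 : 0 ≤ 2 * ν.ord ((glCoeffs γ k).1 : K) + ν.ord ((glDiscr γ : inf.affineRing) : K) := by
    have := ho _ ha'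
    have := ho _ hΔ'
    omega
  obtain ⟨n, hn⟩ := Int.eq_ofNat_of_zero_le h2
  have h3 : Valued.v (ν.emb (((glCoeffs γ k).1 ^ 2 * glDiscr γ : inf.affineRing) : K)) =
      WithZero.exp (-(n : ℤ)) := by
    rw [ν.v_emb, ← hn]
    simp only [MulMemClass.coe_mul, SubmonoidClass.coe_pow, map_mul, map_pow]
    rw [← WithZero.exp_log ha', ← WithZero.exp_log hΔ', ← WithZero.exp_nsmul, ← WithZero.exp_add]
    congr 1
    simp only [Place.ord, nsmul_eq_mul]
    push_cast
    ring
  have h4 := h1.le_eIndex_mul h3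
  rw [hn]
  exact_mod_cast (by omega : 2 * N ≤ eIndex inf ν γ * n)

/-- `IsEigenpair.two_mul_le` for k = d_ν bounds the set whose supremum is r_ν, so the supremum is
attained; the set contains 1 by the choice of d_ν. -/
theorem rIndex_spec (hK : IsGlobalFunctionField Fq K) (hν : ν ≠ inf)
    (ha : ∀ k, 0 < k → (glCoeffs γ k).1 ≠ 0) (hΔ : glDiscr γ ≠ 0) :
    0 < rIndex inf ν γ ∧ ∃ lam lam', IsEigenpair inf ν γ lam lam' ∧
      OrdAtLeast inf ν γ (rIndex inf ν γ) ((lam / lam') ^ dIndex inf ν γ - 1) := by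
  obtain ⟨hd, h1⟩ := dIndex_spec (γ := γ) hK hν
  set s := {k | ∃ lam lam', IsEigenpair inf ν γ lam lam' ∧
    OrdAtLeast inf ν γ k ((lam / lam') ^ dIndex inf ν γ - 1)} with hs
  have hb : BddAbove s := by
    refine ⟨(eIndex inf ν γ * (2 * ν.ord ((glCoeffs γ (dIndex inf ν γ)).1 : K) +
      ν.ord ((glDiscr γ : inf.affineRing) : K)) : ℤ).toNat, ?_⟩
    rintro k ⟨lam, lam', hl, hk⟩
    have := hl.two_mul_le hν hk (ha _ hd) hΔ
    omega
  exact ⟨lt_of_lt_of_le one_pos (le_csSup hb h1), Nat.sSup_mem ⟨1, h1⟩ hb⟩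

/-- In characteristic p, u^(d p^m) − 1 = (u^d − 1)^(p^m). So v_ν(a_k) grows linearly in k along k =
d_ν p^m, which makes the escaping proportion of mass positive. -/
theorem two_mul_rIndex_mul_le (hK : IsGlobalFunctionField Fq K) (hν : ν ≠ inf) (p : ℕ)
    [Fact p.Prime] [CharP Fq p] (ha : ∀ k, 0 < k → (glCoeffs γ k).1 ≠ 0) (hΔ : glDiscr γ ≠ 0)
    (m : ℕ) :
    2 * (rIndex inf ν γ * p ^ m : ℤ) ≤ eIndex inf ν γ *
      (2 * ν.ord ((glCoeffs γ (dIndex inf ν γ * p ^ m)).1 : K) + ν.ord ((glDiscr γ : inf.affineRing) : K)) := by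
  obtain ⟨hd, -⟩ := dIndex_spec (γ := γ) hK hν
  obtain ⟨-, lam, lam', hl, h⟩ := rIndex_spec hK hν ha hΔ
  have : CharP (SplitField inf ν γ) p := charP_of_injective_ringHom
    (f := ((algebraMap ν.Compl (SplitField inf ν γ)).comp ν.emb).comp (algebraMap Fq K))
    (RingHom.injective _) p
  have hp : 0 < p ^ m := pow_pos (Fact.out : p.Prime).pos m
  have h1 : OrdAtLeast inf ν γ (rIndex inf ν γ * p ^ m)
      ((lam / lam') ^ (dIndex inf ν γ * p ^ m) - 1) := by
    rw [pow_mul, ← one_pow (p ^ m), ← sub_pow_char_pow]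
    exact h.pow _
  have := hl.two_mul_le hν h1 (ha _ (Nat.mul_pos hd hp)) hΔ
  exact_mod_cast this

end

end

section

variable {Fq K : Type*} [Field Fq] [Field K] [Algebra Fq K]

/-! ### Points of `X_∞` and their periods in terms of matrices -/

/-- The embedding of `R_∞` in `K_∞`. -/
def Place.affineHom (inf : Place Fq K) : inf.affineRing →+* inf.Compl :=
  inf.emb.comp inf.affineRing.subtype

/-- The diagonal matrix with entries `1, t`. -/
def diagOne {F : Type*} [Field F] (t : F) : Matrix (Fin 2) (Fin 2) F := !![1, 0; 0, t]

theorem diagOne_mul {F : Type*} [Field F] (s t : F) : diagOne s * diagOne t = diagOne (s * t) := by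
  simp [diagOne]

theorem diagOne_pow {F : Type*} [Field F] (t : F) (k : ℕ) : diagOne t ^ k = diagOne (t ^ k) := by
  induction k with
  | zero => simp [diagOne, Matrix.one_fin_two]
  | succ k ih => rw [pow_succ, ih, diagOne_mul, pow_succ]

theorem det_diagOne {F : Type*} [Field F] (t : F) : (diagOne t).det = t := by
  simp [diagOne]

/-- The point `Γ_∞ g` of `X_∞` for a matrix `g`. -/
def XInf.ofMat (inf : Place Fq K) (G : Matrix.GeneralLinearGroup (Fin 2) inf.Compl) : XInf inf :=
  XInf.mk inf (.mk G)

theorem XInf.ofMat_surjective (inf : Place Fq K) : Function.Surjective (XInf.ofMat inf) := by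
  intro x
  obtain ⟨g, rfl⟩ := XInf.mk_surjective x
  obtain ⟨G, rfl⟩ := QuotientGroup.mk_surjective g
  exact ⟨G, rfl⟩

variable {inf : Place Fq K}

theorem toG_ofGL (γ : Matrix.GeneralLinearGroup (Fin 2) inf.affineRing) :
    inf.toG (ofGL inf γ) = .mk (Matrix.GeneralLinearGroup.map inf.affineHom γ) := rfl

theorem pgl_mul_eq_iff {F : Type*} [Field F] {A B C D : Matrix.GeneralLinearGroup (Fin 2) F} :
    (.mk A * .mk B : PGL2 F) = .mk C * .mk D ↔ ∃ c : Fˣ, (C : Matrix (Fin 2) (Fin 2) F) * D =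
      (c : F) • ((A : Matrix (Fin 2) (Fin 2) F) * B) := by
  rw [← map_mul, ← map_mul, pgl_mk_eq_mk_iff]
  simp only [Units.val_mul]

theorem XInf.ofMat_eq_ofMat {G G' : Matrix.GeneralLinearGroup (Fin 2) inf.Compl} :
    XInf.ofMat inf G = XInf.ofMat inf G' ↔
      ∃ (D : Matrix.GeneralLinearGroup (Fin 2) inf.affineRing) (c : inf.Complˣ),
        (G' : Matrix (Fin 2) (Fin 2) inf.Compl) = (c : inf.Compl) •
          ((D : Matrix (Fin 2) (Fin 2) inf.affineRing).map inf.affineHom * G) := by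
  rw [XInf.ofMat, XInf.ofMat, XInf.mk_eq_mk]
  have key : ∀ D : Matrix.GeneralLinearGroup (Fin 2) inf.affineRing,
      inf.toG (ofGL inf D) = .mk G' * (.mk G)⁻¹ ↔ ∃ c : inf.Complˣ,
      (G' : Matrix (Fin 2) (Fin 2) inf.Compl) = (c : inf.Compl) •
          ((D : Matrix (Fin 2) (Fin 2) inf.affineRing).map inf.affineHom * G) := by
    intro D
    rw [eq_mul_inv_iff_mul_eq, toG_ofGL, ← map_mul, pgl_mk_eq_mk_iff]
    simp only [Units.val_mul]
    rfl
  constructor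
  · rintro ⟨g, hg, h⟩
    obtain ⟨D, rfl⟩ := (mem_Gam_iff inf g).mp hg
    exact ⟨D, (key D).mp h⟩
  · rintro ⟨D, h⟩
    exact ⟨ofGL inf D, (mem_Gam_iff inf _).mpr ⟨D, rfl⟩, (key D).mpr h⟩

/-- The diagonal element of `GL₂` with entries `1, t`. -/
def glDiag {F : Type*} [Field F] (t : Fˣ) : Matrix.GeneralLinearGroup (Fin 2) F :=
  Matrix.GeneralLinearGroup.mkOfDetNeZero !![(1 : F), 0; 0, (t : F)] (by simp)

theorem coe_glDiag {F : Type*} [Field F] (t : Fˣ) :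
    (glDiag t : Matrix (Fin 2) (Fin 2) F) = diagOne (t : F) := rfl

theorem XInf.act_ofMat (t : inf.Complˣ) (G : Matrix.GeneralLinearGroup (Fin 2) inf.Compl) :
    XInf.act (alpha t) (XInf.ofMat inf G) = XInf.ofMat inf (G * glDiag t) := rfl

/-- The matrix `D` over `R_∞` acts on the columns of `G` as a multiple of `diag(1, t)`. -/
def HasPeriod (D : Matrix (Fin 2) (Fin 2) inf.affineRing)
    (G : Matrix (Fin 2) (Fin 2) inf.Compl) (c t : inf.Compl) : Prop :=
  D.map inf.affineHom * G = c • (G * diagOne t)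

theorem XInf.act_ofMat_eq_iff {t : inf.Complˣ} {G : Matrix.GeneralLinearGroup (Fin 2) inf.Compl} :
    XInf.act (alpha t) (XInf.ofMat inf G) = XInf.ofMat inf G ↔
      ∃ (D : Matrix.GeneralLinearGroup (Fin 2) inf.affineRing) (c : inf.Complˣ),
        HasPeriod (D : Matrix (Fin 2) (Fin 2) inf.affineRing)
          (G : Matrix (Fin 2) (Fin 2) inf.Compl) (c : inf.Compl) t := by
  rw [eq_comm, XInf.act_ofMat, XInf.ofMat_eq_ofMat]
  refine exists_congr fun D => ⟨?_, ?_⟩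
  · rintro ⟨c, hc⟩
    refine ⟨c⁻¹, ?_⟩
    rw [Units.val_mul, coe_glDiag] at hc
    rw [HasPeriod, hc, smul_smul, Units.inv_mul, one_smul]
  · rintro ⟨c, hc⟩
    refine ⟨c⁻¹, ?_⟩
    rw [HasPeriod] at hc
    rw [Units.val_mul, coe_glDiag, hc, smul_smul, Units.inv_mul, one_smul]

theorem HasPeriod.pow {D : Matrix (Fin 2) (Fin 2) inf.affineRing}
    {G : Matrix (Fin 2) (Fin 2) inf.Compl} {c t : inf.Compl} (h : HasPeriod D G c t) (k : ℕ) :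
    HasPeriod (D ^ k) G (c ^ k) (t ^ k) := by
  unfold HasPeriod at *
  induction k with
  | zero =>
    have h1 : diagOne (1 : inf.Compl) = 1 := Matrix.one_fin_two.symm
    simp [h1]
  | succ k ih =>
    rw [pow_succ, Matrix.map_mul, mul_assoc, h, mul_smul_comm, ← mul_assoc, ih, smul_mul_assoc,
      mul_assoc, diagOne_mul, smul_smul, pow_succ, pow_succ, mul_comm c]

/-! ### Hecke neighbours -/

/-- x/π lies in R_∞[π⁻¹] and is integral at ν, hence lies in R_∞: here π generates the prime ideal
ν. -/
theorem exists_eq_mul_of_val_lt_one {ν : Place Fq K} {π : K} (hπR : π ∈ inf.affineRing)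
    (hπν : ν.ord π = 1) (hπS : ∀ y ∈ inf.sRing π, ν.val y ≤ 1 → y ∈ inf.affineRing)
    {x : inf.affineRing} (hx : ν.val (x : K) < 1) :
    ∃ y : inf.affineRing, x = ⟨π, hπR⟩ * y := by
  have hπ0 : π ≠ 0 := by
    rintro rfl
    simp [Place.ord] at hπν
  have hv : ν.val π = WithZero.exp (-1) := by
    rw [Place.ord] at hπν
    rw [← WithZero.exp_log ((Valuation.ne_zero_iff ν.val).mpr hπ0)]
    congr 1
    omega
  have h1 : π⁻¹ * x ∈ inf.affineRing := by
    refine hπS _ (mul_mem (Subring.subset_closure (Or.inr rfl))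
      (Subring.subset_closure (Or.inl x.2))) ?_
    by_cases hx0 : (x : K) = 0
    · simp [hx0]
    have hx1 : ν.val (x : K) ≠ 0 := (Valuation.ne_zero_iff _).mpr hx0
    rw [← WithZero.exp_log hx1, ← WithZero.exp_zero, WithZero.exp_lt_exp] at hx
    rw [map_mul, map_inv₀, hv, ← WithZero.exp_log hx1, ← WithZero.exp_neg, ← WithZero.exp_add,
      ← WithZero.exp_zero, WithZero.exp_le_exp]
    omega
  exact ⟨⟨_, h1⟩, Subtype.ext (by simp [hπ0])⟩

/-- Two powers of D are congruent modulo ν by finiteness of the residue field, and D is invertible.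
-/
theorem exists_pow_eq_one_add (hK : IsGlobalFunctionField Fq K) {ν : Place Fq K} (hν : ν ≠ inf)
    {π : K} (hπR : π ∈ inf.affineRing)
    (hπν : ν.ord π = 1) (hπS : ∀ y ∈ inf.sRing π, ν.val y ≤ 1 → y ∈ inf.affineRing)
    (D : Matrix.GeneralLinearGroup (Fin 2) inf.affineRing) :
    ∃ k, 0 < k ∧ ∃ E : Matrix (Fin 2) (Fin 2) inf.affineRing,
      (D : Matrix (Fin 2) (Fin 2) inf.affineRing) ^ k = 1 + (⟨π, hπR⟩ : inf.affineRing) • E := by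
  obtain ⟨m, n, hmn, h⟩ := ν.exists_lt_val_sub_lt_one hK
    (fun k (i : Fin 2 × Fin 2) =>
      (((D : Matrix (Fin 2) (Fin 2) inf.affineRing) ^ k) i.1 i.2 : K))
    (fun k i => val_le_one_of_mem_affineRing hν _)
  choose E hE using fun i j => exists_eq_mul_of_val_lt_one hπR hπν hπS
    (x := ((D : Matrix (Fin 2) (Fin 2) inf.affineRing) ^ n) i j -
      ((D : Matrix (Fin 2) (Fin 2) inf.affineRing) ^ m) i j) (by simpa using h (i, j))
  have h1 : (D : Matrix (Fin 2) (Fin 2) inf.affineRing) ^ n -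
      (D : Matrix (Fin 2) (Fin 2) inf.affineRing) ^ m =
      (⟨π, hπR⟩ : inf.affineRing) • Matrix.of E := by
    refine Matrix.ext fun i j => ?_
    exact hE i j
  refine ⟨n - m, Nat.sub_pos_of_lt hmn,
    ((D ^ m)⁻¹ : Matrix.GeneralLinearGroup (Fin 2) inf.affineRing) * Matrix.of E, ?_⟩
  rw [← mul_smul_comm, ← h1, mul_sub, ← Units.val_pow_eq_pow_val D m,
    ← Units.val_pow_eq_pow_val D n, ← Units.val_mul, Units.inv_mul, ← Units.val_pow_eq_pow_val]
  have : D ^ (n - m) = (D ^ m)⁻¹ * D ^ n := by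
    rw [eq_inv_mul_iff_mul_eq, ← pow_add, Nat.add_sub_cancel' hmn.le]
  rw [this]
  simp

theorem isPeriodic_ofMat_iff (hK : IsGlobalFunctionField Fq K)
    {G : Matrix.GeneralLinearGroup (Fin 2) inf.Compl} : IsPeriodic (XInf.ofMat inf G) ↔
      ∃ t : inf.Complˣ, Valued.v (t : inf.Compl) < 1 ∧
      ∃ (D : Matrix.GeneralLinearGroup (Fin 2) inf.affineRing) (c : inf.Complˣ),
        HasPeriod (D : Matrix (Fin 2) (Fin 2) inf.affineRing)
          (G : Matrix (Fin 2) (Fin 2) inf.Compl) (c : inf.Compl) t := by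
  rw [isPeriodic_iff hK]
  simp only [XInf.act_ofMat_eq_iff]

/-- If D^k = 1 + πE, then s' s = π gives (1 + s E s') s = s D^k. So the conjugate of D^k by s is
again integral, with the same determinant, and it is a period matrix for G'. -/
theorem isPeriodic_of_mul (hK : IsGlobalFunctionField Fq K) {ν : Place Fq K} (hν : ν ≠ inf)
    {π : K} (hπR : π ∈ inf.affineRing)
    (hπν : ν.ord π = 1) (hπS : ∀ y ∈ inf.sRing π, ν.val y ≤ 1 → y ∈ inf.affineRing)
    {G G' : Matrix.GeneralLinearGroup (Fin 2) inf.Compl}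
    {s s' : Matrix (Fin 2) (Fin 2) inf.affineRing} (hs : s * s' = (⟨π, hπR⟩ : inf.affineRing) • 1)
    (hs' : s' * s = (⟨π, hπR⟩ : inf.affineRing) • 1) {b : inf.Compl}
    (hG : (G' : Matrix (Fin 2) (Fin 2) inf.Compl) = b • (s.map inf.affineHom * G))
    (h : IsPeriodic (XInf.ofMat inf G)) : IsPeriodic (XInf.ofMat inf G') := by
  rw [isPeriodic_ofMat_iff hK] at h ⊢
  obtain ⟨t, ht, D, c, hD⟩ := h
  obtain ⟨k, hk, E, hE⟩ := exists_pow_eq_one_add hK hν hπR hπν hπS D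
  have hπ0 : (⟨π, hπR⟩ : inf.affineRing) ≠ 0 := by
    intro h0
    have : π = 0 := congrArg Subtype.val h0
    simp [this, Place.ord] at hπν
  have hint : (1 + s * E * s') * s = s * (D : Matrix (Fin 2) (Fin 2) inf.affineRing) ^ k := by
    rw [hE, add_mul, mul_add, one_mul, mul_one, mul_assoc, hs', mul_smul_comm, mul_smul_comm,
      mul_one]
  have hdet : (1 + s * E * s').det = (D ^ k : Matrix.GeneralLinearGroup (Fin 2) inf.affineRing).1.det := by
    have h1 := congrArg Matrix.det hint
    have h2 : s.det ≠ 0 := by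
      intro h2
      have h3 := congrArg Matrix.det hs
      rw [Matrix.det_mul, h2, zero_mul, Matrix.det_smul, Matrix.det_one, mul_one] at h3
      exact hπ0 (pow_eq_zero_iff (by simp) |>.mp h3.symm)
    rw [Matrix.det_mul, Matrix.det_mul, mul_comm] at h1
    rw [Units.val_pow_eq_pow_val]
    exact mul_left_cancel₀ h2 h1
  have hu : IsUnit (1 + s * E * s') := by
    rw [Matrix.isUnit_iff_isUnit_det, hdet, ← Matrix.isUnit_iff_isUnit_det]
    exact Units.isUnit _
  refine ⟨t ^ k, ?_, hu.unit, c ^ k, ?_⟩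
  · rw [Units.val_pow_eq_pow_val, map_pow]
    exact pow_lt_one₀ zero_le ht hk.ne'
  · have h1 := hD.pow k
    rw [IsUnit.unit_spec]
    unfold HasPeriod at *
    rw [hG, mul_smul_comm, ← mul_assoc, ← Matrix.map_mul, hint, Matrix.map_mul, mul_assoc, h1,
      Units.val_pow_eq_pow_val, Units.val_pow_eq_pow_val, mul_smul_comm, smul_mul_assoc,
      smul_smul, smul_smul, mul_comm b, mul_assoc]

theorem mem_lattice_iff {F : Type*} [Field F] (R : Subring F)
    (M : Matrix.GeneralLinearGroup (Fin 2) F) (x : Fin 2 → F) :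
    x ∈ lattice R M ↔ ∃ c : Fin 2 → R, x = fun i =>
      ∑ j, (M : Matrix (Fin 2) (Fin 2) F) i j * (c j : F) := by
  rw [lattice, Submodule.mem_span_range_iff_exists_fun]
  refine exists_congr fun c => ?_
  rw [eq_comm]
  refine Eq.congr_right ?_
  ext i
  simp [Finset.sum_apply, Subring.smul_def, mul_comm]

theorem exists_mul_eq_of_lattice_le {F : Type*} [Field F] (R : Subring F)
    {M : Matrix (Fin 2) (Fin 2) F} {M' : Matrix.GeneralLinearGroup (Fin 2) F}
    (h : ∀ j, (fun i => M i j) ∈ lattice R M') :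
    ∃ s : Matrix (Fin 2) (Fin 2) R, M = (M' : Matrix (Fin 2) (Fin 2) F) * s.map R.subtype := by
  choose c hc using fun j => (mem_lattice_iff R M' _).mp (h j)
  refine ⟨Matrix.of fun i j => c j i, ?_⟩
  ext i j
  rw [Matrix.mul_apply]
  exact congrFun (hc j) i

theorem IsElementarySublattice.smul_mem {F : Type*} [Field F] {R : Subring F} {ϖ : R}
    {L L' : Submodule R (Fin 2 → F)} (h : IsElementarySublattice R ϖ L L') {x : Fin 2 → F}
    (hx : x ∈ L') : ϖ • x ∈ L := by
  obtain ⟨-, ⟨e⟩⟩ := h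
  have h1 : ϖ • (Submodule.Quotient.mk ⟨x, hx⟩ : L' ⧸ L.submoduleOf L') = 0 := by
    apply e.injective
    rw [map_smul, map_zero]
    obtain ⟨y, hy⟩ := Ideal.Quotient.mk_surjective (e (Submodule.Quotient.mk ⟨x, hx⟩))
    rw [← hy, Algebra.smul_def]
    change Ideal.Quotient.mk _ ϖ * _ = 0
    rw [← map_mul, Ideal.Quotient.eq_zero_iff_mem]
    exact Ideal.mem_span_singleton.mpr (dvd_mul_right _ _)
  rw [← Submodule.Quotient.mk_smul, Submodule.Quotient.mk_eq_zero] at h1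
  exact h1

/-- The inclusions ϖL' ⊆ L ⊆ L' become integral matrices with product ϖ. Nothing else is extracted
from adjacency, in the Hecke graph or in the Bruhat–Tits tree. -/
theorem IsElementarySublattice.exists_matrix {F : Type*} [Field F] {R : Subring F} {ϖ : R}
    {M M' : Matrix.GeneralLinearGroup (Fin 2) F}
    (h : IsElementarySublattice R ϖ (lattice R M) (lattice R M')) :
    ∃ s s' : Matrix (Fin 2) (Fin 2) R, (M : Matrix (Fin 2) (Fin 2) F) = M' * s.map R.subtype ∧
      (ϖ : F) • (M' : Matrix (Fin 2) (Fin 2) F) = M * s'.map R.subtype ∧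
      s * s' = ϖ • 1 ∧ s' * s = ϖ • 1 := by
  have hcol : ∀ (A : Matrix.GeneralLinearGroup (Fin 2) F) j,
      (fun i => (A : Matrix (Fin 2) (Fin 2) F) i j) ∈ lattice R A :=
    fun A j => Submodule.subset_span ⟨j, rfl⟩
  obtain ⟨s, hs⟩ := exists_mul_eq_of_lattice_le R (M := (M : Matrix (Fin 2) (Fin 2) F))
    fun j => h.1 (hcol M j)
  obtain ⟨s', hs'⟩ := exists_mul_eq_of_lattice_le R
    (M := (ϖ : F) • (M' : Matrix (Fin 2) (Fin 2) F)) fun j => h.smul_mem (hcol M' j)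
  have hinj : Function.Injective (fun A : Matrix (Fin 2) (Fin 2) R => A.map R.subtype) :=
    Matrix.map_injective Subtype.val_injective
  have h1 : (M' : Matrix (Fin 2) (Fin 2) F) * (s * s').map R.subtype = M' * ((ϖ : F) • 1) := by
    rw [Matrix.map_mul, ← mul_assoc, ← hs, ← hs', mul_smul_comm, mul_one]
  have h2 : (M : Matrix (Fin 2) (Fin 2) F) * (s' * s).map R.subtype = M * ((ϖ : F) • 1) := by
    rw [Matrix.map_mul, ← mul_assoc, ← hs', smul_mul_assoc, ← hs, mul_smul_comm, mul_one]
  have h3 : ((ϖ • 1 : Matrix (Fin 2) (Fin 2) R)).map R.subtype = (ϖ : F) • 1 := by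
    ext i j
    rw [Matrix.map_apply, Matrix.smul_apply, Matrix.smul_apply, Matrix.one_apply, Matrix.one_apply]
    split_ifs <;> simp
  refine ⟨s, s', hs, hs', hinj ?_, hinj ?_⟩
  · exact (M'.isUnit.mul_left_cancel h1).trans h3.symm
  · exact (M.isUnit.mul_left_cancel h2).trans h3.symm

theorem exists_affineRing_lift (s : Matrix (Fin 2) (Fin 2) (inf.affineRing.map inf.emb)) :
    ∃ r : Matrix (Fin 2) (Fin 2) inf.affineRing,
      r.map inf.affineHom = s.map (inf.affineRing.map inf.emb).subtype := by
  choose r hr hrs using fun i j => Subring.mem_map.mp (s i j).2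
  exact ⟨Matrix.of fun i j => ⟨r i j, hr i j⟩, by ext i j; exact hrs i j⟩

theorem isPeriodic_of_adj (hK : IsGlobalFunctionField Fq K) {ν : Place Fq K} (hν : ν ≠ inf)
    {π : K} (hπR : π ∈ inf.affineRing)
    (hπν : ν.ord π = 1) (hπS : ∀ y ∈ inf.sRing π, ν.val y ≤ 1 → y ∈ inf.affineRing)
    {x x' : XInf inf} (h : (heckeGraph inf π).Adj x x') (hx : IsPeriodic x) : IsPeriodic x' := by
  have hπ0 : inf.emb π ≠ 0 := by
    rw [map_ne_zero]
    rintro rfl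
    simp [Place.ord] at hπν
  have hinj : Function.Injective (fun A : Matrix (Fin 2) (Fin 2) inf.affineRing =>
      A.map inf.affineHom) :=
    Matrix.map_injective (inf.emb.injective.comp Subtype.val_injective)
  have key : ∀ {M M' : Matrix.GeneralLinearGroup (Fin 2) inf.Compl}
      {ϖ : inf.affineRing.map inf.emb}, (ϖ : inf.Compl) = inf.emb π →
      IsElementarySublattice (inf.affineRing.map inf.emb) ϖ
        (lattice (inf.affineRing.map inf.emb) M) (lattice (inf.affineRing.map inf.emb) M') →
      (IsPeriodic (XInf.ofMat inf M⁻¹) ↔ IsPeriodic (XInf.ofMat inf M'⁻¹)) := by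
    intro M M' ϖ hϖ h
    obtain ⟨s, s', h1, h2, h3, h4⟩ := h.exists_matrix
    obtain ⟨r, hr⟩ := exists_affineRing_lift s
    obtain ⟨r', hr'⟩ := exists_affineRing_lift s'
    have e1 : ((ϖ • 1 : Matrix (Fin 2) (Fin 2) (inf.affineRing.map inf.emb))).map
        (inf.affineRing.map inf.emb).subtype =
        ((⟨π, hπR⟩ : inf.affineRing) • 1 : Matrix (Fin 2) (Fin 2) inf.affineRing).map
          inf.affineHom := by
      ext i j
      rw [Matrix.map_apply, Matrix.map_apply, Matrix.smul_apply, Matrix.smul_apply,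
        Matrix.one_apply, Matrix.one_apply]
      split_ifs <;> simp [hϖ, Place.affineHom]
    have e2 : r * r' = (⟨π, hπR⟩ : inf.affineRing) • 1 := by
      apply hinj
      change (r * r').map inf.affineHom = _
      rw [Matrix.map_mul, hr, hr', ← Matrix.map_mul, h3, e1]
    have e3 : r' * r = (⟨π, hπR⟩ : inf.affineRing) • 1 := by
      apply hinj
      change (r' * r).map inf.affineHom = _
      rw [Matrix.map_mul, hr, hr', ← Matrix.map_mul, h4, e1]
    -- M'⁻¹ = s M⁻¹ in one direction and M⁻¹ = π⁻¹ s' M'⁻¹ in the other; both are needed since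
    -- adjacency is the symmetrized relation.
    constructor
    · refine isPeriodic_of_mul hK hν hπR hπν hπS e2 e3 (b := 1) ?_
      rw [one_smul, hr]
      refine M'.isUnit.mul_left_cancel (M.isUnit.mul_right_cancel ?_)
      rw [← mul_assoc, ← h1, Units.mul_inv, one_mul, Units.mul_inv, one_mul]
    · refine isPeriodic_of_mul hK hν hπR hπν hπS e3 e2 (b := (inf.emb π)⁻¹) ?_
      rw [hr']
      refine M.isUnit.mul_left_cancel (M'.isUnit.mul_right_cancel ?_)
      rw [mul_smul_comm, ← mul_assoc, ← h2, Units.mul_inv, one_mul, hϖ, smul_mul_assoc, smul_mul_assoc,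
        Units.mul_inv, smul_mul_assoc, smul_smul, inv_mul_cancel₀ hπ0, one_smul, one_mul]
  rw [heckeGraph, SimpleGraph.fromRel_adj] at h
  rcases h.2 with ⟨M, M', rfl, rfl, ϖ, hϖ, h⟩ | ⟨M, M', rfl, rfl, ϖ, hϖ, h⟩
  · exact (key hϖ h).mp hx
  · exact (key hϖ h).mpr hx

theorem isPeriodic_of_reachable (hK : IsGlobalFunctionField Fq K) {ν : Place Fq K} (hν : ν ≠ inf)
    {π : K} (hπR : π ∈ inf.affineRing)
    (hπν : ν.ord π = 1) (hπS : ∀ y ∈ inf.sRing π, ν.val y ≤ 1 → y ∈ inf.affineRing)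
    {x x' : XInf inf} (h : (heckeGraph inf π).Reachable x x') (hx : IsPeriodic x) :
    IsPeriodic x' := by
  obtain ⟨w⟩ := h
  induction w with
  | nil => exact hx
  | cons hadj _ ih => exact ih (isPeriodic_of_adj hK hν hπR hπν hπS hadj hx)

end

/-! ### Trace, determinant and eigenvectors of a period matrix -/

section

variable {Fq K : Type*} [Field Fq] [Field K] [Algebra Fq K]

theorem Place.v_affineHom (inf : Place Fq K) (x : inf.affineRing) :
    Valued.v (inf.affineHom x) = inf.val (x : K) := inf.v_emb x

theorem exists_v_eq_exp {F : Type*} [Field F] (v : Valuation F ℤᵐ⁰) {x : F} (hx : x ≠ 0) :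
    ∃ n : ℤ, v x = WithZero.exp n :=
  ⟨(v x).log, (WithZero.exp_log ((Valuation.ne_zero_iff v).mpr hx)).symm⟩

variable {inf : Place Fq K}

theorem v_det_affineRing (hK : IsGlobalFunctionField Fq K)
    (D : Matrix.GeneralLinearGroup (Fin 2) inf.affineRing) :
    inf.val ((D : Matrix (Fin 2) (Fin 2) inf.affineRing).det : K) = 1 :=
  v_unit_affineRing hK inf (Matrix.GeneralLinearGroup.det D)

theorem HasPeriod.trace_eq {D : Matrix (Fin 2) (Fin 2) inf.affineRing}
    {G : Matrix.GeneralLinearGroup (Fin 2) inf.Compl} {c t : inf.Compl}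
    (h : HasPeriod D (G : Matrix (Fin 2) (Fin 2) inf.Compl) c t) :
    inf.affineHom D.trace = c * (1 + t) := by
  have h1 : D.map inf.affineHom = c • ((G : Matrix (Fin 2) (Fin 2) inf.Compl) * diagOne t *
      ((G⁻¹ : Matrix.GeneralLinearGroup (Fin 2) inf.Compl) :
        Matrix (Fin 2) (Fin 2) inf.Compl)) := by
    rw [← smul_mul_assoc, ← h, mul_assoc, Units.mul_inv, mul_one]
  have h2 := congrArg Matrix.trace h1
  rw [Matrix.trace_smul, Matrix.trace_mul_comm, ← mul_assoc, Units.inv_mul, one_mul] at h2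
  have h3 : (D.map inf.affineHom).trace = inf.affineHom D.trace :=
    (AddMonoidHom.map_trace inf.affineHom D).symm
  rw [← h3, h2]
  simp [diagOne, Matrix.trace_fin_two]

theorem HasPeriod.det_eq {D : Matrix (Fin 2) (Fin 2) inf.affineRing}
    {G : Matrix.GeneralLinearGroup (Fin 2) inf.Compl} {c t : inf.Compl}
    (h : HasPeriod D (G : Matrix (Fin 2) (Fin 2) inf.Compl) c t) :
    inf.affineHom D.det = c ^ 2 * t := by
  have h2 := congrArg Matrix.det h
  rw [Matrix.det_mul, Matrix.det_smul, Matrix.det_mul, det_diagOne, Fintype.card_fin] at h2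
  have h0 : (G : Matrix (Fin 2) (Fin 2) inf.Compl).det ≠ 0 := G.det_ne_zero
  have h3 : (D.map inf.affineHom).det = inf.affineHom D.det := (RingHom.map_det inf.affineHom D).symm
  rw [h3] at h2
  refine mul_right_cancel₀ h0 (h2.trans ?_)
  ring

theorem HasPeriod.discr_eq {D : Matrix (Fin 2) (Fin 2) inf.affineRing}
    {G : Matrix.GeneralLinearGroup (Fin 2) inf.Compl} {c t : inf.Compl}
    (h : HasPeriod D (G : Matrix (Fin 2) (Fin 2) inf.Compl) c t) :
    inf.affineHom (D.trace ^ 2 - 4 * D.det) = (c * (1 - t)) ^ 2 := by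
  rw [map_sub, map_mul, map_pow, h.trace_eq, h.det_eq, map_ofNat]
  ring

/-- If a_k were 0, γ^k would be scalar, with zero discriminant, whereas its eigenvalues c^k and c^k
t^k are distinct. -/
theorem HasPeriod.glCoeffs_ne_zero {γ : Matrix.GeneralLinearGroup (Fin 2) inf.affineRing}
    {G : Matrix.GeneralLinearGroup (Fin 2) inf.Compl} {c t : inf.Complˣ}
    (h : HasPeriod (γ : Matrix (Fin 2) (Fin 2) inf.affineRing)
      (G : Matrix (Fin 2) (Fin 2) inf.Compl) (c : inf.Compl) t)
    (ht : Valued.v (t : inf.Compl) < 1) {k : ℕ} (hk : 0 < k) : (glCoeffs γ k).1 ≠ 0 := by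
  intro h0
  have h1 := (h.pow k).discr_eq
  have h2 : (γ : Matrix (Fin 2) (Fin 2) inf.affineRing) ^ k = (glCoeffs γ k).2 • 1 := by
    have := pow_eq_powCoeffs (A := inf.affineRing) (τ :=
      (γ : Matrix (Fin 2) (Fin 2) inf.affineRing).trace)
      (δ := (γ : Matrix (Fin 2) (Fin 2) inf.affineRing).det)
      (x := (γ : Matrix (Fin 2) (Fin 2) inf.affineRing)) (by
        set D := (γ : Matrix (Fin 2) (Fin 2) inf.affineRing)
        rw [Matrix.trace_fin_two, Matrix.det_fin_two]
        ext i j : 2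
        fin_cases i <;> fin_cases j <;> simp [Matrix.mul_apply, Fin.sum_univ_two] <;> ring) k
    rw [this, show (powCoeffs (γ : Matrix (Fin 2) (Fin 2) inf.affineRing).trace
      (γ : Matrix (Fin 2) (Fin 2) inf.affineRing).det k).1 = 0 from h0, zero_smul, zero_add]
  rw [h2] at h1
  have h3 : (((glCoeffs γ k).2 • 1 : Matrix (Fin 2) (Fin 2) inf.affineRing)).trace ^ 2 -
      4 * (((glCoeffs γ k).2 • 1 : Matrix (Fin 2) (Fin 2) inf.affineRing)).det = 0 := by
    rw [Matrix.trace_fin_two, Matrix.det_fin_two]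
    simp
    ring
  rw [h3, map_zero, eq_comm, sq_eq_zero_iff, mul_eq_zero, or_iff_right
    (pow_ne_zero k c.ne_zero), sub_eq_zero] at h1
  have h4 : Valued.v ((t : inf.Compl) ^ k) < 1 := by
    rw [map_pow]; exact pow_lt_one₀ zero_le ht hk.ne'
  rw [← h1, map_one] at h4
  exact lt_irrefl _ h4

theorem HasPeriod.glDiscr_ne_zero {γ : Matrix.GeneralLinearGroup (Fin 2) inf.affineRing}
    {G : Matrix.GeneralLinearGroup (Fin 2) inf.Compl} {c t : inf.Complˣ}
    (h : HasPeriod (γ : Matrix (Fin 2) (Fin 2) inf.affineRing)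
      (G : Matrix (Fin 2) (Fin 2) inf.Compl) (c : inf.Compl) t)
    (ht : Valued.v (t : inf.Compl) < 1) : glDiscr γ ≠ 0 := by
  intro h0
  have h1 := h.discr_eq
  rw [show (γ : Matrix (Fin 2) (Fin 2) inf.affineRing).trace ^ 2 -
    4 * (γ : Matrix (Fin 2) (Fin 2) inf.affineRing).det = 0 from h0, map_zero, eq_comm,
    sq_eq_zero_iff, mul_eq_zero, or_iff_right c.ne_zero, sub_eq_zero] at h1
  rw [← h1, map_one] at ht
  exact lt_irrefl _ ht

/-- The eigenvalues are c and ct, so |tr γ| = |c| and |c² t| = |det γ| = 1. Hence v_∞(t) = 2 |v_∞(tr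
γ)|, which is how the trace enters the constant. -/
theorem HasPeriod.v_trace (hK : IsGlobalFunctionField Fq K)
    {γ : Matrix.GeneralLinearGroup (Fin 2) inf.affineRing}
    {G : Matrix.GeneralLinearGroup (Fin 2) inf.Compl} {c t : inf.Complˣ}
    (h : HasPeriod (γ : Matrix (Fin 2) (Fin 2) inf.affineRing)
      (G : Matrix (Fin 2) (Fin 2) inf.Compl) (c : inf.Compl) t)
    (ht : Valued.v (t : inf.Compl) < 1) :
    inf.val ((γ : Matrix (Fin 2) (Fin 2) inf.affineRing).trace : K) ^ 2 *
      Valued.v (t : inf.Compl) = 1 := by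
  have h1 : Valued.v (1 + (t : inf.Compl)) = 1 := by
    rw [Valuation.map_add_eq_of_lt_left _ (by rwa [map_one]), map_one]
  have h2 := congrArg Valued.v h.trace_eq
  have h3 := congrArg Valued.v h.det_eq
  rw [inf.v_affineHom, map_mul, h1, mul_one] at h2
  rw [inf.v_affineHom, v_det_affineRing hK, map_mul, map_pow] at h3
  rw [h2, ← h3]

/-- A matrix in `GL₂(R_∞)` with eigenvalues of distinct absolute values has no eigenvector in
`K × K`. -/
theorem HasPeriod.not_eigenvector (hK : IsGlobalFunctionField Fq K)
    {γ : Matrix.GeneralLinearGroup (Fin 2) inf.affineRing}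
    {G : Matrix.GeneralLinearGroup (Fin 2) inf.Compl} {c t : inf.Compl}
    (h : HasPeriod (γ : Matrix (Fin 2) (Fin 2) inf.affineRing)
      (G : Matrix (Fin 2) (Fin 2) inf.Compl) c t)
    (ht : Valued.v t ≠ 1) {w : Fin 2 → inf.affineRing} (hw : w ≠ 0)
    (hdet : w 0 * ((γ : Matrix (Fin 2) (Fin 2) inf.affineRing).mulVec w) 1 =
      w 1 * ((γ : Matrix (Fin 2) (Fin 2) inf.affineRing).mulVec w) 0) : False := by
  set D := (γ : Matrix (Fin 2) (Fin 2) inf.affineRing) with hD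
  set z := D.mulVec w with hz
  have hz0 : z 0 = D 0 0 * w 0 + D 0 1 * w 1 := by
    rw [hz, Matrix.mulVec, dotProduct, Fin.sum_univ_two]
  have hz1 : z 1 = D 1 0 * w 0 + D 1 1 * w 1 := by
    rw [hz, Matrix.mulVec, dotProduct, Fin.sum_univ_two]
  have hdetK : D.det = D 0 0 * D 1 1 - D 0 1 * D 1 0 := Matrix.det_fin_two D
  have htrK : D.trace = D 0 0 + D 1 1 := Matrix.trace_fin_two D
  obtain ⟨μ, hμ⟩ : ∃ μ : K, μ ^ 2 - (D.trace : K) * μ + (D.det : K) = 0 := by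
    have e0 : (z 0 : K) = D 0 0 * w 0 + D 0 1 * w 1 := by exact_mod_cast congrArg Subtype.val hz0
    have e1 : (z 1 : K) = D 1 0 * w 0 + D 1 1 * w 1 := by exact_mod_cast congrArg Subtype.val hz1
    have e2 : (w 0 * z 1 : K) = w 1 * z 0 := by exact_mod_cast congrArg Subtype.val hdet
    have e3 : (D.det : K) = D 0 0 * D 1 1 - D 0 1 * D 1 0 := by
      exact_mod_cast congrArg Subtype.val hdetK
    have e4 : (D.trace : K) = D 0 0 + D 1 1 := by exact_mod_cast congrArg Subtype.val htrK
    rw [e0, e1] at e2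
    by_cases hw0 : (w 0 : K) = 0
    · have hw1 : (w 1 : K) ≠ 0 := by
        intro hw1
        refine hw (funext fun i => Subtype.ext ?_)
        fin_cases i
        · exact hw0
        · exact hw1
      refine ⟨z 1 / w 1, ?_⟩
      rw [e1, e3, e4]
      rw [hw0] at e2 ⊢
      field_simp
      have e5 : (D 0 1 : K) = 0 := by
        have : (D 0 1 : K) * (w 1 * w 1) = 0 := by linear_combination -e2
        rcases mul_eq_zero.mp this with h | h
        · exact h
        · exact absurd h (mul_ne_zero hw1 hw1)
      rw [e5]
      ring
    · refine ⟨z 0 / w 0, ?_⟩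
      rw [e0, e3, e4]
      field_simp
      linear_combination (-(D 0 1 : K)) * e2
  have hδ : inf.val (D.det : K) = 1 := v_det_affineRing hK γ
  have hδ0 : (D.det : K) ≠ 0 := by
    intro h0
    rw [h0, map_zero] at hδ
    exact zero_ne_one hδ
  -- Eigenvalues in K are integral over R_∞, hence in R_∞; their product is a unit, so both have
  -- absolute value 1 and |tr γ| ≤ 1. This contradicts |c² t| = 1 with |t| ≠ 1, where the trace is c
  -- (1 + t).
  have hμR : ∀ μ : K, μ ^ 2 - (D.trace : K) * μ + (D.det : K) = 0 → μ ∈ inf.affineRing := by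
    intro μ hμ
    refine inf.mem_affineRing_of_isIntegralElem inf.affineRing.subtype (fun a => a.2)
      ⟨Polynomial.X ^ 2 - Polynomial.C D.trace * Polynomial.X + Polynomial.C D.det, ?_, ?_⟩
    · monicity!
    · simpa using hμ
  have hμ' : ((D.trace : K) - μ) ^ 2 - (D.trace : K) * ((D.trace : K) - μ) + (D.det : K) = 0 := by
    linear_combination hμ
  have hprod : μ * ((D.trace : K) - μ) = D.det := by linear_combination -hμ
  have hμ0 : μ ≠ 0 := by
    rintro rfl
    rw [zero_mul] at hprod
    exact hδ0 hprod.symm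
  have hμ'0 : (D.trace : K) - μ ≠ 0 := by
    intro h0
    rw [h0, mul_zero] at hprod
    exact hδ0 hprod.symm
  have l1 := inf.one_le_val hK (hμR _ hμ) hμ0
  have l2 := inf.one_le_val hK (hμR _ hμ') hμ'0
  have l3 : inf.val μ * inf.val ((D.trace : K) - μ) = 1 := by rw [← map_mul, hprod, hδ]
  have l4 : inf.val μ = 1 := by
    refine le_antisymm ?_ l1
    calc inf.val μ ≤ inf.val μ * inf.val ((D.trace : K) - μ) := le_mul_of_one_le_right' l2
      _ = 1 := l3
  have l5 : inf.val ((D.trace : K) - μ) = 1 := by rwa [l4, one_mul] at l3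
  have l6 : inf.val (D.trace : K) ≤ 1 := by
    have := Valuation.map_add inf.val ((D.trace : K) - μ) μ
    rwa [sub_add_cancel, l4, l5, max_self] at this
  have h2 := congrArg Valued.v h.trace_eq
  have h3 := congrArg Valued.v h.det_eq
  rw [inf.v_affineHom, map_mul] at h2
  rw [inf.v_affineHom, hδ, map_mul, map_pow] at h3
  rw [h2] at l6
  have hc0 : Valued.v c ≠ 0 := by
    intro h0
    rw [h0] at h3
    simp at h3
  have ht0 : Valued.v t ≠ 0 := by
    intro h0
    rw [h0] at h3
    simp at h3
  rcases lt_or_gt_of_ne ht with ht1 | ht1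
  · rw [Valuation.map_add_eq_of_lt_left _ (by rwa [map_one]), map_one, mul_one] at l6
    have : Valued.v c ^ 2 * Valued.v t < 1 := by
      calc Valued.v c ^ 2 * Valued.v t ≤ 1 * Valued.v t :=
            mul_le_mul_left (pow_le_one₀ zero_le l6) _
        _ < 1 := by rwa [one_mul]
    exact absurd h3.symm this.ne
  · rw [Valuation.map_add_eq_of_lt_right _ (by rwa [map_one])] at l6
    have h4 : (Valued.v c * Valued.v t) ^ 2 = Valued.v t := by
      calc (Valued.v c * Valued.v t) ^ 2 = (Valued.v c ^ 2 * Valued.v t) * Valued.v t := by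
            rw [mul_pow, sq (Valued.v t), mul_assoc]
        _ = _ := by rw [← h3, one_mul]
    have h5 : (Valued.v c * Valued.v t) ^ 2 ≤ 1 := pow_le_one₀ zero_le l6
    rw [h4] at h5
    exact absurd ht1 (not_lt.mpr h5)

end

section

variable {Fq K : Type*} [Field Fq] [Field K] [Algebra Fq K] {inf : Place Fq K}

/-! ### Short vectors -/

/-- The vector `G⁻¹ w` of the lattice `G⁻¹ (R_∞ × R_∞)`. -/
def latVec (G : Matrix.GeneralLinearGroup (Fin 2) inf.Compl) (w : Fin 2 → inf.affineRing) :
    Fin 2 → inf.Compl :=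
  ((G⁻¹ : Matrix.GeneralLinearGroup (Fin 2) inf.Compl) : Matrix (Fin 2) (Fin 2) inf.Compl).mulVec
    (inf.affineHom ∘ w)

theorem mulVec_latVec (G : Matrix.GeneralLinearGroup (Fin 2) inf.Compl)
    (w : Fin 2 → inf.affineRing) :
    (G : Matrix (Fin 2) (Fin 2) inf.Compl).mulVec (latVec G w) = inf.affineHom ∘ w := by
  rw [latVec, Matrix.mulVec_mulVec, Units.mul_inv, Matrix.one_mulVec]

theorem eq_latVec {G : Matrix.GeneralLinearGroup (Fin 2) inf.Compl}
    {w : Fin 2 → inf.affineRing} {y : Fin 2 → inf.Compl}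
    (h : (G : Matrix (Fin 2) (Fin 2) inf.Compl).mulVec y = inf.affineHom ∘ w) :
    latVec G w = y := by
  rw [latVec, ← h, Matrix.mulVec_mulVec, Units.inv_mul, Matrix.one_mulVec]

/-- The vector `G⁻¹ w` is short in comparison with the covolume of `G⁻¹ (R_∞ × R_∞)`. -/
def IsShort (G : Matrix.GeneralLinearGroup (Fin 2) inf.Compl) (w : Fin 2 → inf.affineRing)
    (T : ℤ) : Prop :=
  ∀ i, Valued.v (latVec G w i) ^ 2 * Valued.v (G : Matrix (Fin 2) (Fin 2) inf.Compl).det ≤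
    WithZero.exp (-T)

theorem IsShort.mono {G : Matrix.GeneralLinearGroup (Fin 2) inf.Compl}
    {w : Fin 2 → inf.affineRing} {S T : ℤ} (h : IsShort G w T) (hST : S ≤ T) : IsShort G w S :=
  fun i => (h i).trans (by rw [WithZero.exp_le_exp]; omega)

theorem map_mulVec_comp {A B : Type*} [CommRing A] [CommRing B] (f : A →+* B)
    (D : Matrix (Fin 2) (Fin 2) A) (w : Fin 2 → A) :
    (D.map f).mulVec (f ∘ w) = f ∘ D.mulVec w :=
  (funext fun i => RingHom.map_mulVec f D w i).symm

theorem latVec_mul_left {G G' : Matrix.GeneralLinearGroup (Fin 2) inf.Compl}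
    {D : Matrix (Fin 2) (Fin 2) inf.affineRing} {c : inf.Complˣ}
    (h : (G' : Matrix (Fin 2) (Fin 2) inf.Compl) = (c : inf.Compl) •
      (D.map inf.affineHom * G)) (w : Fin 2 → inf.affineRing) :
    latVec G' (D.mulVec w) = (c : inf.Compl)⁻¹ • latVec G w := by
  refine eq_latVec ?_
  rw [h, Matrix.smul_mulVec, Matrix.mulVec_smul, smul_smul, mul_inv_cancel₀ c.ne_zero, one_smul,
    ← Matrix.mulVec_mulVec, mulVec_latVec, map_mulVec_comp]

theorem v_det_mul_left (hK : IsGlobalFunctionField Fq K)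
    {G G' : Matrix.GeneralLinearGroup (Fin 2) inf.Compl}
    {D : Matrix.GeneralLinearGroup (Fin 2) inf.affineRing} {c : inf.Complˣ}
    (h : (G' : Matrix (Fin 2) (Fin 2) inf.Compl) = (c : inf.Compl) •
      ((D : Matrix (Fin 2) (Fin 2) inf.affineRing).map inf.affineHom * G)) :
    Valued.v (G' : Matrix (Fin 2) (Fin 2) inf.Compl).det = Valued.v (c : inf.Compl) ^ 2 *
      Valued.v (G : Matrix (Fin 2) (Fin 2) inf.Compl).det := by
  have h3 : ((D : Matrix (Fin 2) (Fin 2) inf.affineRing).map inf.affineHom).det =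
    inf.affineHom (D : Matrix (Fin 2) (Fin 2) inf.affineRing).det :=
    (RingHom.map_det inf.affineHom _).symm
  rw [h, Matrix.det_smul, Matrix.det_mul, h3, Fintype.card_fin, map_mul, map_mul, map_pow,
    inf.v_affineHom, v_det_affineRing hK, one_mul]

/-- GL₂(R_∞) only changes the coordinates of the lattice vectors, and squaring the length makes the
comparison with the covolume invariant under homotheties. -/
theorem IsShort.mul_left (hK : IsGlobalFunctionField Fq K)
    {G G' : Matrix.GeneralLinearGroup (Fin 2) inf.Compl}
    {D : Matrix.GeneralLinearGroup (Fin 2) inf.affineRing} {c : inf.Complˣ}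
    (h : (G' : Matrix (Fin 2) (Fin 2) inf.Compl) = (c : inf.Compl) •
      ((D : Matrix (Fin 2) (Fin 2) inf.affineRing).map inf.affineHom * G))
    {w : Fin 2 → inf.affineRing} {T : ℤ} (hw : IsShort G w T) :
    IsShort G' ((D : Matrix (Fin 2) (Fin 2) inf.affineRing).mulVec w) T := by
  intro i
  have hc : Valued.v (c : inf.Compl) ≠ 0 := (Valuation.ne_zero_iff _).mpr c.ne_zero
  rw [latVec_mul_left h, v_det_mul_left hK h, Pi.smul_apply, smul_eq_mul, map_mul, map_inv₀,
    mul_pow, inv_pow, mul_mul_mul_comm, inv_mul_cancel₀ (pow_ne_zero 2 hc), one_mul]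
  exact hw i

/-- The determinant of w and w' is in R_∞, so it is 0 or of absolute value at least 1; the shortness
of the two vectors makes it smaller than 1. -/
theorem IsShort.det_eq_zero (hK : IsGlobalFunctionField Fq K)
    {G : Matrix.GeneralLinearGroup (Fin 2) inf.Compl} {w w' : Fin 2 → inf.affineRing}
    (h : IsShort G w 1) (h' : IsShort G w' 1) : w 0 * w' 1 = w 1 * w' 0 := by
  set A := (G : Matrix (Fin 2) (Fin 2) inf.Compl) with hA
  set y := latVec G w
  set y' := latVec G w'
  have hy : ∀ i, inf.affineHom (w i) = A i 0 * y 0 + A i 1 * y 1 := fun i => by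
    have := congrFun (mulVec_latVec G w) i
    rw [Matrix.mulVec, dotProduct, Fin.sum_univ_two] at this
    exact this.symm
  have hy' : ∀ i, inf.affineHom (w' i) = A i 0 * y' 0 + A i 1 * y' 1 := fun i => by
    have := congrFun (mulVec_latVec G w') i
    rw [Matrix.mulVec, dotProduct, Fin.sum_univ_two] at this
    exact this.symm
  have h1 : inf.affineHom (w 0 * w' 1 - w 1 * w' 0) = (y 0 * y' 1 - y 1 * y' 0) * A.det := by
    rw [map_sub, map_mul, map_mul, hy, hy, hy', hy', Matrix.det_fin_two]
    ring
  have h2 : ∀ i j, (Valued.v (y i * y' j) * Valued.v A.det) ^ 2 < 1 := by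
    intro i j
    calc (Valued.v (y i * y' j) * Valued.v A.det) ^ 2
        = (Valued.v (y i) ^ 2 * Valued.v A.det) * (Valued.v (y' j) ^ 2 * Valued.v A.det) := by
          rw [map_mul, mul_pow, mul_pow, sq (Valued.v A.det), mul_mul_mul_comm]
      _ ≤ WithZero.exp (-1) * WithZero.exp (-1) := mul_le_mul' (h i) (h' j)
      _ < 1 := by
          rw [← WithZero.exp_add, ← WithZero.exp_zero, WithZero.exp_lt_exp]; norm_num
  have h3 : ∀ i j, Valued.v (y i * y' j) * Valued.v A.det < 1 := by
    intro i j
    by_contra hle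
    exact absurd (h2 i j) (not_lt.mpr (one_le_pow₀ (not_lt.mp hle)))
  have h4 : inf.val ((w 0 * w' 1 - w 1 * w' 0 : inf.affineRing) : K) < 1 := by
    rw [← inf.v_affineHom, h1, map_mul]
    rcases le_max_iff.mp (Valuation.map_sub Valued.v (y 0 * y' 1) (y 1 * y' 0)) with h | h
    · exact (mul_le_mul_left h _).trans_lt (h3 _ _)
    · exact (mul_le_mul_left h _).trans_lt (h3 _ _)
  by_contra hne
  refine absurd h4 (not_lt.mpr (inf.one_le_val hK (Subtype.property _) ?_))
  intro h0
  exact hne (sub_eq_zero.mp (Subtype.ext h0))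

/-- If two times give the same point, the matrix D of GL₂(R_∞) relating them sends w to another
short vector of the same lattice, so Dw is proportional to w; `HasPeriod.not_eigenvector` forbids
this unless |s| = |t|. So w stays short for at most one period. -/
theorem v_eq_of_ofMat_eq (hK : IsGlobalFunctionField Fq K)
    {H : Matrix.GeneralLinearGroup (Fin 2) inf.Compl} {s t : inf.Complˣ}
    {w : Fin 2 → inf.affineRing} (hw : w ≠ 0) (hs : IsShort (H * glDiag s) w 1)
    (ht : IsShort (H * glDiag t) w 1)
    (h : XInf.ofMat inf (H * glDiag s) = XInf.ofMat inf (H * glDiag t)) :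
    Valued.v (s : inf.Compl) = Valued.v (t : inf.Compl) := by
  obtain ⟨D, c, hD⟩ := XInf.ofMat_eq_ofMat.mp h
  have h1 := (ht.det_eq_zero hK (hs.mul_left hK hD))
  have hs0 : diagOne (s : inf.Compl) * diagOne ((s⁻¹ : inf.Complˣ) : inf.Compl) = 1 := by
    rw [diagOne_mul, Units.mul_inv]
    exact Matrix.one_fin_two.symm
  have h2 : HasPeriod (D : Matrix (Fin 2) (Fin 2) inf.affineRing)
      (H : Matrix (Fin 2) (Fin 2) inf.Compl) ((c⁻¹ : inf.Complˣ) : inf.Compl)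
      ((t : inf.Compl) * ((s⁻¹ : inf.Complˣ) : inf.Compl)) := by
    rw [Units.val_mul, Units.val_mul, coe_glDiag, coe_glDiag] at hD
    rw [HasPeriod, ← diagOne_mul, ← mul_assoc, hD, smul_mul_assoc, smul_smul, Units.inv_mul,
      one_smul, mul_assoc, mul_assoc, hs0, mul_one]
  by_contra hne
  refine h2.not_eigenvector hK ?_ hw h1
  rw [map_mul, Units.val_inv_eq_inv_val, map_inv₀]
  intro h3
  rw [mul_inv_eq_one₀ ((Valuation.ne_zero_iff _).mpr s.ne_zero)] at h3
  exact hne h3.symm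

/-- The points of `X_∞` with a short vector in `W`. -/
def cuspSet (inf : Place Fq K) (W : Set (Fin 2 → inf.affineRing)) (T : ℤ) : Set (XInf inf) :=
  {x | ∃ G, XInf.ofMat inf G = x ∧ ∃ w ∈ W, IsShort G w T}

/-- For the diagonal flow, the vector `w` is short during an interval of times. -/
theorem exists_isShort_mul_glDiag (G₀ : Matrix.GeneralLinearGroup (Fin 2) inf.Compl)
    {y : Fin 2 → inf.Compl} : ∃ C : ℤ, ∀ (S G : Matrix.GeneralLinearGroup (Fin 2) inf.Compl)
      (w : Fin 2 → inf.affineRing) (h T : ℤ), (G : Matrix (Fin 2) (Fin 2) inf.Compl) =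
      ((S⁻¹ : Matrix.GeneralLinearGroup (Fin 2) inf.Compl) : Matrix (Fin 2) (Fin 2) inf.Compl) *
        G₀ → Valued.v (S : Matrix (Fin 2) (Fin 2) inf.Compl).det = WithZero.exp h →
      (G₀ : Matrix (Fin 2) (Fin 2) inf.Compl).mulVec y =
        (S : Matrix (Fin 2) (Fin 2) inf.Compl).mulVec (inf.affineHom ∘ w) →
      ∀ (t : inf.Complˣ) (n : ℤ), Valued.v (t : inf.Compl) = WithZero.exp n →
        |n| ≤ h - C - T → IsShort (G * glDiag t) w T := by
  obtain ⟨d, hd⟩ := exists_v_eq_exp Valued.v G₀.det_ne_zero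
  have hb : ∃ B : ℤ, ∀ i, Valued.v (y i) ^ 2 ≤ WithZero.exp B := by
    have key : ∀ z : inf.Compl, ∃ B : ℤ, Valued.v z ^ 2 ≤ WithZero.exp B := by
      intro z
      by_cases hz : z = 0
      · exact ⟨0, by simp [hz]⟩
      · obtain ⟨m, hm⟩ := exists_v_eq_exp Valued.v hz
        exact ⟨2 • m, by rw [hm, ← WithZero.exp_nsmul]⟩
    obtain ⟨a, ha⟩ := key (y 0)
    obtain ⟨b, hb⟩ := key (y 1)
    refine ⟨max a b, fun i => ?_⟩
    fin_cases i
    · exact ha.trans (by rw [WithZero.exp_le_exp]; exact le_max_left _ _)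
    · exact hb.trans (by rw [WithZero.exp_le_exp]; exact le_max_right _ _)
  obtain ⟨B, hB⟩ := hb
  refine ⟨B + d, fun S G w h T hG hS hy t n ht hn => ?_⟩
  have hdet : Valued.v (G * glDiag t : Matrix.GeneralLinearGroup (Fin 2) inf.Compl).1.det =
      WithZero.exp (-h + d + n) := by
    have h1 := congrArg (fun A => Valued.v (Matrix.det A)) (S.mul_inv)
    simp only [Matrix.det_mul, map_mul, Matrix.det_one, map_one] at h1
    have h2 : Valued.v ((S⁻¹ : Matrix.GeneralLinearGroup (Fin 2) inf.Compl) :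
        Matrix (Fin 2) (Fin 2) inf.Compl).det = WithZero.exp (-h) := by
      rw [WithZero.exp_neg, ← hS]
      exact eq_inv_of_mul_eq_one_right h1
    rw [Units.val_mul, Matrix.det_mul, hG, Matrix.det_mul, coe_glDiag, det_diagOne, map_mul,
      map_mul, h2, hd, ht, WithZero.exp_add, WithZero.exp_add]
  -- The lattice vector is diag(1, t)⁻¹ y, where y does not depend on S: only the determinant of G
  -- depends on it.
  have hl : latVec (G * glDiag t) w = ![y 0, (t : inf.Compl)⁻¹ * y 1] := by
    refine eq_latVec ?_
    have h1 : (diagOne (t : inf.Compl)).mulVec ![y 0, (t : inf.Compl)⁻¹ * y 1] = y := by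
      ext i
      fin_cases i
      · simp [diagOne]
      · simp [diagOne, mul_comm]
    rw [Units.val_mul, coe_glDiag, ← Matrix.mulVec_mulVec, h1, hG, ← Matrix.mulVec_mulVec, hy,
      Matrix.mulVec_mulVec, Units.inv_mul, Matrix.one_mulVec]
  -- With |t| = exp n, the first coordinate is constant while the determinant grows like exp n; the
  -- squared second coordinate brings exp(−2n). The two conditions bound n and −n by the same
  -- number.
  have hn1 := (abs_le.mp hn)
  intro i
  rw [hdet, hl]
  fin_cases i
  · refine (mul_le_mul_left (hB 0) _).trans ?_
    rw [← WithZero.exp_add, WithZero.exp_le_exp]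
    omega
  · change Valued.v ((t : inf.Compl)⁻¹ * y 1) ^ 2 * _ ≤ _
    rw [map_mul, map_inv₀, ht, mul_pow, ← WithZero.exp_neg, ← WithZero.exp_nsmul]
    refine (mul_le_mul_left (mul_le_mul_right (hB 1) _) _).trans ?_
    rw [← WithZero.exp_add, ← WithZero.exp_add, WithZero.exp_le_exp, nsmul_eq_mul]
    push_cast
    omega

end

section

variable {Fq K : Type*} [Field Fq] [Field K] [Algebra Fq K]

theorem v_mul_apply_le {F : Type*} [Field F] (v : Valuation F ℤᵐ⁰) {A B : Matrix (Fin 2) (Fin 2) F}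
    {α β : ℤᵐ⁰} (hA : ∀ i j, v (A i j) ≤ α) (hB : ∀ i j, v (B i j) ≤ β) (i j : Fin 2) :
    v ((A * B) i j) ≤ α * β := by
  rw [Matrix.mul_apply]
  refine Valuation.map_sum_le _ fun k _ => ?_
  rw [map_mul]
  exact mul_le_mul' (hA i k) (hB k j)

theorem v_mulVec_apply_le {F : Type*} [Field F] (v : Valuation F ℤᵐ⁰)
    {A : Matrix (Fin 2) (Fin 2) F} {y : Fin 2 → F}
    {α β : ℤᵐ⁰} (hA : ∀ i j, v (A i j) ≤ α) (hy : ∀ j, v (y j) ≤ β) (i : Fin 2) :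
    v (A.mulVec y i) ≤ α * β := by
  rw [Matrix.mulVec, dotProduct]
  refine Valuation.map_sum_le _ fun k _ => ?_
  rw [map_mul]
  exact mul_le_mul' (hA i k) (hy k)

theorem exists_v_entries_le {F : Type*} [Field F] (v : Valuation F ℤᵐ⁰)
    (A : Matrix (Fin 2) (Fin 2) F) : ∃ C : ℤ, 0 ≤ C ∧ ∀ i j, v (A i j) ≤ WithZero.exp C := by
  have key : ∀ x : F, ∃ C : ℤ, 0 ≤ C ∧ v x ≤ WithZero.exp C := by
    intro x
    by_cases hx : x = 0
    · exact ⟨0, le_rfl, by simp [hx]⟩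
    · obtain ⟨n, hn⟩ := exists_v_eq_exp v hx
      exact ⟨max n 0, le_max_right _ _, by rw [hn, WithZero.exp_le_exp]; exact le_max_left _ _⟩
  choose C hC0 hC using fun i j => key (A i j)
  refine ⟨∑ i, ∑ j, C i j, Finset.sum_nonneg fun i _ => Finset.sum_nonneg fun j _ => hC0 i j,
    fun i j => (hC i j).trans ?_⟩
  rw [WithZero.exp_le_exp]
  exact (Finset.single_le_sum (fun j _ => hC0 i j) (Finset.mem_univ j)).trans
    (Finset.single_le_sum (f := fun i => ∑ j, C i j)
      (fun i _ => Finset.sum_nonneg fun j _ => hC0 i j) (Finset.mem_univ i))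

/-! ### The ring `R_∞[π⁻¹]` -/

section

variable {inf ν : Place Fq K} {π : K}

theorem ne_zero_of_ord_eq_one (hπν : ν.ord π = 1) : π ≠ 0 := by
  rintro rfl
  simp [Place.ord] at hπν

theorem val_eq_of_ord_eq_one (hπν : ν.ord π = 1) : ν.val π = WithZero.exp (-1) := by
  rw [Place.ord] at hπν
  rw [← WithZero.exp_log ((Valuation.ne_zero_iff ν.val).mpr (ne_zero_of_ord_eq_one hπν))]
  congr 1
  omega

theorem mem_sRing_of_mem_affineRing {x : K} (hx : x ∈ inf.affineRing) : x ∈ inf.sRing π :=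
  Subring.subset_closure (Or.inl hx)

theorem zpow_mem_sRing (hπR : π ∈ inf.affineRing) (n : ℤ) : π ^ n ∈ inf.sRing π := by
  rcases n with n | n
  · rw [Int.ofNat_eq_natCast, zpow_natCast]
    exact pow_mem (mem_sRing_of_mem_affineRing hπR) n
  · rw [zpow_negSucc, ← inv_pow]
    have h : π⁻¹ ∈ inf.sRing π := Subring.subset_closure (Or.inr rfl)
    exact pow_mem h _

/-- x π^(−n) and its inverse are in R_∞[π⁻¹] and integral at ν, so x π^(−n) is a unit of R_∞ and has
absolute value 1 at ∞. -/
theorem val_unit_sRing (hK : IsGlobalFunctionField Fq K) (hπR : π ∈ inf.affineRing)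
    (hπν : ν.ord π = 1) (hπS : ∀ y ∈ inf.sRing π, ν.val y ≤ 1 → y ∈ inf.affineRing) {x : K}
    (hx : x ∈ inf.sRing π) (hx' : x⁻¹ ∈ inf.sRing π) (hx0 : x ≠ 0) {n : ℤ}
    (hn : ν.val x = WithZero.exp (-n)) : inf.val x = inf.val π ^ n := by
  have hπ0 := ne_zero_of_ord_eq_one hπν
  have hv := val_eq_of_ord_eq_one hπν
  have h1 : ν.val (x * π ^ (-n)) = 1 := by
    rw [map_mul, map_zpow₀, hn, hv, ← WithZero.exp_zsmul, ← WithZero.exp_add, ← WithZero.exp_zero]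
    simp
  have h2 : x * π ^ (-n) ∈ inf.affineRing :=
    hπS _ (mul_mem hx (zpow_mem_sRing hπR _)) h1.le
  have h3 : (x * π ^ (-n))⁻¹ ∈ inf.affineRing := by
    refine hπS _ ?_ (by rw [map_inv₀, h1, inv_one])
    rw [mul_inv, ← zpow_neg, neg_neg]
    exact mul_mem hx' (zpow_mem_sRing hπR _)
  have h0 : x * π ^ (-n) ≠ 0 := mul_ne_zero hx0 (zpow_ne_zero _ hπ0)
  have l1 := inf.one_le_val hK h2 h0
  have l2 := inf.one_le_val hK h3 (inv_ne_zero h0)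
  have l3 : inf.val (x * π ^ (-n)) = 1 := by
    refine le_antisymm ?_ l1
    rw [map_inv₀] at l2
    exact (one_le_inv₀ (zero_lt_iff.mpr ((Valuation.ne_zero_iff _).mpr h0))).mp l2
  rw [map_mul, map_zpow₀, zpow_neg] at l3
  exact (mul_inv_eq_one₀ (zpow_ne_zero _ ((Valuation.ne_zero_iff _).mpr hπ0))).mp l3

/-- A vector which is unimodular over `R_∞[π⁻¹]` and not divisible by `π` is unimodular over
`R_∞`. -/
theorem exists_unimodular (hK : IsGlobalFunctionField Fq K) (hν : ν ≠ inf)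
    (hπR : π ∈ inf.affineRing) (hπν : ν.ord π = 1)
    (hπS : ∀ y ∈ inf.sRing π, ν.val y ≤ 1 → y ∈ inf.affineRing) {u₀ u₁ : inf.affineRing}
    (hu : ν.val (u₀ : K) = 1) (k : ℕ) {a b : inf.affineRing}
    (h : a * u₀ + b * u₁ = (⟨π, hπR⟩ : inf.affineRing) ^ k) :
    ∃ a b : inf.affineRing, a * u₀ + b * u₁ = 1 := by
  induction k generalizing a b with
  | zero => exact ⟨a, b, by simpa using h⟩
  | succ k ih =>
    have hπ0 : (⟨π, hπR⟩ : inf.affineRing) ≠ 0 := fun h0 =>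
      ne_zero_of_ord_eq_one hπν (congrArg Subtype.val h0)
    have hv := val_eq_of_ord_eq_one hπν
    -- The powers of u₀ repeat modulo ν, so u₀^l is an inverse of u₀ modulo ν. Replacing (a, b) by
    -- (a + c u₁, b − c u₀) with c = u₀^l b does not change a u₀ + b u₁ and makes both coefficients
    -- divisible by π, which is then cancelled.
    obtain ⟨m, n, hmn, hpow⟩ := ν.exists_lt_val_sub_lt_one hK
      (fun k (_ : Unit) => (u₀ : K) ^ k) (fun k _ => by rw [map_pow, hu, one_pow])
    obtain ⟨l, rfl⟩ : ∃ l, n = m + l + 1 := ⟨n - m - 1, by omega⟩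
    have h1 : ν.val (1 - (u₀ : K) ^ (l + 1)) < 1 := by
      have h2 := hpow ()
      have h3 : (u₀ : K) ^ (m + l + 1) - (u₀ : K) ^ m = -((u₀ : K) ^ m * (1 - (u₀ : K) ^ (l + 1))) := by
        ring
      rw [h3, Valuation.map_neg, map_mul, map_pow, hu, one_pow, one_mul] at h2
      exact h2
    set c : inf.affineRing := u₀ ^ l * b with hc
    have e1 : ν.val ((b - c * u₀ : inf.affineRing) : K) < 1 := by
      have : ((b - c * u₀ : inf.affineRing) : K) = (b : K) * (1 - (u₀ : K) ^ (l + 1)) := by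
        simp [hc]
        ring
      rw [this, map_mul]
      exact (mul_le_mul_left (val_le_one_of_mem_affineRing hν b) _).trans_lt (by rwa [one_mul])
    have e2 : ν.val ((a + c * u₁ : inf.affineRing) : K) < 1 := by
      have h2 : (u₀ : K) * ((a + c * u₁ : inf.affineRing) : K) =
          π ^ (k + 1) - u₁ * ((b - c * u₀ : inf.affineRing) : K) := by
        have := congrArg Subtype.val h
        simp only [Subring.coe_add, Subring.coe_mul, Subring.coe_pow, AddSubgroupClass.coe_sub] at this ⊢
        rw [← this]
        ring
      have h3 := congrArg ν.val h2
      rw [map_mul, hu, one_mul] at h3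
      rw [h3]
      refine (Valuation.map_sub _ _ _).trans_lt (max_lt ?_ ?_)
      · rw [map_pow, hv, ← WithZero.exp_nsmul, ← WithZero.exp_zero, WithZero.exp_lt_exp]
        simp only [nsmul_eq_mul]
        push_cast
        omega
      · rw [map_mul]
        exact (mul_le_mul_left (val_le_one_of_mem_affineRing hν u₁) _).trans_lt (by rwa [one_mul])
    obtain ⟨b', hb'⟩ := exists_eq_mul_of_val_lt_one hπR hπν hπS e1
    obtain ⟨a', ha'⟩ := exists_eq_mul_of_val_lt_one hπR hπν hπS e2
    refine ih (a := a') (b := b') (mul_left_cancel₀ hπ0 ?_)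
    calc (⟨π, hπR⟩ : inf.affineRing) * (a' * u₀ + b' * u₁)
        = (⟨π, hπR⟩ * a') * u₀ + (⟨π, hπR⟩ * b') * u₁ := by ring
      _ = a * u₀ + b * u₁ := by rw [← ha', ← hb']; ring
      _ = _ := by rw [h, pow_succ']

theorem exists_pow_mul_mem (hπR : π ∈ inf.affineRing)
    (hπν : ν.ord π = 1) (hπS : ∀ y ∈ inf.sRing π, ν.val y ≤ 1 → y ∈ inf.affineRing) {x : K}
    (hx : x ∈ inf.sRing π) : ∃ k, ∀ n, k ≤ n → π ^ n * x ∈ inf.affineRing := by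
  have hv := val_eq_of_ord_eq_one hπν
  by_cases hx0 : x = 0
  · exact ⟨0, fun n _ => by simp [hx0]⟩
  obtain ⟨m, hm⟩ := exists_v_eq_exp ν.val hx0
  refine ⟨m.toNat, fun n hn => hπS _ (mul_mem (by simpa using zpow_mem_sRing hπR n) hx) ?_⟩
  rw [map_mul, map_pow, hv, hm, ← WithZero.exp_nsmul, ← WithZero.exp_add, ← WithZero.exp_zero,
    WithZero.exp_le_exp]
  simp only [nsmul_eq_mul]
  omega

/-- Clearing denominators in the Bézout relation leaves a power of π, removed by
`exists_unimodular`; the unimodular column is then completed to a matrix of determinant 1. -/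
theorem exists_glMulVec_of_sRing (hK : IsGlobalFunctionField Fq K) (hν : ν ≠ inf)
    (hπR : π ∈ inf.affineRing) (hπν : ν.ord π = 1)
    (hπS : ∀ y ∈ inf.sRing π, ν.val y ≤ 1 → y ∈ inf.affineRing) {u : Fin 2 → inf.affineRing}
    (hu : ∃ i, ν.val (u i : K) = 1) {a b : K} (ha : a ∈ inf.sRing π) (hb : b ∈ inf.sRing π)
    (hab : a * u 0 + b * u 1 = 1) : ∃ D : Matrix.GeneralLinearGroup (Fin 2) inf.affineRing,
      (D : Matrix (Fin 2) (Fin 2) inf.affineRing).mulVec ![1, 0] = u := by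
  obtain ⟨k, hk⟩ := exists_pow_mul_mem hπR hπν hπS ha
  obtain ⟨l, hl⟩ := exists_pow_mul_mem hπR hπν hπS hb
  have h1 : (⟨_, hk (max k l) (le_max_left _ _)⟩ : inf.affineRing) * u 0 +
      ⟨_, hl (max k l) (le_max_right _ _)⟩ * u 1 = (⟨π, hπR⟩ : inf.affineRing) ^ (max k l) := by
    refine Subtype.ext ?_
    simp only [Subring.coe_add, Subring.coe_mul, Subring.coe_pow]
    linear_combination π ^ (max k l) * hab
  obtain ⟨a', b', h2⟩ : ∃ a b : inf.affineRing, a * u 0 + b * u 1 = 1 := by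
    obtain ⟨i, hi⟩ := hu
    fin_cases i
    · exact exists_unimodular hK hν hπR hπν hπS hi _ h1
    · rw [add_comm] at h1
      obtain ⟨a', b', h⟩ := exists_unimodular hK hν hπR hπν hπS hi _ h1
      exact ⟨b', a', by rw [add_comm]; exact h⟩
  have hd : (!![u 0, -b'; u 1, a'] : Matrix (Fin 2) (Fin 2) inf.affineRing).det = 1 := by
    rw [Matrix.det_fin_two_of]
    linear_combination h2
  refine ⟨(Matrix.isUnit_iff_isUnit_det _ |>.mpr (by rw [hd]; exact isUnit_one)).unit, ?_⟩
  rw [IsUnit.unit_spec]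
  ext i
  fin_cases i <;> simp

end

end

section

variable {Fq K : Type*} [Field Fq] [Field K] [Algebra Fq K] {inf ν : Place Fq K} {π : K}

/-! ### The matrices attached to a Hecke ray -/

/-- The invertible matrix `S` over `R_∞[π⁻¹]` represents the `N`-th vertex of the ray with point at
infinity `C ∞` of the Bruhat–Tits tree at `ν`. -/
structure IsRayMatrix (inf ν : Place Fq K) (π : K) (C : Matrix.GeneralLinearGroup (Fin 2) K)
    (N : ℕ) (S : Matrix.GeneralLinearGroup (Fin 2) K) : Prop where
  mem : ∀ i j, (S : Matrix (Fin 2) (Fin 2) K) i j ∈ inf.sRing π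
  inv_mem : ∀ i j, ((S⁻¹ : Matrix.GeneralLinearGroup (Fin 2) K) :
    Matrix (Fin 2) (Fin 2) K) i j ∈ inf.sRing π
  val_le : ∀ i j, ν.val (((S⁻¹ * C * glDiag (Units.mk0 ν.unif (unif_ne_zero ν)) ^ N :
    Matrix.GeneralLinearGroup (Fin 2) K) : Matrix (Fin 2) (Fin 2) K) i j) ≤ 1
  val_inv_le : ∀ i j, ν.val ((((S⁻¹ * C * glDiag (Units.mk0 ν.unif (unif_ne_zero ν)) ^ N)⁻¹ :
    Matrix.GeneralLinearGroup (Fin 2) K) : Matrix (Fin 2) (Fin 2) K) i j) ≤ 1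

/-- The embedding of `GL₂(K)` in `GL₂(K_ω)`. -/
abbrev Place.glEmb (ω : Place Fq K) :
    Matrix.GeneralLinearGroup (Fin 2) K →* Matrix.GeneralLinearGroup (Fin 2) ω.Compl :=
  Matrix.GeneralLinearGroup.map ω.emb

/-- Equality of vertices puts S₀⁻¹ C diag(1, ϖ^N) in GL₂(O_ν) only up to a scalar. Since π is a
uniformizer at ν and a unit of R_∞[π⁻¹], a power of π absorbs the valuation of this scalar without
leaving the ring or changing the class. -/
theorem exists_isRayMatrix (hπR : π ∈ inf.affineRing) (hπν : ν.ord π = 1)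
    {G₀ : Matrix.GeneralLinearGroup (Fin 2) inf.Compl} {C : Matrix.GeneralLinearGroup (Fin 2) K}
    {N : ℕ} {x : XInf inf}
    (h : IsHec inf ν π (.mk G₀) (btv ν (ν.toG (.mk C * aElt ν ^ N))) x) :
    ∃ S, IsRayMatrix inf ν π C N S ∧ x = XInf.ofMat inf ((inf.glEmb S)⁻¹ * G₀) := by
  obtain ⟨s, hs, hy, rfl⟩ := h
  obtain ⟨s, rfl⟩ := hs
  obtain ⟨s, rfl⟩ := Matrix.ProjGenLinGroup.mk_surjective s
  set S₀ : Matrix.GeneralLinearGroup (Fin 2) K :=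
    Matrix.GeneralLinearGroup.map (inf.sRing π).subtype s with hS₀
  have hS₀inv : S₀⁻¹ = Matrix.GeneralLinearGroup.map (inf.sRing π).subtype s⁻¹ :=
    (map_inv _ _).symm
  set B := glDiag (Units.mk0 ν.unif (unif_ne_zero ν)) ^ N with hB
  have hmk : (Matrix.ProjGenLinGroup.map (inf.sRing π).subtype (.mk s) : PGL2 K) = .mk S₀ := rfl
  have haB : (.mk C * aElt ν ^ N : PGL2 K) = .mk (C * B) := by
    rw [map_mul, hB, map_pow]
    rfl
  rw [hmk] at hy ⊢
  rw [haB] at hy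
  have hy' := QuotientGroup.eq.mp hy.symm
  obtain ⟨κ, hκ⟩ := hy'
  obtain ⟨κ, rfl⟩ := Matrix.ProjGenLinGroup.mk_surjective κ
  rw [← map_inv, ← map_mul, ← map_inv, ← map_mul, Matrix.ProjGenLinGroup.map_mk, Place.toG_mk,
    pgl_mk_eq_mk_iff] at hκ
  obtain ⟨u, hu⟩ := hκ
  obtain ⟨j, hj⟩ := exists_v_eq_exp Valued.v u.ne_zero
  have hπ0 := ne_zero_of_ord_eq_one hπν
  have hv := val_eq_of_ord_eq_one hπν
  set r : Kˣ := Units.mk0 π hπ0 with hr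
  set S : Matrix.GeneralLinearGroup (Fin 2) K :=
    Matrix.GeneralLinearGroup.scalar (Fin 2) (r ^ (-j)) * S₀ with hS
  have hSc : (S : Matrix (Fin 2) (Fin 2) K) = π ^ (-j) • (S₀ : Matrix (Fin 2) (Fin 2) K) := by
    rw [hS, Units.val_mul, Matrix.GeneralLinearGroup.coe_scalar, Matrix.scalar_apply,
      ← Matrix.smul_one_eq_diagonal, smul_mul_assoc, one_mul, Units.val_zpow_eq_zpow_val]
    rfl
  have hSi : ((S⁻¹ : Matrix.GeneralLinearGroup (Fin 2) K) : Matrix (Fin 2) (Fin 2) K) =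
      π ^ j • ((S₀⁻¹ : Matrix.GeneralLinearGroup (Fin 2) K) : Matrix (Fin 2) (Fin 2) K) := by
    have : S⁻¹ = Matrix.GeneralLinearGroup.scalar (Fin 2) (r ^ j) * S₀⁻¹ := by
      rw [hS, mul_inv_rev, ← map_inv (Matrix.GeneralLinearGroup.scalar (Fin 2)), ← zpow_neg, neg_neg]
      refine Units.ext ?_
      simp only [Units.val_mul, Matrix.GeneralLinearGroup.coe_scalar]
      exact (Matrix.scalar_commute _ (fun r' => Commute.all _ _) _).symm.eq
    rw [this, Units.val_mul, Matrix.GeneralLinearGroup.coe_scalar, Matrix.scalar_apply,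
      ← Matrix.smul_one_eq_diagonal, smul_mul_assoc, one_mul, Units.val_zpow_eq_zpow_val]
    rfl
  have hκ1 : ∀ (κ : Matrix.GeneralLinearGroup (Fin 2) ν.integers) i j, Valued.v
      ((Matrix.GeneralLinearGroup.map ν.integers.subtype κ :
        Matrix.GeneralLinearGroup (Fin 2) ν.Compl).1 i j) ≤ 1 := by
    intro κ i j
    rw [Matrix.GeneralLinearGroup.map_apply]
    exact (κ.1 i j).2
  have hent : ∀ i k, ν.val ((S₀⁻¹ * (C * B) : Matrix.GeneralLinearGroup (Fin 2) K).1 i k) ≤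
      WithZero.exp j := by
    intro i k
    rw [← ν.v_emb, ← Matrix.GeneralLinearGroup.map_apply, hu, Matrix.smul_apply, smul_eq_mul,
      map_mul, hj]
    exact mul_le_of_le_one_right' (hκ1 κ i k)
  have hent' : ∀ i k, ν.val (((S₀⁻¹ * (C * B))⁻¹ : Matrix.GeneralLinearGroup (Fin 2) K).1 i k) ≤
      WithZero.exp (-j) := by
    intro i k
    have h1 : (Matrix.GeneralLinearGroup.map ν.emb (S₀⁻¹ * (C * B))⁻¹).1 =
        (u : ν.Compl)⁻¹ • (Matrix.GeneralLinearGroup.map ν.integers.subtype κ⁻¹).1 := by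
      rw [map_inv, map_inv]
      refine (Units.inv_eq_of_mul_eq_one_right ?_)
      rw [hu, smul_mul_assoc, mul_smul_comm, smul_smul, mul_inv_cancel₀ u.ne_zero, one_smul,
        Units.mul_inv]
    rw [← ν.v_emb, ← Matrix.GeneralLinearGroup.map_apply, h1, Matrix.smul_apply, smul_eq_mul,
      map_mul, map_inv₀, hj, WithZero.exp_neg]
    exact mul_le_of_le_one_right' (hκ1 κ⁻¹ i k)
  refine ⟨S, ⟨?_, ?_, ?_, ?_⟩, ?_⟩
  · intro i k
    rw [hSc, Matrix.smul_apply, smul_eq_mul]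
    exact mul_mem (zpow_mem_sRing hπR _) (Subtype.property _)
  · intro i k
    rw [hSi, Matrix.smul_apply, smul_eq_mul, hS₀inv]
    exact mul_mem (zpow_mem_sRing hπR _) (Subtype.property _)
  · intro i k
    have h1 : (S⁻¹ * C * B).1 = π ^ j • (S₀⁻¹ * (C * B)).1 := by
      rw [mul_assoc, Units.val_mul, hSi, smul_mul_assoc, ← Units.val_mul]
    rw [h1, Matrix.smul_apply, smul_eq_mul, map_mul, map_zpow₀, hv, ← WithZero.exp_zsmul]
    refine (mul_le_mul_right (hent i k) _).trans ?_
    rw [← WithZero.exp_add, ← WithZero.exp_zero, WithZero.exp_le_exp]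
    simp
  · intro i k
    have h1 : ((S⁻¹ * C * B)⁻¹).1 = π ^ (-j) • ((S₀⁻¹ * (C * B))⁻¹).1 := by
      rw [mul_assoc, mul_inv_rev, inv_inv, Units.val_mul, hSc, mul_smul_comm, ← Units.val_mul,
        mul_inv_rev S₀⁻¹, inv_inv]
    rw [h1, Matrix.smul_apply, smul_eq_mul, map_mul, map_zpow₀, hv, ← WithZero.exp_zsmul]
    refine (mul_le_mul_right (hent' i k) _).trans ?_
    rw [← WithZero.exp_add, ← WithZero.exp_zero, WithZero.exp_le_exp]
    simp
  · have h1 : (.mk S : PGL2 K) = .mk S₀ := by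
      rw [hS, map_mul, Matrix.ProjGenLinGroup.mk_scalar, one_mul]
    rw [← h1]
    rfl

end

/-! ### Conjugation of powers of γ by a ray matrix, and the mass bound -/

section

variable {Fq K : Type*} [Field Fq] [Field K] [Algebra Fq K] {inf ν : Place Fq K} {π : K}

theorem Place.val_unif (ω : Place Fq K) : ω.val ω.unif = WithZero.exp (-1) :=
  (ω.surj (WithZero.exp (-1))).choose_spec

theorem coe_glDiag_unif_pow (ω : Place Fq K) (N : ℕ) :
    (glDiag (Units.mk0 ω.unif (unif_ne_zero ω)) ^ N : Matrix.GeneralLinearGroup (Fin 2) K).1 =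
      diagOne (ω.unif ^ N) := by
  rw [Units.val_pow_eq_pow_val, coe_glDiag, diagOne_pow]
  rfl

theorem coe_glDiag_unif_pow_inv (ω : Place Fq K) (N : ℕ) :
    ((glDiag (Units.mk0 ω.unif (unif_ne_zero ω)) ^ N)⁻¹ : Matrix.GeneralLinearGroup (Fin 2) K).1 =
      diagOne (ω.unif ^ N)⁻¹ := by
  refine Units.inv_eq_of_mul_eq_one_right ?_
  rw [coe_glDiag_unif_pow, diagOne_mul, mul_inv_cancel₀ (pow_ne_zero _ (unif_ne_zero ω))]
  exact Matrix.one_fin_two.symm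

theorem det_mem_of_forall_mem {R : Subring K} {A : Matrix (Fin 2) (Fin 2) K}
    (h : ∀ i j, A i j ∈ R) : A.det ∈ R := by
  rw [Matrix.det_fin_two]
  exact sub_mem (mul_mem (h _ _) (h _ _)) (mul_mem (h _ _) (h _ _))

theorem mul_mem_of_forall_mem {R : Subring K} {A B : Matrix (Fin 2) (Fin 2) K}
    (hA : ∀ i j, A i j ∈ R) (hB : ∀ i j, B i j ∈ R) (i j : Fin 2) : (A * B) i j ∈ R := by
  rw [Matrix.mul_apply]
  exact sum_mem fun k _ => mul_mem (hA i k) (hB k j)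

theorem v_det_le_one {F : Type*} [Field F] (v : Valuation F ℤᵐ⁰) {A : Matrix (Fin 2) (Fin 2) F}
    (h : ∀ i j, v (A i j) ≤ 1) : v A.det ≤ 1 := by
  rw [Matrix.det_fin_two]
  refine (Valuation.map_sub _ _ _).trans (max_le ?_ ?_) <;> rw [map_mul] <;>
    exact mul_le_one' (h _ _) (h _ _)

theorem det_mul_det_inv {F : Type*} [Field F] (A : Matrix.GeneralLinearGroup (Fin 2) F) :
    A.1.det * (A⁻¹).1.det = 1 := by
  rw [← Matrix.det_mul, ← Units.val_mul, mul_inv_cancel, Units.val_one, Matrix.det_one]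

namespace IsRayMatrix

variable {C S : Matrix.GeneralLinearGroup (Fin 2) K} {N : ℕ}

theorem val_det (h : IsRayMatrix inf ν π C N S) :
    ν.val S.1.det = ν.val C.1.det * WithZero.exp (-(N : ℤ)) := by
  set κ := S⁻¹ * C * glDiag (Units.mk0 ν.unif (unif_ne_zero ν)) ^ N with hκ
  have h1 : ν.val κ.1.det = 1 := by
    refine le_antisymm (v_det_le_one _ h.val_le) ?_
    have h2 := v_det_le_one _ h.val_inv_le
    have h3 := congrArg ν.val (det_mul_det_inv κ)
    rw [map_mul, map_one] at h3
    rw [← h3]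
    exact mul_le_of_le_one_right' h2
  have h2 : S * κ = C * glDiag (Units.mk0 ν.unif (unif_ne_zero ν)) ^ N := by
    rw [hκ, mul_assoc, mul_inv_cancel_left]
  have h3 := congrArg (fun A : Matrix.GeneralLinearGroup (Fin 2) K => ν.val A.1.det) h2
  simp only [Units.val_mul _ κ, Units.val_mul C, Matrix.det_mul, map_mul, coe_glDiag_unif_pow,
    det_diagOne, map_pow, ν.val_unif, h1, mul_one] at h3
  rw [h3, ← WithZero.exp_nsmul]
  simp

theorem val_inf_det (hK : IsGlobalFunctionField Fq K) (hπR : π ∈ inf.affineRing)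
    (hπν : ν.ord π = 1) (hπS : ∀ y ∈ inf.sRing π, ν.val y ≤ 1 → y ∈ inf.affineRing)
    (h : IsRayMatrix inf ν π C N S) {c : ℤ} (hc : ν.val C.1.det = WithZero.exp (-c)) :
    inf.val S.1.det = inf.val π ^ (c + N) := by
  refine val_unit_sRing hK hπR hπν hπS (det_mem_of_forall_mem h.mem) ?_ S.det_ne_zero ?_
  · rw [inv_eq_of_mul_eq_one_right (det_mul_det_inv S)]
    exact det_mem_of_forall_mem h.inv_mem
  · rw [h.val_det, hc, ← WithZero.exp_add]
    congr 1
    ring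

theorem val_conj_le (h : IsRayMatrix inf ν π C N S) {P : Matrix (Fin 2) (Fin 2) K} {c : ℤ}
    (hP : ∀ i j, ν.val (((C⁻¹).1 * P * C.1) i j) ≤ WithZero.exp c) (i j : Fin 2) :
    ν.val (((S⁻¹).1 * P * S.1) i j) ≤ WithZero.exp (c + N) := by
  set B := glDiag (Units.mk0 ν.unif (unif_ne_zero ν)) ^ N with hB
  set M := (C⁻¹).1 * P * C.1 with hM
  have h1 : (S⁻¹).1 * P * S.1 = (S⁻¹ * C * B).1 * (((B⁻¹).1 * M * B.1) * ((S⁻¹ * C * B)⁻¹).1) := by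
    rw [hM]
    have h2 : ((S⁻¹ * C * B)⁻¹).1 = (B⁻¹).1 * ((C⁻¹).1 * S.1) := by
      rw [mul_inv_rev, mul_inv_rev, inv_inv, Units.val_mul, Units.val_mul]
    have h3 : B.1 * (B⁻¹).1 = 1 := B.mul_inv
    have h4 : C.1 * (C⁻¹).1 = 1 := C.mul_inv
    rw [h2, Units.val_mul, Units.val_mul]
    calc (S⁻¹).1 * P * S.1 = (S⁻¹).1 * 1 * 1 * P * 1 * 1 * S.1 := by simp only [mul_one]
      _ = (S⁻¹).1 * (C.1 * (B.1 * (B⁻¹).1) * (C⁻¹).1) * 1 * P * (C.1 * (B.1 * (B⁻¹).1) * (C⁻¹).1)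
          * 1 * S.1 := by
          simp only [h3, mul_one, h4]
      _ = _ := by simp only [mul_assoc, mul_one]
  have h2 : ∀ i j, ν.val (((B⁻¹).1 * M * B.1) i j) ≤ WithZero.exp (c + N) := by
    intro i j
    have hu : ν.val (ν.unif ^ N) = WithZero.exp (-(N : ℤ)) := by
      rw [map_pow, ν.val_unif, ← WithZero.exp_nsmul]; simp
    have hi : ∀ i j, ν.val ((B⁻¹).1 i j) ≤ WithZero.exp (N : ℤ) := by
      intro i j
      rw [hB, coe_glDiag_unif_pow_inv]
      fin_cases i <;> fin_cases j
      · simp [diagOne, ← WithZero.exp_zero]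
      · simp [diagOne]
      · simp [diagOne]
      · simp only [diagOne]
        change ν.val (ν.unif ^ N)⁻¹ ≤ _
        rw [map_inv₀, hu, ← WithZero.exp_neg, neg_neg]
    have hb : ∀ i j, ν.val (B.1 i j) ≤ 1 := by
      intro i j
      rw [hB, coe_glDiag_unif_pow]
      fin_cases i <;> fin_cases j
      · simp [diagOne]
      · simp [diagOne]
      · simp [diagOne]
      · change ν.val (ν.unif ^ N) ≤ _
        rw [hu, ← WithZero.exp_zero, WithZero.exp_le_exp]
        omega
    refine (v_mul_apply_le ν.val (v_mul_apply_le ν.val hi hP) hb i j).trans ?_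
    rw [mul_one, ← WithZero.exp_add, add_comm]
  rw [h1]
  refine (v_mul_apply_le ν.val h.val_le (v_mul_apply_le ν.val h2 h.val_inv_le) i j).trans ?_
  rw [one_mul, mul_one]

/-- In S⁻¹γ^kS = a_k S⁻¹γS + b_k, whose entries are in R_∞[π⁻¹], the divisibility of a_k compensates
the denominators of S⁻¹γS at ν. The integral conjugate bounds the period of the point attached to S.
-/
theorem exists_conj_pow (hπS : ∀ y ∈ inf.sRing π, ν.val y ≤ 1 → y ∈ inf.affineRing)
    (hν : ν ≠ inf) (h : IsRayMatrix inf ν π C N S)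
    {γ : Matrix.GeneralLinearGroup (Fin 2) inf.affineRing} {c : ℤ}
    (hP : ∀ i j, ν.val (((C⁻¹).1 * γ.1.map inf.affineRing.subtype * C.1) i j) ≤ WithZero.exp c)
    {k : ℕ} (hk : ν.val ((glCoeffs γ k).1 : K) ≤ WithZero.exp (-(c + N))) :
    ∃ D : Matrix.GeneralLinearGroup (Fin 2) inf.affineRing, S.1 * D.1.map inf.affineRing.subtype =
      (γ.1 ^ k).map inf.affineRing.subtype * S.1 := by
  set P := γ.1.map inf.affineRing.subtype with hPdef
  set Q := (S⁻¹).1 * (γ.1 ^ k).map inf.affineRing.subtype * S.1 with hQ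
  have hSS : S.1 * (S⁻¹).1 = 1 := S.mul_inv
  have hSS' : (S⁻¹).1 * S.1 = 1 := S.inv_mul
  have hpow : (γ.1 ^ k).map inf.affineRing.subtype = ((glCoeffs γ k).1 : K) • P +
      ((glCoeffs γ k).2 : K) • 1 := by
    have := pow_eq_powCoeffs (A := inf.affineRing) (τ := γ.1.trace) (δ := γ.1.det) (x := γ.1) (by
        rw [Matrix.trace_fin_two, Matrix.det_fin_two]
        ext i j : 2
        fin_cases i <;> fin_cases j <;> simp [Matrix.mul_apply, Fin.sum_univ_two] <;> ring) k
    rw [this]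
    ext i j
    rw [Matrix.map_apply, Matrix.add_apply, Matrix.add_apply, Matrix.smul_apply, Matrix.smul_apply,
      Matrix.smul_apply, Matrix.smul_apply, Matrix.one_apply, Matrix.one_apply, hPdef,
      Matrix.map_apply]
    split_ifs <;> simp
  have hQmem : ∀ i j, Q i j ∈ inf.affineRing := by
    intro i j
    refine hπS _ ?_ ?_
    · exact mul_mem_of_forall_mem (mul_mem_of_forall_mem h.inv_mem
        fun i j => mem_sRing_of_mem_affineRing (Subtype.property _)) h.mem i j
    · have h1 : Q = ((glCoeffs γ k).1 : K) • ((S⁻¹).1 * P * S.1) + ((glCoeffs γ k).2 : K) • 1 := by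
        rw [hQ, hpow, mul_add, add_mul, mul_smul_comm, smul_mul_assoc, mul_smul_comm,
          smul_mul_assoc, mul_one, hSS']
      rw [h1, Matrix.add_apply]
      refine (Valuation.map_add _ _ _).trans (max_le ?_ ?_)
      · rw [Matrix.smul_apply, smul_eq_mul, map_mul]
        refine (mul_le_mul' hk (h.val_conj_le hP i j)).trans ?_
        rw [← WithZero.exp_add, neg_add_cancel, WithZero.exp_zero]
      · rw [Matrix.smul_apply, smul_eq_mul, map_mul]
        refine mul_le_one' (val_le_one_of_mem_affineRing hν _) ?_
        rw [Matrix.one_apply]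
        split_ifs <;> simp
  set D : Matrix (Fin 2) (Fin 2) inf.affineRing := Matrix.of fun i j => ⟨Q i j, hQmem i j⟩ with hD
  have hDQ : D.map inf.affineRing.subtype = Q := rfl
  have hdet : D.det = (γ ^ k).1.det := by
    refine Subtype.ext ?_
    have h1 : (D.map inf.affineRing.subtype).det = (D.det : K) :=
      (RingHom.map_det inf.affineRing.subtype D).symm
    have h2 : ((γ.1 ^ k).map inf.affineRing.subtype).det = ((γ.1 ^ k).det : K) :=
      (RingHom.map_det inf.affineRing.subtype _).symm
    have h3 : S.1.det * (S⁻¹).1.det = 1 := det_mul_det_inv S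
    rw [← h1, hDQ, hQ, Matrix.det_mul, Matrix.det_mul, h2, Units.val_pow_eq_pow_val]
    linear_combination ((γ.1 ^ k).det : K) * h3
  have hu : IsUnit D := by
    rw [Matrix.isUnit_iff_isUnit_det, hdet, ← Matrix.isUnit_iff_isUnit_det]
    exact Units.isUnit _
  refine ⟨hu.unit, ?_⟩
  rw [IsUnit.unit_spec, hDQ, hQ, ← mul_assoc, ← mul_assoc, hSS, one_mul]

end IsRayMatrix

/-- Along a rational Hecke ray, a proportion of the mass of the periodic measures is carried by the
points with a short vector. -/
theorem exists_mass_bound (hK : IsGlobalFunctionField Fq K) (hν : ν ≠ inf)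
    (hπR : π ∈ inf.affineRing) (hπν : ν.ord π = 1)
    (hπS : ∀ y ∈ inf.sRing π, ν.val y ≤ 1 → y ∈ inf.affineRing)
    {γ : Matrix.GeneralLinearGroup (Fin 2) inf.affineRing}
    {G₀ : Matrix.GeneralLinearGroup (Fin 2) inf.Compl} {c t₀ : inf.Complˣ}
    (h₀ : HasPeriod γ.1 G₀.1 (c : inf.Compl) t₀) {τ deg : ℕ}
    (ht₀ : Valued.v (t₀ : inf.Compl) = WithZero.exp (-(2 * τ : ℤ))) (hτ : 0 < τ)
    (hdeg : inf.val π = WithZero.exp (deg : ℤ)) (C : Matrix.GeneralLinearGroup (Fin 2) K)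
    (z : Fin 2 → K) :
    ∃ A : ℤ, ∀ (N : ℕ) (S : Matrix.GeneralLinearGroup (Fin 2) K) (u : Fin 2 → inf.affineRing)
      (T : ℤ) (k : ℕ) (μ : Measure (XInf inf)) (W : Set (Fin 2 → inf.affineRing)),
      IsRayMatrix inf ν π C N S → u ≠ 0 → u ∈ W → S.1.mulVec (inf.affineRing.subtype ∘ u) = z →
      0 < k → ν.val ((glCoeffs γ k).1 : K) ≤ WithZero.exp (-(N + A)) → 1 ≤ T →
      IsOrbitMeasure (XInf.ofMat inf ((inf.glEmb S)⁻¹ * G₀)) μ →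
      ((2 * (N * deg - A - T)).toNat : ENNReal) ≤
        ((2 * τ * k : ℕ) : ENNReal) * μ (cuspSet inf W T) := by
  obtain ⟨c₁, -, hc₁⟩ := exists_v_entries_le ν.val
    ((C⁻¹).1 * γ.1.map inf.affineRing.subtype * C.1)
  obtain ⟨c₀, hc₀⟩ : ∃ c₀ : ℤ, ν.val C.1.det = WithZero.exp (-c₀) := by
    obtain ⟨n, hn⟩ := exists_v_eq_exp ν.val C.det_ne_zero
    exact ⟨-n, by rw [neg_neg]; exact hn⟩
  obtain ⟨c₂, hc₂⟩ := exists_isShort_mul_glDiag G₀ (y := (G₀⁻¹).1.mulVec (inf.emb ∘ z))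
  -- A absorbs the loss c₁ of conjugating by C, the valuation c₀ of det C at ν and the constant c₂
  -- of the short-vector window; it does not depend on N.
  refine ⟨max c₁ (c₂ - deg * c₀), fun N S u T k μ W hS hu huW hz hk hval hT hμ => ?_⟩
  set A := max c₁ (c₂ - deg * c₀) with hA
  have hA1 : c₁ ≤ A := le_max_left _ _
  have hA2 : c₂ - deg * c₀ ≤ A := le_max_right _ _
  obtain ⟨D, hD⟩ := hS.exists_conj_pow hπS hν hc₁ (k := k)
    (hval.trans (by rw [WithZero.exp_le_exp]; omega))
  set G := (inf.glEmb S)⁻¹ * G₀ with hG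
  have hGval : G.1 = ((inf.glEmb S)⁻¹).1 * G₀.1 := rfl
  have hper : HasPeriod D.1 G.1 ((c ^ k : inf.Complˣ) : inf.Compl)
      ((t₀ ^ k : inf.Complˣ) : inf.Compl) := by
    have h1 := h₀.pow k
    rw [HasPeriod] at h1 ⊢
    have h2 := congrArg (fun A : Matrix (Fin 2) (Fin 2) K => A.map inf.emb) hD
    simp only [Matrix.map_mul] at h2
    have h3 : (inf.glEmb S).1 * D.1.map inf.affineHom =
        (γ.1 ^ k).map inf.affineHom * (inf.glEmb S).1 := h2
    refine (inf.glEmb S).isUnit.mul_left_cancel ?_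
    rw [hGval, ← mul_assoc, h3, mul_assoc, ← mul_assoc (inf.glEmb S).1, Units.mul_inv, one_mul, h1,
      mul_smul_comm, mul_assoc, ← mul_assoc (inf.glEmb S).1, Units.mul_inv, one_mul,
      Units.val_pow_eq_pow_val, Units.val_pow_eq_pow_val]
  have hact : XInf.act (alpha (t₀ ^ k)) (XInf.ofMat inf G) = XInf.ofMat inf G :=
    XInf.act_ofMat_eq_iff.mpr ⟨D, c ^ k, hper⟩
  have hdet : Valued.v (inf.glEmb S).1.det = WithZero.exp (deg * (c₀ + N)) := by
    have h1 : (inf.glEmb S).1.det = inf.emb S.1.det := (RingHom.map_det inf.emb S.1).symm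
    rw [h1, inf.v_emb, hS.val_inf_det hK hπR hπν hπS hc₀, hdeg, ← WithZero.exp_zsmul]
    congr 1
    rw [smul_eq_mul, mul_comm]
  have hy : G₀.1.mulVec ((G₀⁻¹).1.mulVec (inf.emb ∘ z)) =
      (inf.glEmb S).1.mulVec (inf.affineHom ∘ u) := by
    rw [Matrix.mulVec_mulVec, Units.mul_inv, Matrix.one_mulVec, ← hz]
    exact (map_mulVec_comp inf.emb S.1 _).symm
  have hshort := hc₂ (inf.glEmb S) G u _ T hGval hdet hy
  set H : ℤ := deg * (c₀ + N) - c₂ - T with hH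
  have hHle : N * deg - A - T ≤ H := by
    rw [hH]
    nlinarith
  have hl : 0 < 2 * τ * k := by positivity
  have ht₁ : Valued.v ((t₀ ^ k : inf.Complˣ) : inf.Compl) =
      WithZero.exp (-((2 * τ * k : ℕ) : ℤ)) := by
    rw [Units.val_pow_eq_pow_val, map_pow, ht₀, ← WithZero.exp_nsmul]
    congr 1
    rw [nsmul_eq_mul]
    push_cast
    ring
  -- The window is −H ≤ n < H, with 2H times; `toNat` makes it empty when H is negative.
  have hwin : ∀ n : ℤ, -H ≤ n → n < -H + ((2 * H).toNat : ℤ) → |n| ≤ H := by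
    intro n h1 h2
    rw [abs_le]
    omega
  refine le_trans ?_ (hμ.mass_window hK (cuspSet inf W T) (-H) (2 * H).toNat (2 * τ * k) hl
    (t₀ ^ k) ht₁ hact ?_ ?_)
  · exact_mod_cast Int.toNat_le_toNat (by omega)
  · intro t n h1 h2 ht
    exact ⟨G * glDiag t, rfl, u, huW, hshort t n ht (hwin n h1 h2)⟩
  · intro s t m n h1 h2 h3 h4 hs ht he
    have := v_eq_of_ofMat_eq hK hu ((hshort s m hs (hwin m h1 h2)).mono hT)
      ((hshort t n ht (hwin n h3 h4)).mono hT) he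
    rw [hs, ht] at this
    exact WithZero.exp_inj.mp this

end

section

variable {Fq K : Type*} [Field Fq] [Field K] [Algebra Fq K] {inf : Place Fq K}

/-! ### Vertices of the modular graph and short vectors -/

/-- The vertex of the modular graph represented by a matrix. -/
def vert (inf : Place Fq K) (G : Matrix.GeneralLinearGroup (Fin 2) inf.Compl) : ModVertex inf :=
  modProj inf (btv inf (.mk G))

theorem btv_eq_iff {G G' : Matrix.GeneralLinearGroup (Fin 2) inf.Compl} :
    btv inf (.mk G) = btv inf (.mk G') ↔
      ∃ (κ : Matrix.GeneralLinearGroup (Fin 2) inf.integers) (c : inf.Complˣ),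
        G'.1 = (c : inf.Compl) • (G.1 * κ.1.map inf.integers.subtype) := by
  have key : ∀ κ : Matrix.GeneralLinearGroup (Fin 2) inf.integers,
      (.mk (Matrix.GeneralLinearGroup.map inf.integers.subtype κ) : PGL2 inf.Compl) =
        (.mk G)⁻¹ * .mk G' ↔
      ∃ c : inf.Complˣ, G'.1 = (c : inf.Compl) • (G.1 * κ.1.map inf.integers.subtype) := by
    intro κ
    rw [eq_inv_mul_iff_mul_eq, ← map_mul, pgl_mk_eq_mk_iff]
    simp only [Units.val_mul]
    rfl
  rw [QuotientGroup.eq]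
  constructor
  · rintro ⟨κ, hκ⟩
    obtain ⟨κ, rfl⟩ := Matrix.ProjGenLinGroup.mk_surjective κ
    exact ⟨κ, (key κ).mp hκ⟩
  · rintro ⟨κ, h⟩
    exact ⟨.mk κ, (key κ).mpr h⟩

theorem modProj_eq_iff {b b' : BTVertex inf} :
    modProj inf b = modProj inf b' ↔ ∃ g ∈ GamInf inf, g • b = b' := by
  constructor
  · intro h
    have h1 : (MulAction.orbitRel (GamInf inf) (BTVertex inf)) b b' := Quotient.exact h
    obtain ⟨g, hg⟩ := h1
    refine ⟨(g : PGL2 inf.Compl)⁻¹, inv_mem g.2, ?_⟩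
    rw [inv_smul_eq_iff]
    exact hg.symm
  · rintro ⟨g, hg, rfl⟩
    refine (Quotient.sound (s := MulAction.orbitRel (GamInf inf) (BTVertex inf)) ?_).symm
    exact ⟨⟨g, hg⟩, rfl⟩

theorem vert_eq_iff {G G' : Matrix.GeneralLinearGroup (Fin 2) inf.Compl} :
    vert inf G = vert inf G' ↔ ∃ (D : Matrix.GeneralLinearGroup (Fin 2) inf.affineRing)
      (κ : Matrix.GeneralLinearGroup (Fin 2) inf.integers) (c : inf.Complˣ),
        G'.1 = (c : inf.Compl) •
          (D.1.map inf.affineHom * G.1 * κ.1.map inf.integers.subtype) := by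
  have key : ∀ D : Matrix.GeneralLinearGroup (Fin 2) inf.affineRing,
      inf.toG (ofGL inf D) • btv inf (.mk G) = btv inf (.mk G') ↔
      ∃ (κ : Matrix.GeneralLinearGroup (Fin 2) inf.integers) (c : inf.Complˣ),
        G'.1 = (c : inf.Compl) •
          (D.1.map inf.affineHom * G.1 * κ.1.map inf.integers.subtype) := by
    intro D
    have : inf.toG (ofGL inf D) • btv inf (.mk G) =
        btv inf (.mk (Matrix.GeneralLinearGroup.map inf.affineHom D * G)) := rfl
    rw [this, btv_eq_iff]
    rfl
  rw [vert, vert, modProj_eq_iff]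
  constructor
  · rintro ⟨_, ⟨g, hg, rfl⟩, h⟩
    obtain ⟨D, rfl⟩ := (mem_Gam_iff inf g).mp hg
    exact ⟨D, (key D).mp h⟩
  · rintro ⟨D, h⟩
    exact ⟨_, ⟨ofGL inf D, (mem_Gam_iff inf _).mpr ⟨D, rfl⟩, rfl⟩, (key D).mpr h⟩

theorem vert_surjective (inf : Place Fq K) : Function.Surjective (vert inf) := by
  intro y
  obtain ⟨b, rfl⟩ := Quotient.exists_rep y
  obtain ⟨g, rfl⟩ := QuotientGroup.mk_surjective b
  obtain ⟨G, rfl⟩ := Matrix.ProjGenLinGroup.mk_surjective g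
  exact ⟨G, rfl⟩

/-- An integral matrix A does not lengthen vectors; b bounds the ratio of the determinants, and a is
the resulting loss of height. -/
theorem IsShort.of_mulVec {G G' : Matrix.GeneralLinearGroup (Fin 2) inf.Compl}
    {w : Fin 2 → inf.affineRing} {T a : ℤ} (h : IsShort G w T)
    {A : Matrix (Fin 2) (Fin 2) inf.Compl} (hA : ∀ i j, Valued.v (A i j) ≤ 1) {b : ℤᵐ⁰}
    {c : inf.Compl} (hl : latVec G' w = c • A.mulVec (latVec G w))
    (hd : Valued.v G'.1.det ≤ b * Valued.v G.1.det) (hc : Valued.v c ^ 2 * b ≤ WithZero.exp a) :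
    IsShort G' w (T - a) := by
  obtain ⟨d, hdet⟩ := exists_v_eq_exp Valued.v G.det_ne_zero
  have key : ∃ j, ∀ i, Valued.v (A.mulVec (latVec G w) i) ≤ Valued.v (latVec G w j) := by
    rcases le_total (Valued.v (latVec G w 0)) (Valued.v (latVec G w 1)) with h1 | h1
    · refine ⟨1, fun i => ?_⟩
      have := v_mulVec_apply_le Valued.v hA (y := latVec G w) (β := Valued.v (latVec G w 1))
        (fun j => by fin_cases j; exacts [h1, le_rfl]) i
      rwa [one_mul] at this
    · refine ⟨0, fun i => ?_⟩
      have := v_mulVec_apply_le Valued.v hA (y := latVec G w) (β := Valued.v (latVec G w 0))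
        (fun j => by fin_cases j; exacts [le_rfl, h1]) i
      rwa [one_mul] at this
  obtain ⟨j, hj⟩ := key
  intro i
  rw [hl, Pi.smul_apply, smul_eq_mul, map_mul, mul_pow]
  calc Valued.v c ^ 2 * Valued.v (A.mulVec (latVec G w) i) ^ 2 * Valued.v G'.1.det
      ≤ Valued.v c ^ 2 * Valued.v (latVec G w j) ^ 2 * (b * Valued.v G.1.det) :=
        mul_le_mul' (mul_le_mul_right (pow_le_pow_left₀ zero_le (hj i) 2) _) hd
    _ = (Valued.v c ^ 2 * b) * (Valued.v (latVec G w j) ^ 2 * Valued.v G.1.det) := by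
        rw [mul_mul_mul_comm]
    _ ≤ WithZero.exp a * WithZero.exp (-T) := mul_le_mul' hc (h j)
    _ = WithZero.exp (-(T - a)) := by
        rw [← WithZero.exp_add]; congr 1; ring

theorem v_entries_integers {κ : Matrix (Fin 2) (Fin 2) inf.integers} (i j : Fin 2) :
    Valued.v (κ.map inf.integers.subtype i j) ≤ 1 := (κ i j).2

theorem v_det_integers (κ : Matrix.GeneralLinearGroup (Fin 2) inf.integers) :
    Valued.v (κ.1.map inf.integers.subtype).det = 1 := by
  have h1 := v_det_le_one Valued.v (v_entries_integers (κ := κ.1))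
  have h2 := v_det_le_one Valued.v (v_entries_integers (κ := (κ⁻¹).1))
  have h3 : Valued.v (κ.1.map inf.integers.subtype).det *
      Valued.v ((κ⁻¹).1.map inf.integers.subtype).det = 1 := by
    rw [← map_mul, ← Matrix.det_mul, ← Matrix.map_mul, Units.mul_inv]
    simp
  refine le_antisymm h1 ?_
  rw [← h3]
  exact mul_le_of_le_one_right' h2

theorem IsShort.mul_right {G G' : Matrix.GeneralLinearGroup (Fin 2) inf.Compl}
    {w : Fin 2 → inf.affineRing} {T : ℤ} (h : IsShort G w T)
    (κ : Matrix.GeneralLinearGroup (Fin 2) inf.integers)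
    (hG : G'.1 = G.1 * κ.1.map inf.integers.subtype) : IsShort G' w T := by
  have h1 : κ.1.map inf.integers.subtype * (κ⁻¹).1.map inf.integers.subtype = 1 := by
    rw [← Matrix.map_mul, Units.mul_inv]
    simp
  have := h.of_mulVec (G' := G') (A := (κ⁻¹).1.map inf.integers.subtype) v_entries_integers
    (b := 1) (c := 1) (a := 0) ?_ ?_ ?_
  · simpa using this
  · refine eq_latVec ?_
    rw [one_smul, hG, ← Matrix.mulVec_mulVec, Matrix.mulVec_mulVec (latVec G w), h1,
      Matrix.one_mulVec, mulVec_latVec]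
  · rw [hG, Matrix.det_mul, map_mul, v_det_integers, mul_one, one_mul]
  · simp

/-- The vertices of the modular graph with a short vector in `W`. -/
def cuspVert (inf : Place Fq K) (W : Set (Fin 2 → inf.affineRing)) (T : ℤ) : Set (ModVertex inf) :=
  {y | ∃ G, vert inf G = y ∧ ∃ w ∈ W, IsShort G w T}

theorem cuspVert_anti (W : Set (Fin 2 → inf.affineRing)) {S T : ℤ} (h : S ≤ T) :
    cuspVert inf W T ⊆ cuspVert inf W S := by
  rintro y ⟨G, hG, w, hw, hs⟩
  exact ⟨G, hG, w, hw, hs.mono h⟩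

/-- The set `W` of vectors is invariant under `GL₂(R_∞)`. -/
def IsGLInvariant (W : Set (Fin 2 → inf.affineRing)) : Prop :=
  ∀ (D : Matrix.GeneralLinearGroup (Fin 2) inf.affineRing), ∀ w ∈ W, D.1.mulVec w ∈ W

/-- The vertex determines G up to homothety, GL₂(O_∞) on the right and GL₂(R_∞) on the left. The
first two preserve shortness and the third moves the vector inside W, so any representative may be
used. -/
theorem exists_isShort_of_vert_mem (hK : IsGlobalFunctionField Fq K)
    {W : Set (Fin 2 → inf.affineRing)} (hW : IsGLInvariant W) {T : ℤ}
    {G : Matrix.GeneralLinearGroup (Fin 2) inf.Compl} (h : vert inf G ∈ cuspVert inf W T) :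
    ∃ w ∈ W, IsShort G w T := by
  obtain ⟨G₁, h₁, w, hw, hs⟩ := h
  obtain ⟨D, κ, c, hc⟩ := vert_eq_iff.mp h₁
  set G₂ : Matrix.GeneralLinearGroup (Fin 2) inf.Compl :=
    G₁ * Matrix.GeneralLinearGroup.map inf.integers.subtype κ with hG₂
  have hs₂ : IsShort G₂ w T := hs.mul_right κ rfl
  refine ⟨D.1.mulVec w, hW D w hw, hs₂.mul_left hK (c := c) ?_⟩
  rw [hc, mul_assoc]
  rfl

theorem preimage_cuspVert (hK : IsGlobalFunctionField Fq K)
    {W : Set (Fin 2 → inf.affineRing)} (hW : IsGLInvariant W) (T : ℤ) :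
    pInf ⁻¹' cuspVert inf W T = cuspSet inf W T := by
  ext x
  obtain ⟨G, rfl⟩ := XInf.ofMat_surjective inf x
  constructor
  · intro h
    obtain ⟨w, hw, hs⟩ := exists_isShort_of_vert_mem hK hW h
    exact ⟨G, rfl, w, hw, hs⟩
  · rintro ⟨G', hG', w, hw, hs⟩
    rw [← hG']
    exact ⟨G', rfl, w, hw, hs⟩

/-- The nonzero vectors. -/
def nonzeroVec (inf : Place Fq K) : Set (Fin 2 → inf.affineRing) := {w | w ≠ 0}

/-- The orbit of the first basis vector. -/
def orbitVec (inf : Place Fq K) : Set (Fin 2 → inf.affineRing) :=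
  {w | ∃ D : Matrix.GeneralLinearGroup (Fin 2) inf.affineRing, D.1.mulVec ![1, 0] = w}

theorem glMulVec_ne_zero {R : Type*} [CommRing R] (D : Matrix.GeneralLinearGroup (Fin 2) R)
    {w : Fin 2 → R} (hw : w ≠ 0) : D.1.mulVec w ≠ 0 := by
  intro h
  apply hw
  have := congrArg ((D⁻¹).1.mulVec) h
  rwa [Matrix.mulVec_mulVec, Units.inv_mul, Matrix.one_mulVec, Matrix.mulVec_zero] at this

theorem isGLInvariant_nonzeroVec : IsGLInvariant (nonzeroVec inf) := fun D _ hw =>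
  glMulVec_ne_zero D hw

theorem isGLInvariant_orbitVec : IsGLInvariant (orbitVec inf) := by
  rintro D _ ⟨D', rfl⟩
  exact ⟨D * D', by rw [Matrix.mulVec_mulVec, Units.val_mul]⟩

theorem orbitVec_subset : orbitVec inf ⊆ nonzeroVec inf := by
  rintro _ ⟨D, rfl⟩
  refine glMulVec_ne_zero D fun h => ?_
  exact one_ne_zero (congrFun h 0)

/-- If G⁻¹w is short enough, all coordinates of w are elements of R_∞ smaller than 1, hence zero. -/
theorem exists_not_isShort (hK : IsGlobalFunctionField Fq K)
    (G : Matrix.GeneralLinearGroup (Fin 2) inf.Compl) :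
    ∃ T, ∀ w ∈ nonzeroVec inf, ¬ IsShort G w T := by
  obtain ⟨C, -, hC⟩ := exists_v_entries_le Valued.v G.1
  obtain ⟨d, hd⟩ := exists_v_eq_exp Valued.v G.det_ne_zero
  refine ⟨2 * C - d + 1, fun w hw hs => ?_⟩
  have h1 : ∀ i, Valued.v (latVec G w i) < WithZero.exp (-C) := by
    intro i
    by_contra hle
    have h2 := pow_le_pow_left₀ zero_le (not_lt.mp hle) 2
    have h3 := (mul_le_mul_left h2 _).trans (hs i)
    rw [hd, ← WithZero.exp_nsmul, ← WithZero.exp_add, WithZero.exp_le_exp] at h3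
    simp only [nsmul_eq_mul] at h3
    push_cast at h3
    omega
  obtain ⟨i, hi⟩ : ∃ i, w i ≠ 0 := by
    by_contra! h
    exact hw (funext h)
  have h4 : inf.val (w i : K) < 1 := by
    rw [← inf.v_affineHom]
    have h5 := congrFun (mulVec_latVec G w) i
    rw [Function.comp_apply] at h5
    rw [← h5, Matrix.mulVec, dotProduct]
    refine Valuation.map_sum_lt _ one_ne_zero fun j _ => ?_
    rw [map_mul]
    have h6 : WithZero.exp C * WithZero.exp (-C) = (1 : ℤᵐ⁰) := by
      rw [← WithZero.exp_add, add_neg_cancel, WithZero.exp_zero]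
    calc Valued.v (G.1 i j) * Valued.v (latVec G w j)
        ≤ WithZero.exp C * Valued.v (latVec G w j) := mul_le_mul_left (hC i j) _
      _ < WithZero.exp C * WithZero.exp (-C) := by
          refine mul_lt_mul_of_pos_left (h1 j) ?_
          exact zero_lt_iff.mpr WithZero.exp_ne_zero
      _ = 1 := h6
  exact absurd h4 (not_lt.mpr (inf.one_le_val hK (w i).2 fun h => hi (Subtype.ext h)))

theorem exists_notMem_cuspVert (hK : IsGlobalFunctionField Fq K) (y : ModVertex inf) :
    ∃ T, y ∉ cuspVert inf (nonzeroVec inf) T := by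
  obtain ⟨G, rfl⟩ := vert_surjective inf y
  obtain ⟨T, hT⟩ := exists_not_isShort hK G
  refine ⟨T, fun h => ?_⟩
  obtain ⟨w, hw, hs⟩ := exists_isShort_of_vert_mem hK isGLInvariant_nonzeroVec h
  exact hT w hw hs

theorem exists_disjoint_cuspVert (hK : IsGlobalFunctionField Fq K) {F : Set (ModVertex inf)}
    (hF : F.Finite) : ∃ T : ℤ, 1 ≤ T ∧ Disjoint F (cuspVert inf (nonzeroVec inf) T) := by
  induction F, hF using Set.Finite.induction_on with
  | empty => exact ⟨1, le_rfl, Set.empty_disjoint _⟩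
  | @insert y F _ _ ih =>
    obtain ⟨T, hT, h⟩ := ih
    obtain ⟨S, hS⟩ := exists_notMem_cuspVert hK y
    refine ⟨max S T, hT.trans (le_max_right _ _), ?_⟩
    rw [Set.disjoint_insert_left]
    exact ⟨fun h => hS (cuspVert_anti _ (le_max_left _ _) h),
      h.mono_right (cuspVert_anti _ (le_max_right _ _))⟩

/-- The height of a short vector varies by at most `2` along an edge. -/
theorem mem_cuspVert_of_adj {W : Set (Fin 2 → inf.affineRing)}
    (hK : IsGlobalFunctionField Fq K) (hW : IsGLInvariant W) {y y' : ModVertex inf}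
    (h : (modGraph inf).Adj y y') {T : ℤ} (hy : y ∈ cuspVert inf W T) :
    y' ∈ cuspVert inf W (T - 2) := by
  have key : ∀ {M M' : Matrix.GeneralLinearGroup (Fin 2) inf.Compl} {ϖ : inf.integers},
      Valued.v (ϖ : inf.Compl) = WithZero.exp (-1) →
      IsElementarySublattice inf.integers ϖ (lattice inf.integers M) (lattice inf.integers M') →
      ∀ T, (vert inf M ∈ cuspVert inf W T → vert inf M' ∈ cuspVert inf W (T - 2)) ∧
        (vert inf M' ∈ cuspVert inf W T → vert inf M ∈ cuspVert inf W (T - 2)) := by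
    intro M M' ϖ hϖ hL T
    obtain ⟨s, s', h1, h2, h3, h4⟩ := hL.exists_matrix
    have hϖ0 : (ϖ : inf.Compl) ≠ 0 := by
      intro h0
      rw [h0, map_zero] at hϖ
      exact WithZero.exp_ne_zero hϖ.symm
    have hdets : Valued.v (s.map inf.integers.subtype).det *
        Valued.v (s'.map inf.integers.subtype).det = WithZero.exp (-2) := by
      rw [← map_mul, ← Matrix.det_mul, ← Matrix.map_mul, h3]
      have h5 : ((ϖ • 1 : Matrix (Fin 2) (Fin 2) inf.integers)).map inf.integers.subtype =
          (ϖ : inf.Compl) • 1 := by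
        ext i j
        rw [Matrix.map_apply, Matrix.smul_apply, Matrix.smul_apply, Matrix.one_apply,
          Matrix.one_apply]
        split_ifs <;> simp
      rw [h5, Matrix.det_smul, Matrix.det_one, mul_one, Fintype.card_fin, map_pow, hϖ,
        ← WithZero.exp_nsmul]
      rfl
    have hds := v_det_le_one Valued.v (v_entries_integers (κ := s))
    have hds' := v_det_le_one Valued.v (v_entries_integers (κ := s'))
    constructor
    · intro hM
      obtain ⟨w, hw, hs⟩ := exists_isShort_of_vert_mem hK hW hM
      refine ⟨M', rfl, w, hw, hs.of_mulVec (A := s.map inf.integers.subtype) v_entries_integers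
        (b := WithZero.exp 2) (c := 1) ?_ ?_ (by simp)⟩
      · refine eq_latVec ?_
        rw [one_smul, Matrix.mulVec_mulVec, ← h1, mulVec_latVec]
      · have h5 : Valued.v M.1.det = Valued.v M'.1.det *
            Valued.v (s.map inf.integers.subtype).det := by
          rw [h1, Matrix.det_mul, map_mul]
        have h6 : WithZero.exp (-2) ≤ Valued.v (s.map inf.integers.subtype).det := by
          rw [← hdets]
          exact mul_le_of_le_one_right' hds'
        rw [h5]
        calc Valued.v M'.1.det = WithZero.exp 2 * (Valued.v M'.1.det * WithZero.exp (-2)) := by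
              rw [mul_left_comm, ← WithZero.exp_add]
              simp
          _ ≤ _ := by gcongr
    · intro hM
      obtain ⟨w, hw, hs⟩ := exists_isShort_of_vert_mem hK hW hM
      refine ⟨M, rfl, w, hw, hs.of_mulVec (A := s'.map inf.integers.subtype) v_entries_integers
        (b := 1) (c := (ϖ : inf.Compl)⁻¹) ?_ ?_ ?_⟩
      · refine eq_latVec ?_
        rw [Matrix.mulVec_smul, Matrix.mulVec_mulVec, ← h2, Matrix.smul_mulVec, smul_smul,
          inv_mul_cancel₀ hϖ0, one_smul, mulVec_latVec]
      · rw [h1, Matrix.det_mul, map_mul, one_mul]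
        exact mul_le_of_le_one_right' hds
      · rw [map_inv₀, hϖ, ← WithZero.exp_neg, ← WithZero.exp_nsmul, mul_one]
        rfl
  have key2 : ∀ {b b' : BTVertex inf}, (btTree inf).Adj b b' → modProj inf b ∈ cuspVert inf W T →
      modProj inf b' ∈ cuspVert inf W (T - 2) := by
    intro b b' hb hy
    rw [btTree, SimpleGraph.fromRel_adj] at hb
    rcases hb.2 with ⟨M, M', rfl, rfl, ϖ, hϖ, hL⟩ | ⟨M, M', rfl, rfl, ϖ, hϖ, hL⟩
    · exact (key hϖ hL T).1 hy
    · exact (key hϖ hL T).2 hy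
  rw [modGraph, SimpleGraph.fromRel_adj] at h
  rcases h.2 with ⟨b, b', rfl, rfl, hb⟩ | ⟨b, b', rfl, rfl, hb⟩
  · exact key2 hb hy
  · exact key2 hb.symm hy

end

section

variable {Fq K : Type*} [Field Fq] [Field K] [Algebra Fq K] {inf : Place Fq K}

/-! ### Finiteness of the set of vertices of bounded height -/

theorem exists_glIntegers {A : Matrix (Fin 2) (Fin 2) inf.Compl}
    (hA : ∀ i j, Valued.v (A i j) ≤ 1) (hd : Valued.v A.det = 1) :
    ∃ κ : Matrix.GeneralLinearGroup (Fin 2) inf.integers, κ.1.map inf.integers.subtype = A := by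
  set B : Matrix (Fin 2) (Fin 2) inf.integers := Matrix.of fun i j => ⟨A i j, hA i j⟩
  have hB : B.map inf.integers.subtype = A := rfl
  have hdB : (B.det : inf.Compl) = A.det := by
    rw [← hB]
    exact RingHom.map_det inf.integers.subtype B
  have hu : IsUnit B := by
    rw [Matrix.isUnit_iff_isUnit_det]
    have h0 : A.det ≠ 0 := by
      intro h0
      rw [h0, map_zero] at hd
      exact zero_ne_one hd
    refine IsUnit.of_mul_eq_one ⟨A.det⁻¹, ?_⟩ (Subtype.ext ?_)
    · change Valued.v A.det⁻¹ ≤ 1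
      rw [map_inv₀, hd, inv_one]
    · change (B.det : inf.Compl) * A.det⁻¹ = 1
      rw [hdB, mul_inv_cancel₀ h0]
  exact ⟨hu.unit, by rw [IsUnit.unit_spec, hB]⟩

theorem Place.exists_finite_approx (hK : IsGlobalFunctionField Fq K) (ω : Place Fq K) (γ : ℤᵐ⁰) :
    ∃ B : Set ω.Compl, B.Finite ∧ ∀ b, Valued.v b ≤ γ → ∃ b' ∈ B, Valued.v (b' - b) ≤ 1 := by
  obtain ⟨t, -, ht⟩ := (ω.isCompact_setOf_v_le hK γ).elim_nhds_subcover
    (fun x => {y | Valued.v (y - x) < 1}) fun x _ =>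
      (ω.mem_nhds).mpr ⟨1, one_ne_zero, subset_rfl⟩
  refine ⟨t, t.finite_toSet, fun b hb => ?_⟩
  obtain ⟨b', hb', h⟩ := Set.mem_iUnion₂.mp (ht hb)
  refine ⟨b', hb', ?_⟩
  rw [Valuation.map_sub_swap]
  exact (show Valued.v (b - b') < 1 from h).le

/-- A primitive vector is the first column of an integral matrix, up to the scalar `s`. -/
theorem exists_glIntegers_mulVec {y : Fin 2 → inf.Compl} (hy : y ≠ 0) :
    ∃ (κ : Matrix.GeneralLinearGroup (Fin 2) inf.integers) (s : inf.Complˣ) (j : Fin 2),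
      (s : inf.Compl) = y j ∧ (∀ i, Valued.v (y i) ≤ Valued.v (s : inf.Compl)) ∧
      (s : inf.Compl) • (κ.1.map inf.integers.subtype).mulVec ![1, 0] = y := by
  have hne : ∀ j, (∀ i, Valued.v (y i) ≤ Valued.v (y j)) → y j ≠ 0 := by
    intro j hj h0
    refine hy (funext fun i => ?_)
    have := hj i
    rw [h0, map_zero, nonpos_iff_eq_zero, Valuation.zero_iff] at this
    exact this
  rcases le_total (Valued.v (y 1)) (Valued.v (y 0)) with h | h
  · have hmax : ∀ i, Valued.v (y i) ≤ Valued.v (y 0) := fun i => by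
      fin_cases i
      exacts [le_rfl, h]
    have h0 := hne 0 hmax
    have h1 : Valued.v (y 1 / y 0) ≤ 1 := by
      rw [map_div₀]
      exact div_le_one_of_le₀ h zero_le
    obtain ⟨κ, hκ⟩ := exists_glIntegers (inf := inf) (A := !![1, 0; y 1 / y 0, 1])
      (by intro i j; fin_cases i <;> fin_cases j <;> simp [-map_div₀, h1]) (by simp)
    refine ⟨κ, Units.mk0 _ h0, 0, rfl, hmax, ?_⟩
    rw [hκ]
    ext i
    fin_cases i
    · simp
    · simp [mul_div_cancel₀ _ h0]
  · have hmax : ∀ i, Valued.v (y i) ≤ Valued.v (y 1) := fun i => by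
      fin_cases i
      exacts [h, le_rfl]
    have h0 := hne 1 hmax
    have h1 : Valued.v (y 0 / y 1) ≤ 1 := by
      rw [map_div₀]
      exact div_le_one_of_le₀ h zero_le
    obtain ⟨κ, hκ⟩ := exists_glIntegers (inf := inf) (A := !![y 0 / y 1, 1; 1, 0])
      (by intro i j; fin_cases i <;> fin_cases j <;> simp [-map_div₀, h1]) (by simp)
    refine ⟨κ, Units.mk0 _ h0, 1, rfl, hmax, ?_⟩
    rw [hκ]
    ext i
    fin_cases i
    · simp [mul_div_cancel₀ _ h0]
    · simp

/-- GL₂(R_∞) moves the short vector to the first basis vector, GL₂(O_∞) then makes the matrix upper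
triangular, and a homothety makes its first entry 1. The height leaves two exponents for the last
diagonal entry. The remaining entry matters only modulo translations by R_∞ and modulo O_∞, so
cocompactness of R_∞ leaves finitely many values. -/
theorem finite_cuspVert_diff (hK : IsGlobalFunctionField Fq K) {y₀ : K} (hy₀ : y₀ ∈ inf.affineRing)
    (ht : Transcendental Fq y₀) (T : ℤ) :
    (cuspVert inf (orbitVec inf) T \ cuspVert inf (orbitVec inf) (T + 2)).Finite := by
  obtain ⟨γ₀, hγ₀, happ⟩ := inf.exists_affineRing_sub_le hK hy₀ ht
  obtain ⟨B, hB, hBapp⟩ := inf.exists_finite_approx hK (WithZero.exp (-T) * γ₀)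
  obtain ⟨ϖ, hϖ⟩ := inf.v_surjective (WithZero.exp (-1))
  have hϖ0 : ϖ ≠ 0 := by
    rintro rfl
    rw [map_zero] at hϖ
    exact WithZero.exp_ne_zero hϖ.symm
  let std : inf.Compl × ℤ → Matrix.GeneralLinearGroup (Fin 2) inf.Compl := fun q =>
    Matrix.GeneralLinearGroup.mkOfDetNeZero !![1, q.1; 0, ϖ ^ q.2] (by simp [zpow_ne_zero _ hϖ0])
  have hstd : ∀ q, (std q).1 = !![1, q.1; 0, ϖ ^ q.2] := fun q => rfl
  refine ((hB.prod (Set.finite_Ico T (T + 2))).image fun q => vert inf (std q)).subset ?_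
  rintro y ⟨⟨G, rfl, _, ⟨D, rfl⟩, hs⟩, hns⟩
  set e : Fin 2 → inf.affineRing := ![1, 0] with he
  obtain ⟨G₁, hG₁⟩ : ∃ G₁, G₁ = Matrix.GeneralLinearGroup.map inf.affineHom D⁻¹ * G := ⟨_, rfl⟩
  have hv₁ : vert inf G = vert inf G₁ := vert_eq_iff.mpr ⟨D⁻¹, 1, 1, by
    rw [hG₁, Units.val_one, Units.val_one, one_smul, Matrix.map_one _ (map_zero _) (map_one _),
      mul_one]
    rfl⟩
  have hs₁ : IsShort G₁ e T := by
    have := hs.mul_left hK (G' := G₁) (D := D⁻¹) (c := 1) (by rw [Units.val_one, one_smul, hG₁]; rfl)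
    rwa [Matrix.mulVec_mulVec, Units.inv_mul, Matrix.one_mulVec] at this
  have hns₁ : ¬ IsShort G₁ e (T + 2) := fun h =>
    hns ⟨G₁, hv₁.symm, e, ⟨1, by rw [Units.val_one, Matrix.one_mulVec]⟩, h⟩
  set yv := latVec G₁ e with hyv
  have hGy : G₁.1.mulVec yv = ![1, 0] := by
    rw [hyv, mulVec_latVec]
    ext i
    fin_cases i <;> simp [he]
  have hyv0 : yv ≠ 0 := by
    intro h
    rw [h, Matrix.mulVec_zero] at hGy
    exact zero_ne_one (congrFun hGy 0)
  obtain ⟨κ₁, s, j, hsj, hmax, hκ₁⟩ := exists_glIntegers_mulVec hyv0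
  set M := G₁.1 * κ₁.1.map inf.integers.subtype with hM
  have hMcol : M.mulVec ![1, 0] = (s : inf.Compl)⁻¹ • ![1, 0] := by
    rw [eq_inv_smul_iff₀ s.ne_zero, ← Matrix.mulVec_smul, hM, ← Matrix.mulVec_mulVec,
      Matrix.mulVec_smul, hκ₁, hGy]
  have hM00 : M 0 0 = (s : inf.Compl)⁻¹ := by simpa using congrFun hMcol 0
  have hM10 : M 1 0 = 0 := by simpa using congrFun hMcol 1
  have hMdet : M.det = (s : inf.Compl)⁻¹ * M 1 1 := by
    rw [Matrix.det_fin_two, hM00, hM10, mul_zero, sub_zero]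
  have hvdet : Valued.v G₁.1.det = Valued.v ((s : inf.Compl)⁻¹ * M 1 1) := by
    rw [← hMdet, hM, Matrix.det_mul, map_mul, v_det_integers, mul_one]
  have hq : Valued.v (s : inf.Compl) ^ 2 * Valued.v G₁.1.det = Valued.v (s * M 1 1) := by
    rw [hvdet, ← map_pow, ← map_mul]
    congr 1
    field_simp
  have hd0 : (s : inf.Compl) * M 1 1 ≠ 0 := by
    intro h0
    rw [h0, map_zero] at hq
    rcases mul_eq_zero.mp hq with h | h
    · exact s.ne_zero (by simp at h)
    · exact G₁.det_ne_zero (by simpa using h)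
  obtain ⟨n, hn⟩ := exists_v_eq_exp Valued.v hd0
  have hT1 : n ≤ -T := by
    have := hs₁ j
    rwa [← hyv, ← hsj, hq, hn, WithZero.exp_le_exp] at this
  have hT2 : -(T + 2) < n := by
    by_contra hle
    refine hns₁ fun i => ?_
    refine (mul_le_mul_left (pow_le_pow_left₀ zero_le (hmax i) 2) _).trans ?_
    rw [hq, hn, WithZero.exp_le_exp]
    omega
  set ε := (s : inf.Compl) * M 1 1 * ϖ ^ n with hε
  have hvε : Valued.v ε = 1 := by
    rw [hε, map_mul, map_zpow₀, hϖ, hn, ← WithZero.exp_zsmul, ← WithZero.exp_add]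
    simp
  have hε0 : ε ≠ 0 := mul_ne_zero hd0 (zpow_ne_zero _ hϖ0)
  obtain ⟨r, hr, hrb⟩ := happ (-(M 0 1 / M 1 1))
  have hM11 : M 1 1 ≠ 0 := right_ne_zero_of_mul hd0
  set b := ε⁻¹ * ((s : inf.Compl) * (M 0 1 + inf.emb r * M 1 1)) with hb
  have hvb : Valued.v b ≤ WithZero.exp (-T) * γ₀ := by
    have : b = ε⁻¹ * (((s : inf.Compl) * M 1 1) * -(-(M 0 1 / M 1 1) - inf.emb r)) := by
      rw [hb]
      field_simp
      ring
    rw [this, map_mul, map_inv₀, hvε, inv_one, one_mul, map_mul, Valuation.map_neg, hn]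
    exact mul_le_mul' (by rwa [WithZero.exp_le_exp]) hrb
  obtain ⟨b₀, hb₀, hb₀b⟩ := hBapp b hvb
  obtain ⟨κ₂, hκ₂⟩ := exists_glIntegers (inf := inf) (A := !![1, b₀ - b; 0, ε⁻¹])
    (by intro i j; fin_cases i <;> fin_cases j <;> simp [hb₀b, hvε]) (by simp [hvε])
  have hDr : IsUnit (!![1, ⟨r, hr⟩; 0, 1] : Matrix (Fin 2) (Fin 2) inf.affineRing) := by
    rw [Matrix.isUnit_iff_isUnit_det]
    simp
  refine ⟨(b₀, -n), ⟨hb₀, by rw [Set.mem_Ico]; constructor <;> omega⟩, ?_⟩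
  change vert inf (std (b₀, -n)) = vert inf G
  rw [hv₁]
  refine (vert_eq_iff.mpr ⟨hDr.unit, κ₁ * κ₂, s, ?_⟩).symm
  rw [hstd, IsUnit.unit_spec, Units.val_mul, Matrix.map_mul, hκ₂, mul_assoc, ← mul_assoc G₁.1, ← hM]
  have hϖn : ϖ ^ (-n) = (s : inf.Compl) * M 1 1 * ε⁻¹ := by
    rw [hε, zpow_neg]
    field_simp
  have hmap : (!![1, ⟨r, hr⟩; 0, 1] : Matrix (Fin 2) (Fin 2) inf.affineRing).map inf.affineHom =
      !![1, inf.emb r; 0, 1] := by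
    ext i j
    fin_cases i <;> fin_cases j <;> simp [Place.affineHom]
  rw [hmap, Matrix.eta_fin_two M, hM00, hM10, hϖn]
  ext i j
  fin_cases i <;> fin_cases j
  · simp
  · simp [hb]
    field_simp
    ring
  · simp
  · simp [mul_assoc]

end

section

variable {Fq K : Type*} [Field Fq] [Field K] [Algebra Fq K] {inf : Place Fq K}

/-! ### Cusps and rays -/

theorem cuspOf_eq_cuspOf {C C' : Matrix.GeneralLinearGroup (Fin 2) K} :
    cuspOf inf (.mk C) = cuspOf inf (.mk C') ↔
      ∃ (D : Matrix.GeneralLinearGroup (Fin 2) inf.affineRing) (a : Kˣ),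
        (a : K) • C.1.mulVec ![1, 0] =
          (D.1.map inf.affineRing.subtype).mulVec (C'.1.mulVec ![1, 0]) := by
  have key : ∀ D : Matrix.GeneralLinearGroup (Fin 2) inf.affineRing,
      ofGL inf D • (.mk C' : PGL2 K) • ptInf K = (.mk C : PGL2 K) • ptInf K ↔
      ∃ a : Kˣ, (a : K) • C.1.mulVec ![1, 0] =
          (D.1.map inf.affineRing.subtype).mulVec (C'.1.mulVec ![1, 0]) := by
    intro D
    have h1 : ∀ A : Matrix.GeneralLinearGroup (Fin 2) K, A.1.mulVec ![1, 0] ≠ 0 := fun A =>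
      glMulVec_ne_zero A fun h => one_ne_zero (congrFun h 0)
    have h2 : ∀ A : Matrix.GeneralLinearGroup (Fin 2) K, (.mk A : PGL2 K) • ptInf K =
      Projectivization.mk K (A.1.mulVec ![1, 0]) (h1 A) := fun A => rfl
    have h3 : ofGL inf D • (.mk C' : PGL2 K) • ptInf K = Projectivization.mk K
        ((D.1.map inf.affineRing.subtype).mulVec (C'.1.mulVec ![1, 0]))
        (glMulVec_ne_zero (Matrix.GeneralLinearGroup.map inf.affineRing.subtype D) (h1 C')) := rfl
    rw [h3, h2]
    exact Projectivization.mk_eq_mk_iff K _ _ _ _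
  constructor
  · intro h
    have h1 : (MulAction.orbitRel (Gam inf) (Projectivization K (Fin 2 → K)))
      ((.mk C : PGL2 K) • ptInf K) ((.mk C' : PGL2 K) • ptInf K) := Quotient.exact h
    obtain ⟨⟨g, hg⟩, h2⟩ := h1
    obtain ⟨D, rfl⟩ := (mem_Gam_iff inf g).mp hg
    exact ⟨D, (key D).mp h2⟩
  · rintro ⟨D, h⟩
    exact Quotient.sound (s := MulAction.orbitRel (Gam inf) (Projectivization K (Fin 2 → K)))
      ⟨⟨ofGL inf D, (mem_Gam_iff inf _).mpr ⟨D, rfl⟩⟩, (key D).mpr h⟩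

/-- The matrices of the vertices of the ray with point at infinity `C ∞`. -/
def rayMat (inf : Place Fq K) (C : Matrix.GeneralLinearGroup (Fin 2) K) (n : ℕ) :
    Matrix.GeneralLinearGroup (Fin 2) inf.Compl :=
  inf.glEmb (C * glDiag (Units.mk0 inf.unif (unif_ne_zero inf)) ^ n)

theorem cuspRay_mk (C : Matrix.GeneralLinearGroup (Fin 2) K) (n : ℕ) :
    cuspRay inf (.mk C) n = vert inf (rayMat inf C n) := by
  have : (.mk C * aElt inf ^ n : PGL2 K) =
      .mk (C * glDiag (Units.mk0 inf.unif (unif_ne_zero inf)) ^ n) := by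
    rw [map_mul, map_pow]
    rfl
  rw [cuspRay, this]
  rfl

/-- In the lattice of the n-th vertex of the ray, w has the constant coordinates (f, 0), while the
determinant decreases like the n-th power of the uniformizer. -/
theorem eventually_isShort_rayMat (C : Matrix.GeneralLinearGroup (Fin 2) K)
    {w : Fin 2 → inf.affineRing} {f : K}
    (hw : inf.affineRing.subtype ∘ w = f • C.1.mulVec ![1, 0]) (T : ℤ) :
    ∀ᶠ n in atTop, IsShort (rayMat inf C n) w T := by
  obtain ⟨d, hd⟩ := exists_v_eq_exp inf.val C.det_ne_zero
  obtain ⟨B, hB⟩ : ∃ B : ℤ, inf.val f ^ 2 ≤ WithZero.exp B := by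
    by_cases hf : f = 0
    · exact ⟨0, by simp [hf]⟩
    · obtain ⟨m, hm⟩ := exists_v_eq_exp inf.val hf
      exact ⟨2 • m, by rw [hm, ← WithZero.exp_nsmul]⟩
  filter_upwards [eventually_ge_atTop (B + d + T).toNat] with n hn
  have hmat : (rayMat inf C n).1 = (C.1 * diagOne (inf.unif ^ n)).map inf.emb := by
    rw [← diagOne_pow]
    rfl
  have hl : latVec (rayMat inf C n) w = ![inf.emb f, 0] := by
    refine eq_latVec ?_
    have h1 : (![inf.emb f, 0] : Fin 2 → inf.Compl) = inf.emb ∘ ![f, 0] := by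
      ext i; fin_cases i <;> simp
    have h2 : inf.affineHom ∘ w = inf.emb ∘ (inf.affineRing.subtype ∘ w) := rfl
    rw [hmat, h1, map_mulVec_comp, h2, hw, ← Matrix.mulVec_mulVec, ← Matrix.mulVec_smul]
    congr 3
    ext i
    fin_cases i <;> simp [diagOne]
  have hdet : Valued.v (rayMat inf C n).1.det = WithZero.exp (d - n) := by
    have h3 : ((C.1 * diagOne (inf.unif ^ n)).map inf.emb).det =
      inf.emb (C.1 * diagOne (inf.unif ^ n)).det := (RingHom.map_det inf.emb _).symm
    rw [hmat, h3, inf.v_emb, Matrix.det_mul, det_diagOne, map_mul, map_pow, hd, inf.val_unif,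
      ← WithZero.exp_nsmul, ← WithZero.exp_add]
    congr 1
    simp [sub_eq_add_neg]
  intro i
  rw [hl, hdet]
  fin_cases i
  · change Valued.v (inf.emb f) ^ 2 * _ ≤ _
    rw [inf.v_emb]
    refine (mul_le_mul_left hB _).trans ?_
    rw [← WithZero.exp_add, WithZero.exp_le_exp]
    have := Int.self_le_toNat (B + d + T)
    omega
  · simp

theorem exists_affineRing_smul (hK : IsGlobalFunctionField Fq K) {y₀ : K}
    (hy₀ : y₀ ∈ inf.affineRing) (ht : Transcendental Fq y₀)
    {u : Fin 2 → K} (hu : u ≠ 0) :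
    ∃ (f : K) (w : Fin 2 → inf.affineRing), f ∈ inf.affineRing ∧ f ≠ 0 ∧ w ≠ 0 ∧
      inf.affineRing.subtype ∘ w = f • u := by
  obtain ⟨f, hf, hf0, h0⟩ := inf.exists_mul_mem_affineRing hK hy₀ ht (u 0)
  obtain ⟨g, hg, hg0, h1⟩ := inf.exists_mul_mem_affineRing hK hy₀ ht (u 1)
  have h : inf.affineRing.subtype ∘ (![⟨g * (f * u 0), mul_mem hg h0⟩,
      ⟨f * (g * u 1), mul_mem hf h1⟩] : Fin 2 → inf.affineRing) = (f * g) • u := by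
    ext i
    fin_cases i
    · simp; ring
    · simp; ring
  refine ⟨f * g, _, mul_mem hf hg, mul_ne_zero hf0 hg0, ?_, h⟩
  intro hw
  rw [hw] at h
  have h2 : (f * g) • u = 0 := by
    rw [← h]
    ext i
    simp
  exact (smul_ne_zero (mul_ne_zero hf0 hg0) hu) h2

/-- The quotient is read off the second coordinate in the basis M, modulo ϖ. -/
theorem isElementarySublattice_mul_glDiag {F : Type*} [Field F] {O : Subring F} {ϖ : O}
    (M : Matrix.GeneralLinearGroup (Fin 2) F) (u : Fˣ) (hu : (u : F) = ϖ) :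
    IsElementarySublattice O ϖ (lattice O (M * glDiag u)) (lattice O M) := by
  have hN : ∀ c : Fin 2 → O, (fun i => ∑ j, (M * glDiag u).1 i j * (c j : F)) =
      fun i => ∑ j, M.1 i j * ((![c 0, ϖ * c 1] : Fin 2 → O) j : F) := by
    intro c
    ext i
    simp only [Units.val_mul, coe_glDiag, Fin.sum_univ_two, Matrix.mul_apply, diagOne, hu]
    simp
    ring
  have hc : ∀ (c : Fin 2 → O) (x : Fin 2 → F), (x = fun i => ∑ j, M.1 i j * (c j : F)) →
      (M⁻¹).1.mulVec x = fun i => (c i : F) := by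
    intro c x hx
    have : x = M.1.mulVec (fun i => (c i : F)) := hx
    rw [this, Matrix.mulVec_mulVec, Units.inv_mul, Matrix.one_mulVec]
  have hex : ∀ x : lattice O M, ∃ a : O, (a : F) = (M⁻¹).1.mulVec x.1 1 := by
    intro x
    obtain ⟨c, h⟩ := (mem_lattice_iff O M x.1).mp x.2
    exact ⟨c 1, by rw [hc c _ h]⟩
  choose a ha using hex
  let f : lattice O M →ₗ[O] O :=
    { toFun := a
      map_add' := fun x y => Subtype.ext (by
        rw [ha, Subring.coe_add, ha, ha, Submodule.coe_add, Matrix.mulVec_add, Pi.add_apply])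
      map_smul' := fun r x => Subtype.ext (by
        rw [ha, RingHom.id_apply, smul_eq_mul, Subring.coe_mul, ha, Submodule.coe_smul,
          show r • x.1 = (r : F) • x.1 from rfl, Matrix.mulVec_smul, Pi.smul_apply, smul_eq_mul]) }
  have hf : ∀ x, ((f x : O) : F) = (M⁻¹).1.mulVec x.1 1 := ha
  let g : lattice O M →ₗ[O] (O ⧸ Ideal.span ({ϖ} : Set O)) :=
    (Submodule.mkQ (Ideal.span ({ϖ} : Set O))).comp f
  have hsurj : Function.Surjective g := by
    refine (Submodule.mkQ_surjective _).comp fun b => ?_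
    refine ⟨⟨fun i => ∑ j, M.1 i j * ((![0, b] : Fin 2 → O) j : F),
      (mem_lattice_iff O M _).mpr ⟨_, rfl⟩⟩, Subtype.ext ?_⟩
    rw [hf, hc ![0, b] _ rfl]
    simp
  have hle : lattice O (M * glDiag u) ≤ lattice O M := by
    intro x hx
    obtain ⟨c, rfl⟩ := (mem_lattice_iff O _ x).mp hx
    rw [hN]
    exact (mem_lattice_iff O M _).mpr ⟨_, rfl⟩
  have hker : LinearMap.ker g = (lattice O (M * glDiag u)).submoduleOf (lattice O M) := by
    ext x
    rw [LinearMap.mem_ker, LinearMap.comp_apply, Submodule.mkQ_apply,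
      Submodule.Quotient.mk_eq_zero, Ideal.mem_span_singleton', Submodule.submoduleOf, Submodule.mem_comap,
      Submodule.subtype_apply, mem_lattice_iff]
    constructor
    · rintro ⟨b, hb⟩
      obtain ⟨c, h⟩ := (mem_lattice_iff O M x.1).mp x.2
      have h1 : (c 1 : F) = b * ϖ := by
        have := hf x
        rw [← hb, hc c _ h] at this
        exact this.symm
      refine ⟨![c 0, b], ?_⟩
      rw [hN, h]
      ext i
      simp only [Fin.sum_univ_two]
      simp [h1]
      left; ring
    · rintro ⟨c, h⟩
      rw [hN] at h
      refine ⟨c 1, Subtype.ext ?_⟩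
      rw [hf, hc _ _ h]
      simp [mul_comm]
  exact ⟨hle, ⟨(Submodule.quotEquivOfEq _ _ hker.symm).trans (g.quotKerEquivOfSurjective hsurj)⟩⟩

/-- Projection to the modular graph may collapse an edge, and this graph has no loops; hence the
alternative. -/
theorem vert_eq_or_adj (G : Matrix.GeneralLinearGroup (Fin 2) inf.Compl) {u : inf.Complˣ}
    (hu : Valued.v (u : inf.Compl) = WithZero.exp (-1)) :
    vert inf (G * glDiag u) = vert inf G ∨ (modGraph inf).Adj (vert inf (G * glDiag u)) (vert inf G) := by
  by_cases h : vert inf (G * glDiag u) = vert inf G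
  · exact Or.inl h
  · refine Or.inr ?_
    rw [modGraph, SimpleGraph.fromRel_adj]
    refine ⟨h, Or.inl ⟨_, _, rfl, rfl, ?_⟩⟩
    rw [btTree, SimpleGraph.fromRel_adj]
    have hu1 : Valued.v (u : inf.Compl) ≤ 1 := by
      rw [hu, ← WithZero.exp_zero, WithZero.exp_le_exp]
      norm_num
    exact ⟨fun h' => h (congrArg (modProj inf) h'), Or.inl ⟨_, _, rfl, rfl, ⟨u, hu1⟩, hu,
      isElementarySublattice_mul_glDiag G u rfl⟩⟩

theorem sameComponent_cuspRay {F : Set (ModVertex inf)} (C : Matrix.GeneralLinearGroup (Fin 2) K)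
    {m : ℕ} (hm : ∀ n ≥ m, cuspRay inf (.mk C) n ∉ F) {n : ℕ} (hn : m ≤ n) :
    SameComponent inf F (cuspRay inf (.mk C) m) (cuspRay inf (.mk C) n) := by
  induction n, hn using Nat.le_induction with
  | base => exact ⟨hm m le_rfl, hm m le_rfl, SimpleGraph.Reachable.refl _⟩
  | succ n hn ih =>
    obtain ⟨h1, h2, h3⟩ := ih
    have h4 := hm (n + 1) (by omega)
    refine ⟨h1, h4, h3.trans ?_⟩
    have hray : rayMat inf C (n + 1) = rayMat inf C n *
        glDiag (Units.map inf.emb.toMonoidHom (Units.mk0 inf.unif (unif_ne_zero inf))) := by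
      rw [rayMat, pow_succ, ← mul_assoc, map_mul]
      congr 1
      ext i j
      fin_cases i <;> fin_cases j <;> simp [glDiag]
    have h5 := vert_eq_or_adj (rayMat inf C n)
      (u := Units.map inf.emb.toMonoidHom (Units.mk0 inf.unif (unif_ne_zero inf))) (by
        change Valued.v (inf.emb inf.unif) = _
        rw [inf.v_emb, inf.val_unif])
    rw [← hray, ← cuspRay_mk, ← cuspRay_mk] at h5
    rcases h5 with h5 | h5
    · have : (⟨_, h2⟩ : (Fᶜ : Set (ModVertex inf))) = ⟨_, h4⟩ := Subtype.ext h5.symm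
      rw [this]
    · exact SimpleGraph.Adj.reachable (SimpleGraph.Adj.symm h5)

end

section

variable {Fq K : Type*} [Field Fq] [Field K] [Algebra Fq K] {inf : Place Fq K}

/-! ### The topology of the compactification -/

theorem cuspVert_mono {W W' : Set (Fin 2 → inf.affineRing)} (h : W ⊆ W') (T : ℤ) :
    cuspVert inf W T ⊆ cuspVert inf W' T := by
  rintro y ⟨G, hG, w, hw, hs⟩
  exact ⟨G, hG, w, h hw, hs⟩

theorem cuspRay_mem_cuspVert_of_eq {γ : PGL2 K} (h : cuspOf inf γ = cuspOf inf 1) (T : ℤ) :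
    ∀ᶠ n in atTop, cuspRay inf γ n ∈ cuspVert inf (orbitVec inf) T := by
  obtain ⟨C, rfl⟩ := Matrix.ProjGenLinGroup.mk_surjective γ
  rw [← map_one Matrix.ProjGenLinGroup.mk, cuspOf_eq_cuspOf] at h
  obtain ⟨D, a, h⟩ := h
  have h1 : inf.affineRing.subtype ∘ D.1.mulVec ![1, 0] = (a : K) • C.1.mulVec ![1, 0] := by
    rw [h, Units.val_one, Matrix.one_mulVec, ← map_mulVec_comp]
    congr 1
    ext i
    fin_cases i <;> simp
  filter_upwards [eventually_isShort_rayMat C h1 T] with n hn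
  rw [cuspRay_mk]
  exact ⟨_, rfl, _, ⟨D, rfl⟩, hn⟩

/-- Far along the ray towards C∞ a multiple of the first column of C is short. A vector of the orbit
of the first basis vector which is short at the same vertex is proportional to it, so C∞ is in the
Γ_∞-orbit of ∞. -/
theorem cuspOf_eq_of_cuspRay_mem (hK : IsGlobalFunctionField Fq K) {y₀ : K}
    (hy₀ : y₀ ∈ inf.affineRing) (ht : Transcendental Fq y₀) {γ : PGL2 K}
    (h : ∃ᶠ n in atTop, cuspRay inf γ n ∈ cuspVert inf (orbitVec inf) 1) :
    cuspOf inf γ = cuspOf inf 1 := by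
  obtain ⟨C, rfl⟩ := Matrix.ProjGenLinGroup.mk_surjective γ
  have hC : C.1.mulVec ![1, 0] ≠ 0 := glMulVec_ne_zero C fun h => one_ne_zero (congrFun h 0)
  obtain ⟨f, w, -, hf, hw, hfw⟩ := exists_affineRing_smul hK hy₀ ht hC
  obtain ⟨n, hn, hs⟩ := (h.and_eventually (eventually_isShort_rayMat C hfw 1)).exists
  rw [cuspRay_mk] at hn
  obtain ⟨_, ⟨D, rfl⟩, hD⟩ := exists_isShort_of_vert_mem hK isGLInvariant_orbitVec hn
  set e := D.1.mulVec ![1, 0] with he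
  have hpar := hs.det_eq_zero hK hD
  have he0 : e ≠ 0 := orbitVec_subset ⟨D, rfl⟩
  obtain ⟨a, ha0, ha⟩ : ∃ a : K, a ≠ 0 ∧
      a • (inf.affineRing.subtype ∘ w) = inf.affineRing.subtype ∘ e := by
    have hpar' : (w 0 : K) * e 1 = w 1 * e 0 := congrArg Subtype.val hpar
    have hwi : (w 0 : K) ≠ 0 ∨ (w 1 : K) ≠ 0 := by
      by_contra! h0
      refine hw (funext fun i => Subtype.ext ?_)
      fin_cases i
      exacts [h0.1, h0.2]
    have key : ∀ a : K, a • (inf.affineRing.subtype ∘ w) = inf.affineRing.subtype ∘ e →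
        a ≠ 0 := by
      rintro a h0 rfl
      refine he0 (funext fun i => Subtype.ext ?_)
      rw [zero_smul] at h0
      exact (congrFun h0 i).symm
    rcases hwi with h0 | h0
    · have h1 : ((e 0 : K) / w 0) • (inf.affineRing.subtype ∘ w) = inf.affineRing.subtype ∘ e := by
        ext i
        fin_cases i
        · simp [h0]
        · simp only [Fin.mk_one, Pi.smul_apply, Function.comp_apply, Subring.subtype_apply,
            smul_eq_mul]
          field_simp
          linear_combination -hpar'
      exact ⟨_, key _ h1, h1⟩
    · have h1 : ((e 1 : K) / w 1) • (inf.affineRing.subtype ∘ w) = inf.affineRing.subtype ∘ e := by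
        ext i
        fin_cases i
        · simp only [Fin.zero_eta, Pi.smul_apply, Function.comp_apply, Subring.subtype_apply,
            smul_eq_mul]
          field_simp
          linear_combination hpar'
        · simp [h0]
      exact ⟨_, key _ h1, h1⟩
  rw [← map_one Matrix.ProjGenLinGroup.mk, cuspOf_eq_cuspOf]
  refine ⟨D, Units.mk0 (a * f) (mul_ne_zero ha0 hf), ?_⟩
  rw [Units.val_mk0, mul_smul, ← hfw, ha, he, Units.val_one, Matrix.one_mulVec, ← map_mulVec_comp]
  congr 1
  ext i
  fin_cases i <;> simp

theorem SameComponent.symm {F : Set (ModVertex inf)} {y y' : ModVertex inf}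
    (h : SameComponent inf F y y') : SameComponent inf F y' y :=
  ⟨h.2.1, h.1, h.2.2.symm⟩

theorem SameComponent.trans {F : Set (ModVertex inf)} {y y' y'' : ModVertex inf}
    (h : SameComponent inf F y y') (h' : SameComponent inf F y' y'') : SameComponent inf F y y'' :=
  ⟨h.1, h'.2.1, h.2.2.trans h'.2.2⟩

theorem notMem_of_mem_endNhd {F : Set (ModVertex inf)} {z : Cusp inf} {y : ModVertex inf}
    (h : y ∈ endNhd inf F z) : y ∉ F := by
  obtain ⟨γ, -, h⟩ := h
  obtain ⟨n, hn⟩ := h.exists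
  exact hn.1

theorem exists_cuspOf_eq (z : Cusp inf) : ∃ C, cuspOf inf (.mk C) = z := by
  obtain ⟨q, rfl⟩ := Quotient.exists_rep z
  induction q with
  | h v hv =>
    obtain ⟨C, hC⟩ : ∃ C : Matrix.GeneralLinearGroup (Fin 2) K, C.1.mulVec ![1, 0] = v := by
      by_cases h0 : v 0 = 0
      · have h1 : v 1 ≠ 0 := fun h1 => hv (funext fun i => by fin_cases i; exacts [h0, h1])
        refine ⟨Matrix.GeneralLinearGroup.mkOfDetNeZero !![0, 1; v 1, 0] (by simpa using h1), ?_⟩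
        ext i
        fin_cases i <;> simp [Matrix.GeneralLinearGroup.mkOfDetNeZero, h0]
      · refine ⟨Matrix.GeneralLinearGroup.mkOfDetNeZero !![v 0, 0; v 1, 1] (by simpa using h0), ?_⟩
        ext i
        fin_cases i <;> simp [Matrix.GeneralLinearGroup.mkOfDetNeZero]
    refine ⟨C, congrArg (Quotient.mk _) ?_⟩
    subst hC
    rfl

/-- The vertices of the ray eventually have vectors too short for the vertices of F, so a tail of
the ray stays in one component of the complement. -/
theorem cuspRay_mem_endNhd (hK : IsGlobalFunctionField Fq K) {y₀ : K}
    (hy₀ : y₀ ∈ inf.affineRing) (ht : Transcendental Fq y₀) {F : Set (ModVertex inf)}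
    (hF : F.Finite) (C : Matrix.GeneralLinearGroup (Fin 2) K) :
    ∀ᶠ n in atTop, cuspRay inf (.mk C) n ∈ endNhd inf F (cuspOf inf (.mk C)) := by
  have hC : C.1.mulVec ![1, 0] ≠ 0 := glMulVec_ne_zero C fun h => one_ne_zero (congrFun h 0)
  obtain ⟨f, w, -, -, hw, hfw⟩ := exists_affineRing_smul hK hy₀ ht hC
  obtain ⟨T, -, hT⟩ := exists_disjoint_cuspVert hK hF
  obtain ⟨m, hm⟩ := eventually_atTop.mp (eventually_isShort_rayMat C hfw T)
  have hm' : ∀ n ≥ m, cuspRay inf (.mk C) n ∉ F := fun n hn h => by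
    refine Set.disjoint_left.mp hT h ?_
    rw [cuspRay_mk]
    exact ⟨_, rfl, w, hw, hm n hn⟩
  have hsame : ∀ n ≥ m, SameComponent inf F (cuspRay inf (.mk C) m) (cuspRay inf (.mk C) n) :=
    fun n hn => sameComponent_cuspRay C hm' hn
  filter_upwards [eventually_ge_atTop m] with n hn
  refine ⟨.mk C, rfl, ?_⟩
  filter_upwards [eventually_ge_atTop m] with k hk
  exact (hsame n hn).symm.trans (hsame k hk)

/-- The discrete topology makes p_∞ continuous, since PGL₂(O_∞) is open; all sets of vertices then
have clopen preimages in X_∞. -/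
instance : TopologicalSpace (ModVertex inf) := ⊥

instance : DiscreteTopology (ModVertex inf) := ⟨rfl⟩

theorem continuous_modProj_btv (inf : Place Fq K) :
    Continuous fun g : PGL2 inf.Compl => modProj inf (btv inf g) := by
  have : DiscreteTopology (BTVertex inf) :=
    QuotientGroup.discreteTopology (inf.isOpen_pglOf_integers)
  exact (continuous_of_discreteTopology (f := modProj inf)).comp continuous_quot_mk

theorem continuous_pInf : Continuous (pInf : XInf inf → ModVertex inf) :=
  (continuous_modProj_btv inf).quotient_lift _

/-- GL₂(K_∞) is σ-compact and maps continuously onto the discrete set of vertices. Countability is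
what allows X_∞ to be exhausted by the preimages of finite sets of vertices in a measure
computation. -/
theorem countable_modVertex (hK : IsGlobalFunctionField Fq K) (inf : Place Fq K) :
    Countable (ModVertex inf) := by
  have h1 : SigmaCompactSpace inf.Compl := by
    refine ⟨fun n => {x | Valued.v x ≤ WithZero.exp (n : ℤ)},
      fun n => inf.isCompact_setOf_v_le hK _, ?_⟩
    refine Set.eq_univ_of_forall fun x => Set.mem_iUnion.mpr ?_
    by_cases hx : x = 0
    · exact ⟨0, by simp [hx]⟩
    · obtain ⟨n, hn⟩ := exists_v_eq_exp Valued.v hx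
      exact ⟨n.toNat, by
        change Valued.v x ≤ _
        rw [hn, WithZero.exp_le_exp]
        exact Int.self_le_toNat n⟩
  have h2 : SigmaCompactSpace (Matrix (Fin 2) (Fin 2) inf.Compl) :=
    inferInstanceAs (SigmaCompactSpace (Fin 2 → Fin 2 → inf.Compl))
  have h3 : SigmaCompactSpace (Matrix (Fin 2) (Fin 2) inf.Compl)ᵐᵒᵖ :=
    MulOpposite.opHomeomorph.symm.isClosedEmbedding.sigmaCompactSpace
  have h4 : SigmaCompactSpace (Matrix.GeneralLinearGroup (Fin 2) inf.Compl) :=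
    (Units.isClosedEmbedding_embedProduct (α := Matrix (Fin 2) (Fin 2) inf.Compl)).sigmaCompactSpace
  have h5 : Continuous (vert inf) := (continuous_modProj_btv inf).comp continuous_pgl_mk
  have h6 : LindelofSpace (ModVertex inf) := by
    rw [← isLindelof_univ_iff, ← (vert_surjective inf).range_eq]
    exact isLindelof_range h5
  exact countable_of_Lindelof_of_discrete

theorem isOpen_pt_image {U : Set (XInf inf)} (hU : IsOpen U) :
    IsOpen (XHat.pt '' U : Set (XHat inf)) :=
  TopologicalSpace.isOpen_generateFrom_of_mem (Or.inl ⟨U, hU, rfl⟩)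

theorem isOpen_cuspNhd {F : Set (ModVertex inf)} (hF : F.Finite) (z : Cusp inf) :
    IsOpen (cuspNhd inf F z) :=
  TopologicalSpace.isOpen_generateFrom_of_mem (Or.inr ⟨F, z, hF, rfl⟩)

theorem pt_injective : Function.Injective (XHat.pt : XInf inf → XHat inf) := fun _ _ h => by
  injection h

theorem pt_mem_cuspNhd_iff {F : Set (ModVertex inf)} {z : Cusp inf} {x : XInf inf} :
    XHat.pt x ∈ cuspNhd inf F z ↔ pInf x ∈ endNhd inf F z := by
  constructor
  · rintro (⟨x', h, h'⟩ | ⟨γ, h, -⟩)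
    · rwa [pt_injective h]
    · exact absurd h (by simp)
  · exact fun h => Or.inl ⟨x, rfl, h⟩

theorem cusp_mem_cuspNhd_iff {F : Set (ModVertex inf)} {z z' : Cusp inf} :
    XHat.cusp z' ∈ cuspNhd inf F z ↔
      ∃ γ : PGL2 K, z' = cuspOf inf γ ∧ ∀ᶠ n in atTop, cuspRay inf γ n ∈ endNhd inf F z := by
  constructor
  · rintro (⟨x', h, -⟩ | ⟨γ, h, h'⟩)
    · exact absurd h (by simp)
    · exact ⟨γ, by injection h, h'⟩
  · rintro ⟨γ, rfl, h⟩
    exact Or.inr ⟨γ, rfl, h⟩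

theorem continuous_pt : Continuous (XHat.pt : XInf inf → XHat inf) := by
  refine continuous_generateFrom_iff.mpr ?_
  rintro _ (⟨U, hU, rfl⟩ | ⟨F, z, -, rfl⟩)
  · rwa [Set.preimage_image_eq _ pt_injective]
  · have : XHat.pt ⁻¹' cuspNhd inf F z = pInf ⁻¹' endNhd inf F z :=
      Set.ext fun x => pt_mem_cuspNhd_iff
    rw [this]
    exact (isOpen_discrete _).preimage continuous_pInf

theorem self_mem_cuspNhd (hK : IsGlobalFunctionField Fq K) {y₀ : K}
    (hy₀ : y₀ ∈ inf.affineRing) (ht : Transcendental Fq y₀) {F : Set (ModVertex inf)}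
    (hF : F.Finite) (z : Cusp inf) : XHat.cusp z ∈ cuspNhd inf F z := by
  obtain ⟨C, rfl⟩ := exists_cuspOf_eq z
  exact cusp_mem_cuspNhd_iff.mpr ⟨_, rfl, cuspRay_mem_endNhd hK hy₀ ht hF C⟩

/-- The basic neighbourhoods of the cusps defined by F itself avoid the preimage of F. -/
theorem isClopen_pt_image_preimage (hK : IsGlobalFunctionField Fq K) {y₀ : K}
    (hy₀ : y₀ ∈ inf.affineRing) (ht : Transcendental Fq y₀) {F : Set (ModVertex inf)}
    (hF : F.Finite) : IsClopen (XHat.pt '' (pInf ⁻¹' F) : Set (XHat inf)) := by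
  refine ⟨⟨?_⟩, isOpen_pt_image ((isOpen_discrete F).preimage continuous_pInf)⟩
  rw [isOpen_iff_mem_nhds]
  rintro (x | z) hx
  · refine mem_of_superset ((isOpen_pt_image ((isOpen_discrete Fᶜ).preimage
      continuous_pInf)).mem_nhds ⟨x, fun h => hx ⟨x, h, rfl⟩, rfl⟩) ?_
    rintro _ ⟨x', hx', rfl⟩ ⟨x'', hx'', h⟩
    exact hx' (pt_injective h ▸ hx'')
  · refine mem_of_superset ((isOpen_cuspNhd hF z).mem_nhds (self_mem_cuspNhd hK hy₀ ht hF z)) ?_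
    rintro _ hw ⟨x, hx', rfl⟩
    exact notMem_of_mem_endNhd (pt_mem_cuspNhd_iff.mp hw) hx'

/-- In the complement of a layer, the horoball is a union of components. -/
theorem SameComponent.mem_cuspVert (hK : IsGlobalFunctionField Fq K)
    {W : Set (Fin 2 → inf.affineRing)} (hW : IsGLInvariant W) {T : ℤ} {y y' : ModVertex inf}
    (h : SameComponent inf (cuspVert inf W T \ cuspVert inf W (T + 2)) y y')
    (hy : y ∈ cuspVert inf W (T + 2)) : y' ∈ cuspVert inf W (T + 2) := by
  obtain ⟨h1, h2, ⟨p⟩⟩ := h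
  have key : ∀ (a b : ((cuspVert inf W T \ cuspVert inf W (T + 2))ᶜ : Set (ModVertex inf))),
      ((modGraph inf).induce _).Walk a b → a.1 ∈ cuspVert inf W (T + 2) →
      b.1 ∈ cuspVert inf W (T + 2) := by
    intro a b p
    induction p with
    | nil => exact id
    | @cons a b c hab _ ih =>
      intro ha
      refine ih ?_
      have hb := mem_cuspVert_of_adj hK hW (SimpleGraph.induce_adj.mp hab) ha
      rw [add_sub_cancel_right] at hb
      by_contra hb'
      exact b.2 ⟨hb, hb'⟩
  exact key _ _ p hy

/-- Heights change by at most 2 along an edge, so no path crosses a layer of thickness 2: components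
of its complement lie inside or outside the horoball, and those inside only receive rays towards the
cusp Γ_∞∞. -/
theorem mem_endNhd_layer_iff (hK : IsGlobalFunctionField Fq K) {y₀ : K}
    (hy₀ : y₀ ∈ inf.affineRing) (ht : Transcendental Fq y₀) {T : ℤ} (hT : 1 ≤ T) {z : Cusp inf}
    {y : ModVertex inf} (h : y ∈ endNhd inf
      (cuspVert inf (orbitVec inf) T \ cuspVert inf (orbitVec inf) (T + 2)) z) :
    y ∈ cuspVert inf (orbitVec inf) T ↔ z = cuspOf inf 1 := by
  have hnot := notMem_of_mem_endNhd h
  obtain ⟨γ, rfl, h⟩ := h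
  constructor
  · intro hy
    have hy' : y ∈ cuspVert inf (orbitVec inf) (T + 2) := by
      by_contra h'
      exact hnot ⟨hy, h'⟩
    refine cuspOf_eq_of_cuspRay_mem hK hy₀ ht (Eventually.frequently ?_)
    filter_upwards [h] with n hn
    exact cuspVert_anti _ (by omega) (hn.mem_cuspVert hK isGLInvariant_orbitVec hy')
  · intro hz
    obtain ⟨n, hn, hn'⟩ := (h.and (cuspRay_mem_cuspVert_of_eq hz (T + 2))).exists
    exact cuspVert_anti _ (by omega) (hn.symm.mem_cuspVert hK isGLInvariant_orbitVec hn')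

/-- The neighbourhoods of the cusp `Γ_∞ ∞` given by the horoballs. -/
def horoNhd (inf : Place Fq K) (T : ℤ) : Set (XHat inf) :=
  XHat.pt '' cuspSet inf (orbitVec inf) T ∪ {XHat.cusp (cuspOf inf 1)}

/-- The finite layer of heights in [T, T + 2) defines a neighbourhood of each cusp, contained in the
horoball for the cusp Γ_∞∞ and disjoint from it for the others. -/
theorem isClopen_horoNhd (hK : IsGlobalFunctionField Fq K) {y₀ : K}
    (hy₀ : y₀ ∈ inf.affineRing) (ht : Transcendental Fq y₀) {T : ℤ} (hT : 1 ≤ T) :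
    IsClopen (horoNhd inf T) := by
  have hpt : ∀ x, XHat.pt x ∈ horoNhd inf T ↔ pInf x ∈ cuspVert inf (orbitVec inf) T := by
    intro x
    rw [horoNhd, ← preimage_cuspVert hK isGLInvariant_orbitVec]
    constructor
    · rintro (⟨x', h, h'⟩ | h)
      · rwa [← pt_injective h']
      · exact absurd h (by simp)
    · exact fun h => Or.inl ⟨x, h, rfl⟩
  have hcusp : ∀ z, XHat.cusp z ∈ horoNhd inf T ↔ z = cuspOf inf 1 := by
    intro z
    constructor
    · rintro (⟨x', h, h'⟩ | h)
      · exact absurd h' (by simp)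
      · injection h
    · rintro rfl
      exact Or.inr rfl
  have hF := finite_cuspVert_diff hK hy₀ ht T
  have hnhd : ∀ z w, w ∈ cuspNhd inf
      (cuspVert inf (orbitVec inf) T \ cuspVert inf (orbitVec inf) (T + 2)) z →
      (w ∈ horoNhd inf T ↔ z = cuspOf inf 1) := by
    rintro z (x | z') hw
    · rw [hpt, mem_endNhd_layer_iff hK hy₀ ht hT (pt_mem_cuspNhd_iff.mp hw)]
    · obtain ⟨γ, rfl, hγ⟩ := cusp_mem_cuspNhd_iff.mp hw
      rw [hcusp]
      have hiff : ∀ᶠ n in atTop, (cuspRay inf γ n ∈ cuspVert inf (orbitVec inf) T ↔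
          z = cuspOf inf 1) := by
        filter_upwards [hγ] with n hn
        exact mem_endNhd_layer_iff hK hy₀ ht hT hn
      constructor
      · intro h
        obtain ⟨n, h1, h2⟩ := (hiff.and (cuspRay_mem_cuspVert_of_eq h T)).exists
        exact h1.mp h2
      · intro h
        refine cuspOf_eq_of_cuspRay_mem hK hy₀ ht (Eventually.frequently ?_)
        filter_upwards [hiff] with n hn
        exact cuspVert_anti _ hT (hn.mpr h)
  constructor
  · refine ⟨isOpen_iff_mem_nhds.mpr ?_⟩
    rintro (x | z) hx
    · refine mem_of_superset ((isOpen_pt_image ((isOpen_discrete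
        (cuspVert inf (orbitVec inf) T)ᶜ).preimage continuous_pInf)).mem_nhds
          ⟨x, fun h => hx ((hpt x).mpr h), rfl⟩) ?_
      rintro _ ⟨x', hx', rfl⟩ h
      exact hx' ((hpt x').mp h)
    · refine mem_of_superset ((isOpen_cuspNhd hF z).mem_nhds (self_mem_cuspNhd hK hy₀ ht hF z)) ?_
      intro w hw h
      exact hx ((hcusp z).mpr ((hnhd z w hw).mp h))
  · refine isOpen_iff_mem_nhds.mpr ?_
    rintro (x | z) hx
    · refine mem_of_superset ((isOpen_pt_image ((isOpen_discrete
        (cuspVert inf (orbitVec inf) T)).preimage continuous_pInf)).mem_nhds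
          ⟨x, (hpt x).mp hx, rfl⟩) ?_
      rintro _ ⟨x', hx', rfl⟩
      exact (hpt x').mpr hx'
    · refine mem_of_superset ((isOpen_cuspNhd hF z).mem_nhds (self_mem_cuspNhd hK hy₀ ht hF z)) ?_
      intro w hw
      exact (hnhd z w hw).mpr ((hcusp z).mp hx)

theorem iInter_horoNhd (hK : IsGlobalFunctionField Fq K) :
    ⋂ n : ℕ, horoNhd inf (n + 1) = {XHat.cusp (cuspOf inf 1)} := by
  refine Set.Subset.antisymm ?_ (Set.singleton_subset_iff.mpr
    (Set.mem_iInter.mpr fun n => Or.inr rfl))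
  intro w hw
  have hw' := fun n => Set.mem_iInter.mp hw n
  rcases w with x | z
  · obtain ⟨T, hT⟩ := exists_notMem_cuspVert hK (pInf x)
    rcases hw' T.toNat with ⟨x', hx', h⟩ | h
    · rw [pt_injective h, ← preimage_cuspVert hK isGLInvariant_orbitVec] at hx'
      refine absurd (cuspVert_mono orbitVec_subset _ (cuspVert_anti _ ?_ hx')) hT
      have := Int.self_le_toNat T
      omega
    · exact absurd h (by simp)
  · rcases hw' 0 with ⟨x', -, h⟩ | h
    · exact absurd h (by simp)
    · exact h

/-! ### Escape of mass from lower bounds on the mass of the horoballs -/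

/-- The indicator function of a clopen set is continuous, hence a test function. -/
theorem tendsto_measure_of_isClopen {x : ℕ → XInf inf} {φ : ℕ → ℕ} {θ : Measure (XHat inf)}
    (hφ : ∀ f : XHat inf →ᵇ ℝ, Tendsto (fun n => ∫ w, f (XHat.pt w) ∂(periodicMeasure (x (φ n))))
      atTop (𝓝 (∫ w, f w ∂θ))) {Y : Set (XHat inf)} (hY : IsClopen Y) :
    Tendsto (fun n => (periodicMeasure (x (φ n))).real (XHat.pt ⁻¹' Y)) atTop (𝓝 (θ.real Y)) := by
  have h := hφ (BoundedContinuousFunction.indicator Y hY)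
  have h1 : ∀ w, BoundedContinuousFunction.indicator Y hY w = Y.indicator (1 : XHat inf → ℝ) w :=
    fun w => rfl
  have h2 : ∀ w, BoundedContinuousFunction.indicator Y hY (XHat.pt w) =
      (XHat.pt ⁻¹' Y).indicator (1 : XInf inf → ℝ) w := fun w => rfl
  simp_rw [h2] at h
  simp_rw [h1] at h
  rw [integral_indicator_one hY.isOpen.measurableSet] at h
  refine h.congr fun n => ?_
  rw [integral_indicator_one (hY.isOpen.preimage continuous_pt).measurableSet]

/-- A finite set F of vertices has no vector above some height T, so the limit measure gives mass at
most 1 − c to the clopen preimage of F. These preimages form a countable directed family with union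
X_∞, and the rest of the space consists of the cusps. -/
theorem uniformEscape_univ (hK : IsGlobalFunctionField Fq K) {y₀ : K}
    (hy₀ : y₀ ∈ inf.affineRing) (ht : Transcendental Fq y₀) {x : ℕ → XInf inf}
    (hx : ∀ n, IsPeriodic (x n)) {c : ℝ}
    (h : ∀ T ≥ 1, ∀ ε > 0, ∀ᶠ n in atTop,
      c - ε ≤ (periodicMeasure (x n)).real (cuspSet inf (nonzeroVec inf) T)) :
    UniformEscape x Set.univ c := by
  rintro θ ⟨hθ, φ, hφ, hlim⟩
  have := countable_modVertex hK inf
  have hfin : ∀ F : Finset (ModVertex inf),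
      θ.real (XHat.pt '' (pInf ⁻¹' (F : Set (ModVertex inf)))) ≤ 1 - c := by
    intro F
    have hcl := isClopen_pt_image_preimage hK hy₀ ht F.finite_toSet
    obtain ⟨T, hT, hdisj⟩ := exists_disjoint_cuspVert hK F.finite_toSet
    refine le_of_forall_pos_le_add fun ε hε => ?_
    refine le_of_tendsto (tendsto_measure_of_isClopen hlim hcl) ?_
    filter_upwards [hφ.tendsto_atTop.eventually (h T hT ε hε)] with n hn
    have hprob := (isOrbitMeasure_periodicMeasure (hx (φ n))).prob
    rw [Set.preimage_image_eq _ pt_injective]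
    rw [← preimage_cuspVert hK isGLInvariant_nonzeroVec] at hn
    have h1 : (pInf ⁻¹' (F : Set (ModVertex inf)) : Set (XInf inf)) ⊆
        (pInf ⁻¹' cuspVert inf (nonzeroVec inf) T)ᶜ := fun w hw hw' =>
      Set.disjoint_left.mp hdisj hw hw'
    have h2 := measureReal_mono (μ := periodicMeasure (x (φ n))) h1
    rw [probReal_compl_eq_one_sub
      ((isOpen_discrete _).preimage continuous_pInf).measurableSet] at h2
    linarith
  have hrange : (Set.range XHat.pt : Set (XHat inf)) =
      ⋃ F : Finset (ModVertex inf), XHat.pt '' (pInf ⁻¹' (F : Set (ModVertex inf))) := by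
    refine Set.Subset.antisymm ?_ (Set.iUnion_subset fun F => Set.image_subset_range _ _)
    rintro _ ⟨w, rfl⟩
    exact Set.mem_iUnion.mpr ⟨{pInf w}, w, by simp, rfl⟩
  have hdir : Directed (· ⊆ ·) fun F : Finset (ModVertex inf) =>
      (XHat.pt '' (pInf ⁻¹' (F : Set (ModVertex inf))) : Set (XHat inf)) := by
    classical
    intro F F'
    refine ⟨F ∪ F', Set.image_mono (Set.preimage_mono ?_),
      Set.image_mono (Set.preimage_mono ?_)⟩ <;> simp
  have hle : θ (Set.range XHat.pt) ≤ ENNReal.ofReal (1 - c) := by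
    rw [hrange, hdir.measure_iUnion]
    refine iSup_le fun F => ?_
    rw [← ENNReal.ofReal_toReal (measure_ne_top θ _)]
    exact ENNReal.ofReal_le_ofReal (hfin F)
  have hcompl : (XHat.cusp '' Set.univ : Set (XHat inf)) = (Set.range XHat.pt)ᶜ := by
    ext w
    rcases w with w | w <;> simp
  have hmeas : MeasurableSet (Set.range XHat.pt : Set (XHat inf)) := by
    rw [← Set.image_univ]
    exact (isOpen_pt_image isOpen_univ).measurableSet
  rw [hcompl]
  have h1 : θ.real (Set.range XHat.pt) ≤ 1 - c := by
    have h0 : 0 ≤ 1 - c := measureReal_nonneg.trans (hfin ∅)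
    exact ENNReal.toReal_le_of_le_ofReal h0 hle
  have h2 : c ≤ θ.real (Set.range XHat.pt)ᶜ := by
    rw [probReal_compl_eq_one_sub hmeas]
    linarith
  exact ENNReal.ofReal_le_of_le_toReal h2

/-- Each horoball, completed by its cusp, is clopen and keeps mass at least c in the limit; these
sets decrease to the cusp. -/
theorem uniformEscape_cusp (hK : IsGlobalFunctionField Fq K) {y₀ : K}
    (hy₀ : y₀ ∈ inf.affineRing) (ht : Transcendental Fq y₀) {x : ℕ → XInf inf} {c : ℝ}
    (h : ∀ T ≥ 1, ∀ ε > 0, ∀ᶠ n in atTop,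
      c - ε ≤ (periodicMeasure (x n)).real (cuspSet inf (orbitVec inf) T)) :
    UniformEscape x {cuspOf inf 1} c := by
  rintro θ ⟨hθ, φ, hφ, hlim⟩
  have hT : ∀ n : ℕ, ENNReal.ofReal c ≤ θ (horoNhd inf (n + 1)) := by
    intro n
    have hcl := isClopen_horoNhd hK hy₀ ht (T := n + 1) (by omega)
    refine ENNReal.ofReal_le_of_le_toReal (le_of_forall_pos_le_add fun ε hε => ?_)
    rw [← sub_le_iff_le_add]
    refine ge_of_tendsto (tendsto_measure_of_isClopen hlim hcl) ?_
    filter_upwards [hφ.tendsto_atTop.eventually (h (n + 1) (by omega) ε hε)] with k hk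
    have hpre : (XHat.pt ⁻¹' horoNhd inf (n + 1) : Set (XInf inf)) =
        cuspSet inf (orbitVec inf) (n + 1) := by
      rw [horoNhd, Set.preimage_union, Set.preimage_image_eq _ pt_injective]
      refine Set.union_eq_left.mpr fun w hw => ?_
      have hw' : XHat.pt w = XHat.cusp (cuspOf inf 1) := hw
      exact absurd hw' (by simp)
    rwa [hpre]
  rw [Set.image_singleton, ← iInter_horoNhd hK]
  have hanti : Antitone fun n : ℕ => horoNhd inf ((n : ℤ) + 1) := by
    intro m n hmn
    refine Set.union_subset_union_left _ (Set.image_mono ?_)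
    rw [← preimage_cuspVert hK isGLInvariant_orbitVec, ← preimage_cuspVert hK isGLInvariant_orbitVec]
    exact Set.preimage_mono (cuspVert_anti _ (by omega))
  rw [hanti.measure_iInter (fun n => (isClopen_horoNhd hK hy₀ ht
    (by omega)).isOpen.measurableSet.nullMeasurableSet) ⟨0, measure_ne_top _ _⟩]
  exact le_iInf hT

end

section

variable {Fq K : Type*} [Field Fq] [Field K] [Algebra Fq K] {inf ν : Place Fq K} {π : K}

/-! ### Asymptotic lower bound for the mass of the horoballs -/

/-- Here k = d_ν p^m with the least m for which a_k is divisible enough. Since the exponent m − 1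
fails, k is at most p times the optimal real value: this is the p in the denominator of the
constant. -/
theorem exists_small_glCoeffs (hK : IsGlobalFunctionField Fq K) (hν : ν ≠ inf) (p : ℕ)
    [Fact p.Prime] [CharP Fq p] {γ : Matrix.GeneralLinearGroup (Fin 2) inf.affineRing}
    (ha : ∀ k, 0 < k → (glCoeffs γ k).1 ≠ 0) (hΔ : glDiscr γ ≠ 0) {n : ℤ}
    (hn : 2 * (rIndex inf ν γ : ℤ) <
      eIndex inf ν γ * (2 * n + ν.ord ((glDiscr γ : inf.affineRing) : K))) :
    ∃ k : ℕ, 0 < k ∧ ν.val ((glCoeffs γ k).1 : K) ≤ WithZero.exp (-n) ∧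
      2 * (rIndex inf ν γ : ℤ) * k < dIndex inf ν γ * p * eIndex inf ν γ *
        (2 * n + ν.ord ((glDiscr γ : inf.affineRing) : K)) := by
  obtain ⟨hd, -⟩ := dIndex_spec (γ := γ) hK hν
  obtain ⟨hr, -⟩ := rIndex_spec hK hν ha hΔ
  have he : 0 < eIndex inf ν γ := eIndex_pos
  have hp : 1 < p := (Fact.out : p.Prime).one_lt
  set δ := ν.ord ((glDiscr γ : inf.affineRing) : K) with hδ
  set Q := (eIndex inf ν γ : ℤ) * (2 * n + δ) with hQ
  have hex : ∃ m : ℕ, Q ≤ 2 * rIndex inf ν γ * (p : ℤ) ^ m := by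
    refine ⟨Q.toNat, ?_⟩
    have h1 : Q.toNat < p ^ Q.toNat := Nat.lt_pow_self hp
    have h2 : (Q.toNat : ℤ) < (p : ℤ) ^ Q.toNat := by exact_mod_cast h1
    have h3 : (1 : ℤ) ≤ rIndex inf ν γ := by exact_mod_cast hr
    nlinarith [Int.self_le_toNat Q]
  classical
  -- The hypothesis on n excludes the exponent 0, so the preceding exponent exists and fails.
  obtain ⟨m, hm⟩ : ∃ m, Nat.find hex = m + 1 := by
    refine Nat.exists_eq_succ_of_ne_zero fun h0 => ?_
    have := Nat.find_spec hex
    rw [h0, pow_zero, mul_one] at this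
    omega
  have h1 := Nat.find_spec hex
  have h2 := Nat.find_min hex (m := m) (by omega)
  rw [hm] at h1
  have hk : 0 < dIndex inf ν γ * p ^ (m + 1) := Nat.mul_pos hd (pow_pos (by omega) _)
  refine ⟨dIndex inf ν γ * p ^ (m + 1), hk, ?_, ?_⟩
  · have h3 := two_mul_rIndex_mul_le hK hν p ha hΔ (m + 1)
    rw [← hδ] at h3
    have h4 : (eIndex inf ν γ : ℤ) * (2 * n + δ) ≤ eIndex inf ν γ *
        (2 * ν.ord ((glCoeffs γ (dIndex inf ν γ * p ^ (m + 1))).1 : K) + δ) := by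
      rw [← hQ]
      linarith
    have h5 := le_of_mul_le_mul_left h4 (by exact_mod_cast he)
    have h6 : ν.val ((glCoeffs γ (dIndex inf ν γ * p ^ (m + 1))).1 : K) ≠ 0 := by
      rw [Valuation.ne_zero_iff]
      exact fun h => ha _ hk (Subtype.ext h)
    rw [← WithZero.exp_log h6, WithZero.exp_le_exp]
    simp only [Place.ord] at h5
    omega
  · have h3 : 2 * (rIndex inf ν γ : ℤ) * (p : ℤ) ^ m < Q := not_le.mp h2
    have h4 : (0 : ℤ) < dIndex inf ν γ * p := by
      exact_mod_cast Nat.mul_pos hd (by omega)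
    have h5 := mul_lt_mul_of_pos_left h3 h4
    push_cast
    rw [mul_assoc _ (eIndex inf ν γ : ℤ), ← hQ]
    refine lt_of_eq_of_lt ?_ h5
    ring

/-- The lower bound for the mass of the points with a short vector in `W` along a sequence of
Hecke translates. -/
theorem eventually_le_measureReal_cuspSet (hK : IsGlobalFunctionField Fq K) (hν : ν ≠ inf)
    (p : ℕ) [Fact p.Prime] [CharP Fq p]
    (hπR : π ∈ inf.affineRing) (hπν : ν.ord π = 1)
    (hπS : ∀ y ∈ inf.sRing π, ν.val y ≤ 1 → y ∈ inf.affineRing)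
    {γ : Matrix.GeneralLinearGroup (Fin 2) inf.affineRing}
    {G₀ : Matrix.GeneralLinearGroup (Fin 2) inf.Compl} {c t₀ : inf.Complˣ}
    (h₀ : HasPeriod γ.1 G₀.1 (c : inf.Compl) t₀) {τ deg : ℕ}
    (ht₀ : Valued.v (t₀ : inf.Compl) = WithZero.exp (-(2 * τ : ℤ))) (hτ : 0 < τ)
    (hdeg : inf.val π = WithZero.exp (deg : ℤ)) {C : Matrix.GeneralLinearGroup (Fin 2) K}
    {z : Fin 2 → K} {W : Set (Fin 2 → inf.affineRing)} {x : ℕ → XInf inf}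
    (hper : ∀ n, IsPeriodic (x n)) {a b : ℕ}
    (hx : ∀ n, ∃ (S : Matrix.GeneralLinearGroup (Fin 2) K) (u : Fin 2 → inf.affineRing),
      IsRayMatrix inf ν π C (n + a) S ∧ u ≠ 0 ∧ u ∈ W ∧
      S.1.mulVec (inf.affineRing.subtype ∘ u) = z ∧
      x (n + b) = XInf.ofMat inf ((inf.glEmb S)⁻¹ * G₀)) {T : ℤ} (hT : 1 ≤ T) {ε : ℝ} (hε : 0 < ε) :
    ∀ᶠ n in atTop, (rIndex inf ν γ * deg / (τ * eIndex inf ν γ * dIndex inf ν γ) : ℝ) / p - ε ≤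
      (periodicMeasure (x n)).real (cuspSet inf W T) := by
  have ht₀' : Valued.v (t₀ : inf.Compl) < 1 := by
    rw [ht₀, ← WithZero.exp_zero, WithZero.exp_lt_exp]
    omega
  have ha : ∀ k, 0 < k → (glCoeffs γ k).1 ≠ 0 := fun k hk => h₀.glCoeffs_ne_zero ht₀' hk
  have hΔ : glDiscr γ ≠ 0 := h₀.glDiscr_ne_zero ht₀'
  obtain ⟨hd, -⟩ := dIndex_spec (γ := γ) hK hν
  obtain ⟨hr, -⟩ := rIndex_spec hK hν ha hΔ
  have he : 0 < eIndex inf ν γ := eIndex_pos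
  have hp : 0 < p := (Fact.out : p.Prime).pos
  obtain ⟨A, hA⟩ := exists_mass_bound hK hν hπR hπν hπS h₀ ht₀ hτ hdeg C z
  obtain ⟨δ, hδ⟩ : ∃ δ, δ = ν.ord ((glDiscr γ : inf.affineRing) : K) := ⟨_, rfl⟩
  obtain ⟨r, hr'⟩ : ∃ r, r = rIndex inf ν γ := ⟨_, rfl⟩
  obtain ⟨e, he'⟩ : ∃ e, e = eIndex inf ν γ := ⟨_, rfl⟩
  obtain ⟨d, hd'⟩ : ∃ d, d = dIndex inf ν γ := ⟨_, rfl⟩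
  have hsmall := fun n => exists_small_glCoeffs hK hν p ha hΔ (n := n)
  rw [← hr'] at hr
  rw [← he'] at he
  rw [← hd'] at hd
  rw [← hr', ← he', ← hd']
  rw [← hr', ← he', ← hd', ← hδ] at hsmall
  have hr1 : (1 : ℤ) ≤ r := by exact_mod_cast hr
  have he1 : (1 : ℤ) ≤ e := by exact_mod_cast he
  have hrR : (0 : ℝ) < r := by exact_mod_cast hr
  have heR : (0 : ℝ) < e := by exact_mod_cast he
  have hdR : (0 : ℝ) < d := by exact_mod_cast hd
  have hpR : (0 : ℝ) < p := by exact_mod_cast hp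
  have hτR : (0 : ℝ) < τ := by exact_mod_cast hτ
  set E : ℝ := τ * d * p * e with hE
  have hE0 : 0 < E := by positivity
  have hlim : Tendsto (fun n : ℕ => 2 * (((n + a : ℕ) : ℝ) + A) + δ) atTop atTop := by
    refine tendsto_atTop_add_const_right _ _ (Tendsto.const_mul_atTop (by norm_num)
      (tendsto_atTop_add_const_right _ _ ?_))
    exact tendsto_natCast_atTop_atTop.comp (tendsto_add_atTop_nat a)
  -- The first threshold permits the choice of k; the second makes the loss ε outweigh the bounded
  -- terms, which come from A, T and the valuation δ of the discriminant.
  obtain ⟨M, hM⟩ := eventually_atTop.mp ((hlim.eventually_gt_atTop (2 * r : ℝ)).and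
    (hlim.eventually_ge_atTop ((r * deg * (2 * A + δ) + 2 * r * (A + T)) / (ε * E) : ℝ)))
  filter_upwards [eventually_ge_atTop (M + b)] with n' hn'
  obtain ⟨n, rfl⟩ : ∃ n, n' = n + b := ⟨n' - b, by omega⟩
  obtain ⟨h1, h2⟩ := hM n (by omega)
  set Q : ℝ := 2 * (((n + a : ℕ) : ℝ) + A) + δ with hQ
  have h1' : 2 * (r : ℤ) < e * (2 * (((n + a : ℕ) : ℤ) + A) + δ) := by
    have h3 : (2 * r : ℤ) < 2 * (((n + a : ℕ) : ℤ) + A) + δ := by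
      rw [hQ] at h1
      exact_mod_cast h1
    nlinarith
  obtain ⟨k, hk, hval, hlt⟩ := hsmall _ h1'
  obtain ⟨S, u, hS, hu, huW, hz, hxn⟩ := hx n
  have hμ := isOrbitMeasure_periodicMeasure (hper (n + b))
  have hprob := hμ.prob
  have hmass := hA (n + a) S u T k (periodicMeasure (x (n + b))) W hS hu huW hz hk hval hT
    (by rw [← hxn]; exact hμ)
  have hmass' : 2 * (((n + a : ℕ) : ℝ) * deg - A - T) ≤
      2 * τ * k * (periodicMeasure (x (n + b))).real (cuspSet inf W T) := by
    have h3 := ENNReal.toReal_mono (ENNReal.mul_ne_top (ENNReal.natCast_ne_top _) (measure_ne_top _ _)) hmass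
    rw [ENNReal.toReal_mul, ENNReal.toReal_natCast, ENNReal.toReal_natCast] at h3
    have h4 : (2 * (((n + a : ℕ) : ℤ) * deg - A - T) : ℤ) ≤
      ((2 * (((n + a : ℕ) : ℤ) * deg - A - T)).toNat : ℤ) := Int.self_le_toNat _
    have h5 : ((2 * (((n + a : ℕ) : ℤ) * deg - A - T) : ℤ) : ℝ) ≤
      (((2 * (((n + a : ℕ) : ℤ) * deg - A - T)).toNat : ℤ) : ℝ) := by exact_mod_cast h4
    rw [Int.cast_natCast] at h5
    have h6 := h5.trans h3
    push_cast at h6 ⊢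
    exact h6
  set m := (periodicMeasure (x (n + b))).real (cuspSet inf W T) with hm
  have hm0 : 0 ≤ m := measureReal_nonneg
  have hlt' : 2 * (r : ℝ) * k ≤ d * p * e * Q := by
    have h3 : (2 * (r : ℤ) * k : ℤ) ≤ d * p * e * (2 * (((n + a : ℕ) : ℤ) + A) + δ) := hlt.le
    rw [hQ]
    exact_mod_cast h3
  have hQ0 : 0 < Q := lt_trans (by positivity) h1
  rw [div_le_iff₀ (by positivity)] at h2
  have hc : (r * deg / (τ * e * d) : ℝ) / p * E = r * deg := by
    rw [hE]
    field_simp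
  refine le_of_mul_le_mul_right ?_ (mul_pos hE0 hQ0)
  have h3 : 2 * (r : ℝ) * (((n + a : ℕ) : ℝ) * deg - A - T) ≤ m * (E * Q) := by
    have h4 : 2 * (r : ℝ) * (((n + a : ℕ) : ℝ) * deg - A - T) ≤ τ * m * (2 * r * k) := by
      nlinarith
    have h5 : τ * m * (2 * r * k) ≤ τ * m * (d * p * e * Q) :=
      mul_le_mul_of_nonneg_left hlt' (by positivity)
    refine h4.trans (h5.trans_eq ?_)
    rw [hE]
    ring
  refine le_trans ?_ h3
  have h4 : ((r * deg / (τ * e * d) : ℝ) / p - ε) * (E * Q) = r * deg * Q - Q * (ε * E) := by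
    linear_combination Q * hc
  rw [h4]
  have h5 : (r * deg * Q : ℝ) = 2 * r * (((n + a : ℕ) : ℝ) * deg) + r * deg * (2 * A + δ) := by
    rw [hQ]
    ring
  rw [h5]
  linarith

end

section

variable {Fq K : Type*} [Field Fq] [Field K] [Algebra Fq K] {inf ν : Place Fq K} {π : K}

/-! ### Rational and `S`-rational rays -/

theorem mulVec_e (A : Matrix (Fin 2) (Fin 2) K) : A.mulVec ![1, 0] = fun i => A i 0 := by
  ext i
  fin_cases i <;> simp

theorem mulVec_e_apply (A : Matrix (Fin 2) (Fin 2) K) (i : Fin 2) :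
    A.mulVec ![1, 0] i = A i 0 := congrFun (mulVec_e A) i

theorem exists_orbitVec_of_sRing (hK : IsGlobalFunctionField Fq K) (hν : ν ≠ inf)
    (hπR : π ∈ inf.affineRing) (hπν : ν.ord π = 1)
    (hπS : ∀ y ∈ inf.sRing π, ν.val y ≤ 1 → y ∈ inf.affineRing) {w : Fin 2 → K}
    (hw : ∀ i, w i ∈ inf.sRing π) {a b : K} (ha : a ∈ inf.sRing π) (hb : b ∈ inf.sRing π)
    (hab : a * w 0 + b * w 1 = 1) (hval : ∀ i, ν.val (w i) ≤ 1) (hone : ∃ i, ν.val (w i) = 1) :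
    ∃ u ∈ orbitVec inf, inf.affineRing.subtype ∘ u = w := by
  let u : Fin 2 → inf.affineRing := fun i => ⟨w i, hπS _ (hw i) (hval i)⟩
  obtain ⟨D, hD⟩ := exists_glMulVec_of_sRing hK hν hπR hπν hπS (u := u) hone ha hb hab
  exact ⟨u, ⟨D, hD⟩, rfl⟩

theorem inv_mul_entry {F : Type*} [Field F] (C : Matrix.GeneralLinearGroup (Fin 2) F) :
    (C⁻¹).1 0 0 * C.1 0 0 + (C⁻¹).1 0 1 * C.1 1 0 = 1 := by
  have h := congrFun (congrFun (C.inv_mul) 0) 0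
  rwa [Matrix.mul_apply, Fin.sum_univ_two, Matrix.one_apply_eq] at h

theorem max_val_eq_one_of_integral {κ : Matrix.GeneralLinearGroup (Fin 2) K}
    (h : ∀ i j, ν.val (κ.1 i j) ≤ 1) (h' : ∀ i j, ν.val ((κ⁻¹).1 i j) ≤ 1) :
    ∃ i, ν.val (κ.1 i 0) = 1 := by
  by_contra! hne
  have hlt : ∀ i, ν.val (κ.1 i 0) < 1 := fun i => lt_of_le_of_ne (h i 0) (hne i)
  have h1 : ν.val ((κ⁻¹).1 0 0 * κ.1 0 0 + (κ⁻¹).1 0 1 * κ.1 1 0) < 1 := by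
    refine Valuation.map_add_lt _ ?_ ?_ <;> rw [map_mul]
    · exact (mul_le_mul_left (h' _ _) _).trans_lt (by rw [one_mul]; exact hlt 0)
    · exact (mul_le_mul_left (h' _ _) _).trans_lt (by rw [one_mul]; exact hlt 1)
  rw [inv_mul_entry, map_one] at h1
  exact lt_irrefl _ h1

/-- `Γ_S ∞ = Γ_∞ ∞`. -/
theorem cuspOf_eq_of_mem_GamS (hK : IsGlobalFunctionField Fq K) (hν : ν ≠ inf)
    (hπR : π ∈ inf.affineRing) (hπν : ν.ord π = 1)
    (hπS : ∀ y ∈ inf.sRing π, ν.val y ≤ 1 → y ∈ inf.affineRing)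
    {C : Matrix.GeneralLinearGroup (Fin 2) K} (hC : ∀ i j, C.1 i j ∈ inf.sRing π)
    (hC' : ∀ i j, (C⁻¹).1 i j ∈ inf.sRing π) : cuspOf inf (.mk C) = cuspOf inf 1 := by
  -- The largest entry of the first column at ν gives the power of π that makes the column primitive
  -- at ν; it is already unimodular over R_∞[π⁻¹], hence becomes unimodular over R_∞.
  obtain ⟨m, hm, hmax⟩ : ∃ m, ν.val (C.1 m 0) ≠ 0 ∧ ∀ i, ν.val (C.1 i 0) ≤ ν.val (C.1 m 0) := by
    have key : ∀ m, (∀ i, ν.val (C.1 i 0) ≤ ν.val (C.1 m 0)) → ν.val (C.1 m 0) ≠ 0 := by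
      intro m hm h0
      have hz : ∀ i, C.1 i 0 = 0 := fun i => by
        have := hm i
        rwa [h0, nonpos_iff_eq_zero, Valuation.zero_iff] at this
      have := inv_mul_entry C
      rw [hz, hz, mul_zero, mul_zero, add_zero] at this
      exact zero_ne_one this
    rcases le_total (ν.val (C.1 0 0)) (ν.val (C.1 1 0)) with h | h
    · have : ∀ i, ν.val (C.1 i 0) ≤ ν.val (C.1 1 0) := fun i => by
        fin_cases i
        exacts [h, le_rfl]
      exact ⟨1, key 1 this, this⟩
    · have : ∀ i, ν.val (C.1 i 0) ≤ ν.val (C.1 0 0) := fun i => by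
        fin_cases i
        exacts [le_rfl, h]
      exact ⟨0, key 0 this, this⟩
  obtain ⟨j, hj⟩ : ∃ j : ℤ, ν.val (C.1 m 0) = WithZero.exp j := ⟨_, (WithZero.exp_log hm).symm⟩
  have hπ0 := ne_zero_of_ord_eq_one hπν
  have hscale : ∀ i, ν.val (π ^ j * C.1 i 0) = WithZero.exp (-j) * ν.val (C.1 i 0) := by
    intro i
    rw [map_mul, map_zpow₀, val_eq_of_ord_eq_one hπν, ← WithZero.exp_zsmul]
    simp
  have hone : ν.val (π ^ j * C.1 m 0) = 1 := by
    rw [hscale, hj, ← WithZero.exp_add, neg_add_cancel, WithZero.exp_zero]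
  obtain ⟨_, ⟨D, rfl⟩, hD⟩ := exists_orbitVec_of_sRing hK hν hπR hπν hπS
    (w := fun i => π ^ j * C.1 i 0) (fun i => mul_mem (zpow_mem_sRing hπR j) (hC i 0))
    (mul_mem (zpow_mem_sRing hπR (-j)) (hC' 0 0)) (mul_mem (zpow_mem_sRing hπR (-j)) (hC' 0 1))
    (by
      have h1 : π ^ (-j) * π ^ j = 1 := by rw [← zpow_add₀ hπ0, neg_add_cancel, zpow_zero]
      linear_combination inv_mul_entry C + ((C⁻¹).1 0 0 * C.1 0 0 + (C⁻¹).1 0 1 * C.1 1 0) * h1)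
    (fun i => by
      rw [← hone, hscale, hscale]
      exact mul_le_mul_right (hmax i) _) ⟨m, hone⟩
  rw [← map_one Matrix.ProjGenLinGroup.mk, cuspOf_eq_cuspOf]
  refine ⟨D, Units.mk0 _ (zpow_ne_zero j hπ0), ?_⟩
  rw [Units.val_mk0, mulVec_e, Units.val_one, Matrix.one_mulVec]
  have h1 : (![1, 0] : Fin 2 → K) = inf.affineRing.subtype ∘ ![1, 0] := by
    ext i
    fin_cases i <;> simp
  rw [h1, map_mulVec_comp, hD]
  rfl

theorem IsRayMatrix.inv_mul_mulVec {C S : Matrix.GeneralLinearGroup (Fin 2) K} {N : ℕ} :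
    (S⁻¹ * C).1.mulVec ![1, 0] =
      (S⁻¹ * C * glDiag (Units.mk0 ν.unif (unif_ne_zero ν)) ^ N).1.mulVec ![1, 0] := by
  rw [Units.val_mul (S⁻¹ * C), coe_glDiag_unif_pow, ← Matrix.mulVec_mulVec]
  congr 1
  ext i
  fin_cases i <;> simp [diagOne]

/-- The vector attached to an `S`-rational ray. -/
theorem IsRayMatrix.exists_orbitVec (hK : IsGlobalFunctionField Fq K) (hν : ν ≠ inf)
    (hπR : π ∈ inf.affineRing) (hπν : ν.ord π = 1)
    (hπS : ∀ y ∈ inf.sRing π, ν.val y ≤ 1 → y ∈ inf.affineRing)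
    {C S : Matrix.GeneralLinearGroup (Fin 2) K} {N : ℕ} (h : IsRayMatrix inf ν π C N S)
    (hC : ∀ i j, C.1 i j ∈ inf.sRing π) (hC' : ∀ i j, (C⁻¹).1 i j ∈ inf.sRing π) :
    ∃ u ∈ orbitVec inf, S.1.mulVec (inf.affineRing.subtype ∘ u) = C.1.mulVec ![1, 0] := by
  -- Multiplication by diag(1, ϖ^N) preserves the first column. So this column is unimodular over
  -- R_∞[π⁻¹], because of S⁻¹C, and primitive at ν, because of GL₂(O_ν).
  have hcol : ∀ i, (S⁻¹ * C).1 i 0 =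
      (S⁻¹ * C * glDiag (Units.mk0 ν.unif (unif_ne_zero ν)) ^ N).1 i 0 := by
    intro i
    have := congrFun (IsRayMatrix.inv_mul_mulVec (ν := ν) (C := C) (S := S) (N := N)) i
    rwa [mulVec_e_apply, mulVec_e_apply] at this
  obtain ⟨u, hu, hu'⟩ := exists_orbitVec_of_sRing hK hν hπR hπν hπS
    (w := (S⁻¹ * C).1.mulVec ![1, 0]) (a := ((S⁻¹ * C)⁻¹).1 0 0) (b := ((S⁻¹ * C)⁻¹).1 0 1)
    (fun i => by
      rw [mulVec_e_apply]
      exact mul_mem_of_forall_mem h.inv_mem hC i 0)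
    (by rw [mul_inv_rev, inv_inv]; exact mul_mem_of_forall_mem hC' h.mem 0 0)
    (by rw [mul_inv_rev, inv_inv]; exact mul_mem_of_forall_mem hC' h.mem 0 1)
    (by rw [mulVec_e_apply, mulVec_e_apply]; exact inv_mul_entry _)
    (fun i => by rw [mulVec_e_apply, hcol]; exact h.val_le i 0)
    (by
      obtain ⟨i, hi⟩ := max_val_eq_one_of_integral h.val_le h.val_inv_le
      exact ⟨i, by rw [mulVec_e_apply, hcol]; exact hi⟩)
  refine ⟨u, hu, ?_⟩
  rw [hu', Matrix.mulVec_mulVec, ← Units.val_mul, mul_inv_cancel_left]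

/-- The vector attached to a rational ray. -/
theorem IsRayMatrix.exists_nonzeroVec (hν : ν ≠ inf)
    (hπS : ∀ y ∈ inf.sRing π, ν.val y ≤ 1 → y ∈ inf.affineRing)
    {C S : Matrix.GeneralLinearGroup (Fin 2) K} {N : ℕ} (h : IsRayMatrix inf ν π C N S) {f : K}
    {w : Fin 2 → inf.affineRing} (hf : f ∈ inf.affineRing) (hw : w ≠ 0)
    (hfw : inf.affineRing.subtype ∘ w = f • C.1.mulVec ![1, 0]) :
    ∃ u ∈ nonzeroVec inf, S.1.mulVec (inf.affineRing.subtype ∘ u) = inf.affineRing.subtype ∘ w := by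
  set y := (S⁻¹).1.mulVec (inf.affineRing.subtype ∘ w) with hy
  have hyS : ∀ i, y i ∈ inf.sRing π := by
    intro i
    rw [hy, Matrix.mulVec, dotProduct]
    exact sum_mem fun j _ => mul_mem (h.inv_mem i j) (mem_sRing_of_mem_affineRing (w j).2)
  have hyv : ∀ i, ν.val (y i) ≤ 1 := by
    intro i
    rw [hy, hfw, Matrix.mulVec_smul, Matrix.mulVec_mulVec, ← Units.val_mul,
      IsRayMatrix.inv_mul_mulVec (ν := ν) (N := N), Pi.smul_apply, mulVec_e_apply, smul_eq_mul, map_mul]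
    exact mul_le_one' (val_le_one_of_mem_affineRing hν ⟨f, hf⟩) (h.val_le i 0)
  have hSy : S.1.mulVec y = inf.affineRing.subtype ∘ w := by
    rw [hy, Matrix.mulVec_mulVec, Units.mul_inv, Matrix.one_mulVec]
  refine ⟨fun i => ⟨y i, hπS _ (hyS i) (hyv i)⟩, fun h0 => hw ?_, hSy⟩
  have hy0 : y = 0 := funext fun i => congrArg Subtype.val (congrFun h0 i)
  rw [hy0, Matrix.mulVec_zero] at hSy
  exact funext fun i => Subtype.ext (congrFun hSy i).symm

/-- The scalar is a quotient of two entries, so it descends from L to F. -/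
theorem exists_smul_eq_of_map {F L : Type*} [Field F] [Field L] (f : F →+* L)
    {A D : Matrix (Fin 2) (Fin 2) F} {c : L} (hD : D ≠ 0) (h : A.map f = c • D.map f) :
    ∃ k : F, A = k • D := by
  obtain ⟨i, j, hij⟩ : ∃ i j, D i j ≠ 0 := by
    by_contra! h0
    exact hD (Matrix.ext h0)
  have h1 : ∀ i j, f (A i j) = c * f (D i j) := fun i j => by
    have := congrFun (congrFun h i) j
    rwa [Matrix.map_apply, Matrix.smul_apply, Matrix.map_apply, smul_eq_mul] at this
  refine ⟨A i j / D i j, Matrix.ext fun a b => f.injective ?_⟩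
  have h2 : f (D i j) ≠ 0 := (map_ne_zero f).mpr hij
  rw [Matrix.smul_apply, smul_eq_mul, map_mul, map_div₀, h1, h1]
  field_simp

/-- Two rays with the same vertices far away have the same cusp. -/
theorem cuspOf_eq_of_isRayMatrix (hν : ν ≠ inf)
    {G₀ : Matrix.GeneralLinearGroup (Fin 2) inf.Compl} {C C' : Matrix.GeneralLinearGroup (Fin 2) K}
    {a a' : ℕ} (h : ∀ n : ℕ, ∃ S S', IsRayMatrix inf ν π C (n + a) S ∧
      IsRayMatrix inf ν π C' (n + a') S' ∧
      XInf.ofMat inf ((inf.glEmb S)⁻¹ * G₀) = XInf.ofMat inf ((inf.glEmb S')⁻¹ * G₀)) :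
    cuspOf inf (.mk C) = cuspOf inf (.mk C') := by
  obtain ⟨M, hM⟩ : ∃ M, M = C'⁻¹ * C := ⟨_, rfl⟩
  -- Equality of the points gives M diag(1, ϖ^(n+a)) = k diag(1, ϖ^(n+a')) X with X in GL₂(O_ν),
  -- since GL₂(R_∞) ⊆ GL₂(O_ν). The determinant fixes the valuation of k independently of n, so the
  -- lower left entry of M is divisible by ever higher powers of ϖ and vanishes: M fixes ∞.
  have key : ∀ n : ℕ, ν.val (M.1 1 0) ^ 2 * WithZero.exp (2 * (n + a' : ℤ)) ≤
      ν.val M.1.det * WithZero.exp ((a' : ℤ) - a) := by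
    intro n
    obtain ⟨S, S', hS, hS', hx⟩ := h n
    obtain ⟨D, c, hD⟩ := XInf.ofMat_eq_ofMat.mp hx
    obtain ⟨E, hE⟩ : ∃ E, E = Matrix.GeneralLinearGroup.map inf.affineRing.subtype D := ⟨_, rfl⟩
    have h1 : (S'⁻¹ * S).1.map inf.emb = (c : inf.Compl) • E.1.map inf.emb := by
      have h2 : (inf.glEmb (S'⁻¹ * S)).1 = (c : inf.Compl) • D.1.map inf.affineHom := by
        have h3 : ((inf.glEmb S)⁻¹ * G₀).1 * ((G₀⁻¹ * inf.glEmb S)).1 = 1 := by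
          rw [← Units.val_mul, mul_assoc, mul_inv_cancel_left, inv_mul_cancel, Units.val_one]
        have h4 := congrArg (fun A => A * (G₀⁻¹ * inf.glEmb S).1) hD
        simp only [smul_mul_assoc, mul_assoc (D.1.map inf.affineHom), h3, mul_one] at h4
        rw [← h4, ← Units.val_mul, mul_assoc, mul_inv_cancel_left, map_mul, map_inv]
      rw [hE]
      exact h2
    obtain ⟨k, hk⟩ := exists_smul_eq_of_map inf.emb (Units.ne_zero E) h1
    obtain ⟨κ, hκ⟩ : ∃ κ, κ = S⁻¹ * C * glDiag (Units.mk0 ν.unif (unif_ne_zero ν)) ^ (n + a) :=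
      ⟨_, rfl⟩
    obtain ⟨κ', hκ'⟩ : ∃ κ, κ = S'⁻¹ * C' * glDiag (Units.mk0 ν.unif (unif_ne_zero ν)) ^ (n + a') :=
      ⟨_, rfl⟩
    have hEv : ∀ (E : Matrix.GeneralLinearGroup (Fin 2) inf.affineRing) i j, ν.val
        ((Matrix.GeneralLinearGroup.map inf.affineRing.subtype E).1 i j) ≤ 1 := fun E i j =>
      val_le_one_of_mem_affineRing hν (E.1 i j)
    have hdet1 : ∀ A : Matrix.GeneralLinearGroup (Fin 2) K, (∀ i j, ν.val (A.1 i j) ≤ 1) →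
        (∀ i j, ν.val ((A⁻¹).1 i j) ≤ 1) → ν.val A.1.det = 1 := by
      intro A hA hA'
      refine le_antisymm (v_det_le_one _ hA) ?_
      have h2 := congrArg ν.val (det_mul_det_inv A)
      rw [map_mul, map_one] at h2
      rw [← h2]
      exact mul_le_of_le_one_right' (v_det_le_one _ hA')
    have hXv : ∀ i j, ν.val ((κ'⁻¹ * E * κ).1 i j) ≤ 1 := by
      have hmul : ∀ A B : Matrix.GeneralLinearGroup (Fin 2) K, (∀ i j, ν.val (A.1 i j) ≤ 1) →
          (∀ i j, ν.val (B.1 i j) ≤ 1) → ∀ i j, ν.val ((A * B).1 i j) ≤ 1 := by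
        intro A B hA hB i j
        rw [Units.val_mul, Matrix.mul_apply]
        exact Valuation.map_sum_le _ fun l _ => by
          rw [map_mul]
          exact mul_le_one' (hA i l) (hB l j)
      refine hmul _ _ (hmul _ _ ?_ ?_) ?_
      · rw [hκ']; exact hS'.val_inv_le
      · rw [hE]; exact hEv D
      · rw [hκ]; exact hS.val_le
    have hXd : ν.val (κ'⁻¹ * E * κ).1.det = 1 := by
      rw [Units.val_mul, Units.val_mul, Matrix.det_mul, Matrix.det_mul, map_mul, map_mul,
        hdet1 κ'⁻¹ (by rw [hκ']; exact hS'.val_inv_le)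
          (by rw [inv_inv, hκ']; exact hS'.val_le),
        hdet1 E (by rw [hE]; exact hEv D) (by rw [hE, ← map_inv]; exact hEv D⁻¹),
        hdet1 κ (by rw [hκ]; exact hS.val_le) (by rw [hκ]; exact hS.val_inv_le), one_mul, one_mul]
    have hgrp : M * glDiag (Units.mk0 ν.unif (unif_ne_zero ν)) ^ (n + a) =
        glDiag (Units.mk0 ν.unif (unif_ne_zero ν)) ^ (n + a') * (κ'⁻¹ * (S'⁻¹ * S) * κ) := by
      rw [hM, hκ, hκ']
      group
    have hmat : M.1 * diagOne (ν.unif ^ (n + a)) =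
        diagOne (ν.unif ^ (n + a')) * (k • (κ'⁻¹ * E * κ).1) := by
      have h2 := congrArg Units.val hgrp
      rw [Units.val_mul, Units.val_mul, Units.val_mul, Units.val_mul κ'⁻¹, hk,
        coe_glDiag_unif_pow, coe_glDiag_unif_pow, mul_smul_comm, smul_mul_assoc, ← Units.val_mul,
        ← Units.val_mul] at h2
      exact h2
    have h10 : M.1 1 0 = ν.unif ^ (n + a') * (k * (κ'⁻¹ * E * κ).1 1 0) := by
      have h2 := congrFun (congrFun hmat 1) 0
      rw [Matrix.mul_apply, Matrix.mul_apply, Fin.sum_univ_two, Fin.sum_univ_two] at h2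
      simpa [diagOne] using h2
    have hdet : M.1.det * ν.unif ^ (n + a) =
        ν.unif ^ (n + a') * (k ^ 2 * (κ'⁻¹ * E * κ).1.det) := by
      have h2 := congrArg Matrix.det hmat
      rwa [Matrix.det_mul, Matrix.det_mul, det_diagOne, det_diagOne, Matrix.det_smul,
        Fintype.card_fin] at h2
    have hu : ∀ l : ℕ, ν.val (ν.unif ^ l) = WithZero.exp (-(l : ℤ)) := by
      intro l
      rw [map_pow, ν.val_unif, ← WithZero.exp_nsmul]
      simp
    have hdetv : ν.val k ^ 2 = ν.val M.1.det * WithZero.exp ((a' : ℤ) - a) := by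
      have h2 := congrArg ν.val hdet
      rw [map_mul, map_mul, map_mul, hXd, mul_one, hu, hu, map_pow] at h2
      have h3 : WithZero.exp ((n + a' : ℕ) : ℤ) * WithZero.exp (-((n + a' : ℕ) : ℤ)) =
          (1 : ℤᵐ⁰) := by rw [← WithZero.exp_add, add_neg_cancel, WithZero.exp_zero]
      calc ν.val k ^ 2 = WithZero.exp ((n + a' : ℕ) : ℤ) *
            (WithZero.exp (-((n + a' : ℕ) : ℤ)) * ν.val k ^ 2) := by rw [← mul_assoc, h3, one_mul]
        _ = _ := by
            rw [← h2, mul_left_comm, ← WithZero.exp_add]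
            congr 2
            push_cast
            ring
    rw [← hdetv, h10, map_mul, map_mul, hu, mul_pow, mul_pow, ← WithZero.exp_nsmul]
    calc WithZero.exp (2 • -((n + a' : ℕ) : ℤ)) * (ν.val k ^ 2 *
          ν.val ((κ'⁻¹ * E * κ).1 1 0) ^ 2) * WithZero.exp (2 * (n + a' : ℤ))
        = ν.val k ^ 2 * ν.val ((κ'⁻¹ * E * κ).1 1 0) ^ 2 *
            (WithZero.exp (2 • -((n + a' : ℕ) : ℤ)) * WithZero.exp (2 * (n + a' : ℤ))) := by
          rw [mul_comm (WithZero.exp _), mul_assoc]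
      _ = ν.val k ^ 2 * ν.val ((κ'⁻¹ * E * κ).1 1 0) ^ 2 := by
          have h2 : (2 • -((n + a' : ℕ) : ℤ) + 2 * (n + a' : ℤ)) = 0 := by
            rw [nsmul_eq_mul]
            push_cast
            ring
          rw [← WithZero.exp_add, h2, WithZero.exp_zero, mul_one]
      _ ≤ ν.val k ^ 2 := mul_le_of_le_one_right' (pow_le_one₀ zero_le (hXv 1 0))
  have hM10 : M.1 1 0 = 0 := by
    by_contra h0
    obtain ⟨m, hm⟩ := exists_v_eq_exp ν.val h0
    obtain ⟨d, hd⟩ := exists_v_eq_exp ν.val M.det_ne_zero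
    have h1 := key (d + a' - a - 2 * m + 1).toNat
    rw [hm, hd, ← WithZero.exp_nsmul, ← WithZero.exp_add, ← WithZero.exp_add,
      WithZero.exp_le_exp, nsmul_eq_mul] at h1
    push_cast at h1
    omega
  have hM00 : M.1 0 0 ≠ 0 := by
    intro h0
    have := M.det_ne_zero
    rw [Matrix.det_fin_two, hM10, h0] at this
    simp at this
  refine (cuspOf_eq_cuspOf.mpr ⟨1, Units.mk0 _ hM00, ?_⟩).symm
  rw [Units.val_mk0, Units.val_one, Matrix.map_one _ (map_zero _) (map_one _), Matrix.one_mulVec,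
    ← Matrix.mulVec_smul]
  have h1 : M.1 0 0 • ![1, 0] = M.1.mulVec ![1, 0] := by
    ext i
    fin_cases i <;> simp [hM10]
  rw [h1, Matrix.mulVec_mulVec, ← Units.val_mul, hM, mul_inv_cancel_left]

end

section

variable {Fq K : Type*} [Field Fq] [Field K] [Algebra Fq K] {inf ν : Place Fq K} {π : K}

/-! ### Change of base point -/

theorem Gam_le_GamS (inf : Place Fq K) (π : K) : Gam inf ≤ GamS inf π := by
  intro g hg
  obtain ⟨M, rfl⟩ := (mem_Gam_iff inf g).mp hg
  exact ⟨.mk (Matrix.GeneralLinearGroup.map (Subring.inclusion (S := inf.affineRing)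
    (T := inf.sRing π) fun x hx => mem_sRing_of_mem_affineRing hx) M), rfl⟩

theorem exists_of_mem_GamS {γ : PGL2 K} (h : γ ∈ GamS inf π) :
    ∃ C : Matrix.GeneralLinearGroup (Fin 2) K, γ = .mk C ∧ (∀ i j, C.1 i j ∈ inf.sRing π) ∧
      ∀ i j, (C⁻¹).1 i j ∈ inf.sRing π := by
  obtain ⟨s, rfl⟩ := h
  obtain ⟨s, rfl⟩ := Matrix.ProjGenLinGroup.mk_surjective s
  refine ⟨Matrix.GeneralLinearGroup.map (inf.sRing π).subtype s, rfl, fun i j => (s.1 i j).2, ?_⟩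
  rw [← map_inv]
  exact fun i j => ((s⁻¹).1 i j).2

theorem cuspOf_mul_of_mem_Gam {δ : PGL2 K} (hδ : δ ∈ Gam inf) (γ : PGL2 K) :
    cuspOf inf (δ * γ) = cuspOf inf γ :=
  Quotient.sound (s := MulAction.orbitRel (Gam inf) (Projectivization K (Fin 2 → K)))
    ⟨⟨δ, hδ⟩, smul_smul δ γ (ptInf K)⟩

/-- Changing the representative g by δ in Γ_∞ translates the end by δ, which does not change its
cusp. -/
theorem ConvergesTo.exists_of_mk_eq {g g₀ : PGL2 inf.Compl} {γ : PGL2 K} {x : ℕ → XInf inf}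
    (h : ConvergesTo inf ν π g γ x) (hg : XInf.mk inf g = XInf.mk inf g₀) :
    ∃ δ ∈ Gam inf, ConvergesTo inf ν π g₀ (δ * γ) x := by
  obtain ⟨δ, hδ, hδg⟩ := XInf.mk_eq_mk.mp hg
  obtain ⟨a, b, h⟩ := h
  refine ⟨δ, hδ, a, b, fun n => ?_⟩
  obtain ⟨s, hs, hy, hx⟩ := h n
  refine ⟨δ * s, mul_mem (Gam_le_GamS inf π hδ) hs, ?_, ?_⟩
  · have h1 := congrArg (fun y : BTVertex ν => ν.toG δ • y) hy
    have h2 : ∀ t : PGL2 K, ν.toG δ • btv ν (ν.toG t) = btv ν (ν.toG (δ * t)) := fun t => by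
      rw [map_mul]
      rfl
    simp only [h2] at h1
    rw [← h1, mul_assoc]
  · have hg₀ : g₀ = inf.toG δ * g := by
      rw [show inf.toG δ = g₀ * g⁻¹ from hδg, inv_mul_cancel_right]
    rw [hx, hg₀, map_mul, mul_inv_rev, mul_assoc, inv_mul_cancel_left]

theorem ConvergesTo.exists_isRayMatrix (hπR : π ∈ inf.affineRing) (hπν : ν.ord π = 1)
    {G₀ : Matrix.GeneralLinearGroup (Fin 2) inf.Compl} {C : Matrix.GeneralLinearGroup (Fin 2) K}
    {x : ℕ → XInf inf} (h : ConvergesTo inf ν π (.mk G₀) (.mk C) x) :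
    ∃ a b : ℕ, ∀ n, ∃ S, IsRayMatrix inf ν π C (n + a) S ∧
      x (n + b) = XInf.ofMat inf ((inf.glEmb S)⁻¹ * G₀) := by
  obtain ⟨a, b, h⟩ := h
  exact ⟨a, b, fun n => HeckeEscape.exists_isRayMatrix hπR hπν (h n)⟩

theorem ConvergesTo.cuspOf_eq (hν : ν ≠ inf) (hπR : π ∈ inf.affineRing) (hπν : ν.ord π = 1)
    {g : PGL2 inf.Compl} {γ γ' : PGL2 K} {x : ℕ → XInf inf}
    (h : ConvergesTo inf ν π g γ x) (h' : ConvergesTo inf ν π g γ' x) :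
    cuspOf inf γ = cuspOf inf γ' := by
  obtain ⟨G₀, rfl⟩ := Matrix.ProjGenLinGroup.mk_surjective g
  obtain ⟨C, rfl⟩ := Matrix.ProjGenLinGroup.mk_surjective γ
  obtain ⟨C', rfl⟩ := Matrix.ProjGenLinGroup.mk_surjective γ'
  obtain ⟨a, b, h⟩ := h.exists_isRayMatrix hπR hπν
  obtain ⟨a', b', h'⟩ := h'.exists_isRayMatrix hπR hπν
  refine cuspOf_eq_of_isRayMatrix (π := π) hν (G₀ := G₀) (a := b' + a) (a' := b + a') fun n => ?_
  obtain ⟨S, hS, hx⟩ := h (n + b')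
  obtain ⟨S', hS', hx'⟩ := h' (n + b)
  refine ⟨S, S', by rwa [add_assoc] at hS, by rwa [add_assoc] at hS', ?_⟩
  rw [← hx, ← hx', add_right_comm]

/-! ### The element associated with a periodic point -/

theorem toG_ofGL_mul_eq_iff {G₀ : Matrix.GeneralLinearGroup (Fin 2) inf.Compl}
    {γ : Matrix.GeneralLinearGroup (Fin 2) inf.affineRing} {t : inf.Complˣ} :
    inf.toG (ofGL inf γ) * .mk G₀ = .mk G₀ * alpha t ↔
      ∃ c : inf.Complˣ, HasPeriod γ.1 G₀.1 (c : inf.Compl) t := by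
  rw [eq_comm, toG_ofGL]
  exact pgl_mul_eq_iff (A := G₀) (B := glDiag t)

theorem exists_isAssociated (hK : IsGlobalFunctionField Fq K)
    {G₀ : Matrix.GeneralLinearGroup (Fin 2) inf.Compl} (h : IsPeriodic (XInf.ofMat inf G₀)) :
    ∃ γ t₀, IsAssociated (.mk G₀) γ t₀ := by
  have hexp : ∀ t : inf.Complˣ, Valued.v (t : inf.Compl) < 1 →
      ∃ n : ℕ, Valued.v (t : inf.Compl) = WithZero.exp (-(n : ℤ)) := by
    intro t ht
    obtain ⟨m, hm⟩ := exists_v_eq_exp Valued.v t.ne_zero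
    rw [hm, ← WithZero.exp_zero, WithZero.exp_lt_exp] at ht
    refine ⟨(-m).toNat, ?_⟩
    rw [hm]
    congr 1
    omega
  have hex : ∃ n : ℕ, ∃ (γ : Matrix.GeneralLinearGroup (Fin 2) inf.affineRing) (t : inf.Complˣ),
      Valued.v (t : inf.Compl) < 1 ∧ Valued.v (t : inf.Compl) = WithZero.exp (-(n : ℤ)) ∧
        inf.toG (ofGL inf γ) * .mk G₀ = .mk G₀ * alpha t := by
    obtain ⟨t, ht, D, c, hD⟩ := (isPeriodic_ofMat_iff hK).mp h
    obtain ⟨n, hn⟩ := hexp t ht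
    exact ⟨n, D, t, ht, hn, toG_ofGL_mul_eq_iff.mpr ⟨c, hD⟩⟩
  classical
  obtain ⟨γ, t, ht, hn, hcomm⟩ := Nat.find_spec hex
  refine ⟨γ, t, ht, hcomm, ?_⟩
  intro γ' hγ' t' ht' hcomm'
  obtain ⟨M, rfl⟩ := (mem_Gam_iff inf γ').mp hγ'
  obtain ⟨n', hn'⟩ := hexp t' ht'
  have := Nat.find_min' hex ⟨M, t', ht', hn', hcomm'⟩
  rw [hn, hn', WithZero.exp_le_exp]
  omega

/-- Escape of mass along the rational rays, for the explicit constant. -/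
theorem uniformEscape_of_isAssociated (hK : IsGlobalFunctionField Fq K) (hν : ν ≠ inf)
    (p : ℕ) [Fact p.Prime] [CharP Fq p]
    (hπR : π ∈ inf.affineRing) (hπν : ν.ord π = 1)
    (hπS : ∀ y ∈ inf.sRing π, ν.val y ≤ 1 → y ∈ inf.affineRing) {g₀ : PGL2 inf.Compl}
    {γ : Matrix.GeneralLinearGroup (Fin 2) inf.affineRing} {t₀ : inf.Complˣ}
    (h : IsAssociated g₀ γ t₀) :
    0 < LOM inf ν π γ / p ∧ ∀ x : ℕ → XInf inf, (∀ n, IsPeriodic (x n)) →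
      (IsRational inf ν π (XInf.mk inf g₀) x → UniformEscape x Set.univ (LOM inf ν π γ / p)) ∧
      (IsSRational inf ν π (XInf.mk inf g₀) x → ∀ z, IsCuspOf inf ν π (XInf.mk inf g₀) x z →
        UniformEscape x {z} (LOM inf ν π γ / p)) := by
  obtain ⟨G₀, rfl⟩ := Matrix.ProjGenLinGroup.mk_surjective g₀
  obtain ⟨c, hc⟩ := toG_ofGL_mul_eq_iff.mp h.comm
  -- v_ν(π) = 1 makes π nonconstant, so its pole is at ∞ and deg > 0. It also serves as the
  -- transcendental element of R_∞ in the finiteness and topological lemmas.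
  have htr : Transcendental Fq π := ν.transcendental (ne_zero_of_ord_eq_one hπν) (by
    rw [val_eq_of_ord_eq_one hπν, ← WithZero.exp_zero]
    exact fun h => absurd (WithZero.exp_inj.mp h) (by norm_num))
  obtain ⟨deg, hdeg0, hdeg⟩ : ∃ deg : ℕ, 0 < deg ∧ inf.val π = WithZero.exp (deg : ℤ) := by
    have h1 := inf.one_lt_val_of_transcendental hK hπR htr
    obtain ⟨n, hn⟩ := exists_v_eq_exp inf.val (ne_zero_of_ord_eq_one hπν)
    rw [hn, ← WithZero.exp_zero, WithZero.exp_lt_exp] at h1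
    exact ⟨n.toNat, by omega, by rw [hn]; congr 1; omega⟩
  have hvt := hc.v_trace hK h.pos
  obtain ⟨τ, hτ, htrace, ht₀⟩ : ∃ τ : ℕ, 0 < τ ∧ inf.val (γ.1.trace : K) = WithZero.exp (τ : ℤ) ∧
      Valued.v (t₀ : inf.Compl) = WithZero.exp (-(2 * τ : ℤ)) := by
    have h0 : (γ.1.trace : K) ≠ 0 := by
      intro h0
      rw [h0, map_zero, zero_pow two_ne_zero, zero_mul] at hvt
      exact zero_ne_one hvt
    obtain ⟨n, hn⟩ := exists_v_eq_exp inf.val h0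
    obtain ⟨m, hm⟩ := exists_v_eq_exp Valued.v t₀.ne_zero
    have hpos := h.pos
    rw [hm, ← WithZero.exp_zero, WithZero.exp_lt_exp] at hpos
    rw [hn, hm, ← WithZero.exp_nsmul, ← WithZero.exp_add, ← WithZero.exp_zero,
      WithZero.exp_inj, nsmul_eq_mul] at hvt
    push_cast at hvt
    exact ⟨n.toNat, by omega, by rw [hn]; congr 1; omega, by rw [hm]; congr 1; omega⟩
  have hLOM : LOM inf ν π γ = rIndex inf ν γ * deg / (τ * eIndex inf ν γ * dIndex inf ν γ) := by
    rw [LOM, Place.ord, Place.ord, hdeg, htrace, WithZero.log_exp, WithZero.log_exp]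
    simp
  have hr := (rIndex_spec hK hν (fun k hk => hc.glCoeffs_ne_zero h.pos hk)
    (hc.glDiscr_ne_zero h.pos)).1
  have hd := (dIndex_spec (γ := γ) hK hν).1
  have he : 0 < eIndex inf ν γ := eIndex_pos
  have hp : 0 < p := (Fact.out : p.Prime).pos
  refine ⟨by rw [hLOM]; positivity, fun x hper => ⟨?_, ?_⟩⟩
  · rintro ⟨g, hg, γ₁, hconv⟩
    obtain ⟨δ, -, hconv⟩ := hconv.exists_of_mk_eq hg
    obtain ⟨C, hC⟩ := Matrix.ProjGenLinGroup.mk_surjective (δ * γ₁)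
    rw [← hC] at hconv
    obtain ⟨a, b, hS⟩ := hconv.exists_isRayMatrix hπR hπν
    obtain ⟨f, w, hf, -, hw, hfw⟩ := exists_affineRing_smul hK hπR htr
      (glMulVec_ne_zero C (w := ![1, 0]) fun h => one_ne_zero (congrFun h 0))
    refine uniformEscape_univ hK hπR htr hper fun T hT ε hε => ?_
    rw [hLOM]
    refine eventually_le_measureReal_cuspSet hK hν p hπR hπν hπS hc ht₀ hτ hdeg (C := C)
      (z := inf.affineRing.subtype ∘ w) hper (a := a) (b := b) (fun n => ?_) hT hε
    obtain ⟨S, hS, hx⟩ := hS n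
    obtain ⟨u, hu, hu'⟩ := hS.exists_nonzeroVec hν hπS hf hw hfw
    exact ⟨S, u, hS, hu, hu, hu', hx⟩
  · rintro ⟨g, hg, γ₁, hγ₁, hconv⟩ z ⟨g', hg', γ₂, hconv', rfl⟩
    obtain ⟨δ, hδ, hconv⟩ := hconv.exists_of_mk_eq hg
    obtain ⟨δ', hδ', hconv'⟩ := hconv'.exists_of_mk_eq hg'
    obtain ⟨C, hC, hCmem, hCinv⟩ := exists_of_mem_GamS (mul_mem (Gam_le_GamS inf π hδ) hγ₁)
    -- γ₂ need not lie in Γ_S. But the cusp depends only on the ray, so it can be computed with δ γ₁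
    -- in Γ_S, and Γ_S∞ = Γ_∞∞.
    have hz : cuspOf inf γ₂ = cuspOf inf 1 := by
      rw [← cuspOf_mul_of_mem_Gam hδ', hconv'.cuspOf_eq hν hπR hπν hconv, hC]
      exact cuspOf_eq_of_mem_GamS hK hν hπR hπν hπS hCmem hCinv
    rw [hC] at hconv
    obtain ⟨a, b, hS⟩ := hconv.exists_isRayMatrix hπR hπν
    rw [hz]
    refine uniformEscape_cusp hK hπR htr fun T hT ε hε => ?_
    rw [hLOM]
    refine eventually_le_measureReal_cuspSet hK hν p hπR hπν hπS hc ht₀ hτ hdeg (C := C)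
      (z := C.1.mulVec ![1, 0]) hper (a := a) (b := b) (fun n => ?_) hT hε
    obtain ⟨S, hS, hx⟩ := hS n
    obtain ⟨u, hu, hu'⟩ := hS.exists_orbitVec hK hν hπR hπν hπS hCmem hCinv
    exact ⟨S, u, hS, orbitVec_subset hu, hu, hu', hx⟩

end

end HeckeEscape

end

/-! ### The theorem -/

theorem mainTheorem1 {Fq K : Type*} [Field Fq] [Field K] [Algebra Fq K]
    (hK : IsGlobalFunctionField Fq K) (p : ℕ) [Fact p.Prime] [CharP Fq p]
    (inf ν : Place Fq K) (hν : ν ≠ inf)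
    (π : K) (hπR : π ∈ inf.affineRing) (hπν : ν.ord π = 1)
    (hπS : ∀ y ∈ inf.sRing π, ν.val y ≤ 1 → y ∈ inf.affineRing)
    (x₀ : XInf inf) (hx₀ : IsPeriodic x₀) :
    (∀ x, (heckeGraph inf π).Reachable x₀ x → IsPeriodic x) ∧
    (∃ c : ℝ, 0 < c ∧ ∀ x : ℕ → XInf inf, IsHeckeRay inf π x₀ x →
      (IsRational inf ν π x₀ x → UniformEscape x Set.univ c) ∧
      (IsSRational inf ν π x₀ x → ∀ z, IsCuspOf inf ν π x₀ x z → UniformEscape x {z} c)) ∧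
    (∃ g₀, XInf.mk inf g₀ = x₀ ∧ ∃ γ t₀, IsAssociated g₀ γ t₀) ∧
    (∀ g₀, XInf.mk inf g₀ = x₀ → ∀ γ t₀, IsAssociated g₀ γ t₀ →
      0 < LOM inf ν π γ / p ∧ ∀ x : ℕ → XInf inf, IsHeckeRay inf π x₀ x →
      (IsRational inf ν π x₀ x → UniformEscape x Set.univ (LOM inf ν π γ / p)) ∧
      (IsSRational inf ν π x₀ x → ∀ z, IsCuspOf inf ν π x₀ x z →
        UniformEscape x {z} (LOM inf ν π γ / p))) := by
  have hper : ∀ x, (heckeGraph inf π).Reachable x₀ x → IsPeriodic x := fun x hx =>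
    isPeriodic_of_reachable hK hν hπR hπν hπS hx hx₀
  have hray : ∀ x : ℕ → XInf inf, IsHeckeRay inf π x₀ x → ∀ n, IsPeriodic (x n) := by
    intro x hx n
    refine hper _ ?_
    have := hx.reachable 0 n
    rwa [hx.start, zero_add] at this
  have hassoc : ∃ g₀, XInf.mk inf g₀ = x₀ ∧ ∃ γ t₀, IsAssociated g₀ γ t₀ := by
    obtain ⟨G₀, rfl⟩ := XInf.ofMat_surjective inf x₀
    exact ⟨.mk G₀, rfl, exists_isAssociated hK hx₀⟩
  have hmain : ∀ g₀, XInf.mk inf g₀ = x₀ → ∀ γ t₀, IsAssociated g₀ γ t₀ →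
      0 < LOM inf ν π γ / p ∧ ∀ x : ℕ → XInf inf, IsHeckeRay inf π x₀ x →
      (IsRational inf ν π x₀ x → UniformEscape x Set.univ (LOM inf ν π γ / p)) ∧
      (IsSRational inf ν π x₀ x → ∀ z, IsCuspOf inf ν π x₀ x z →
        UniformEscape x {z} (LOM inf ν π γ / p)) := by
    rintro g₀ rfl γ t₀ h
    obtain ⟨h1, h2⟩ := uniformEscape_of_isAssociated hK hν p hπR hπν hπS h
    exact ⟨h1, fun x hx => h2 x (hray x hx)⟩
  refine ⟨hper, ?_, hassoc, hmain⟩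
  obtain ⟨g₀, hg₀, γ, t₀, h⟩ := hassoc
  obtain ⟨h1, h2⟩ := hmain g₀ hg₀ γ t₀ h
  exact ⟨_, h1, h2⟩
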